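/- **Setting.** Let $\mathsf C$ be a site, and let sheaves, stacks and torsors be taken on $\mathsf C$. A crossed module $G_\bullet=(\partial\colon G_1\to G_0)$ consists of sheaves of groups $G_1,G_0$ with a right action of $G_0$ on $G_1$ by automorphisms, such that $\partial(g^x)=x^{-1}\partial(g)x$ and $g^{\partial g'}=g'^{-1}gg'$. It is braided if it has a bracket $\{-,-\}\colon G_0\times G_0\to G_1$ with $\partial\{x,y\}=y^{-1}x^{-1}yx$, $\{x,yz\}=\{x,y\}^z\{x,z\}$, $\{xy,z\}=\{y,z\}\{x,z\}^y$, $\{x,\partial g\}=g^{-1}g^x$ and $\{\partial g,y\}=(g^{-1})^yg$. A group-like stack is a stack in groupoids with a monoidal structure for which all left and right translations are equivalences. It is presented by $G_\bullet$, written $\mathscr G\simeq[G_1\to G_0]^\sim$, via a monoidal morphism $\pi$ to $\mathscr G$ from the prestack with objects the sections of $G_0$ and morphisms $g\colon x\to x\,\partial g$ ($g\in G_1$, tensor product of morphisms $g\otimes g'=g^{x'}g'$ if $x'$ is the source of $g'$), if $\pi$ is fully faithful and locally essentially surjective. In the braided case the braiding of $\mathscr G$ is moreover required to be given by $\{x,y\}\colon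 xy\to yx$. A $(G_1,G_0)$-torsor is a right $G_1$-torsor $E$ with a map $j\colon E\to G_0$ such that $j(eg)=j(e)\,\partial g$; it has the left action $ge=e\,g^{j(e)}$. Let $n\ge 0$, let $H_{1,\bullet},\dots,H_{n,\bullet}$ be crossed modules and $G_\bullet$ a braided crossed module. Let $\mathscr H_i\simeq[H_{i,1}\to H_{i,0}]^\sim$ be group-like stacks and $\mathscr G\simeq[G_1\to G_0]^\sim$ a braided group-like stack. **$n$-additive functors.** An $n$-additive functor $F\colon\mathscr H_1\times\dots\times\mathscr H_n\to\mathscr G$ is a morphism of stacks with a structure of monoidal functor in each variable $i$, given by isomorphisms $\lambda^i\colon F(\dots,a,\dots)\otimes F(\dots,b,\dots)\to F(\dots,a\otimes b,\dots)$ and $\varepsilon^i\colon F(\dots,I,\dots)\to I$, natural in all variables, such that: (i) for all $i<k$, the two ways to compose $\lambda^i$ and $\lambda^k$ from $\bigl(F(a,c)\otimes F(b,c)\bigr)\otimes\bigl(F(a,d)\otimes F(b,d)\bigr)$ to $F(a\otimes b,c\otimes d)$ (with $a,b$ in the variable $i$ and $c,d$ in the variable $k$) agree, where one uses the braiding of $\mathscr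 G$ to exchange the two middle factors; (ii) $\varepsilon^i=\varepsilon^k$ on tuples whose $i$-th and $k$-th entries are $I$. Morphisms are natural transformations compatible with all $\lambda^i$ and $\varepsilon^i$. They form the category $\mathsf{nAdd}(\mathscr H_1,\dots,\mathscr H_n;\mathscr G)$, pointed by the constant functor with value the unit object $I$. **$n$-butterflies.** An $n$-extension of $(H_{1,0},\dots,H_{n,0})$ by $G_\bullet$ is a $(G_1,G_0)$-torsor $E$ over $H_{1,0}\times\dots\times H_{n,0}$ with $n$ associative partial multiplications, $e\times_i e'$ being defined if the base points $y,y'$ of $e,e'$ agree except at the place $i$ and lying over the tuple with $i$-th entry $y_iy_i'$. They satisfy $j(e\times_ie')=j(e)j(e')$, $e\times_i(e'g)=(e\times_ie')g$, $(eg)\times_ie'=e\times_i(ge')$ and, for $i<k$, $$(u\times_iu')\times_k(v\times_iv')=\bigl((u\times_kv)\times_i(u'\times_kv')\bigr)\,\bigl(\{j(u'),j(v)\}^{-1}\bigr)^{j(v')} .$$ An $n$-butterfly is such an $n$-extension with $n$ maps $s_i\colon H_{1,0}\times\dots\times H_{i,1}\times\dots\times H_{n,0}\to E$, trivializations of the pullbacks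 of $E$ along $\partial$ in the variable $i$. That is, $s_i$ lifts the map $\partial$ in the variable $i$, satisfies $j\circ s_i=1$ and is multiplicative for $\times_1,\dots,\times_n$. Moreover: for $i\ne k$, $s_i$ and $s_k$ agree after restriction along $\partial$ to the product with $H_{i,1}$ at the place $i$ and $H_{k,1}$ at the place $k$; and $s_i(\dots,h,\dots)\times_ie=e\times_is_i(\dots,h^{y_i},\dots)$ for $e\in E$ over $y$ (the other entries being those of $y$) and $h\in H_{i,1}$. Morphisms are the maps over $H_{1,0}\times\dots\times H_{n,0}$ compatible with all the structure. They form the category $\mathsf{nBfl}(H_{1,\bullet},\dots,H_{n,\bullet};G_\bullet)$, pointed by the trivial butterfly $H_{1,0}\times\dots\times H_{n,0}\times G_1$. **Theorem.** $\mathsf{nBfl}(H_{1,\bullet},\dots,H_{n,\bullet};G_\bullet)$ and $\mathsf{nAdd}(\mathscr H_1,\dots,\mathscr H_n;\mathscr G)$ are groupoids, and there is an equivalence of pointed groupoids $$u\colon\mathsf{nBfl}(H_{1,\bullet},\dots,H_{n,\bullet};G_\bullet)\overset{\sim}{\longrightarrow}\mathsf{nAdd}(\mathscr H_1,\dots,\mathscr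 H_n;\mathscr G)$$ sending $E$ to the $n$-additive functor $u(E)$ whose value at $(\pi y_1,\dots,\pi y_n)$, for $y_i$ in $H_{i,0}$, is the object of $\mathscr G$ given by the $(G_1,G_0)$-torsor $E_{y_1,\dots,y_n}$. This means that there are isomorphisms $\theta_e\colon\pi(j(e))\to u(E)(\pi y_1,\dots,\pi y_n)$ for $e\in E_{y_1,\dots,y_n}$, natural in $E$ and in the base, compatible with the action of $G_1$, such that the multiplications $\times_i$ correspond to the $\lambda^i$, and such that passing from $e$ to $e\times_is_i(\dots,h,\dots)$ corresponds to applying $u(E)$ to the morphism $h\colon y_i\to y_i\,\partial h$. If $\mathscr G$ is symmetric, then $u$ is an equivalence of group-like groupoids: $\mathsf{nBfl}$ is a monoidal groupoid under the contracted product $E\wedge^{G_1}E'$ over $H_{1,0}\times\dots\times H_{n,0}$ and $\mathsf{nAdd}$ under the pointwise tensor product, all translations are equivalences in both of them, and $u$ is a monoidal functor, with structure isomorphisms under which $\theta_{e\wedge e'}$ corresponds to $\theta_e\otimes\theta_{e'}$. -/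

import Mathlib

open CategoryTheory MonoidalCategory Opposite

universe o₁ h₁ o₂ o h w v u

set_option linter.checkUnivs false
set_option linter.unusedSectionVars false

/-! ## Stacks in groupoids over a site -/

/-- A category fibered in groupoids over `C`, in indexed form: `Ob S` is the set of objects over `S`
and `Hom f x y` the set of morphisms `x ⟶ y` lying over `f : S ⟶ T`.  The composite of morphisms
over `f` and `g` lies over any `k` that is equal to `f ≫ g`. -/
structure FibGpd (C : Type u) [Category.{v} C] where
  Ob : C → Type o
  Hom : ∀ {S T : C}, (S ⟶ T) → Ob S → Ob T → Type h
  id : ∀ {S : C} (x : Ob S), Hom (𝟙 S) x x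
  comp : ∀ {R S T : C} {f : R ⟶ S} {g : S ⟶ T} {k : R ⟶ T} {x : Ob R} {y : Ob S} {z : Ob T},
    Hom f x y → Hom g y z → f ≫ g = k → Hom k x z
  id_comp : ∀ {S T : C} {f : S ⟶ T} {x : Ob S} {y : Ob T} (φ : Hom f x y),
    comp (id x) φ (Category.id_comp f) = φ
  comp_id : ∀ {S T : C} {f : S ⟶ T} {x : Ob S} {y : Ob T} (φ : Hom f x y),
    comp φ (id y) (Category.comp_id f) = φ
  assoc : ∀ {R S T U : C} {f : R ⟶ S} {g : S ⟶ T} {k : T ⟶ U} {fg : R ⟶ T} {gk : S ⟶ U}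
    {fgk : R ⟶ U} {x : Ob R} {y : Ob S} {z : Ob T} {t : Ob U}
    (φ : Hom f x y) (ψ : Hom g y z) (χ : Hom k z t)
    (w₁ : f ≫ g = fg) (w₂ : fg ≫ k = fgk) (w₃ : g ≫ k = gk) (w₄ : f ≫ gk = fgk),
    comp (comp φ ψ w₁) χ w₂ = comp φ (comp ψ χ w₃) w₄
  /-- Objects can be pulled back along morphisms of `C`. -/
  exists_lift : ∀ {S T : C} (f : S ⟶ T) (y : Ob T), ∃ x : Ob S, Nonempty (Hom f x y)
  /-- Every morphism is cartesian. -/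
  cartesian : ∀ {R S T : C} {f : R ⟶ S} {g : S ⟶ T} {k : R ⟶ T} {x : Ob R} {y : Ob S} {z : Ob T}
    (φ : Hom g y z) (ψ : Hom k x z) (w : f ≫ g = k), ∃! χ : Hom f x y, comp χ φ w = ψ

namespace FibGpd

variable {C : Type u} [Category.{v} C] (𝓧 : FibGpd.{o, h} C)

/-- The fibre over `S`: the morphisms are those lying over `𝟙 S`. -/
instance fiberCategory (S : C) : Category.{h} (𝓧.Ob S) where
  Hom x y := 𝓧.Hom (𝟙 S) x y
  id x := 𝓧.id x
  comp φ ψ := 𝓧.comp φ ψ (Category.comp_id _)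
  id_comp φ := 𝓧.id_comp φ
  comp_id φ := 𝓧.comp_id φ
  assoc φ ψ χ := 𝓧.assoc φ ψ χ _ _ _ _

/-- Composition of a morphism over `f` with a morphism of the fibre of its target. -/
def post {S T : C} {f : S ⟶ T} {x : 𝓧.Ob S} {y z : 𝓧.Ob T} (φ : 𝓧.Hom f x y) (b : y ⟶ z) :
    𝓧.Hom f x z :=
  𝓧.comp φ b (Category.comp_id f)

/-- Composition of a morphism of the fibre of its source with a morphism over `f`. -/
def pre {S T : C} {f : S ⟶ T} {x y : 𝓧.Ob S} {z : 𝓧.Ob T} (a : x ⟶ y) (φ : 𝓧.Hom f y z) :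
    𝓧.Hom f x z :=
  𝓧.comp a φ (Category.id_comp f)

/-- `𝓧` is a stack for `J`: over every covering sieve, morphisms glue uniquely and every descent
datum (that is, every section of `𝓧` over the sieve) comes from an object. -/
structure IsStack (J : GrothendieckTopology C) : Prop where
  glue_hom : ∀ {S : C} (x y : 𝓧.Ob S) (R : Sieve S), R ∈ J S →
    ∀ m : ∀ {T : C} (f : T ⟶ S), R f → ∀ x' : 𝓧.Ob T, 𝓧.Hom f x' x → 𝓧.Hom f x' y,
    (∀ {T' T : C} (g : T' ⟶ T) (f : T ⟶ S) (hf : R f) (x'' : 𝓧.Ob T') (x' : 𝓧.Ob T)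
      (b : 𝓧.Hom g x'' x') (a : 𝓧.Hom f x' x),
      m (g ≫ f) (R.downward_closed hf g) x'' (𝓧.comp b a rfl) = 𝓧.comp b (m f hf x' a) rfl) →
    ∃! k : x ⟶ y, ∀ {T : C} (f : T ⟶ S) (hf : R f) (x' : 𝓧.Ob T) (a : 𝓧.Hom f x' x),
      𝓧.post a k = m f hf x' a
  glue_obj : ∀ {S : C} (R : Sieve S), R ∈ J S →
    ∀ (D : ∀ {T : C} (f : T ⟶ S), R f → 𝓧.Ob T)
      (t : ∀ {T' T : C} (g : T' ⟶ T) (f : T ⟶ S) (hf : R f) (f' : T' ⟶ S) (hf' : R f'),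
        g ≫ f = f' → 𝓧.Hom g (D f' hf') (D f hf)),
    (∀ {T : C} (f : T ⟶ S) (hf : R f),
      t (𝟙 T) f hf f hf (Category.id_comp f) = 𝓧.id (D f hf)) →
    (∀ {T'' T' T : C} (g' : T'' ⟶ T') (g : T' ⟶ T) (f : T ⟶ S) (hf : R f) (f' : T' ⟶ S)
      (hf' : R f') (f'' : T'' ⟶ S) (hf'' : R f'') (w : g ≫ f = f') (w' : g' ≫ f' = f'')
      (w'' : (g' ≫ g) ≫ f = f''),
      𝓧.comp (t g' f' hf' f'' hf'' w') (t g f hf f' hf' w) rfl = t (g' ≫ g) f hf f'' hf'' w'') →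
    ∃ (X : 𝓧.Ob S) (q : ∀ {T : C} (f : T ⟶ S) (hf : R f), 𝓧.Hom f (D f hf) X),
      ∀ {T' T : C} (g : T' ⟶ T) (f : T ⟶ S) (hf : R f) (f' : T' ⟶ S) (hf' : R f')
        (w : g ≫ f = f'), 𝓧.comp (t g f hf f' hf' w) (q f hf) w = q f' hf'

end FibGpd

/-- A group-like stack: a stack in groupoids with a monoidal structure (a tensor product and a unit
that are defined on the whole fibered category, with associativity and unit constraints that make
each fibre a monoidal category and are compatible with all morphisms), such that the left and right
translations by objects are equivalences. -/
structure GrStack {C : Type u} [Category.{v} C] (J : GrothendieckTopology C) where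
  fib : FibGpd.{o, h} C
  isStack : fib.IsStack J
  mon : ∀ S : C, MonoidalCategory (fib.Ob S)
  /-- The tensor product of morphisms lying over `f`. -/
  tens : ∀ {S T : C} {f : S ⟶ T} {x x' : fib.Ob S} {y y' : fib.Ob T},
    fib.Hom f x y → fib.Hom f x' y' → fib.Hom f (x ⊗ x') (y ⊗ y')
  tens_fiber : ∀ {S : C} {x x' y y' : fib.Ob S} (φ : x ⟶ y) (ψ : x' ⟶ y'),
    tens φ ψ = (φ ⊗ₘ ψ)
  tens_comp : ∀ {R S T : C} {f : R ⟶ S} {g : S ⟶ T} {k : R ⟶ T} {x x' : fib.Ob R}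
    {y y' : fib.Ob S} {z z' : fib.Ob T} (φ : fib.Hom f x y) (φ' : fib.Hom f x' y')
    (ψ : fib.Hom g y z) (ψ' : fib.Hom g y' z') (e : f ≫ g = k),
    tens (fib.comp φ ψ e) (fib.comp φ' ψ' e) = fib.comp (tens φ φ') (tens ψ ψ') e
  /-- The unit objects form a section of the fibered category. -/
  unitMap : ∀ {S T : C} (f : S ⟶ T), fib.Hom f (𝟙_ (fib.Ob S)) (𝟙_ (fib.Ob T))
  unitMap_id : ∀ S : C, unitMap (𝟙 S) = fib.id (𝟙_ (fib.Ob S))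
  unitMap_comp : ∀ {R S T : C} {f : R ⟶ S} {g : S ⟶ T} {k : R ⟶ T} (e : f ≫ g = k),
    fib.comp (unitMap f) (unitMap g) e = unitMap k
  associator_naturality : ∀ {S T : C} {f : S ⟶ T} {x y z : fib.Ob S} {x' y' z' : fib.Ob T}
    (φ : fib.Hom f x x') (ψ : fib.Hom f y y') (χ : fib.Hom f z z'),
    fib.post (tens (tens φ ψ) χ) (α_ x' y' z').hom =
      fib.pre (α_ x y z).hom (tens φ (tens ψ χ))
  leftUnitor_naturality : ∀ {S T : C} {f : S ⟶ T} {x : fib.Ob S} {x' : fib.Ob T}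
    (φ : fib.Hom f x x'),
    fib.post (tens (unitMap f) φ) (λ_ x').hom = fib.pre (λ_ x).hom φ
  rightUnitor_naturality : ∀ {S T : C} {f : S ⟶ T} {x : fib.Ob S} {x' : fib.Ob T}
    (φ : fib.Hom f x x'),
    fib.post (tens φ (unitMap f)) (ρ_ x').hom = fib.pre (ρ_ x).hom φ
  translation_left : ∀ {S : C} (x : fib.Ob S), (tensorLeft x).IsEquivalence
  translation_right : ∀ {S : C} (x : fib.Ob S), (tensorRight x).IsEquivalence

attribute [instance] GrStack.mon

/-- A braided group-like stack. -/
structure BraidedGrStack {C : Type u} [Category.{v} C] (J : GrothendieckTopology C) where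
  gr : GrStack.{o, h} J
  braided : ∀ S : C, BraidedCategory (gr.fib.Ob S)
  braiding_naturality : ∀ {S T : C} {f : S ⟶ T} {x y : gr.fib.Ob S} {x' y' : gr.fib.Ob T}
    (φ : gr.fib.Hom f x x') (ψ : gr.fib.Hom f y y'),
    gr.fib.post (gr.tens φ ψ) (β_ x' y').hom = gr.fib.pre (β_ x y).hom (gr.tens ψ φ)

attribute [instance] BraidedGrStack.braided

/-- The braiding is symmetric. -/
def BraidedGrStack.IsSymmetric {C : Type u} [Category.{v} C] {J : GrothendieckTopology C}
    (𝓖 : BraidedGrStack.{o, h} J) : Prop :=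
  ∀ (S : C) (x y : 𝓖.gr.fib.Ob S), (β_ x y).hom ≫ (β_ y x).hom = 𝟙 (x ⊗ y)

namespace FibGpd

variable {C : Type u} [Category.{v} C] (𝓧 : FibGpd.{o, h} C) {S T : C} {f : S ⟶ T}

theorem post_id {x : 𝓧.Ob S} {y : 𝓧.Ob T} (φ : 𝓧.Hom f x y) : 𝓧.post φ (𝟙 y) = φ :=
  𝓧.comp_id φ

theorem id_pre {x : 𝓧.Ob S} {y : 𝓧.Ob T} (φ : 𝓧.Hom f x y) : 𝓧.pre (𝟙 x) φ = φ :=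
  𝓧.id_comp φ

theorem post_comp {x : 𝓧.Ob S} {y z t : 𝓧.Ob T} (φ : 𝓧.Hom f x y) (b : y ⟶ z) (c : z ⟶ t) :
    𝓧.post φ (b ≫ c) = 𝓧.post (𝓧.post φ b) c :=
  (𝓧.assoc _ _ _ _ _ _ _).symm

theorem comp_pre {x y z : 𝓧.Ob S} {t : 𝓧.Ob T} (a : x ⟶ y) (b : y ⟶ z) (φ : 𝓧.Hom f z t) :
    𝓧.pre (a ≫ b) φ = 𝓧.pre a (𝓧.pre b φ) :=
  𝓧.assoc _ _ _ _ _ _ _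

theorem pre_post {x y : 𝓧.Ob S} {z t : 𝓧.Ob T} (a : x ⟶ y) (φ : 𝓧.Hom f y z) (b : z ⟶ t) :
    𝓧.post (𝓧.pre a φ) b = 𝓧.pre a (𝓧.post φ b) :=
  𝓧.assoc _ _ _ _ _ _ _

/-- Commutative squares with two sides over `f` and two sides in the fibres. -/
def Sq {x x' : 𝓧.Ob S} {y y' : 𝓧.Ob T} (φ : 𝓧.Hom f x y) (φ' : 𝓧.Hom f x' y')
    (a : x ⟶ x') (b : y ⟶ y') : Prop :=
  𝓧.post φ b = 𝓧.pre a φ'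

variable {𝓧}

theorem Sq.comp {x x' x'' : 𝓧.Ob S} {y y' y'' : 𝓧.Ob T} {φ : 𝓧.Hom f x y} {φ' : 𝓧.Hom f x' y'}
    {φ'' : 𝓧.Hom f x'' y''} {a : x ⟶ x'} {b : y ⟶ y'} {a' : x' ⟶ x''} {b' : y' ⟶ y''}
    (e : 𝓧.Sq φ φ' a b) (e' : 𝓧.Sq φ' φ'' a' b') : 𝓧.Sq φ φ'' (a ≫ a') (b ≫ b') := by
  unfold Sq at *
  rw [post_comp, e, pre_post, e', comp_pre]

theorem Sq.refl {x : 𝓧.Ob S} {y : 𝓧.Ob T} (φ : 𝓧.Hom f x y) : 𝓧.Sq φ φ (𝟙 x) (𝟙 y) := by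
  unfold Sq
  rw [post_id, id_pre]

theorem Sq.inv {x x' : 𝓧.Ob S} {y y' : 𝓧.Ob T} {φ : 𝓧.Hom f x y} {φ' : 𝓧.Hom f x' y'}
    {a : x ≅ x'} {b : y ≅ y'} (e : 𝓧.Sq φ φ' a.hom b.hom) : 𝓧.Sq φ' φ a.inv b.inv := by
  unfold Sq at *
  rw [← 𝓧.id_pre (𝓧.post φ' b.inv), ← a.inv_hom_id, comp_pre, ← pre_post, ← e, ← post_comp,
    b.hom_inv_id, post_id]

end FibGpd

namespace GrStack

variable {C : Type u} [Category.{v} C] {J : GrothendieckTopology C} {𝓧 : GrStack.{o, h} J}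
  {S T : C} {f : S ⟶ T}

theorem sq_tens {x x' z z' : 𝓧.fib.Ob S} {y y' t t' : 𝓧.fib.Ob T} {φ : 𝓧.fib.Hom f x y}
    {φ' : 𝓧.fib.Hom f x' y'} {ψ : 𝓧.fib.Hom f z t} {ψ' : 𝓧.fib.Hom f z' t'}
    {a : x ⟶ x'} {b : y ⟶ y'} {c : z ⟶ z'} {d : t ⟶ t'}
    (e : 𝓧.fib.Sq φ φ' a b) (e' : 𝓧.fib.Sq ψ ψ' c d) :
    𝓧.fib.Sq (𝓧.tens φ ψ) (𝓧.tens φ' ψ') (a ⊗ₘ c) (b ⊗ₘ d) := by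
  unfold FibGpd.Sq FibGpd.post FibGpd.pre at *
  rw [← 𝓧.tens_fiber, ← 𝓧.tens_fiber, ← 𝓧.tens_comp, ← 𝓧.tens_comp, e, e']

theorem sq_whiskerLeft {x z z' : 𝓧.fib.Ob S} {y t t' : 𝓧.fib.Ob T} (φ : 𝓧.fib.Hom f x y)
    {ψ : 𝓧.fib.Hom f z t} {ψ' : 𝓧.fib.Hom f z' t'} {c : z ⟶ z'} {d : t ⟶ t'}
    (e' : 𝓧.fib.Sq ψ ψ' c d) :
    𝓧.fib.Sq (𝓧.tens φ ψ) (𝓧.tens φ ψ') (x ◁ c) (y ◁ d) := by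
  simpa using sq_tens (FibGpd.Sq.refl φ) e'

theorem sq_whiskerRight {x x' z : 𝓧.fib.Ob S} {y y' t : 𝓧.fib.Ob T} {φ : 𝓧.fib.Hom f x y}
    {φ' : 𝓧.fib.Hom f x' y'} (ψ : 𝓧.fib.Hom f z t) {a : x ⟶ x'} {b : y ⟶ y'}
    (e : 𝓧.fib.Sq φ φ' a b) :
    𝓧.fib.Sq (𝓧.tens φ ψ) (𝓧.tens φ' ψ) (a ▷ z) (b ▷ t) := by
  simpa using sq_tens e (FibGpd.Sq.refl ψ)

end GrStack

theorem BraidedGrStack.sq_tensorμ {C : Type u} [Category.{v} C] {J : GrothendieckTopology C}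
    {𝓖 : BraidedGrStack.{o, h} J} {S T : C} {f : S ⟶ T} {x y z t : 𝓖.gr.fib.Ob S}
    {x' y' z' t' : 𝓖.gr.fib.Ob T} (φ : 𝓖.gr.fib.Hom f x x') (ψ : 𝓖.gr.fib.Hom f y y')
    (χ : 𝓖.gr.fib.Hom f z z') (ω : 𝓖.gr.fib.Hom f t t') :
    𝓖.gr.fib.Sq (𝓖.gr.tens (𝓖.gr.tens φ ψ) (𝓖.gr.tens χ ω))
      (𝓖.gr.tens (𝓖.gr.tens φ χ) (𝓖.gr.tens ψ ω)) (tensorμ x y z t) (tensorμ x' y' z' t') :=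
  (FibGpd.Sq.comp (𝓖.gr.associator_naturality _ _ _) <|
    FibGpd.Sq.comp (GrStack.sq_whiskerLeft _ (FibGpd.Sq.inv (𝓖.gr.associator_naturality _ _ _))) <|
    FibGpd.Sq.comp (GrStack.sq_whiskerLeft _ (GrStack.sq_whiskerRight _
      (𝓖.braiding_naturality _ _))) <|
    FibGpd.Sq.comp (GrStack.sq_whiskerLeft _ (𝓖.gr.associator_naturality _ _ _)) <|
    FibGpd.Sq.inv (𝓖.gr.associator_naturality _ _ _))

/-! ## Crossed modules of the topos of sheaves -/

/-- The group of sections over `S`. -/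
abbrev Sec {C : Type u} [Category.{v} C] (A : Cᵒᵖ ⥤ GrpCat.{w}) (S : C) : Type w := A.obj (op S)

/-- Restriction of sections along `f : T ⟶ S`. -/
def res {C : Type u} [Category.{v} C] (A : Cᵒᵖ ⥤ GrpCat.{w}) {T S : C} (f : T ⟶ S) :
    Sec A S →* Sec A T :=
  (A.map f.op).hom

/-- A crossed module of sheaves of groups `∂ : G₁ ⟶ G₀`, with a right action `g ^ x = act g x`. -/
structure CrossedModule {C : Type u} [Category.{v} C] (J : GrothendieckTopology C) where
  G₁ : Cᵒᵖ ⥤ GrpCat.{w}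
  G₀ : Cᵒᵖ ⥤ GrpCat.{w}
  isSheaf₁ : Presieve.IsSheaf J (G₁ ⋙ forget GrpCat)
  isSheaf₀ : Presieve.IsSheaf J (G₀ ⋙ forget GrpCat)
  bdHom : G₁ ⟶ G₀
  act : ∀ {S : C}, Sec G₁ S → Sec G₀ S → Sec G₁ S
  act_one : ∀ {S : C} (g : Sec G₁ S), act g 1 = g
  act_mul : ∀ {S : C} (g : Sec G₁ S) (x y : Sec G₀ S), act g (x * y) = act (act g x) y
  mul_act : ∀ {S : C} (g g' : Sec G₁ S) (x : Sec G₀ S), act (g * g') x = act g x * act g' x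
  res_act : ∀ {T S : C} (f : T ⟶ S) (g : Sec G₁ S) (x : Sec G₀ S),
    res G₁ f (act g x) = act (res G₁ f g) (res G₀ f x)
  bd_act : ∀ {S : C} (g : Sec G₁ S) (x : Sec G₀ S),
    (bdHom.app (op S)).hom (act g x) = x⁻¹ * (bdHom.app (op S)).hom g * x
  act_bd : ∀ {S : C} (g g' : Sec G₁ S), act g ((bdHom.app (op S)).hom g') = g'⁻¹ * g * g'

/-- The boundary map on sections. -/
def CrossedModule.bd {C : Type u} [Category.{v} C] {J : GrothendieckTopology C}
    (G : CrossedModule.{w} J) {S : C} : Sec G.G₁ S →* Sec G.G₀ S :=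
  (G.bdHom.app (op S)).hom

/-- A braided crossed module, with bracket `{x, y} = br x y`. -/
structure BraidedCrossedModule {C : Type u} [Category.{v} C] (J : GrothendieckTopology C)
    extends CrossedModule.{w} J where
  br : ∀ {S : C}, Sec G₀ S → Sec G₀ S → Sec G₁ S
  res_br : ∀ {T S : C} (f : T ⟶ S) (x y : Sec G₀ S),
    res G₁ f (br x y) = br (res G₀ f x) (res G₀ f y)
  bd_br : ∀ {S : C} (x y : Sec G₀ S), toCrossedModule.bd (br x y) = y⁻¹ * x⁻¹ * y * x
  br_mul : ∀ {S : C} (x y z : Sec G₀ S), br x (y * z) = act (br x y) z * br x z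
  mul_br : ∀ {S : C} (x y z : Sec G₀ S), br (x * y) z = br y z * act (br x z) y
  br_bd : ∀ {S : C} (x : Sec G₀ S) (g : Sec G₁ S), br x (toCrossedModule.bd g) = g⁻¹ * act g x
  bd_br_left : ∀ {S : C} (g : Sec G₁ S) (y : Sec G₀ S),
    br (toCrossedModule.bd g) y = act g⁻¹ y * g

/-! ## Presentations of group-like stacks by crossed modules

The categorical group `Γ(G)` of a crossed module has the sections of `G₀` as objects; a morphism
`x ⟶ y` over `f : T ⟶ S` is a section `g` of `G₁` over `T` with `f^* y = x ∂g`; composition is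
multiplication, the tensor product of objects is multiplication and that of the morphisms `g` (with
source `x`) and `g'` (with source `x'`) is `g ^ x' * g'`. -/

section Presentation

variable {C : Type u} [Category.{v} C] {J : GrothendieckTopology C}

/-- A morphism of fibered categories `Γ(G) ⟶ 𝓖`. -/
structure PreMorphism (G : CrossedModule.{w} J) (𝓖 : FibGpd.{o, h} C) where
  obj : ∀ {S : C}, Sec G.G₀ S → 𝓖.Ob S
  map : ∀ {T S : C} (f : T ⟶ S) (x : Sec G.G₀ T) (y : Sec G.G₀ S) (g : Sec G.G₁ T),
    res G.G₀ f y = x * G.bd g → 𝓖.Hom f (obj x) (obj y)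
  map_id : ∀ {S : C} (x : Sec G.G₀ S) (e : res G.G₀ (𝟙 S) x = x * G.bd 1),
    map (𝟙 S) x x 1 e = 𝓖.id (obj x)
  map_comp : ∀ {R T S : C} (f : R ⟶ T) (f' : T ⟶ S) (x : Sec G.G₀ R) (y : Sec G.G₀ T)
    (z : Sec G.G₀ S) (g : Sec G.G₁ R) (g' : Sec G.G₁ T) (e : res G.G₀ f y = x * G.bd g)
    (e' : res G.G₀ f' z = y * G.bd g')
    (e'' : res G.G₀ (f ≫ f') z = x * G.bd (g * res G.G₁ f g')),
    𝓖.comp (map f x y g e) (map f' y z g' e') rfl = map (f ≫ f') x z (g * res G.G₁ f g') e''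

namespace PreMorphism

variable {G : CrossedModule.{w} J} {𝓖 : FibGpd.{o, h} C} (π : PreMorphism G 𝓖)

/-- The image of the pullback morphism `f^* y ⟶ y` over `f`. -/
def cart {T S : C} (f : T ⟶ S) (x : Sec G.G₀ T) (y : Sec G.G₀ S) (e : res G.G₀ f y = x) :
    𝓖.Hom f (π.obj x) (π.obj y) :=
  π.map f x y 1 (by rw [map_one, mul_one, e])

/-- The image of the morphism `g : x ⟶ y` of the fibre over `S`, where `y = x ∂g`. -/
def vert {S : C} (x y : Sec G.G₀ S) (g : Sec G.G₁ S) (e : y = x * G.bd g) :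
    π.obj x ⟶ π.obj y :=
  π.map (𝟙 S) x y g (by simpa [res] using e)

/-- The image of an identity `x = y`. -/
def ident {S : C} (x y : Sec G.G₀ S) (e : x = y) : π.obj x ⟶ π.obj y :=
  π.vert x y 1 (by rw [map_one, mul_one, e])

end PreMorphism

/-- A presentation `𝓖 ≃ [G₁ → G₀]~`: a monoidal morphism `Γ(G) ⟶ 𝓖` to the group-like stack `𝓖`
that is fully faithful and locally essentially surjective, that is, which exhibits `𝓖` as the stack
associated with `Γ(G)`. -/
structure Presentation (G : CrossedModule.{w} J) (𝓖 : GrStack.{o, h} J)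
    extends PreMorphism G 𝓖.fib where
  fully_faithful : ∀ {T S : C} (f : T ⟶ S) (x : Sec G.G₀ T) (y : Sec G.G₀ S)
    (φ : 𝓖.fib.Hom f (obj x) (obj y)),
    ∃! g : Sec G.G₁ T, ∃ e : res G.G₀ f y = x * G.bd g, map f x y g e = φ
  locally_surjective : ∀ {S : C} (X : 𝓖.fib.Ob S), ∃ R : Sieve S, R ∈ J S ∧
    ∀ {T : C} (f : T ⟶ S), R f → ∃ x : Sec G.G₀ T, Nonempty (𝓖.fib.Hom f (obj x) X)
  /-- The monoidality isomorphisms. -/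
  mu : ∀ {S : C} (x y : Sec G.G₀ S),
    (obj x : 𝓖.fib.Ob S) ⊗ obj y ⟶ (obj (x * y) : 𝓖.fib.Ob S)
  mu_naturality : ∀ {T S : C} (f : T ⟶ S) (x y : Sec G.G₀ T) (x' y' : Sec G.G₀ S)
    (g k : Sec G.G₁ T) (e : res G.G₀ f x' = x * G.bd g) (e' : res G.G₀ f y' = y * G.bd k)
    (e'' : res G.G₀ f (x' * y') = x * y * G.bd (G.act g y * k)),
    𝓖.fib.post (𝓖.tens (map f x x' g e) (map f y y' k e')) (mu x' y') =
      𝓖.fib.pre (mu x y) (map f (x * y) (x' * y') (G.act g y * k) e'')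
  mu_assoc : ∀ {S : C} (x y z : Sec G.G₀ S),
    (mu x y ▷ (obj z : 𝓖.fib.Ob S)) ≫ mu (x * y) z ≫
        toPreMorphism.ident (x * y * z) (x * (y * z)) (mul_assoc x y z) =
      (α_ (obj x) (obj y) (obj z)).hom ≫ ((obj x : 𝓖.fib.Ob S) ◁ mu y z) ≫ mu x (y * z)
  /-- The unit isomorphism. -/
  eta : ∀ S : C, 𝟙_ (𝓖.fib.Ob S) ⟶ (obj (1 : Sec G.G₀ S) : 𝓖.fib.Ob S)
  eta_naturality : ∀ {T S : C} (f : T ⟶ S),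
    𝓖.fib.post (𝓖.unitMap f) (eta S) = 𝓖.fib.pre (eta T) (toPreMorphism.cart f 1 1 (map_one _))
  left_unit : ∀ {S : C} (x : Sec G.G₀ S),
    (eta S ▷ (obj x : 𝓖.fib.Ob S)) ≫ mu 1 x ≫ toPreMorphism.ident (1 * x) x (one_mul x) =
      (λ_ (obj x : 𝓖.fib.Ob S)).hom
  right_unit : ∀ {S : C} (x : Sec G.G₀ S),
    ((obj x : 𝓖.fib.Ob S) ◁ eta S) ≫ mu x 1 ≫ toPreMorphism.ident (x * 1) x (mul_one x) =
      (ρ_ (obj x : 𝓖.fib.Ob S)).hom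

/-- A presentation of a braided group-like stack by a braided crossed module: the braiding of `𝓖`
is given on objects that come from `G₀` by `{x, y} : x y ⟶ y x`. -/
structure BraidedPresentation (G : BraidedCrossedModule.{w} J) (𝓖 : BraidedGrStack.{o, h} J)
    extends Presentation G.toCrossedModule 𝓖.gr where
  braided : ∀ {S : C} (x y : Sec G.G₀ S) (e : y * x = x * y * G.bd (G.br x y)),
    mu x y ≫ toPreMorphism.vert (x * y) (y * x) (G.br x y) e =
      (β_ (obj x : 𝓖.gr.fib.Ob S) (obj y)).hom ≫ mu y x

end Presentation

/-! ## Multi-extensions and butterflies -/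

/-- Two tuples have the same components except possibly at `i`. -/
def AgreeOff {n : ℕ} {A : Fin n → Type w} (i : Fin n) (y y' : ∀ k, A k) : Prop :=
  ∀ k, k ≠ i → y k = y' k

section Butterfly

variable {C : Type u} [Category.{v} C] {J : GrothendieckTopology C} {n : ℕ}

/-- An `n`-extension of `(A 0, …, A (n-1))` by the braided crossed module `G`: a `(G₁, G₀)`-torsor
`E` over `∏ k, A k` with `n` pairwise compatible partial multiplication laws. -/
structure NExtension (J : GrothendieckTopology C) (A : Fin n → Cᵒᵖ ⥤ GrpCat.{w})
    (G : BraidedCrossedModule.{w} J) where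
  E : Cᵒᵖ ⥤ Type w
  isSheaf : Presieve.IsSheaf J E
  /-- The projection to the base. -/
  p : ∀ {S : C}, E.obj (op S) → ∀ k, Sec (A k) S
  p_res : ∀ {T S : C} (f : T ⟶ S) (e : E.obj (op S)) (k : Fin n),
    p (E.map f.op e) k = res (A k) f (p e k)
  /-- The right action of `G₁`. -/
  act : ∀ {S : C}, E.obj (op S) → Sec G.G₁ S → E.obj (op S)
  act_res : ∀ {T S : C} (f : T ⟶ S) (e : E.obj (op S)) (g : Sec G.G₁ S),
    E.map f.op (act e g) = act (E.map f.op e) (res G.G₁ f g)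
  act_one : ∀ {S : C} (e : E.obj (op S)), act e 1 = e
  act_mul : ∀ {S : C} (e : E.obj (op S)) (g g' : Sec G.G₁ S), act e (g * g') = act (act e g) g'
  p_act : ∀ {S : C} (e : E.obj (op S)) (g : Sec G.G₁ S), p (act e g) = p e
  simply_transitive : ∀ {S : C} (e e' : E.obj (op S)), p e = p e' → ∃! g : Sec G.G₁ S, act e g = e'
  locally_nonempty : ∀ {S : C} (y : ∀ k, Sec (A k) S), ∃ R : Sieve S, R ∈ J S ∧
    ∀ {T : C} (f : T ⟶ S), R f → ∃ e : E.obj (op T), p e = fun k => res (A k) f (y k)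
  /-- The equivariant map to `G₀`. -/
  j : ∀ {S : C}, E.obj (op S) → Sec G.G₀ S
  j_res : ∀ {T S : C} (f : T ⟶ S) (e : E.obj (op S)), j (E.map f.op e) = res G.G₀ f (j e)
  j_act : ∀ {S : C} (e : E.obj (op S)) (g : Sec G.G₁ S), j (act e g) = j e * G.bd g
  /-- The partial multiplication `e ×ᵢ e'`, defined if the base points agree except at `i`. -/
  mul : ∀ {S : C} (i : Fin n) (e e' : E.obj (op S)), AgreeOff i (p e) (p e') → E.obj (op S)
  mul_res : ∀ {T S : C} (f : T ⟶ S) (i : Fin n) (e e' : E.obj (op S))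
    (a : AgreeOff i (p e) (p e')) (a' : AgreeOff i (p (E.map f.op e)) (p (E.map f.op e'))),
    E.map f.op (mul i e e' a) = mul i (E.map f.op e) (E.map f.op e') a'
  p_mul : ∀ {S : C} (i : Fin n) (e e' : E.obj (op S)) (a : AgreeOff i (p e) (p e')),
    p (mul i e e' a) = Function.update (p e) i (p e i * p e' i)
  /-- Together with `act_mul_left` this says that `×ᵢ` is a morphism of `G₁`-torsors on the
  contracted product of the fibres; the left action of `g` is `g e' = e' (g ^ j e')`. -/
  mul_act_right : ∀ {S : C} (i : Fin n) (e e' : E.obj (op S)) (g : Sec G.G₁ S)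
    (a : AgreeOff i (p e) (p e')) (a' : AgreeOff i (p e) (p (act e' g))),
    mul i e (act e' g) a' = act (mul i e e' a) g
  act_mul_left : ∀ {S : C} (i : Fin n) (e e' : E.obj (op S)) (g : Sec G.G₁ S)
    (a : AgreeOff i (p (act e g)) (p e')) (a' : AgreeOff i (p e) (p (act e' (G.act g (j e'))))),
    mul i (act e g) e' a = mul i e (act e' (G.act g (j e'))) a'
  j_mul : ∀ {S : C} (i : Fin n) (e e' : E.obj (op S)) (a : AgreeOff i (p e) (p e')),
    j (mul i e e' a) = j e * j e'
  mul_assoc : ∀ {S : C} (i : Fin n) (e e' e'' : E.obj (op S)) (a : AgreeOff i (p e) (p e'))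
    (b : AgreeOff i (p (mul i e e' a)) (p e'')) (a' : AgreeOff i (p e') (p e''))
    (b' : AgreeOff i (p e) (p (mul i e' e'' a'))),
    mul i (mul i e e' a) e'' b = mul i e (mul i e' e'' a') b'
  /-- The compatibility of `×ᵢ` and `×ⱼ`:
  `(u ×ᵢ u') ×ⱼ (v ×ᵢ v') = ((u ×ⱼ v) ×ᵢ (u' ×ⱼ v')) ({j u', j v}⁻¹) ^ (j v')`. -/
  interchange : ∀ {S : C} (i k : Fin n), i < k → ∀ (e e' d d' : E.obj (op S))
    (a : AgreeOff i (p e) (p e')) (b : AgreeOff i (p d) (p d'))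
    (c : AgreeOff k (p (mul i e e' a)) (p (mul i d d' b)))
    (a' : AgreeOff k (p e) (p d)) (b' : AgreeOff k (p e') (p d'))
    (c' : AgreeOff i (p (mul k e d a')) (p (mul k e' d' b'))),
    mul k (mul i e e' a) (mul i d d' b) c =
      act (mul i (mul k e d a') (mul k e' d' b') c') (G.act (G.br (j e') (j d))⁻¹ (j d'))

/-- An `n`-butterfly from `H 0 × … × H (n-1)` to `G`: an `n`-extension of the groups `(H k)₀` by `G`
with trivializations `s i` of its pullbacks along `∂` in each of the variables. -/
structure NButterfly (H : Fin n → CrossedModule.{w} J) (G : BraidedCrossedModule.{w} J)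
    extends NExtension J (fun k => (H k).G₀) G where
  /-- The value at the tuple with entry `h` at the place `i` and entries `y k` at the other places;
  the entry `y i` is `∂ h`. -/
  s : ∀ {S : C} (i : Fin n) (y : ∀ k, Sec (H k).G₀ S) (h : Sec (H i).G₁ S), y i = (H i).bd h →
    E.obj (op S)
  s_res : ∀ {T S : C} (f : T ⟶ S) (i : Fin n) (y : ∀ k, Sec (H k).G₀ S) (h : Sec (H i).G₁ S)
    (e : y i = (H i).bd h) (e' : res (H i).G₀ f (y i) = (H i).bd (res (H i).G₁ f h)),
    E.map f.op (s i y h e) = s i (fun k => res (H k).G₀ f (y k)) (res (H i).G₁ f h) e'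
  p_s : ∀ {S : C} (i : Fin n) (y : ∀ k, Sec (H k).G₀ S) (h : Sec (H i).G₁ S)
    (e : y i = (H i).bd h), p (s i y h e) = y
  j_s : ∀ {S : C} (i : Fin n) (y : ∀ k, Sec (H k).G₀ S) (h : Sec (H i).G₁ S)
    (e : y i = (H i).bd h), j (s i y h e) = 1
  s_mul_same : ∀ {S : C} (i : Fin n) (y y' : ∀ k, Sec (H k).G₀ S) (h h' : Sec (H i).G₁ S)
    (e : y i = (H i).bd h) (e' : y' i = (H i).bd h')
    (a : AgreeOff i (p (s i y h e)) (p (s i y' h' e')))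
    (e'' : Function.update y i (y i * y' i) i = (H i).bd (h * h')),
    mul i (s i y h e) (s i y' h' e') a = s i (Function.update y i (y i * y' i)) (h * h') e''
  s_mul_other : ∀ {S : C} (i k : Fin n), k ≠ i → ∀ (y y' : ∀ k, Sec (H k).G₀ S)
    (h : Sec (H i).G₁ S) (e : y i = (H i).bd h) (e' : y' i = (H i).bd h)
    (a : AgreeOff k (p (s i y h e)) (p (s i y' h e')))
    (e'' : Function.update y k (y k * y' k) i = (H i).bd h),
    mul k (s i y h e) (s i y' h e') a = s i (Function.update y k (y k * y' k)) h e''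
  restriction : ∀ {S : C} (i k : Fin n), i ≠ k → ∀ (y : ∀ k, Sec (H k).G₀ S)
    (h : Sec (H i).G₁ S) (h' : Sec (H k).G₁ S) (e : y i = (H i).bd h) (e' : y k = (H k).bd h'),
    s i y h e = s k y h' e'
  compatibility : ∀ {S : C} (i : Fin n) (y y' : ∀ k, Sec (H k).G₀ S) (h : Sec (H i).G₁ S)
    (x : E.obj (op S)) (e : y i = (H i).bd h) (e' : y' i = (H i).bd ((H i).act h (p x i)))
    (a : AgreeOff i (p (s i y h e)) (p x))
    (a' : AgreeOff i (p x) (p (s i y' ((H i).act h (p x i)) e'))),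
    mul i (s i y h e) x a = mul i x (s i y' ((H i).act h (p x i)) e') a'

namespace NButterfly

variable {H : Fin n → CrossedModule.{w} J} {G : BraidedCrossedModule.{w} J}

/-- Sections of a butterfly. -/
abbrev El (B : NButterfly H G) (S : C) : Type w := B.E.obj (op S)

/-- A morphism of butterflies. -/
@[ext]
structure Hom (B B' : NButterfly H G) where
  hom : B.E ⟶ B'.E
  p_hom : ∀ {S : C} (e : B.El S), B'.p (hom.app (op S) e) = B.p e
  act_hom : ∀ {S : C} (e : B.El S) (g : Sec G.G₁ S),
    hom.app (op S) (B.act e g) = B'.act (hom.app (op S) e) g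
  j_hom : ∀ {S : C} (e : B.El S), B'.j (hom.app (op S) e) = B.j e
  mul_hom : ∀ {S : C} (i : Fin n) (e e' : B.El S) (a : AgreeOff i (B.p e) (B.p e'))
    (a' : AgreeOff i (B'.p (hom.app (op S) e)) (B'.p (hom.app (op S) e'))),
    hom.app (op S) (B.mul i e e' a) = B'.mul i (hom.app (op S) e) (hom.app (op S) e') a'
  s_hom : ∀ {S : C} (i : Fin n) (y : ∀ k, Sec (H k).G₀ S) (h : Sec (H i).G₁ S)
    (e : y i = (H i).bd h), hom.app (op S) (B.s i y h e) = B'.s i y h e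

instance category : Category (NButterfly H G) where
  Hom := Hom
  id B := ⟨𝟙 B.E, by simp, by simp, by simp, by simp, by simp⟩
  comp φ ψ := ⟨φ.hom ≫ ψ.hom, by simp [φ.p_hom, ψ.p_hom], by simp [φ.act_hom, ψ.act_hom],
    by simp [φ.j_hom, ψ.j_hom], fun i e e' a a' => by
      have a'' := by simpa only [← φ.p_hom] using a
      exact (congrArg (ψ.hom.app _) (φ.mul_hom i e e' a a'')).trans (ψ.mul_hom i _ _ a'' a'),
    by simp [φ.s_hom, ψ.s_hom]⟩

end NButterfly

end Butterfly

namespace NButterfly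

section Trivial

variable {C : Type u} [Category.{v} C] {J : GrothendieckTopology C} {n : ℕ}
  (H : Fin n → CrossedModule.{w} J) (G : BraidedCrossedModule.{w} J)

/-- The sheaf `∏ k, (H k)₀ × G₁`. -/
def trivialSheaf : Cᵒᵖ ⥤ Type w where
  obj S := (∀ k, Sec (H k).G₀ S.unop) × Sec G.G₁ S.unop
  map f := ↾fun e => (fun k => res (H k).G₀ f.unop (e.1 k), res G.G₁ f.unop e.2)
  map_id S := by
    ext e <;> simp [res]
  map_comp f g := by
    ext e <;> simp [res]

theorem trivialSheaf_map {S T : C} (f : T ⟶ S) (e : (trivialSheaf H G).obj (op S)) :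
    (trivialSheaf H G).map f.op e =
      ((fun k => res (H k).G₀ f (e.1 k), res G.G₁ f e.2) :
        (∀ k, Sec (H k).G₀ T) × Sec G.G₁ T) :=
  rfl

theorem trivialSheaf_isSheaf : Presieve.IsSheaf J (trivialSheaf H G) := by
  intro S R hR x hx
  have h₀ : ∀ k, ∃ t : Sec (H k).G₀ S, ∀ (T : C) (f : T ⟶ S) (hf : R f),
      res (H k).G₀ f t = (x f hf).1 k := by
    intro k
    obtain ⟨t, ht, -⟩ := (H k).isSheaf₀ R hR (fun T f hf => (x f hf).1 k)
      (fun Y₁ Y₂ Z g₁ g₂ f₁ f₂ h₁ h₂ w =>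
        congrFun (congrArg Prod.fst (hx g₁ g₂ h₁ h₂ w)) k)
    exact ⟨t, fun T f hf => ht f hf⟩
  have h₁ : ∃ t : Sec G.G₁ S, ∀ (T : C) (f : T ⟶ S) (hf : R f),
      res G.G₁ f t = (x f hf).2 := by
    obtain ⟨t, ht, -⟩ := G.isSheaf₁ R hR (fun T f hf => (x f hf).2)
      (fun Y₁ Y₂ Z g₁ g₂ f₁ f₂ h₁ h₂ w => congrArg Prod.snd (hx g₁ g₂ h₁ h₂ w))
    exact ⟨t, fun T f hf => ht f hf⟩
  choose t ht using h₀
  obtain ⟨g, hg⟩ := h₁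
  refine ⟨(t, g), fun T f hf => Prod.ext (funext fun k => ht k T f hf) (hg T f hf), ?_⟩
  rintro ⟨t', g'⟩ h'
  refine Prod.ext (funext fun k => ?_) ?_
  · refine ((H k).isSheaf₀ R hR).isSeparatedFor.ext fun T f hf => ?_
    exact (congrFun (congrArg Prod.fst (h' f hf)) k).trans (ht k T f hf).symm
  · refine (G.isSheaf₁ R hR).isSeparatedFor.ext fun T f hf => ?_
    exact (congrArg Prod.snd (h' f hf)).trans (hg T f hf).symm

theorem res_update {S T : C} (f : T ⟶ S) (y : ∀ k, Sec (H k).G₀ S) (i : Fin n)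
    (a : Sec (H i).G₀ S) : (fun k => res (H k).G₀ f (Function.update y i a k)) =
      Function.update (fun k => res (H k).G₀ f (y k)) i (res (H i).G₀ f a) := by
  funext k
  rcases eq_or_ne k i with rfl | hk
  · simp
  · simp [hk]

theorem act_eq_of_bd {S : C} (u' d d' : Sec G.G₁ S) :
    G.act (G.br (G.bd u') (G.bd d))⁻¹ (G.bd d') = d'⁻¹ * (u'⁻¹ * d⁻¹ * u' * d) * d' := by
  have h : ∀ g g' : Sec G.G₁ S, G.act g (G.bd g') = g'⁻¹ * g * g' := G.act_bd
  rw [h, G.br_bd, h]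
  group

/-- The trivial butterfly: the trivial torsor with the componentwise multiplications. -/
def trivial : NButterfly H G where
  E := trivialSheaf H G
  isSheaf := trivialSheaf_isSheaf H G
  p e := e.1
  p_res _ _ _ := rfl
  act e g := (e.1, e.2 * g)
  act_res f e g := Prod.ext rfl (map_mul (res G.G₁ f) _ _)
  act_one e := Prod.ext rfl (mul_one _)
  act_mul e g g' := Prod.ext rfl (mul_assoc _ _ _).symm
  p_act _ _ := rfl
  simply_transitive e e' h :=
    ⟨e.2⁻¹ * e'.2, Prod.ext h (mul_inv_cancel_left _ _), fun g hg => by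
      have := congrArg Prod.snd hg
      exact eq_inv_mul_of_mul_eq this⟩
  locally_nonempty {S} y := ⟨⊤, J.top_mem S, fun f _ => ⟨(fun k => res (H k).G₀ f (y k), 1), rfl⟩⟩
  j e := G.bd e.2
  j_res {T S} f e := by
    have := congrArg (fun m => m.hom e.2) (G.bdHom.naturality f.op)
    exact this
  j_act e g := map_mul G.bd _ _
  mul i e e' _ := (Function.update e.1 i (e.1 i * e'.1 i), e.2 * e'.2)
  mul_res f i e e' _ _ := Prod.ext ((res_update H f _ _ _).trans
    (by rw [map_mul]; rfl)) (map_mul (res G.G₁ f) _ _)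
  p_mul _ _ _ _ := rfl
  mul_act_right i e e' g _ _ := Prod.ext rfl (mul_assoc _ _ _).symm
  act_mul_left {S} i e e' g _ _ := Prod.ext rfl (by
    have h : ∀ g g' : Sec G.G₁ S, G.act g (G.bd g') = g'⁻¹ * g * g' := G.act_bd
    simp only [h]
    group)
  j_mul i e e' _ := map_mul G.bd _ _
  mul_assoc i e e' e'' _ _ _ _ := Prod.ext (by simp [mul_assoc]) (mul_assoc _ _ _)
  interchange i k hik e e' d d' a b c a' b' c' := by
    refine Prod.ext ?_ ?_
    · funext l
      rcases eq_or_ne l i with rfl | hi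
      · have h₁ := a' l hik.ne
        have h₂ := b' l hik.ne
        simp_all [hik.ne]
      · rcases eq_or_ne l k with rfl | hk
        · have h₁ := a l hi
          have h₂ := b l hi
          simp_all
        · simp [hi, hk]
    · simp only [act_eq_of_bd]
      group
  s i y h _ := (y, 1)
  s_res f i y h _ _ := Prod.ext rfl (map_one (res G.G₁ f))
  p_s _ _ _ _ := rfl
  j_s _ _ _ _ := map_one G.bd
  s_mul_same _ _ _ _ _ _ _ _ _ := Prod.ext rfl (mul_one _)
  s_mul_other _ _ _ _ _ _ _ _ _ _ := Prod.ext rfl (mul_one _)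
  restriction _ _ _ _ _ _ _ _ := rfl
  compatibility i y y' h x e e' a a' := by
    refine Prod.ext (funext fun k => ?_) ((one_mul _).trans (mul_one _).symm)
    rcases eq_or_ne k i with rfl | hk
    · have hb := (H k).bd_act h (x.1 k)
      simp only [Function.update_self]
      rw [e, e']
      change _ = x.1 k * (H k).bd ((H k).act h (x.1 k))
      change (H k).bd ((H k).act h (x.1 k)) = _ at hb
      rw [hb]
      simp only [mul_assoc, mul_inv_cancel_left]
      rfl
    · simpa [hk] using a k hk

end Trivial

end NButterfly

/-! ## Additive functors in several variables -/

/-- In a symmetric monoidal category the middle-four interchange is compatible with itself. -/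
theorem tensorμ_hexagon {D : Type o} [Category.{h} D] [MonoidalCategory D] [BraidedCategory D]
    (hs : ∀ x y : D, (β_ x y).hom ≫ (β_ y x).hom = 𝟙 (x ⊗ y)) (a x y z p q r b : D) :
    (tensorμ a x y z ⊗ₘ tensorμ p q r b) ≫ tensorμ (a ⊗ y) (x ⊗ z) (p ⊗ r) (q ⊗ b) ≫
        (tensorμ a y p r ⊗ₘ tensorμ x z q b) =
      tensorμ (a ⊗ x) (y ⊗ z) (p ⊗ q) (r ⊗ b) ≫
        (tensorμ a x p q ⊗ₘ tensorμ y z r b) ≫ tensorμ (a ⊗ p) (x ⊗ q) (y ⊗ r) (z ⊗ b) := by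
  let _ : SymmetricCategory D := { symmetry := hs }
  let _ : BraidedCategory (D × D) :=
    { braiding := fun X Y => Iso.prod (β_ X.1 Y.1) (β_ X.2 Y.2) }
  let _ : (tensor D).LaxBraided :=
    { braided := fun X Y => by
        change tensorμ X.1 X.2 Y.1 Y.2 ≫ ((β_ X.1 Y.1).hom ⊗ₘ (β_ X.2 Y.2).hom) =
          (β_ (X.1 ⊗ X.2) (Y.1 ⊗ Y.2)).hom ≫ tensorμ Y.1 Y.2 X.1 X.2
        simp [tensorμ, SymmetricCategory.braiding_swap_eq_inv_braiding Y.2 X.1,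
          MonoidalCategory.tensorHom_def] }
  exact (tensorμ_comp_μ_tensorHom_μ_comp_μ (tensor D) (a, x) (y, z) (p, q) (r, b)).symm

theorem tensorμ_unit {D : Type o} [Category.{h} D] [MonoidalCategory D] [BraidedCategory D] :
    ((λ_ (𝟙_ D)).hom ⊗ₘ (λ_ (𝟙_ D)).hom) ≫ (λ_ (𝟙_ D)).hom =
      tensorμ (𝟙_ D) (𝟙_ D) (𝟙_ D) (𝟙_ D) ≫ ((λ_ (𝟙_ D)).hom ⊗ₘ (λ_ (𝟙_ D)).hom) ≫
        (λ_ (𝟙_ D)).hom := by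
  rw [leftUnitor_monoidal (𝟙_ D) (𝟙_ D)]
  simp [tensorμ, unitors_equal]
  monoidal

section
variable {D : Type o} [Category.{h} D] [MonoidalCategory D] [BraidedCategory D]

theorem prod_assoc_aux {x y z xy yz l r x' y' z' xy' yz' l' r' : D}
    {a : x ⊗ y ⟶ xy} {b : xy ⊗ z ⟶ l} {c : y ⊗ z ⟶ yz} {d : x ⊗ yz ⟶ r} {A : l ⟶ r}
    {a' : x' ⊗ y' ⟶ xy'} {b' : xy' ⊗ z' ⟶ l'} {c' : y' ⊗ z' ⟶ yz'} {d' : x' ⊗ yz' ⟶ r'}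
    {A' : l' ⟶ r'}
    (e : (a ▷ z) ≫ b ≫ A = (α_ x y z).hom ≫ (x ◁ c) ≫ d)
    (e' : (a' ▷ z') ≫ b' ≫ A' = (α_ x' y' z').hom ≫ (x' ◁ c') ≫ d') :
    ((tensorμ x x' y y' ≫ (a ⊗ₘ a')) ▷ (z ⊗ z')) ≫ (tensorμ xy xy' z z' ≫ (b ⊗ₘ b')) ≫ (A ⊗ₘ A') =
      (α_ (x ⊗ x') (y ⊗ y') (z ⊗ z')).hom ≫
        ((x ⊗ x') ◁ (tensorμ y y' z z' ≫ (c ⊗ₘ c'))) ≫ tensorμ x x' yz yz' ≫ (d ⊗ₘ d') := by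
  have h₁ : ((a ⊗ₘ a') ▷ (z ⊗ z')) ≫ tensorμ xy xy' z z' =
      tensorμ (x ⊗ y) (x' ⊗ y') z z' ≫ ((a ▷ z) ⊗ₘ (a' ▷ z')) := tensorμ_natural_left a a' z z'
  have h₂ : ((x ⊗ x') ◁ (c ⊗ₘ c')) ≫ tensorμ x x' yz yz' =
      tensorμ x x' (y ⊗ z) (y' ⊗ z') ≫ ((x ◁ c) ⊗ₘ (x' ◁ c')) := tensorμ_natural_right x x' c c'
  simp only [comp_whiskerRight, MonoidalCategory.whiskerLeft_comp, Category.assoc]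
  rw [reassoc_of% h₁, reassoc_of% h₂, tensorHom_comp_tensorHom, tensorHom_comp_tensorHom, e, e',
    ← tensorHom_comp_tensorHom, tensor_associativity_assoc, tensorHom_comp_tensorHom]

theorem prod_left_unit_aux {x y z x' y' z' : D} {a : x ⊗ y ⟶ z} {L : z ⟶ y} {ε : x ⟶ 𝟙_ D}
    {a' : x' ⊗ y' ⟶ z'} {L' : z' ⟶ y'} {ε' : x' ⟶ 𝟙_ D}
    (e : a ≫ L = (ε ▷ y) ≫ (λ_ y).hom) (e' : a' ≫ L' = (ε' ▷ y') ≫ (λ_ y').hom) :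
    (tensorμ x x' y y' ≫ (a ⊗ₘ a')) ≫ (L ⊗ₘ L') =
      (((ε ⊗ₘ ε') ≫ (λ_ (𝟙_ D)).hom) ▷ (y ⊗ y')) ≫ (λ_ (y ⊗ y')).hom := by
  have h₁ : ((ε ⊗ₘ ε') ▷ (y ⊗ y')) ≫ tensorμ (𝟙_ D) (𝟙_ D) y y' =
      tensorμ x x' y y' ≫ ((ε ▷ y) ⊗ₘ (ε' ▷ y')) := tensorμ_natural_left ε ε' y y'
  have h₂ := tensor_left_unitality y y'
  rw [Category.assoc, tensorHom_comp_tensorHom, e, e', ← tensorHom_comp_tensorHom,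
    ← reassoc_of% h₁, comp_whiskerRight, Category.assoc, h₂]
  simp

theorem prod_right_unit_aux {x y z x' y' z' : D} {a : x ⊗ y ⟶ z} {L : z ⟶ x} {ε : y ⟶ 𝟙_ D}
    {a' : x' ⊗ y' ⟶ z'} {L' : z' ⟶ x'} {ε' : y' ⟶ 𝟙_ D}
    (e : a ≫ L = (x ◁ ε) ≫ (ρ_ x).hom) (e' : a' ≫ L' = (x' ◁ ε') ≫ (ρ_ x').hom) :
    (tensorμ x x' y y' ≫ (a ⊗ₘ a')) ≫ (L ⊗ₘ L') =
      ((x ⊗ x') ◁ ((ε ⊗ₘ ε') ≫ (λ_ (𝟙_ D)).hom)) ≫ (ρ_ (x ⊗ x')).hom := by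
  have h₁ : ((x ⊗ x') ◁ (ε ⊗ₘ ε')) ≫ tensorμ x x' (𝟙_ D) (𝟙_ D) =
      tensorμ x x' y y' ≫ ((x ◁ ε) ⊗ₘ (x' ◁ ε')) := tensorμ_natural_right x x' ε ε'
  have h₂ := tensor_right_unitality x x'
  rw [Category.assoc, tensorHom_comp_tensorHom, e, e', ← tensorHom_comp_tensorHom,
    ← reassoc_of% h₁, MonoidalCategory.whiskerLeft_comp, Category.assoc, h₂]
  simp [← MonoidalCategory.whiskerLeft_comp_assoc]

theorem prod_interchange_aux (hs : ∀ x y : D, (β_ x y).hom ≫ (β_ y x).hom = 𝟙 (x ⊗ y))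
    {x₁ x₂ x₃ x₄ p q r s t y₁ y₂ y₃ y₄ p' q' r' s' t' : D}
    {a : x₁ ⊗ x₂ ⟶ p} {b : x₃ ⊗ x₄ ⟶ q} {c : p ⊗ q ⟶ t} {d : x₁ ⊗ x₃ ⟶ r} {f : x₂ ⊗ x₄ ⟶ s}
    {g : r ⊗ s ⟶ t} {a' : y₁ ⊗ y₂ ⟶ p'} {b' : y₃ ⊗ y₄ ⟶ q'} {c' : p' ⊗ q' ⟶ t'}
    {d' : y₁ ⊗ y₃ ⟶ r'} {f' : y₂ ⊗ y₄ ⟶ s'} {g' : r' ⊗ s' ⟶ t'}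
    (e : (a ⊗ₘ b) ≫ c = tensorμ x₁ x₂ x₃ x₄ ≫ (d ⊗ₘ f) ≫ g)
    (e' : (a' ⊗ₘ b') ≫ c' = tensorμ y₁ y₂ y₃ y₄ ≫ (d' ⊗ₘ f') ≫ g') :
    ((tensorμ x₁ y₁ x₂ y₂ ≫ (a ⊗ₘ a')) ⊗ₘ (tensorμ x₃ y₃ x₄ y₄ ≫ (b ⊗ₘ b'))) ≫
        tensorμ p p' q q' ≫ (c ⊗ₘ c') =
      tensorμ (x₁ ⊗ y₁) (x₂ ⊗ y₂) (x₃ ⊗ y₃) (x₄ ⊗ y₄) ≫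
        ((tensorμ x₁ y₁ x₃ y₃ ≫ (d ⊗ₘ d')) ⊗ₘ (tensorμ x₂ y₂ x₄ y₄ ≫ (f ⊗ₘ f'))) ≫
          tensorμ r r' s s' ≫ (g ⊗ₘ g') := by
  rw [← tensorHom_comp_tensorHom, ← tensorHom_comp_tensorHom, Category.assoc, Category.assoc,
    tensorμ_natural_assoc, tensorμ_natural_assoc, tensorHom_comp_tensorHom, e, e',
    ← tensorHom_comp_tensorHom, ← reassoc_of% tensorμ_hexagon hs]
  simp only [tensorHom_comp_tensorHom]

theorem associator_prod_aux {x y z x' y' z' x'' y'' z'' : D} (a : x ⊗ y ⟶ z) (a' : x' ⊗ y' ⟶ z')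
    (a'' : x'' ⊗ y'' ⟶ z'') :
    (tensorμ (x ⊗ x') x'' (y ⊗ y') y'' ≫ ((tensorμ x x' y y' ≫ (a ⊗ₘ a')) ⊗ₘ a'')) ≫
        (α_ z z' z'').hom =
      ((α_ x x' x'').hom ⊗ₘ (α_ y y' y'').hom) ≫ tensorμ x (x' ⊗ x'') y (y' ⊗ y'') ≫
        (a ⊗ₘ (tensorμ x' x'' y' y'' ≫ (a' ⊗ₘ a''))) := by
  have h₁ : ((tensorμ x x' y y' ≫ (a ⊗ₘ a')) ⊗ₘ a'') =
      (tensorμ x x' y y' ▷ (x'' ⊗ y'')) ≫ ((a ⊗ₘ a') ⊗ₘ a'') := by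
    rw [← tensorHom_id, tensorHom_comp_tensorHom, Category.id_comp]
  have h₂ : (a ⊗ₘ (tensorμ x' x'' y' y'' ≫ (a' ⊗ₘ a''))) =
      ((x ⊗ y) ◁ tensorμ x' x'' y' y'') ≫ (a ⊗ₘ (a' ⊗ₘ a'')) := by
    rw [← id_tensorHom, tensorHom_comp_tensorHom, Category.id_comp]
  rw [h₁, h₂, Category.assoc, Category.assoc, associator_naturality, associator_monoidal_assoc]

theorem associator_eps_aux {x x' x'' : D} (a : x ⟶ 𝟙_ D) (a' : x' ⟶ 𝟙_ D) (a'' : x'' ⟶ 𝟙_ D) :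
    (α_ x x' x'').hom ≫ (a ⊗ₘ ((a' ⊗ₘ a'') ≫ (λ_ (𝟙_ D)).hom)) ≫ (λ_ (𝟙_ D)).hom =
      (((a ⊗ₘ a') ≫ (λ_ (𝟙_ D)).hom) ⊗ₘ a'') ≫ (λ_ (𝟙_ D)).hom := by
  have h₁ : (a ⊗ₘ ((a' ⊗ₘ a'') ≫ (λ_ (𝟙_ D)).hom)) =
      (a ⊗ₘ (a' ⊗ₘ a'')) ≫ (𝟙_ D ◁ (λ_ (𝟙_ D)).hom) := by
    rw [← id_tensorHom, tensorHom_comp_tensorHom, Category.comp_id]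
  have h₂ : (((a ⊗ₘ a') ≫ (λ_ (𝟙_ D)).hom) ⊗ₘ a'') =
      ((a ⊗ₘ a') ⊗ₘ a'') ≫ ((λ_ (𝟙_ D)).hom ▷ 𝟙_ D) := by
    rw [← tensorHom_id, tensorHom_comp_tensorHom, Category.comp_id]
  rw [h₁, h₂, Category.assoc, Category.assoc, ← associator_naturality_assoc]
  congr 1
  simp [unitors_equal]

theorem leftUnitor_prod_aux {x y z : D} (a : x ⊗ y ⟶ z) :
    (tensorμ (𝟙_ D) x (𝟙_ D) y ≫ ((λ_ (𝟙_ D)).hom ⊗ₘ a)) ≫ (λ_ z).hom =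
      ((λ_ x).hom ⊗ₘ (λ_ y).hom) ≫ a := by
  rw [leftUnitor_monoidal]
  simp [MonoidalCategory.tensorHom_def]

theorem rightUnitor_prod_aux {x y z : D} (a : x ⊗ y ⟶ z) :
    (tensorμ x (𝟙_ D) y (𝟙_ D) ≫ (a ⊗ₘ (λ_ (𝟙_ D)).hom)) ≫ (ρ_ z).hom =
      ((ρ_ x).hom ⊗ₘ (ρ_ y).hom) ≫ a := by
  rw [rightUnitor_monoidal]
  simp [MonoidalCategory.tensorHom_def']
end

section NAdditive

variable {C : Type u} [Category.{v} C] {J : GrothendieckTopology C} {n : ℕ}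

/-- `z` is the product of the tuples `x` and `y` in the variable `i`: the three tuples have the same
components in the other variables, and `z i = x i ⊗ y i`. -/
structure ProdAt (𝓗 : Fin n → GrStack.{o, h} J) {S : C} (i : Fin n)
    (x y z : ∀ k, (𝓗 k).fib.Ob S) : Prop where
  left : ∀ k, k ≠ i → x k = z k
  right : ∀ k, k ≠ i → y k = z k
  prod : z i = x i ⊗ y i

/-- The same for tuples of morphisms over `f`. -/
structure HomProdAt (𝓗 : Fin n → GrStack.{o, h} J) {S T : C} {f : S ⟶ T} (i : Fin n)
    {x y z : ∀ k, (𝓗 k).fib.Ob S} {x' y' z' : ∀ k, (𝓗 k).fib.Ob T}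
    (φ : ∀ k, (𝓗 k).fib.Hom f (x k) (x' k)) (ψ : ∀ k, (𝓗 k).fib.Hom f (y k) (y' k))
    (χ : ∀ k, (𝓗 k).fib.Hom f (z k) (z' k)) : Prop where
  left : ∀ k, k ≠ i → HEq (φ k) (χ k)
  right : ∀ k, k ≠ i → HEq (ψ k) (χ k)
  prod : HEq (χ i) ((𝓗 i).tens (φ i) (ψ i))

/-- An `n`-additive functor `𝓗 0 × … × 𝓗 (n-1) ⟶ 𝓖`: a morphism of fibered categories which is
monoidal in each variable, the monoidal structures being pairwise compatible. -/
structure NAdditive (𝓗 : Fin n → GrStack.{o₁, h₁} J) (𝓖 : BraidedGrStack.{o₂, h} J) where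
  obj : ∀ {S : C}, (∀ k, (𝓗 k).fib.Ob S) → 𝓖.gr.fib.Ob S
  map : ∀ {S T : C} {f : S ⟶ T} {x : ∀ k, (𝓗 k).fib.Ob S} {y : ∀ k, (𝓗 k).fib.Ob T},
    (∀ k, (𝓗 k).fib.Hom f (x k) (y k)) → 𝓖.gr.fib.Hom f (obj x) (obj y)
  map_id : ∀ {S : C} (x : ∀ k, (𝓗 k).fib.Ob S),
    map (fun k => (𝓗 k).fib.id (x k)) = 𝓖.gr.fib.id (obj x)
  map_comp : ∀ {R S T : C} {f : R ⟶ S} {g : S ⟶ T} {k : R ⟶ T} {x : ∀ k, (𝓗 k).fib.Ob R}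
    {y : ∀ k, (𝓗 k).fib.Ob S} {z : ∀ k, (𝓗 k).fib.Ob T}
    (φ : ∀ k, (𝓗 k).fib.Hom f (x k) (y k)) (ψ : ∀ k, (𝓗 k).fib.Hom g (y k) (z k))
    (e : f ≫ g = k),
    map (fun k => (𝓗 k).fib.comp (φ k) (ψ k) e) = 𝓖.gr.fib.comp (map φ) (map ψ) e
  /-- The additivity isomorphism
  `F (…, a, …) ⊗ F (…, b, …) ⟶ F (…, a ⊗ b, …)` in the variable `i`. -/
  lam : ∀ {S : C} (i : Fin n) (x y z : ∀ k, (𝓗 k).fib.Ob S), ProdAt 𝓗 i x y z →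
    (obj x ⊗ obj y ⟶ obj z)
  lam_naturality : ∀ {S T : C} {f : S ⟶ T} (i : Fin n) (x y z : ∀ k, (𝓗 k).fib.Ob S)
    (x' y' z' : ∀ k, (𝓗 k).fib.Ob T) (e : ProdAt 𝓗 i x y z) (e' : ProdAt 𝓗 i x' y' z')
    (φ : ∀ k, (𝓗 k).fib.Hom f (x k) (x' k)) (ψ : ∀ k, (𝓗 k).fib.Hom f (y k) (y' k))
    (χ : ∀ k, (𝓗 k).fib.Hom f (z k) (z' k)), HomProdAt 𝓗 i φ ψ χ →
    𝓖.gr.fib.post (𝓖.gr.tens (map φ) (map ψ)) (lam i x' y' z' e') =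
      𝓖.gr.fib.pre (lam i x y z e) (map χ)
  lam_assoc : ∀ {S : C} (i : Fin n) (x y z xy yz l r : ∀ k, (𝓗 k).fib.Ob S)
    (e₁ : ProdAt 𝓗 i x y xy) (e₂ : ProdAt 𝓗 i xy z l) (e₃ : ProdAt 𝓗 i y z yz)
    (e₄ : ProdAt 𝓗 i x yz r) (A : ∀ k, l k ⟶ r k), (∀ k, k ≠ i → HEq (A k) (𝟙 (l k))) →
    HEq (A i) (α_ (x i) (y i) (z i)).hom →
    (lam i x y xy e₁ ▷ obj z) ≫ lam i xy z l e₂ ≫ (map A : obj l ⟶ obj r) =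
      (α_ (obj x) (obj y) (obj z)).hom ≫ (obj x ◁ lam i y z yz e₃) ≫ lam i x yz r e₄
  /-- The unit isomorphism `F (…, I, …) ⟶ I` in the variable `i`. -/
  eps : ∀ {S : C} (i : Fin n) (x : ∀ k, (𝓗 k).fib.Ob S), x i = 𝟙_ ((𝓗 i).fib.Ob S) →
    (obj x ⟶ 𝟙_ (𝓖.gr.fib.Ob S))
  eps_naturality : ∀ {S T : C} {f : S ⟶ T} (i : Fin n) (x : ∀ k, (𝓗 k).fib.Ob S)
    (x' : ∀ k, (𝓗 k).fib.Ob T) (e : x i = 𝟙_ ((𝓗 i).fib.Ob S)) (e' : x' i = 𝟙_ ((𝓗 i).fib.Ob T))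
    (φ : ∀ k, (𝓗 k).fib.Hom f (x k) (x' k)), HEq (φ i) ((𝓗 i).unitMap f) →
    𝓖.gr.fib.post (map φ) (eps i x' e') = 𝓖.gr.fib.pre (eps i x e) (𝓖.gr.unitMap f)
  left_unit : ∀ {S : C} (i : Fin n) (x y z : ∀ k, (𝓗 k).fib.Ob S)
    (e : x i = 𝟙_ ((𝓗 i).fib.Ob S)) (e' : ProdAt 𝓗 i x y z) (L : ∀ k, z k ⟶ y k),
    (∀ k, k ≠ i → HEq (L k) (𝟙 (y k))) → HEq (L i) (λ_ (y i)).hom →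
    lam i x y z e' ≫ (map L : obj z ⟶ obj y) = (eps i x e ▷ obj y) ≫ (λ_ (obj y)).hom
  right_unit : ∀ {S : C} (i : Fin n) (x y z : ∀ k, (𝓗 k).fib.Ob S)
    (e : y i = 𝟙_ ((𝓗 i).fib.Ob S)) (e' : ProdAt 𝓗 i x y z) (L : ∀ k, z k ⟶ x k),
    (∀ k, k ≠ i → HEq (L k) (𝟙 (x k))) → HEq (L i) (ρ_ (x i)).hom →
    lam i x y z e' ≫ (map L : obj z ⟶ obj x) = (obj x ◁ eps i y e) ≫ (ρ_ (obj x)).hom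
  /-- The compatibility of the additivity isomorphisms in the variables `i` and `k`; `tensorμ` is the
  morphism `(a b) (c d) ⟶ (a c) (b d)` given by the braiding `b c ⟶ c b`. -/
  interchange : ∀ {S : C} (i k : Fin n), i < k →
    ∀ (x x' y y' xx' yy' xy x'y' t : ∀ k, (𝓗 k).fib.Ob S)
    (e₁ : ProdAt 𝓗 i x x' xx') (e₂ : ProdAt 𝓗 i y y' yy') (e₃ : ProdAt 𝓗 k xx' yy' t)
    (e₄ : ProdAt 𝓗 k x y xy) (e₅ : ProdAt 𝓗 k x' y' x'y') (e₆ : ProdAt 𝓗 i xy x'y' t),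
    (lam i x x' xx' e₁ ⊗ₘ lam i y y' yy' e₂) ≫ lam k xx' yy' t e₃ =
      tensorμ (obj x) (obj x') (obj y) (obj y') ≫
        (lam k x y xy e₄ ⊗ₘ lam k x' y' x'y' e₅) ≫ lam i xy x'y' t e₆
  eps_eq : ∀ {S : C} (i k : Fin n) (x : ∀ k, (𝓗 k).fib.Ob S) (e : x i = 𝟙_ ((𝓗 i).fib.Ob S))
    (e' : x k = 𝟙_ ((𝓗 k).fib.Ob S)), eps i x e = eps k x e'

namespace NAdditive

variable {𝓗 : Fin n → GrStack.{o₁, h₁} J} {𝓖 : BraidedGrStack.{o₂, h} J}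

/-- A natural transformation of `n`-additive functors. -/
@[ext]
structure Hom (F F' : NAdditive 𝓗 𝓖) where
  app : ∀ {S : C} (x : ∀ k, (𝓗 k).fib.Ob S), F.obj x ⟶ F'.obj x
  naturality : ∀ {S T : C} {f : S ⟶ T} {x : ∀ k, (𝓗 k).fib.Ob S} {y : ∀ k, (𝓗 k).fib.Ob T}
    (φ : ∀ k, (𝓗 k).fib.Hom f (x k) (y k)),
    𝓖.gr.fib.post (F.map φ) (app y) = 𝓖.gr.fib.pre (app x) (F'.map φ)
  app_lam : ∀ {S : C} (i : Fin n) (x y z : ∀ k, (𝓗 k).fib.Ob S) (e : ProdAt 𝓗 i x y z),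
    F.lam i x y z e ≫ app z = (app x ⊗ₘ app y) ≫ F'.lam i x y z e
  app_eps : ∀ {S : C} (i : Fin n) (x : ∀ k, (𝓗 k).fib.Ob S) (e : x i = 𝟙_ ((𝓗 i).fib.Ob S)),
    app x ≫ F'.eps i x e = F.eps i x e


instance category : Category (NAdditive 𝓗 𝓖) where
  Hom := Hom
  id F := ⟨fun x => 𝟙 (F.obj x), fun φ => FibGpd.Sq.refl _, by simp, by simp⟩
  comp η θ := ⟨fun x => η.app x ≫ θ.app x, fun φ => FibGpd.Sq.comp (η.naturality φ) (θ.naturality φ),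
    fun i x y z e => by
      rw [← Category.assoc, η.app_lam, Category.assoc, θ.app_lam, ← Category.assoc,
        tensorHom_comp_tensorHom],
    fun i x e => by rw [Category.assoc, θ.app_eps, η.app_eps]⟩

@[simp]
theorem id_app (F : NAdditive 𝓗 𝓖) {S : C} (x : ∀ k, (𝓗 k).fib.Ob S) :
    Hom.app (𝟙 F) x = 𝟙 (F.obj x) :=
  rfl

@[simp]
theorem comp_app {F F' F'' : NAdditive 𝓗 𝓖} (η : F ⟶ F') (θ : F' ⟶ F'') {S : C}
    (x : ∀ k, (𝓗 k).fib.Ob S) : Hom.app (η ≫ θ) x = Hom.app η x ≫ Hom.app θ x :=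
  rfl

theorem hom_ext {F F' : NAdditive 𝓗 𝓖} {η θ : F ⟶ F'}
    (e : ∀ {S : C} (x : ∀ k, (𝓗 k).fib.Ob S), Hom.app η x = Hom.app θ x) : η = θ :=
  Hom.ext (by funext S x; exact e x)

variable (𝓗 𝓖) in
/-- The trivial `n`-additive functor, with constant value the unit object. -/
def trivial : NAdditive 𝓗 𝓖 where
  obj {S} _ := 𝟙_ (𝓖.gr.fib.Ob S)
  map {S T f} _ _ _ := 𝓖.gr.unitMap f
  map_id _ := 𝓖.gr.unitMap_id _
  map_comp _ _ e := (𝓖.gr.unitMap_comp e).symm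
  lam _ _ _ _ _ := (λ_ _).hom
  lam_naturality _ _ _ _ _ _ _ _ _ _ _ _ _ := 𝓖.gr.leftUnitor_naturality _
  lam_assoc _ _ _ _ _ _ _ _ _ _ _ _ _ _ _ := by
    rw [𝓖.gr.unitMap_id]
    change _ ≫ _ ≫ 𝟙 _ = _
    monoidal
  eps _ _ _ := 𝟙 _
  eps_naturality _ _ _ _ _ _ _ := FibGpd.Sq.refl _
  left_unit _ _ _ _ _ _ _ _ _ := by
    rw [𝓖.gr.unitMap_id]
    change _ ≫ 𝟙 _ = _
    simp
  right_unit _ _ _ _ _ _ _ _ _ := by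
    rw [𝓖.gr.unitMap_id]
    change _ ≫ 𝟙 _ = _
    simp [unitors_equal]
  interchange _ _ _ _ _ _ _ _ _ _ _ _ _ _ _ _ _ _ := by
    exact tensorμ_unit
  eps_eq _ _ _ _ _ := rfl

/-- The pointwise product of `n`-additive functors, for a symmetric target.  The additivity
isomorphisms are
`(F a ⊗ F' a) ⊗ (F b ⊗ F' b) ⟶ (F a ⊗ F b) ⊗ (F' a ⊗ F' b) ⟶ F (a ⊗ b) ⊗ F' (a ⊗ b)`. -/
def mul (hs : 𝓖.IsSymmetric) (F F' : NAdditive 𝓗 𝓖) : NAdditive 𝓗 𝓖 where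
  obj x := F.obj x ⊗ F'.obj x
  map φ := 𝓖.gr.tens (F.map φ) (F'.map φ)
  map_id x := by
    rw [F.map_id, F'.map_id]
    exact (𝓖.gr.tens_fiber (𝟙 _) (𝟙 _)).trans (id_tensorHom_id _ _)
  map_comp φ ψ e := by rw [F.map_comp, F'.map_comp, 𝓖.gr.tens_comp]
  lam i x y z e := tensorμ (F.obj x) (F'.obj x) (F.obj y) (F'.obj y) ≫
    (F.lam i x y z e ⊗ₘ F'.lam i x y z e)
  lam_naturality i x y z x' y' z' e e' φ ψ χ hχ :=
    FibGpd.Sq.comp (BraidedGrStack.sq_tensorμ _ _ _ _)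
      (GrStack.sq_tens (F.lam_naturality i x y z x' y' z' e e' φ ψ χ hχ)
        (F'.lam_naturality i x y z x' y' z' e e' φ ψ χ hχ))
  lam_assoc i x y z xy yz l r e₁ e₂ e₃ e₄ A hA hA' := by
    have h : (𝓖.gr.tens (F.map A) (F'.map A) : F.obj l ⊗ F'.obj l ⟶ F.obj r ⊗ F'.obj r) =
      MonoidalCategoryStruct.tensorHom (C := 𝓖.gr.fib.Ob _) (F.map A) (F'.map A) :=
      𝓖.gr.tens_fiber (S := _) (x := F.obj l) (y := F.obj r) (x' := F'.obj l) (y' := F'.obj r)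
        (F.map A) (F'.map A)
    exact (congrArg (fun m => _ ≫ _ ≫ m) h).trans
      (prod_assoc_aux (F.lam_assoc i x y z xy yz l r e₁ e₂ e₃ e₄ A hA hA')
        (F'.lam_assoc i x y z xy yz l r e₁ e₂ e₃ e₄ A hA hA'))
  eps i x e := (F.eps i x e ⊗ₘ F'.eps i x e) ≫ (λ_ _).hom
  eps_naturality i x x' e e' φ hφ :=
    FibGpd.Sq.comp (GrStack.sq_tens (F.eps_naturality i x x' e e' φ hφ)
      (F'.eps_naturality i x x' e e' φ hφ)) (𝓖.gr.leftUnitor_naturality _)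
  left_unit i x y z e e' L hL hL' := by
    have h := 𝓖.gr.tens_fiber (x := F.obj z) (y := F.obj y) (x' := F'.obj z) (y' := F'.obj y)
      (F.map L) (F'.map L)
    exact (congrArg (fun m => _ ≫ m) h).trans
      (prod_left_unit_aux (F.left_unit i x y z e e' L hL hL')
        (F'.left_unit i x y z e e' L hL hL'))
  right_unit i x y z e e' L hL hL' := by
    have h := 𝓖.gr.tens_fiber (x := F.obj z) (y := F.obj x) (x' := F'.obj z) (y' := F'.obj x)
      (F.map L) (F'.map L)
    exact (congrArg (fun m => _ ≫ m) h).trans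
      (prod_right_unit_aux (F.right_unit i x y z e e' L hL hL')
        (F'.right_unit i x y z e e' L hL hL'))
  interchange i k hik x x' y y' xx' yy' xy x'y' t e₁ e₂ e₃ e₄ e₅ e₆ :=
    prod_interchange_aux (hs _) (F.interchange i k hik x x' y y' xx' yy' xy x'y' t e₁ e₂ e₃ e₄ e₅ e₆)
      (F'.interchange i k hik x x' y y' xx' yy' xy x'y' t e₁ e₂ e₃ e₄ e₅ e₆)
  eps_eq i k x e e' := by rw [F.eps_eq i k x e e', F'.eps_eq i k x e e']

/-- The isomorphism of `n`-additive functors with given components. -/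
def mkIso {F F' : NAdditive 𝓗 𝓖}
    (φ : ∀ {S : C} (x : ∀ k, (𝓗 k).fib.Ob S), F.obj x ≅ F'.obj x)
    (naturality : ∀ {S T : C} {f : S ⟶ T} {x : ∀ k, (𝓗 k).fib.Ob S} {y : ∀ k, (𝓗 k).fib.Ob T}
      (m : ∀ k, (𝓗 k).fib.Hom f (x k) (y k)),
      𝓖.gr.fib.Sq (F.map m) (F'.map m) (φ x).hom (φ y).hom)
    (app_lam : ∀ {S : C} (i : Fin n) (x y z : ∀ k, (𝓗 k).fib.Ob S) (e : ProdAt 𝓗 i x y z),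
      F.lam i x y z e ≫ (φ z).hom = ((φ x).hom ⊗ₘ (φ y).hom) ≫ F'.lam i x y z e)
    (app_eps : ∀ {S : C} (i : Fin n) (x : ∀ k, (𝓗 k).fib.Ob S) (e : x i = 𝟙_ ((𝓗 i).fib.Ob S)),
      (φ x).hom ≫ F'.eps i x e = F.eps i x e) : F ≅ F' where
  hom := ⟨fun x => (φ x).hom, naturality, app_lam, app_eps⟩
  inv := ⟨fun x => (φ x).inv, fun m => FibGpd.Sq.inv (naturality m), fun i x y z e => by
      rw [Iso.comp_inv_eq, Category.assoc, app_lam, tensorHom_comp_tensorHom_assoc]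
      simp, fun i x e => by rw [Iso.inv_comp_eq, app_eps]⟩
  hom_inv_id := hom_ext fun x => (φ x).hom_inv_id
  inv_hom_id := hom_ext fun x => (φ x).inv_hom_id

/-- The pointwise product of natural transformations. -/
def mulHom (hs : 𝓖.IsSymmetric) {F₁ F₂ F₁' F₂' : NAdditive 𝓗 𝓖} (η : F₁ ⟶ F₂) (θ : F₁' ⟶ F₂') :
    mul hs F₁ F₁' ⟶ mul hs F₂ F₂' where
  app x := Hom.app η x ⊗ₘ Hom.app θ x
  naturality φ := GrStack.sq_tens (Hom.naturality η φ) (Hom.naturality θ φ)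
  app_lam i x y z e := by
    dsimp only [mul]
    rw [Category.assoc, tensorHom_comp_tensorHom, Hom.app_lam, Hom.app_lam,
      ← tensorHom_comp_tensorHom, ← tensorμ_natural_assoc]
  app_eps i x e := by
    dsimp only [mul]
    rw [tensorHom_comp_tensorHom_assoc, Hom.app_eps, Hom.app_eps]

variable (𝓗 𝓖) in
/-- The monoidal structure on the groupoid of `n`-additive functors to a symmetric group-like
stack, given by the pointwise product. -/
@[reducible]
def monoidal (hs : 𝓖.IsSymmetric) : MonoidalCategory (NAdditive 𝓗 𝓖) :=
  letI : MonoidalCategoryStruct (NAdditive 𝓗 𝓖) :=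
    { tensorObj := mul hs
      whiskerLeft := fun F _ _ η => mulHom hs (𝟙 F) η
      whiskerRight := fun η F => mulHom hs η (𝟙 F)
      tensorHom := fun η θ => mulHom hs η θ
      tensorUnit := trivial 𝓗 𝓖
      associator := fun F F' F'' => mkIso (fun x => α_ (F.obj x) (F'.obj x) (F''.obj x))
        (fun m => 𝓖.gr.associator_naturality _ _ _)
        (fun i x y z e => by
          exact associator_prod_aux _ _ _)
        (fun i x e => by
          exact associator_eps_aux _ _ _)
      leftUnitor := fun F => mkIso (fun x => λ_ (F.obj x))
        (fun m => 𝓖.gr.leftUnitor_naturality _)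
        (fun i x y z e => by
          exact leftUnitor_prod_aux _)
        (fun i x e => by
          simp [mul, trivial])
      rightUnitor := fun F => mkIso (fun x => ρ_ (F.obj x))
        (fun m => 𝓖.gr.rightUnitor_naturality _)
        (fun i x y z e => by
          exact rightUnitor_prod_aux _)
        (fun i x e => by
          simp [mul, trivial, unitors_equal]) }
  MonoidalCategory.ofTensorHom
    (id_tensorHom_id := fun F F' => hom_ext fun x => id_tensorHom_id _ _)
    (tensorHom_comp_tensorHom := fun _ _ _ _ => hom_ext fun x => tensorHom_comp_tensorHom _ _ _ _)
    (associator_naturality := fun _ _ _ => hom_ext fun x => associator_naturality _ _ _)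
    (leftUnitor_naturality := fun _ => hom_ext fun x => by
      exact (congrArg (· ≫ _) (id_tensorHom _ _)).trans (leftUnitor_naturality _))
    (rightUnitor_naturality := fun _ => hom_ext fun x => by
      exact (congrArg (· ≫ _) (tensorHom_id _ _)).trans (rightUnitor_naturality _))
    (pentagon := fun _ _ _ _ => hom_ext fun x => by
      exact (congrArg₂ (fun a b => a ≫ _ ≫ b) (tensorHom_id _ _) (id_tensorHom _ _)).trans (pentagon _ _ _ _))
    (triangle := fun _ _ => hom_ext fun x => by
      exact (congrArg (_ ≫ ·) (id_tensorHom _ _)).trans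
        ((triangle _ _).trans (tensorHom_id _ _).symm))

end NAdditive

end NAdditive

/-! ## The comparison of butterflies and additive functors -/

section Comparison

variable {C : Type u} [Category.{v} C] {J : GrothendieckTopology C} {n : ℕ}
  {H : Fin n → CrossedModule.{w} J} {G : BraidedCrossedModule.{w} J}
  {𝓗 : Fin n → GrStack.{o₁, h₁} J} {𝓖 : BraidedGrStack.{o₂, h} J}

/-- The identification `F (π y) ⟶ F (π y')` for equal tuples `y = y'` of sections of the `(H k)₀`. -/
def NAdditive.ident (F : NAdditive 𝓗 𝓖) (πH : ∀ k, Presentation (H k) (𝓗 k)) {S : C}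
    (y y' : ∀ k, Sec (H k).G₀ S) (e : y = y') :
    F.obj (fun k => (πH k).obj (y k)) ⟶ F.obj (fun k => (πH k).obj (y' k)) :=
  F.map fun k => (πH k).ident (y k) (y' k) (congrFun e k)

/-- The datum which says that the value of the `n`-additive functor `F` at the tuple `π y`, where `y`
is a tuple of sections of the `(H k)₀`, is the `(G₁, G₀)`-torsor `E_y`: a point `e` of `E_y` is a
local isomorphism of `F (π y)` with the object `π (j e)` of `𝓖`, in such a way that the torsor
structure, the partial multiplications and the trivializations of `E` correspond to the
composition of morphisms, the additivity isomorphisms and the functoriality of `F`. -/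
structure Comparison (πH : ∀ k, Presentation (H k) (𝓗 k)) (πG : BraidedPresentation G 𝓖)
    (B : NButterfly H G) (F : NAdditive 𝓗 𝓖) where
  app : ∀ {S : C} (e : B.El S),
    (πG.obj (B.j e) : 𝓖.gr.fib.Ob S) ⟶ F.obj (fun k => (πH k).obj (B.p e k))
  app_res : ∀ {T S : C} (f : T ⟶ S) (e : B.El S),
    𝓖.gr.fib.post (πG.cart f (B.j (B.E.map f.op e)) (B.j e) (B.j_res f e).symm) (app e) =
      𝓖.gr.fib.pre (app (B.E.map f.op e)) (F.map fun k =>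
        (πH k).cart f (B.p (B.E.map f.op e) k) (B.p e k) (B.p_res f e k).symm)
  app_act : ∀ {S : C} (e : B.El S) (g : Sec G.G₁ S),
    πG.vert (B.j e) (B.j (B.act e g)) g (B.j_act e g) ≫ app (B.act e g) =
      app e ≫ F.ident πH (B.p e) (B.p (B.act e g)) (B.p_act e g).symm
  /-- Compatibility with the partial multiplications; `m` is the canonical isomorphism from the
  product `z` of the tuples `π (p e)` and `π (p e')` in the variable `i` to `π (p (e ×ᵢ e'))`. -/
  app_mul : ∀ {S : C} (i : Fin n) (e e' : B.El S) (a : AgreeOff i (B.p e) (B.p e'))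
    (z : ∀ k, (𝓗 k).fib.Ob S)
    (hz : ProdAt 𝓗 i (fun k => (πH k).obj (B.p e k)) (fun k => (πH k).obj (B.p e' k)) z)
    (m : ∀ k, z k ⟶ (πH k).obj (B.p (B.mul i e e' a) k)),
    (∀ k, k ≠ i → HEq (m k) (𝟙 (z k))) → HEq (m i) ((πH i).mu (B.p e i) (B.p e' i)) →
    (app e ⊗ₘ app e') ≫ F.lam i _ _ z hz ≫
        (F.map m : F.obj z ⟶ F.obj fun k => (πH k).obj (B.p (B.mul i e e' a) k)) =
      πG.mu (B.j e) (B.j e') ≫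
        πG.ident (B.j e * B.j e') (B.j (B.mul i e e' a)) (B.j_mul i e e' a).symm ≫
          app (B.mul i e e' a)
  /-- Compatibility with the trivializations: translation by `s i y h` is the effect of the morphism
  `h : p e i ⟶ (p e i) ∂h` in the variable `i`. -/
  app_s : ∀ {S : C} (i : Fin n) (e : B.El S) (y : ∀ k, Sec (H k).G₀ S) (h : Sec (H i).G₁ S)
    (hy : y i = (H i).bd h) (a : AgreeOff i (B.p e) (B.p (B.s i y h hy)))
    (γ : ∀ k, Sec (H k).G₁ S)
    (hγ : ∀ k, B.p (B.mul i e (B.s i y h hy) a) k = B.p e k * (H k).bd (γ k)),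
    γ i = h → (∀ k, k ≠ i → γ k = 1) →
    app e ≫ (F.map (fun k => (πH k).vert (B.p e k) (B.p (B.mul i e (B.s i y h hy) a) k) (γ k)
        (hγ k)) : F.obj (fun k => (πH k).obj (B.p e k)) ⟶
          F.obj fun k => (πH k).obj (B.p (B.mul i e (B.s i y h hy) a) k)) =
      πG.ident (B.j e) (B.j (B.mul i e (B.s i y h hy) a)) (by rw [B.j_mul, B.j_s, mul_one]) ≫
        app (B.mul i e (B.s i y h hy) a)

/-- A monoidal structure on the groupoid of butterflies whose tensor product is the contracted
product `E ∧ E'` of `(G₁, G₀)`-torsors over `∏ k, (H k)₀`: the torsor generated by the symbols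
`e ∧ e'`, where `e` and `e'` lie over the same point, with `(e g) ∧ e' = e ∧ (g e')`. -/
structure ContractedMonoidal (H : Fin n → CrossedModule.{w} J) (G : BraidedCrossedModule.{w} J) where
  mon : MonoidalCategory (NButterfly H G)
  wedge : ∀ (B B' : NButterfly H G) {S : C} (e : B.El S) (e' : B'.El S), B.p e = B'.p e' →
    (B ⊗ B').El S
  wedge_res : ∀ (B B' : NButterfly H G) {T S : C} (f : T ⟶ S) (e : B.El S) (e' : B'.El S)
    (a : B.p e = B'.p e') (a' : B.p (B.E.map f.op e) = B'.p (B'.E.map f.op e')),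
    (B ⊗ B').E.map f.op (wedge B B' e e' a) = wedge B B' (B.E.map f.op e) (B'.E.map f.op e') a'
  p_wedge : ∀ (B B' : NButterfly H G) {S : C} (e : B.El S) (e' : B'.El S) (a : B.p e = B'.p e'),
    (B ⊗ B').p (wedge B B' e e' a) = B.p e
  j_wedge : ∀ (B B' : NButterfly H G) {S : C} (e : B.El S) (e' : B'.El S) (a : B.p e = B'.p e'),
    (B ⊗ B').j (wedge B B' e e' a) = B.j e * B'.j e'
  wedge_act : ∀ (B B' : NButterfly H G) {S : C} (e : B.El S) (e' : B'.El S) (g : Sec G.G₁ S)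
    (a : B.p e = B'.p e') (a' : B.p e = B'.p (B'.act e' g)),
    wedge B B' e (B'.act e' g) a' = (B ⊗ B').act (wedge B B' e e' a) g
  act_wedge : ∀ (B B' : NButterfly H G) {S : C} (e : B.El S) (e' : B'.El S) (g : Sec G.G₁ S)
    (a : B.p (B.act e g) = B'.p e') (a' : B.p e = B'.p (B'.act e' (G.act g (B'.j e')))),
    wedge B B' (B.act e g) e' a = wedge B B' e (B'.act e' (G.act g (B'.j e'))) a'
  /-- The partial multiplications of the contracted product. -/
  wedge_mul : ∀ (B B' : NButterfly H G) {S : C} (i : Fin n) (e d : B.El S) (e' d' : B'.El S)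
    (a : B.p e = B'.p e') (b : B.p d = B'.p d')
    (c : AgreeOff i ((B ⊗ B').p (wedge B B' e e' a)) ((B ⊗ B').p (wedge B B' d d' b)))
    (a' : AgreeOff i (B.p e) (B.p d)) (b' : AgreeOff i (B'.p e') (B'.p d'))
    (c' : B.p (B.mul i e d a') = B'.p (B'.mul i e' d' b')),
    (B ⊗ B').mul i (wedge B B' e e' a) (wedge B B' d d' b) c =
      (B ⊗ B').act (wedge B B' (B.mul i e d a') (B'.mul i e' d' b') c')
        (G.act (G.br (B'.j e') (B.j d))⁻¹ (B'.j d'))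
  wedge_s : ∀ (B B' : NButterfly H G) {S : C} (i : Fin n) (y : ∀ k, Sec (H k).G₀ S)
    (h : Sec (H i).G₁ S) (hy : y i = (H i).bd h) (a : B.p (B.s i y h hy) = B'.p (B'.s i y h hy)),
    wedge B B' (B.s i y h hy) (B'.s i y h hy) a = (B ⊗ B').s i y h hy
  wedge_hom : ∀ {B₁ B₂ B₁' B₂' : NButterfly H G} (φ : B₁ ⟶ B₂) (ψ : B₁' ⟶ B₂') {S : C}
    (e : B₁.El S) (e' : B₁'.El S) (a : B₁.p e = B₁'.p e')
    (a' : B₂.p (φ.hom.app (op S) e) = B₂'.p (ψ.hom.app (op S) e')),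
    (φ ⊗ₘ ψ).hom.app (op S) (wedge B₁ B₁' e e' a) =
      wedge B₂ B₂' (φ.hom.app (op S) e) (ψ.hom.app (op S) e') a'
  wedge_assoc : ∀ (B B' B'' : NButterfly H G) {S : C} (e : B.El S) (e' : B'.El S) (e'' : B''.El S)
    (a : B.p e = B'.p e') (b : (B ⊗ B').p (wedge B B' e e' a) = B''.p e'')
    (a' : B'.p e' = B''.p e'') (b' : B.p e = (B' ⊗ B'').p (wedge B' B'' e' e'' a')),
    (α_ B B' B'').hom.hom.app (op S) (wedge (B ⊗ B') B'' (wedge B B' e e' a) e'' b) =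
      wedge B (B' ⊗ B'') e (wedge B' B'' e' e'' a') b'
  /-- The unit object is the trivial butterfly. -/
  unitIso : NButterfly.trivial H G ≅ 𝟙_ (NButterfly H G)
  left_unit : ∀ (B : NButterfly H G) {S : C} (o : (NButterfly.trivial H G).El S) (e : B.El S)
    (a : (𝟙_ (NButterfly H G)).p (unitIso.hom.hom.app (op S) o) = B.p e), o = (B.p e, 1) →
    (λ_ B).hom.hom.app (op S) (wedge (𝟙_ _) B (unitIso.hom.hom.app (op S) o) e a) = e
  right_unit : ∀ (B : NButterfly H G) {S : C} (o : (NButterfly.trivial H G).El S) (e : B.El S)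
    (a : B.p e = (𝟙_ (NButterfly H G)).p (unitIso.hom.hom.app (op S) o)), o = (B.p e, 1) →
    (ρ_ B).hom.hom.app (op S) (wedge B (𝟙_ _) e (unitIso.hom.hom.app (op S) o) a) = e

/-- A group-like groupoid: a monoidal groupoid in which the translations are equivalences. -/
def IsGroupLike (D : Type o) [Category.{h} D] [MonoidalCategory D] : Prop :=
  IsGroupoid D ∧ (∀ X : D, (tensorLeft X).IsEquivalence) ∧ ∀ X : D, (tensorRight X).IsEquivalence

end Comparison

/-! ## Local statements and gluing of morphisms in a stack -/

/-- `P` holds for all members of some covering sieve of `S`. -/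
def Loc {C : Type u} [Category.{v} C] (J : GrothendieckTopology C) (S : C)
    (P : ∀ ⦃T : C⦄, (T ⟶ S) → Prop) : Prop :=
  ∃ R : Sieve S, R ∈ J S ∧ ∀ ⦃T : C⦄ (f : T ⟶ S), R f → P f

namespace Loc

variable {C : Type u} [Category.{v} C] {J : GrothendieckTopology C} {S : C}
  {P Q : ∀ ⦃T : C⦄, (T ⟶ S) → Prop}

theorem of_forall (h : ∀ ⦃T : C⦄ (f : T ⟶ S), P f) : Loc J S P :=
  ⟨⊤, J.top_mem S, fun _ f _ => h f⟩

theorem mono (hP : Loc J S P) (h : ∀ ⦃T : C⦄ (f : T ⟶ S), P f → Q f) : Loc J S Q := by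
  obtain ⟨R, hR, hP⟩ := hP
  exact ⟨R, hR, fun _ f hf => h f (hP f hf)⟩

theorem bind (hP : Loc J S P)
    (h : ∀ ⦃T : C⦄ (f : T ⟶ S), P f → Loc J T fun _ r => Q (r ≫ f)) : Loc J S Q := by
  classical
  obtain ⟨R, hR, hP⟩ := hP
  choose U hU hQ using fun (T : C) (f : T ⟶ S) (hf : R f) => h f (hP f hf)
  refine ⟨Sieve.bind R.arrows fun T f hf => U T f hf,
    J.bind_covering hR fun T f hf => hU T f hf, ?_⟩
  rintro T _ ⟨T', r, f, hf, hr, rfl⟩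
  exact hQ T' f hf r hr

theorem and (hP : Loc J S P) (hQ : Loc J S Q) : Loc J S fun _ f => P f ∧ Q f := by
  obtain ⟨R, hR, hP⟩ := hP
  obtain ⟨R', hR', hQ⟩ := hQ
  exact ⟨R ⊓ R', J.intersection_covering hR hR', fun _ f hf => ⟨hP f hf.1, hQ f hf.2⟩⟩

theorem forall_fin {n : ℕ} {P : Fin n → ∀ ⦃T : C⦄, (T ⟶ S) → Prop}
    (hP : ∀ i, Loc J S (P i)) : Loc J S fun _ f => ∀ i, P i f := by
  induction n with
  | zero => exact of_forall fun _ _ i => i.elim0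
  | succ n ih =>
    exact ((hP 0).and (ih fun i => hP i.succ)).mono fun _ _ h i => Fin.cases h.1 h.2 i

end Loc

namespace FibGpd

variable {C : Type u} [Category.{v} C] {𝓧 : FibGpd.{o, h} C}

theorem comp_cancel {R S T : C} {f : R ⟶ S} {g : S ⟶ T} {k : R ⟶ T} {x : 𝓧.Ob R} {y : 𝓧.Ob S}
    {z : 𝓧.Ob T} {φ : 𝓧.Hom g y z} {χ χ' : 𝓧.Hom f x y} {w : f ≫ g = k}
    (e : 𝓧.comp χ φ w = 𝓧.comp χ' φ w) : χ = χ' :=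
  (𝓧.cartesian φ _ w).unique e rfl

theorem comp_eq_comp {R S S' T : C} {f : R ⟶ S} {g : S ⟶ T} {f' : R ⟶ S'} {g' : S' ⟶ T}
    {k k' : R ⟶ T} {x : 𝓧.Ob R} {y : 𝓧.Ob S} {y' : 𝓧.Ob S'} {z : 𝓧.Ob T} {φ : 𝓧.Hom f x y}
    {ψ : 𝓧.Hom g y z} {φ' : 𝓧.Hom f' x y'} {ψ' : 𝓧.Hom g' y' z} {w₁ : f ≫ g = k}
    {w₁' : f' ≫ g' = k} {w₂ : f ≫ g = k'} {w₂' : f' ≫ g' = k'}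
    (e : 𝓧.comp φ ψ w₁ = 𝓧.comp φ' ψ' w₁') : 𝓧.comp φ ψ w₂ = 𝓧.comp φ' ψ' w₂' := by
  obtain rfl : k = k' := w₁.symm.trans w₂
  exact e

instance isGroupoid_fiber (S : C) : IsGroupoid (𝓧.Ob S) where
  all_isIso {x y} φ := by
    have inv : ∀ {x y : 𝓧.Ob S} (φ : x ⟶ y), ∃ χ : y ⟶ x, χ ≫ φ = 𝟙 y := fun φ =>
      (𝓧.cartesian φ (𝓧.id _) (Category.id_comp (𝟙 S))).exists
    obtain ⟨χ, hχ⟩ := inv φ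
    obtain ⟨ψ, hψ⟩ := inv χ
    have : ψ = φ := by
      rw [← Category.comp_id ψ, ← hχ, ← Category.assoc, hψ, Category.id_comp]
    exact ⟨χ, this ▸ hψ, hχ⟩

theorem IsStack.hom_ext {J : GrothendieckTopology C} (hst : 𝓧.IsStack J) {S S' : C} {g : S ⟶ S'}
    {Z : 𝓧.Ob S} {W : 𝓧.Ob S'} {k k' : 𝓧.Hom g Z W}
    (e : Loc J S fun T f => ∃ (P : 𝓧.Ob T) (θ : 𝓧.Hom f P Z), 𝓧.comp θ k rfl = 𝓧.comp θ k' rfl) :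
    k = k' := by
  obtain ⟨W', ⟨ρ⟩⟩ := 𝓧.exists_lift g W
  obtain ⟨l, hl, -⟩ := 𝓧.cartesian ρ k (Category.id_comp g)
  obtain ⟨l', hl', -⟩ := 𝓧.cartesian ρ k' (Category.id_comp g)
  subst hl hl'
  congr 1
  obtain ⟨R, hR, e⟩ := e
  have key : ∀ {T : C} (f : T ⟶ S), R f → ∀ (x : 𝓧.Ob T) (a : 𝓧.Hom f x Z),
      𝓧.post a l = 𝓧.post a l' := by
    intro T f hf x a
    obtain ⟨P, θ, e⟩ := e f hf
    obtain ⟨χ, rfl, -⟩ := 𝓧.cartesian θ a (Category.id_comp f)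
    have e' : 𝓧.comp θ l (Category.comp_id f) = 𝓧.comp θ l' (Category.comp_id f) := by
      refine comp_cancel (φ := ρ) (w := rfl) ?_
      rw [𝓧.assoc θ l ρ (Category.comp_id f) rfl (Category.id_comp g) rfl,
        𝓧.assoc θ l' ρ (Category.comp_id f) rfl (Category.id_comp g) rfl, e]
    unfold post
    rw [𝓧.assoc χ θ l _ _ (Category.comp_id f) (Category.id_comp f), e',
      𝓧.assoc χ θ l' _ _ (Category.comp_id f) (Category.id_comp f)]
  obtain ⟨m, -, hm⟩ := hst.glue_hom Z W' R hR (fun f _ x a => 𝓧.post a l)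
    (fun g f hf x'' x' b a => 𝓧.assoc _ _ _ _ _ _ _)
  exact (hm l fun f hf x a => rfl).trans (hm l' fun f hf x a => (key f hf x a).symm).symm

/-- Morphisms `Z ⟶ W` over `g` can be defined on a family of local charts of `Z`. -/
theorem IsStack.glue {J : GrothendieckTopology C} (hst : 𝓧.IsStack J) {S S' : C} (g : S ⟶ S')
    (Z : 𝓧.Ob S) (W : 𝓧.Ob S') (I : ∀ {T : C}, (T ⟶ S) → Type w)
    (P : ∀ {T : C} {f : T ⟶ S}, I f → 𝓧.Ob T)
    (θ : ∀ {T : C} {f : T ⟶ S} (i : I f), 𝓧.Hom f (P i) Z)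
    (m : ∀ {T : C} {f : T ⟶ S} (i : I f), 𝓧.Hom (f ≫ g) (P i) W)
    (loc : Loc J S fun _ f => Nonempty (I f))
    (compat : ∀ {T' T : C} (r : T' ⟶ T) (f : T ⟶ S) (f' : T' ⟶ S) (e : r ≫ f = f') (i : I f)
      (j : I f'), ∃ ω : 𝓧.Hom r (P j) (P i), 𝓧.comp ω (θ i) e = θ j ∧
        𝓧.comp ω (m i) (by rw [← e, Category.assoc]) = m j) :
    ∃! k : 𝓧.Hom g Z W, ∀ {T : C} {f : T ⟶ S} (i : I f), 𝓧.comp (θ i) k rfl = m i := by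
  obtain ⟨W', ⟨ρ⟩⟩ := 𝓧.exists_lift g W
  choose m' hm' using fun {T : C} {f : T ⟶ S} (i : I f) =>
    (𝓧.cartesian ρ (m i) (rfl : f ≫ g = f ≫ g)).exists
  have compat' : ∀ {T' T : C} (r : T' ⟶ T) (f : T ⟶ S) (f' : T' ⟶ S) (e : r ≫ f = f') (i : I f)
      (j : I f'), ∃ ω : 𝓧.Hom r (P j) (P i), 𝓧.comp ω (θ i) e = θ j ∧
        𝓧.comp ω (m' i) e = m' j := by
    intro T' T r f f' e i j
    obtain ⟨ω, h₁, h₂⟩ := compat r f f' e i j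
    refine ⟨ω, h₁, comp_cancel (φ := ρ) (w := rfl) ?_⟩
    rw [hm', 𝓧.assoc ω (m' i) ρ e rfl rfl (by rw [← e, Category.assoc]), hm', h₂]
  obtain ⟨R, hR, loc⟩ := loc
  have i₀ : ∀ {T : C} (f : T ⟶ S), R f → I f := fun f hf => (loc f hf).some
  choose χ hχ using fun {T : C} (f : T ⟶ S) (hf : R f) (x : 𝓧.Ob T) (a : 𝓧.Hom f x Z) =>
    (𝓧.cartesian (θ (i₀ f hf)) a (Category.id_comp f)).exists
  obtain ⟨k, hk, -⟩ := hst.glue_hom Z W' R hR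
    (fun f hf x a => 𝓧.comp (χ f hf x a) (m' (i₀ f hf)) (Category.id_comp f)) (by
      intro T' T r f hf x'' x' b a
      obtain ⟨ω, h₁, h₂⟩ := compat' r f (r ≫ f) rfl (i₀ f hf)
        (i₀ (r ≫ f) (R.downward_closed hf r))
      rw [← h₂, ← 𝓧.assoc _ ω _ (Category.id_comp r) rfl rfl (Category.id_comp _),
        ← 𝓧.assoc b _ _ (Category.comp_id r) rfl _ rfl]
      congr 1
      refine comp_cancel (φ := θ (i₀ f hf)) (w := rfl) ?_
      rw [𝓧.assoc _ ω _ (Category.id_comp r) rfl rfl (Category.id_comp _), h₁, hχ,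
        𝓧.assoc b _ _ (Category.comp_id r) rfl (Category.id_comp f) rfl, hχ])
  have key : ∀ {T : C} {f : T ⟶ S} (i : I f), R f →
      𝓧.comp (θ i) k (Category.comp_id f) = m' i := by
    intro T f i hf
    obtain ⟨ω, h₁, h₂⟩ := compat' (𝟙 T) f f (Category.id_comp f) (i₀ f hf) i
    have := hk f hf _ (θ i)
    unfold post at this
    rw [this, ← h₂]
    congr 1
    exact comp_cancel ((hχ f hf _ (θ i)).trans h₁.symm)
  have key' : ∀ {T : C} {f : T ⟶ S} (i : I f), 𝓧.comp (θ i) k (Category.comp_id f) = m' i := by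
    intro T f i
    refine hst.hom_ext ⟨R.pullback f, J.pullback_stable f hR, fun T' r hr => ?_⟩
    obtain ⟨ω, h₁, h₂⟩ := compat' r f (r ≫ f) rfl i (i₀ (r ≫ f) hr)
    refine ⟨_, ω, ?_⟩
    rw [h₂, ← key _ hr, ← 𝓧.assoc ω (θ i) k rfl (Category.comp_id _) _ rfl, h₁]
  refine ⟨𝓧.comp k ρ (Category.id_comp g), fun {T f} i => ?_, fun k' hk' => ?_⟩
  · rw [← hm', ← key', 𝓧.assoc (θ i) k ρ (Category.comp_id f) rfl (Category.id_comp g) rfl]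
  · refine hst.hom_ext ⟨R, hR, fun T f hf => ⟨_, θ (i₀ f hf), ?_⟩⟩
    rw [hk', ← hm', ← key', 𝓧.assoc (θ _) k ρ (Category.comp_id f) rfl (Category.id_comp g) rfl]

/-- Objects can be defined by local charts with a functorial system of transition morphisms. -/
theorem IsStack.glue_charts {J : GrothendieckTopology C} (hst : 𝓧.IsStack J) {S : C}
    (I : ∀ {T : C}, (T ⟶ S) → Type w) (P : ∀ {T : C} {f : T ⟶ S}, I f → 𝓧.Ob T)
    (t : ∀ {T' T : C} (r : T' ⟶ T) {f : T ⟶ S} {f' : T' ⟶ S}, r ≫ f = f' → ∀ (i : I f)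
      (j : I f'), 𝓧.Hom r (P j) (P i))
    (loc : Loc J S fun _ f => Nonempty (I f))
    (t_id : ∀ {T : C} {f : T ⟶ S} (i : I f), t (𝟙 T) (Category.id_comp f) i i = 𝓧.id (P i))
    (t_comp : ∀ {T'' T' T : C} (r' : T'' ⟶ T') (r : T' ⟶ T) {r'' : T'' ⟶ T} {f : T ⟶ S}
      {f' : T' ⟶ S} {f'' : T'' ⟶ S} (e : r ≫ f = f') (e' : r' ≫ f' = f'') (e'' : r'' ≫ f = f'')
      (er : r' ≫ r = r'') (i : I f) (i' : I f') (i'' : I f''),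
      𝓧.comp (t r' e' i' i'') (t r e i i') er = t r'' e'' i i'') :
    ∃ (Z : 𝓧.Ob S) (θ : ∀ {T : C} {f : T ⟶ S} (i : I f), 𝓧.Hom f (P i) Z),
      ∀ {T' T : C} (r : T' ⟶ T) {f : T ⟶ S} {f' : T' ⟶ S} (e : r ≫ f = f') (i : I f)
        (j : I f'), 𝓧.comp (t r e i j) (θ i) e = θ j := by
  obtain ⟨R, hR, loc⟩ := loc
  have i₀ : ∀ {T : C} (f : T ⟶ S), R f → I f := fun f hf => (loc f hf).some
  obtain ⟨Z, q, hq⟩ := hst.glue_obj R hR (fun f hf => P (i₀ f hf))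
    (fun r f hf f' hf' e => t r e (i₀ f hf) (i₀ f' hf')) (fun f hf => t_id _)
    (fun r' r f hf f' hf' f'' hf'' e e' e'' => t_comp r' r e e' e'' rfl _ _ _)
  have ex : ∀ {T : C} {f : T ⟶ S} (i : I f), ∃! k : 𝓧.Hom f (P i) Z,
      ∀ {T' : C} {r : T' ⟶ T} (j : {p : Σ f' : T' ⟶ S, I f' // r ≫ f = p.1 ∧ R p.1}),
        𝓧.comp (t r j.2.1 i j.1.2) k rfl = 𝓧.comp (t (𝟙 T') (Category.id_comp j.1.1)
          (i₀ _ j.2.2) j.1.2) (q j.1.1 j.2.2) ((Category.id_comp _).trans j.2.1.symm) := by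
    intro T f i
    refine hst.glue f (P i) Z (fun {T'} r => {p : Σ f' : T' ⟶ S, I f' // r ≫ f = p.1 ∧ R p.1})
      (fun j => P j.1.2) (fun {T' r} j => t r j.2.1 i j.1.2) _ ?_ ?_
    · exact ⟨R.pullback f, J.pullback_stable f hR,
        fun T' r hr => ⟨⟨⟨r ≫ f, i₀ (r ≫ f) hr⟩, rfl, hr⟩⟩⟩
    · rintro T'' T' r' r _ rfl ⟨⟨f₁, j⟩, e₁, h₁⟩ ⟨⟨f₂, j'⟩, e₂, h₂⟩
      dsimp only at e₁ e₂ h₁ h₂ ⊢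
      have e₃ : r' ≫ f₁ = f₂ := by rw [← e₂, ← e₁, Category.assoc]
      refine ⟨t r' e₃ j j', t_comp _ _ _ _ _ _ _ _ _, ?_⟩
      rw [← 𝓧.assoc (t r' e₃ j j') _ _ (Category.comp_id r') (by rw [e₃, e₂]),
        t_comp r' (𝟙 T') (r'' := r') _ _ e₃, ← hq r' f₁ h₁ f₂ h₂ e₃,
        ← 𝓧.assoc _ _ _ (Category.id_comp r') (by rw [e₃, e₂]),
        t_comp (𝟙 T'') r' (r'' := r') _ _ e₃]
  choose θ hθ hθ' using @ex
  refine ⟨Z, @θ, ?_⟩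
  rintro T' T r f _ rfl i j
  refine hst.hom_ext ⟨R.pullback (r ≫ f), J.pullback_stable _ hR, fun T'' r' hr' => ?_⟩
  refine ⟨_, t r' rfl j (i₀ _ hr'), ?_⟩
  rw [hθ j ⟨⟨_, i₀ _ hr'⟩, rfl, hr'⟩, ← 𝓧.assoc _ _ _ rfl (Category.assoc _ _ _),
    t_comp r' r rfl rfl (Category.assoc _ _ _) rfl]
  have h₁ := hθ i (r := r' ≫ r) ⟨⟨r' ≫ r ≫ f, i₀ _ hr'⟩, Category.assoc _ _ _, hr'⟩
  dsimp only at h₁ ⊢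
  rw [t_id] at h₁ ⊢
  exact comp_eq_comp h₁

end FibGpd

/-! ## Sections of crossed modules and presentations -/

section Sections

variable {C : Type u} [Category.{v} C]

theorem res_id (A : Cᵒᵖ ⥤ GrpCat.{w}) {S : C} (x : Sec A S) : res A (𝟙 S) x = x := by
  simp [res]

theorem res_comp (A : Cᵒᵖ ⥤ GrpCat.{w}) {R T S : C} (f : R ⟶ T) (g : T ⟶ S) (x : Sec A S) :
    res A (f ≫ g) x = res A f (res A g x) := by
  simp [res]

end Sections

namespace CrossedModule

variable {C : Type u} [Category.{v} C] {J : GrothendieckTopology C} (G : CrossedModule.{w} J)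
  {S T : C}

theorem res_bd (f : T ⟶ S) (g : Sec G.G₁ S) : res G.G₀ f (G.bd g) = G.bd (res G.G₁ f g) :=
  (congrArg (fun m => m.hom g) (G.bdHom.naturality f.op)).symm

theorem bd_act' (g : Sec G.G₁ S) (x : Sec G.G₀ S) : G.bd (G.act g x) = x⁻¹ * G.bd g * x :=
  G.bd_act g x

/-- The action of a section of `G₀` as an automorphism of the group of sections of `G₁`. -/
def actHom (x : Sec G.G₀ S) : Sec G.G₁ S →* Sec G.G₁ S :=
  MonoidHom.mk' (fun g => G.act g x) fun g g' => G.mul_act g g' x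

theorem one_act (x : Sec G.G₀ S) : G.act 1 x = 1 :=
  map_one (G.actHom x)

theorem inv_act (g : Sec G.G₁ S) (x : Sec G.G₀ S) : G.act g⁻¹ x = (G.act g x)⁻¹ :=
  map_inv (G.actHom x) g

end CrossedModule

section Presentation

variable {C : Type u} [Category.{v} C] {J : GrothendieckTopology C}

namespace PreMorphism

variable {G : CrossedModule.{w} J} {𝓖 : FibGpd.{o, h} C} (π : PreMorphism G 𝓖)

theorem map_congr {T S : C} {f : T ⟶ S} {x : Sec G.G₀ T} {y : Sec G.G₀ S} {g g' : Sec G.G₁ T}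
    (e : g = g') (h : res G.G₀ f y = x * G.bd g) (h' : res G.G₀ f y = x * G.bd g') :
    π.map f x y g h = π.map f x y g' h' := by
  subst e
  rfl

theorem comp_map {R T S : C} {f : R ⟶ T} {f' : T ⟶ S} {k : R ⟶ S} {x : Sec G.G₀ R}
    {y : Sec G.G₀ T} {z : Sec G.G₀ S} {g : Sec G.G₁ R} {g' : Sec G.G₁ T}
    {e : res G.G₀ f y = x * G.bd g} {e' : res G.G₀ f' z = y * G.bd g'} (w : f ≫ f' = k)
    {g'' : Sec G.G₁ R} (hg : g'' = g * res G.G₁ f g') (e'' : res G.G₀ k z = x * G.bd g'') :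
    𝓖.comp (π.map f x y g e) (π.map f' y z g' e') w = π.map k x z g'' e'' := by
  subst w hg
  exact π.map_comp f f' x y z g g' e e' e''

theorem vert_comp {S : C} {x y z : Sec G.G₀ S} {g g' : Sec G.G₁ S} {e : y = x * G.bd g}
    {e' : z = y * G.bd g'} {g'' : Sec G.G₁ S} (hg : g'' = g * g') (e'' : z = x * G.bd g'') :
    π.vert x y g e ≫ π.vert y z g' e' = π.vert x z g'' e'' :=
  π.comp_map _ (by rw [hg, res_id]) _

theorem vert_one {S : C} (x : Sec G.G₀ S) (e : x = x * G.bd 1) : π.vert x x 1 e = 𝟙 (π.obj x) :=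
  π.map_id x _

theorem ident_self {S : C} (x : Sec G.G₀ S) (e : x = x) : π.ident x x e = 𝟙 (π.obj x) :=
  π.map_id x _

theorem ident_comp_ident {S : C} {x y z : Sec G.G₀ S} (e : x = y) (e' : y = z) :
    π.ident x y e ≫ π.ident y z e' = π.ident x z (e.trans e') := by
  subst e e'
  rw [ident_self, Category.id_comp]

theorem vert_congr {S : C} {x y : Sec G.G₀ S} {g g' : Sec G.G₁ S} (hg : g = g')
    (e : y = x * G.bd g) (e' : y = x * G.bd g') : π.vert x y g e = π.vert x y g' e' :=
  π.map_congr hg _ _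

theorem ident_comp_vert {S : C} {x y z : Sec G.G₀ S} {g : Sec G.G₁ S} (e : x = y)
    (e' : z = y * G.bd g) : π.ident x y e ≫ π.vert y z g e' = π.vert x z g (e ▸ e') := by
  subst e
  rw [ident_self, Category.id_comp]

theorem vert_comp_ident {S : C} {x y z : Sec G.G₀ S} {g : Sec G.G₁ S} (e : y = x * G.bd g)
    (e' : y = z) : π.vert x y g e ≫ π.ident y z e' = π.vert x z g (e' ▸ e) := by
  subst e'
  rw [ident_self, Category.comp_id]

theorem vert_comp_vert_inv {S : C} {x y : Sec G.G₀ S} {g g' : Sec G.G₁ S} (e : y = x * G.bd g)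
    (e' : x = y * G.bd g') (hg : g' = g⁻¹) : π.vert x y g e ≫ π.vert y x g' e' = 𝟙 _ := by
  rw [π.vert_comp (g'' := 1) (by rw [hg, mul_inv_cancel]) (by simp), vert_one]

end PreMorphism

namespace Presentation

variable {G : CrossedModule.{w} J} {𝓖 : GrStack.{o, h} J} (π : Presentation G 𝓖)

theorem exists_map {T S : C} {f : T ⟶ S} {x : Sec G.G₀ T} {y : Sec G.G₀ S}
    (φ : 𝓖.fib.Hom f (π.obj x) (π.obj y)) : ∃ g e, π.map f x y g e = φ :=
  (π.fully_faithful f x y φ).exists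

theorem map_inj {T S : C} {f : T ⟶ S} {x : Sec G.G₀ T} {y : Sec G.G₀ S} {g g' : Sec G.G₁ T}
    {e : res G.G₀ f y = x * G.bd g} {e' : res G.G₀ f y = x * G.bd g'}
    (h : π.map f x y g e = π.map f x y g' e') : g = g' :=
  (π.fully_faithful f x y _).unique ⟨e, h⟩ ⟨e', rfl⟩

theorem exists_vert {S : C} {x y : Sec G.G₀ S} (φ : π.obj x ⟶ π.obj y) :
    ∃ g, ∃ e : y = x * G.bd g, π.vert x y g e = φ := by
  obtain ⟨g, e, h⟩ := π.exists_map φ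
  exact ⟨g, by rwa [res_id] at e, h⟩

theorem vert_inj {S : C} {x y : Sec G.G₀ S} {g g' : Sec G.G₁ S} {e : y = x * G.bd g}
    {e' : y = x * G.bd g'} (h : π.vert x y g e = π.vert x y g' e') : g = g' :=
  π.map_inj h

theorem vert_mu {S : C} {x y x' y' : Sec G.G₀ S} {g k : Sec G.G₁ S} (e : x' = x * G.bd g)
    (e' : y' = y * G.bd k) (e'' : x' * y' = x * y * G.bd (G.act g y * k)) :
    (π.vert x x' g e ⊗ₘ π.vert y y' k e') ≫ π.mu x' y' =
      π.mu x y ≫ π.vert (x * y) (x' * y') (G.act g y * k) e'' := by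
  have := π.mu_naturality (𝟙 S) x y x' y' g k (by rwa [res_id]) (by rwa [res_id]) (by rwa [res_id])
  rw [𝓖.tens_fiber] at this
  exact this

theorem whiskerRight_mu {S : C} {x x' : Sec G.G₀ S} {g : Sec G.G₁ S} (e : x' = x * G.bd g)
    (y : Sec G.G₀ S) (e'' : x' * y = x * y * G.bd (G.act g y)) :
    (π.vert x x' g e ▷ π.obj y) ≫ π.mu x' y =
      π.mu x y ≫ π.vert (x * y) (x' * y) (G.act g y) e'' := by
  have := π.vert_mu (y := y) (y' := y) (k := 1) e (by simp) (by simpa using e'')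
  rw [π.vert_one, tensorHom_id] at this
  rw [this]
  congr 1
  exact π.vert_congr (mul_one _) _ _

theorem whiskerLeft_mu {S : C} (x : Sec G.G₀ S) {y y' : Sec G.G₀ S} {g : Sec G.G₁ S}
    (e : y' = y * G.bd g) (e'' : x * y' = x * y * G.bd g) :
    (π.obj x ◁ π.vert y y' g e) ≫ π.mu x y' = π.mu x y ≫ π.vert (x * y) (x * y') g e'' := by
  have := π.vert_mu (x := x) (x' := x) (g := 1) (by simp) e
    (by rw [G.one_act, one_mul]; exact e'')
  rw [π.vert_one, id_tensorHom] at this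
  rw [this]
  congr 1
  exact π.vert_congr (by rw [G.one_act, one_mul]) _ _

theorem mu_assoc_left {S : C} (x y z : Sec G.G₀ S) :
    (π.mu x y ▷ π.obj z) ≫ π.mu (x * y) z =
      (α_ (π.obj x) (π.obj y) (π.obj z)).hom ≫ (π.obj x ◁ π.mu y z) ≫ π.mu x (y * z) ≫
        π.ident (x * (y * z)) (x * y * z) (mul_assoc x y z).symm := by
  rw [← reassoc_of% (π.mu_assoc x y z), π.ident_comp_ident, π.ident_self, Category.comp_id]

theorem mu_assoc_right {S : C} (x y z : Sec G.G₀ S) :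
    (π.obj x ◁ π.mu y z) ≫ π.mu x (y * z) =
      (α_ (π.obj x) (π.obj y) (π.obj z)).inv ≫ (π.mu x y ▷ π.obj z) ≫ π.mu (x * y) z ≫
        π.ident (x * y * z) (x * (y * z)) (mul_assoc x y z) := by
  rw [π.mu_assoc, Iso.inv_hom_id_assoc]

end Presentation

/-- The middle-four interchange in terms of the bracket. -/
theorem BraidedPresentation.tensorμ_mu {G : BraidedCrossedModule.{w} J}
    {𝓖 : BraidedGrStack.{o, h} J} (π : BraidedPresentation G 𝓖) {S : C} (x x' z z' : Sec G.G₀ S)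
    (e : x * z * (x' * z') = x * x' * (z * z') * G.bd (G.act (G.br x' z) z')) :
    tensorμ (π.obj x) (π.obj x') (π.obj z) (π.obj z') ≫ (π.mu x z ⊗ₘ π.mu x' z') ≫
        π.mu (x * z) (x' * z') =
      (π.mu x x' ⊗ₘ π.mu z z') ≫ π.mu (x * x') (z * z') ≫
        π.vert (x * x' * (z * z')) (x * z * (x' * z')) (G.act (G.br x' z) z') e := by
  have outer : ∀ a b c d : Sec G.G₀ S, (π.mu a b ⊗ₘ π.mu c d) ≫ π.mu (a * b) (c * d) =
      (α_ _ _ _).hom ≫ (π.obj a ◁ ((α_ _ _ _).inv ≫ (π.mu b c ▷ π.obj d) ≫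
        π.mu (b * c) d)) ≫ π.mu a (b * c * d) ≫
          π.ident (a * (b * c * d)) (a * b * (c * d)) (by simp only [mul_assoc]) := by
    intro a b c d
    rw [tensorHom_def', Category.assoc, π.mu_assoc_left, associator_naturality_right_assoc]
    congr 1
    rw [← MonoidalCategory.whiskerLeft_comp_assoc, π.mu_assoc_right]
    simp only [MonoidalCategory.whiskerLeft_comp, Category.assoc]
    congr 3
    unfold PreMorphism.ident
    rw [reassoc_of% (π.whiskerLeft_mu a (g := 1) (by simp [mul_assoc]) (by simp [mul_assoc]))]
    rw [π.vert_comp (g'' := 1) (by simp) (by simp [mul_assoc])]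
  have e₁ : z * x' = x' * z * G.bd (G.br x' z) := by rw [G.bd_br]; group
  have e₂ : z * x' * z' = x' * z * z' * G.bd (G.act (G.br x' z) z') := by
    rw [e₁, G.bd_act']; group
  have mid : ((β_ (π.obj x') (π.obj z)).hom ▷ π.obj z') ≫ (π.mu z x' ▷ π.obj z') ≫
      π.mu (z * x') z' = (π.mu x' z ▷ π.obj z') ≫ π.mu (x' * z) z' ≫
        π.vert (x' * z * z') (z * x' * z') (G.act (G.br x' z) z') e₂ := by
    rw [← comp_whiskerRight_assoc, ← π.braided x' z e₁, comp_whiskerRight_assoc,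
      π.whiskerRight_mu]
  rw [outer, reassoc_of% outer]
  simp only [tensorμ, Category.assoc, Iso.inv_hom_id_assoc, Iso.hom_inv_id_assoc,
    ← MonoidalCategory.whiskerLeft_comp_assoc, mid]
  simp only [MonoidalCategory.whiskerLeft_comp, Category.assoc]
  rw [reassoc_of% (π.whiskerLeft_mu x e₂ (by rw [e₂]; group))]
  congr 5
  unfold PreMorphism.ident
  rw [π.vert_comp (g'' := G.act (G.br x' z) z') (by simp)
      (by rw [e]; group), π.vert_comp (g'' := G.act (G.br x' z) z') (by simp)]

end Presentation

/-! ## Transport in a butterfly along morphisms of the base -/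

namespace NExtension

variable {C : Type u} [Category.{v} C] {J : GrothendieckTopology C} {n : ℕ}
  {A : Fin n → Cᵒᵖ ⥤ GrpCat.{w}} {G : BraidedCrossedModule.{w} J} (B : NExtension J A G) {S : C}

theorem mul_congr {i : Fin n} {e e' d d' : B.E.obj (op S)} (h : e = d) (h' : e' = d')
    (a : AgreeOff i (B.p e) (B.p e')) (b : AgreeOff i (B.p d) (B.p d')) :
    B.mul i e e' a = B.mul i d d' b := by
  subst h h'
  rfl

theorem act_inj {e : B.E.obj (op S)} {g g' : Sec G.G₁ S} (h : B.act e g = B.act e g') : g = g' :=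
  (B.simply_transitive e (B.act e g') (B.p_act e g').symm).unique h rfl

theorem eq_one_of_act {e : B.E.obj (op S)} {g : Sec G.G₁ S} (h : B.act e g = e) : g = 1 :=
  B.act_inj (h.trans (B.act_one e).symm)

theorem exists_act {e e' : B.E.obj (op S)} (h : B.p e = B.p e') : ∃ g, B.act e g = e' :=
  (B.simply_transitive e e' h).exists

/-- The product of two translated elements. -/
theorem mul_act_act (i : Fin n) (e e' : B.E.obj (op S)) (g g' : Sec G.G₁ S)
    (a : AgreeOff i (B.p (B.act e g)) (B.p (B.act e' g'))) (b : AgreeOff i (B.p e) (B.p e')) :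
    B.mul i (B.act e g) (B.act e' g') a = B.act (B.mul i e e' b) (G.act g (B.j e') * g') := by
  have h : ∀ {d d' : B.E.obj (op S)}, B.p d = B.p d' → ∀ {c : B.E.obj (op S)},
      AgreeOff i (B.p c) (B.p d) → AgreeOff i (B.p c) (B.p d') := by
    intro d d' h c hc
    rwa [← h]
  have a₁ : AgreeOff i (B.p (B.act e g)) (B.p e') := by simpa only [B.p_act] using b
  rw [B.mul_act_right i _ _ _ a₁, B.act_mul_left i e e' g a₁ (h (B.p_act _ _).symm b),
    B.mul_act_right i _ _ _ b, B.act_mul]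

theorem map_id (e : B.E.obj (op S)) : B.E.map (𝟙 S).op e = e := by
  simp

theorem map_comp {R T : C} (f : R ⟶ T) (g : T ⟶ S) (e : B.E.obj (op S)) :
    B.E.map (f ≫ g).op e = B.E.map f.op (B.E.map g.op e) := by
  simp

theorem ext_of_loc {e e' : B.E.obj (op S)}
    (h : Loc J S fun _ f => B.E.map f.op e = B.E.map f.op e') : e = e' := by
  obtain ⟨R, hR, h⟩ := h
  exact (B.isSheaf R hR).isSeparatedFor.ext fun T f hf => h f hf

end NExtension

namespace NButterfly

variable {C : Type u} [Category.{v} C] {J : GrothendieckTopology C} {n : ℕ}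
  {H : Fin n → CrossedModule.{w} J} {G : BraidedCrossedModule.{w} J} (B : NButterfly H G) {S T : C}

theorem s_congr {i : Fin n} {y y' : ∀ k, Sec (H k).G₀ S} {h h' : Sec (H i).G₁ S} (e : y = y')
    (e' : h = h') (a : y i = (H i).bd h) (a' : y' i = (H i).bd h') :
    B.s i y h a = B.s i y' h' a' := by
  subst e e'
  rfl

theorem agreeOff_s (i : Fin n) (h : Sec (H i).G₁ S) (e : B.El S) :
    AgreeOff i (B.p e) (B.p (B.s i (Function.update (B.p e) i ((H i).bd h)) h (by simp))) := by
  intro k hk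
  rw [B.p_s, Function.update_of_ne hk]

/-- Translation by the section `s i` with entry `h`. -/
def shift (i : Fin n) (h : Sec (H i).G₁ S) (e : B.El S) : B.El S :=
  B.mul i e (B.s i (Function.update (B.p e) i ((H i).bd h)) h (by simp)) (B.agreeOff_s i h e)

theorem mul_s (i : Fin n) (e : B.El S) (y : ∀ k, Sec (H k).G₀ S) (h : Sec (H i).G₁ S)
    (hy : y i = (H i).bd h) (a : AgreeOff i (B.p e) (B.p (B.s i y h hy))) :
    B.mul i e (B.s i y h hy) a = B.shift i h e := by
  refine B.mul_congr rfl (B.s_congr (funext fun k => ?_) rfl _ _) _ _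
  rcases eq_or_ne k i with rfl | hk
  · simpa using hy
  · rw [Function.update_of_ne hk, a k hk, B.p_s]

theorem p_shift (i : Fin n) (h : Sec (H i).G₁ S) (e : B.El S) :
    B.p (B.shift i h e) = Function.update (B.p e) i (B.p e i * (H i).bd h) := by
  rw [shift, B.p_mul, B.p_s, Function.update_self]

theorem p_shift_self (i : Fin n) (h : Sec (H i).G₁ S) (e : B.El S) :
    B.p (B.shift i h e) i = B.p e i * (H i).bd h := by
  rw [p_shift, Function.update_self]

theorem p_shift_of_ne {i k : Fin n} (hk : k ≠ i) (h : Sec (H i).G₁ S) (e : B.El S) :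
    B.p (B.shift i h e) k = B.p e k := by
  rw [p_shift, Function.update_of_ne hk]

theorem j_shift (i : Fin n) (h : Sec (H i).G₁ S) (e : B.El S) : B.j (B.shift i h e) = B.j e := by
  rw [shift, B.j_mul, B.j_s, mul_one]

theorem shift_act (i : Fin n) (h : Sec (H i).G₁ S) (e : B.El S) (g : Sec G.G₁ S) :
    B.shift i h (B.act e g) = B.act (B.shift i h e) g := by
  have a := B.agreeOff_s i h e
  have a' : AgreeOff i (B.p (B.act e g))
      (B.p (B.act (B.s i (Function.update (B.p e) i ((H i).bd h)) h (by simp)) 1)) := by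
    rwa [B.p_act, B.p_act]
  have := B.mul_act_act i e _ g 1 a' a
  rw [B.j_s, G.act_one, mul_one] at this
  rw [← B.mul_s i e _ h _ a, ← this]
  rw [B.act_one] at a'
  rw [← B.mul_s i (B.act e g) _ h _ a']
  exact B.mul_congr rfl (B.act_one _).symm _ _

theorem map_shift (f : T ⟶ S) (i : Fin n) (h : Sec (H i).G₁ S) (e : B.El S) :
    B.E.map f.op (B.shift i h e) = B.shift i (res (H i).G₁ f h) (B.E.map f.op e) := by
  have a : AgreeOff i (B.p (B.E.map f.op e)) (B.p (B.E.map f.op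
      (B.s i (Function.update (B.p e) i ((H i).bd h)) h (by simp)))) := by
    intro k hk
    rw [B.p_res, B.p_res, B.p_s, Function.update_of_ne hk]
  have hs : res (H i).G₀ f (Function.update (B.p e) i ((H i).bd h) i) =
      (H i).bd (res (H i).G₁ f h) := by
    rw [Function.update_self, (H i).res_bd]
  rw [shift, B.mul_res f i _ _ _ a,
    B.mul_congr rfl (B.s_res f i _ h _ hs) a (by rwa [← B.s_res f i _ h _ hs])]
  exact B.mul_s _ _ _ _ _ _

theorem shift_shift (i : Fin n) (h h' : Sec (H i).G₁ S) (e : B.El S) :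
    B.shift i h' (B.shift i h e) = B.shift i (h * h') e := by
  have a := B.agreeOff_s i h e
  have a' : AgreeOff i (B.p (B.s i (Function.update (B.p e) i ((H i).bd h)) h (by simp)))
      (B.p (B.s i (Function.update (B.p e) i ((H i).bd h')) h' (by simp))) := by
    intro k hk
    rw [B.p_s, B.p_s, Function.update_of_ne hk, Function.update_of_ne hk]
  have b : AgreeOff i (B.p (B.shift i h e))
      (B.p (B.s i (Function.update (B.p e) i ((H i).bd h')) h' (by simp))) := by
    intro k hk
    rw [B.p_s, Function.update_of_ne hk, B.p_shift_of_ne hk]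
  rw [← B.mul_s i (B.shift i h e) _ h' _ b]
  have hs := B.s_mul_same i _ _ h h' (by simp) (by simp) a' (by simp)
  have b' : AgreeOff i (B.p e) (B.p (B.mul i _ _ a')) := by
    intro k hk
    rw [B.p_mul, B.p_s, Function.update_of_ne hk, Function.update_of_ne hk]
  exact (B.mul_assoc i e _ _ a b a' b').trans
    ((B.mul_congr rfl hs b' (by rwa [← hs])).trans (B.mul_s _ _ _ _ _ _))

theorem shift_one (i : Fin n) (e : B.El S) : B.shift i 1 e = e := by
  obtain ⟨g, hg⟩ := B.exists_act (e := e) (e' := B.shift i 1 e) (by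
    rw [B.p_shift, map_one, mul_one, Function.update_eq_self])
  have h := B.shift_shift i 1 1 e
  rw [mul_one] at h
  nth_rw 1 [← hg] at h
  rw [B.shift_act] at h
  rw [← hg, B.eq_one_of_act h, B.act_one]

theorem agreeOff_shift {i k : Fin n} (hk : k ≠ i) (h : Sec (H i).G₁ S) {e e' : B.El S}
    (a : AgreeOff k (B.p e) (B.p e')) :
    AgreeOff k (B.p (B.shift i h e)) (B.p (B.shift i h e')) := by
  intro l hl
  rcases eq_or_ne l i with rfl | hi
  · rw [p_shift_self, p_shift_self, a l hl]
  · rw [B.p_shift_of_ne hi, B.p_shift_of_ne hi, a l hl]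

theorem shift_mul_of_ne {i k : Fin n} (hk : k ≠ i) (h : Sec (H i).G₁ S) (e e' : B.El S)
    (a : AgreeOff k (B.p e) (B.p e'))
    (a' : AgreeOff k (B.p (B.shift i h e)) (B.p (B.shift i h e'))) :
    B.mul k (B.shift i h e) (B.shift i h e') a' = B.shift i h (B.mul k e e' a) := by
  have hu := B.agreeOff_s i h
  have b : AgreeOff k (B.p (B.s i (Function.update (B.p e) i ((H i).bd h)) h (by simp)))
      (B.p (B.s i (Function.update (B.p e') i ((H i).bd h)) h (by simp))) := by
    intro l hl
    rw [B.p_s, B.p_s]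
    rcases eq_or_ne l i with rfl | hi
    · rw [Function.update_self, Function.update_self]
    · rw [Function.update_of_ne hi, Function.update_of_ne hi, a l hl]
  have hs := B.s_mul_other i k hk _ _ h (by simp) (by simp) b (by simp [hk.symm])
  have c : AgreeOff i (B.p (B.mul k e e' a)) (B.p (B.mul k _ _ b)) := by
    intro l hl
    rw [B.p_mul, B.p_mul, B.p_s, B.p_s]
    rcases eq_or_ne l k with rfl | hlk
    · simp [hl]
    · simp [hl, hlk]
  have key : B.mul i (B.mul k e e' a) (B.mul k _ _ b) c = B.shift i h (B.mul k e e' a) :=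
    (B.mul_congr rfl hs c (by rwa [← hs])).trans (B.mul_s _ _ _ _ _ _)
  rw [← key]
  have one_br : ∀ x : Sec G.G₀ S, G.br 1 x = 1 := by
    intro x
    have := G.mul_br 1 1 x
    rw [G.act_one, mul_one] at this
    exact left_eq_mul.1 this
  have br_one : ∀ x : Sec G.G₀ S, G.br x 1 = 1 := by
    intro x
    have := G.br_mul x 1 1
    rw [G.act_one, mul_one] at this
    exact left_eq_mul.1 this
  rcases lt_or_gt_of_ne hk with hlt | hlt
  · have := B.interchange k i hlt e e' _ _ a b c (hu e) (hu e') a'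
    rw [this, B.j_s, br_one, inv_one, G.one_act, B.act_one]
    rfl
  · have := B.interchange i k hlt e _ e' _ (hu e) (hu e') a' a b c
    rw [B.j_s, one_br, inv_one, G.one_act, B.act_one] at this
    exact this

theorem shift_comm {i k : Fin n} (hk : k ≠ i) (h : Sec (H i).G₁ S) (h' : Sec (H k).G₁ S)
    (e : B.El S) : B.shift k h' (B.shift i h e) = B.shift i h (B.shift k h' e) := by
  have a := B.agreeOff_s k h' e
  have key : B.shift i h (B.s k (Function.update (B.p e) k ((H k).bd h')) h' (by simp)) =
      B.s k (Function.update (B.p (B.shift i h e)) k ((H k).bd h')) h' (by simp) := by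
    have hs := B.restriction i k hk.symm (Function.update
      (Function.update (B.p e) k ((H k).bd h')) i ((H i).bd h)) h h' (by simp) (by
        rw [Function.update_of_ne hk, Function.update_self])
    have b : AgreeOff i (B.p (B.s k (Function.update (B.p e) k ((H k).bd h')) h' (by simp)))
        (B.p (B.s k (Function.update (Function.update (B.p e) k ((H k).bd h')) i ((H i).bd h)) h'
          (by simp [hk]))) := by
      intro l hl
      rw [B.p_s, B.p_s, Function.update_of_ne hl]
    rw [← B.mul_s i _ (Function.update (Function.update (B.p e) k ((H k).bd h')) i ((H i).bd h)) h
        (by simp) (by rwa [hs]), B.mul_congr rfl hs (by rwa [hs]) b,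
      B.s_mul_other k i hk.symm _ _ h' (by simp) (by simp [hk]) b (by simp [hk])]
    refine B.s_congr (funext fun l => ?_) rfl _ _
    rw [B.p_shift]
    rcases eq_or_ne l i with rfl | hi
    · rw [Function.update_self, Function.update_of_ne hk.symm, Function.update_self,
        Function.update_of_ne hk.symm, Function.update_self]
    · rcases eq_or_ne l k with rfl | hlk
      · simp [hi]
      · simp [hi, hlk]
  have a' := B.agreeOff_shift hk h a
  have := B.shift_mul_of_ne hk h e _ a a'
  rw [B.mul_congr rfl key a' (by rwa [← key]), B.mul_s, B.mul_s] at this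
  exact this

theorem mul_shift_shift (i : Fin n) (h h' : Sec (H i).G₁ S) (e e' : B.El S)
    (a : AgreeOff i (B.p e) (B.p e'))
    (a' : AgreeOff i (B.p (B.shift i h e)) (B.p (B.shift i h' e'))) :
    B.mul i (B.shift i h e) (B.shift i h' e') a' =
      B.shift i ((H i).act h (B.p e' i) * h') (B.mul i e e' a) := by
  have hu := fun (e : B.El S) h => B.agreeOff_s i h e
  have p₁ : AgreeOff i (B.p (B.shift i h e)) (B.p e') := by
    intro k hk
    rw [B.p_shift_of_ne hk, a k hk]
  have p₂ : AgreeOff i (B.p (B.mul i (B.shift i h e) e' p₁))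
      (B.p (B.s i (Function.update (B.p e') i ((H i).bd h')) h' (by simp))) := by
    intro k hk
    rw [B.p_mul, B.p_s, Function.update_of_ne hk, Function.update_of_ne hk, p₁ k hk]
  have h₁ : B.mul i (B.shift i h e) (B.shift i h' e') a' =
      B.shift i h' (B.mul i (B.shift i h e) e' p₁) := by
    rw [← B.mul_s i _ _ h' _ p₂]
    exact (B.mul_assoc i _ e' _ p₁ p₂ (hu e' h') a').symm
  have p₃ : AgreeOff i (B.p (B.s i (Function.update (B.p e) i ((H i).bd h)) h (by simp)))
      (B.p e') := by
    intro k hk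
    rw [B.p_s, Function.update_of_ne hk, a k hk]
  have p₄ : AgreeOff i (B.p e) (B.p (B.mul i _ e' p₃)) := by
    intro k hk
    rw [B.p_mul, B.p_s, Function.update_of_ne hk, Function.update_of_ne hk]
  have p₅ := hu e' ((H i).act h (B.p e' i))
  have p₆ : AgreeOff i (B.p (B.mul i e e' a)) (B.p (B.s i
      (Function.update (B.p e') i ((H i).bd ((H i).act h (B.p e' i)))) ((H i).act h (B.p e' i)) (by simp))) := by
    intro k hk
    rw [B.p_mul, B.p_s, Function.update_of_ne hk, Function.update_of_ne hk, a k hk]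
  have p₇ : AgreeOff i (B.p e) (B.p (B.mul i e' _ p₅)) := by
    intro k hk
    rw [B.p_mul, Function.update_of_ne hk, a k hk]
  have h₂ : B.mul i (B.shift i h e) e' p₁ =
      B.shift i ((H i).act h (B.p e' i)) (B.mul i e e' a) := by
    rw [← B.mul_s i _ _ _ _ p₆, B.mul_assoc i e e' _ a p₆ p₅ p₇]
    refine (B.mul_assoc i e _ e' (hu e h) p₁ p₃ p₄).trans ?_
    exact B.mul_congr rfl (B.compatibility i _ _ h e' (by simp) (by simp) p₃ p₅) _ _
  rw [h₁, h₂, B.shift_shift]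

end NButterfly

namespace NButterfly

variable {C : Type u} [Category.{v} C] {J : GrothendieckTopology C} {n : ℕ}
  {H : Fin n → CrossedModule.{w} J} {G : BraidedCrossedModule.{w} J} (B : NButterfly H G) {S T : C}

/-- The successive translations in the variables of a list. -/
def shiftList (γ : ∀ k, Sec (H k).G₁ S) : List (Fin n) → B.El S → B.El S
  | [], e => e
  | i :: l, e => shiftList γ l (B.shift i (γ i) e)

section ShiftList

variable (γ : ∀ k, Sec (H k).G₁ S)

theorem p_shiftList_of_notMem {k : Fin n} : ∀ {l : List (Fin n)}, k ∉ l → ∀ e : B.El S,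
    B.p (B.shiftList γ l e) k = B.p e k
  | [], _, _ => rfl
  | i :: l, hk, e => by
    rw [List.mem_cons, not_or] at hk
    rw [shiftList, p_shiftList_of_notMem hk.2, B.p_shift_of_ne hk.1]

theorem p_shiftList_of_mem {k : Fin n} : ∀ {l : List (Fin n)}, l.Nodup → k ∈ l → ∀ e : B.El S,
    B.p (B.shiftList γ l e) k = B.p e k * (H k).bd (γ k)
  | i :: l, hl, hk, e => by
    rw [List.nodup_cons] at hl
    rw [shiftList]
    rcases eq_or_ne k i with rfl | hki
    · rw [B.p_shiftList_of_notMem γ hl.1, B.p_shift_self]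
    · rw [p_shiftList_of_mem hl.2 ((List.mem_cons.1 hk).resolve_left hki), B.p_shift_of_ne hki]

theorem j_shiftList : ∀ (l : List (Fin n)) (e : B.El S), B.j (B.shiftList γ l e) = B.j e
  | [], _ => rfl
  | i :: l, e => by rw [shiftList, j_shiftList l, B.j_shift]

theorem shiftList_act (g : Sec G.G₁ S) : ∀ (l : List (Fin n)) (e : B.El S),
    B.shiftList γ l (B.act e g) = B.act (B.shiftList γ l e) g
  | [], _ => rfl
  | i :: l, e => by rw [shiftList, B.shift_act, shiftList_act g l, shiftList]

theorem map_shiftList (f : T ⟶ S) : ∀ (l : List (Fin n)) (e : B.El S),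
    B.E.map f.op (B.shiftList γ l e) =
      B.shiftList (fun k => res (H k).G₁ f (γ k)) l (B.E.map f.op e)
  | [], _ => rfl
  | i :: l, e => by rw [shiftList, map_shiftList f l, B.map_shift, shiftList]

theorem shift_shiftList {i : Fin n} (h : Sec (H i).G₁ S) : ∀ {l : List (Fin n)}, i ∉ l →
    ∀ e : B.El S, B.shift i h (B.shiftList γ l e) = B.shiftList γ l (B.shift i h e)
  | [], _, _ => rfl
  | k :: l, hi, e => by
    rw [List.mem_cons, not_or] at hi
    rw [shiftList, shift_shiftList h hi.2, B.shift_comm hi.1, shiftList]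

theorem shiftList_shiftList (γ' : ∀ k, Sec (H k).G₁ S) : ∀ {l : List (Fin n)}, l.Nodup →
    ∀ e : B.El S, B.shiftList γ' l (B.shiftList γ l e) = B.shiftList (fun k => γ k * γ' k) l e
  | [], _, _ => rfl
  | i :: l, hl, e => by
    rw [List.nodup_cons] at hl
    rw [shiftList, shiftList, B.shift_shiftList γ _ hl.1, shiftList_shiftList γ' hl.2,
      B.shift_shift, shiftList]

theorem shiftList_eq_self {γ : ∀ k, Sec (H k).G₁ S} : ∀ {l : List (Fin n)},
    (∀ k ∈ l, γ k = 1) → ∀ e : B.El S, B.shiftList γ l e = e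
  | [], _, _ => rfl
  | i :: l, hl, e => by
    rw [shiftList, hl i List.mem_cons_self, B.shift_one,
      shiftList_eq_self fun k hk => hl k (List.mem_cons_of_mem _ hk)]

theorem shiftList_eq_shift {γ : ∀ k, Sec (H k).G₁ S} {i : Fin n} : ∀ {l : List (Fin n)},
    l.Nodup → i ∈ l → (∀ k, k ≠ i → γ k = 1) → ∀ e : B.El S,
      B.shiftList γ l e = B.shift i (γ i) e
  | k :: l, hl, hi, h, e => by
    rw [List.nodup_cons] at hl
    rw [shiftList]
    rcases eq_or_ne i k with rfl | hk
    · exact B.shiftList_eq_self (fun k hk => h k fun e => hl.1 (e ▸ hk)) _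
    · rw [h k hk.symm, B.shift_one,
        shiftList_eq_shift hl.2 ((List.mem_cons.1 hi).resolve_left hk) h]

theorem mul_shiftList {γ γ' γ'' : ∀ k, Sec (H k).G₁ S} {i : Fin n} (h₁ : ∀ k, k ≠ i → γ k = γ' k)
    (h₂ : ∀ k, k ≠ i → γ'' k = γ k) : ∀ {l : List (Fin n)}, l.Nodup → ∀ {e e' : B.El S},
      (i ∈ l → γ'' i = (H i).act (γ i) (B.p e' i) * γ' i) →
      ∀ (a : AgreeOff i (B.p e) (B.p e'))
      (a' : AgreeOff i (B.p (B.shiftList γ l e)) (B.p (B.shiftList γ' l e'))),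
      B.mul i (B.shiftList γ l e) (B.shiftList γ' l e') a' = B.shiftList γ'' l (B.mul i e e' a)
  | [], _, _, _, _, _, _ => rfl
  | k :: l, hl, e, e', h₃, a, a' => by
    rw [List.nodup_cons] at hl
    rcases eq_or_ne i k with rfl | hk
    · have b : AgreeOff i (B.p (B.shift i (γ i) e)) (B.p (B.shift i (γ' i) e')) := by
        intro k hk
        rw [B.p_shift_of_ne hk, B.p_shift_of_ne hk, a k hk]
      refine (mul_shiftList h₁ h₂ hl.2 (fun h => (hl.1 h).elim) b a').trans ?_
      rw [B.mul_shift_shift i _ _ _ _ a b, shiftList, h₃ List.mem_cons_self]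
    · have b : AgreeOff i (B.p (B.shift k (γ k) e)) (B.p (B.shift k (γ' k) e')) := by
        rw [← h₁ k hk.symm]
        exact B.agreeOff_shift hk _ a
      refine (mul_shiftList h₁ h₂ hl.2 (fun h => ?_) b a').trans ?_
      · rw [h₃ (List.mem_cons_of_mem _ h), B.p_shift_of_ne hk]
      · rw [shiftList, h₂ k hk.symm, ← B.shift_mul_of_ne hk _ _ _ a
          (by simpa only [← h₁ k hk.symm] using b)]
        congr 1
        exact B.mul_congr rfl (by rw [h₁ k hk.symm]) _ _

theorem shift_s_one {i k : Fin n} (hk : k ≠ i) (h : Sec (H k).G₁ S) (y : ∀ k, Sec (H k).G₀ S)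
    (hy : y i = (H i).bd 1)
    (hy' : Function.update y k (y k * (H k).bd h) i = (H i).bd 1) :
    B.shift k h (B.s i y 1 hy) = B.s i (Function.update y k (y k * (H k).bd h)) 1 hy' := by
  have e₁ : Function.update y k ((H k).bd h) i = (H i).bd 1 := by
    rw [Function.update_of_ne hk.symm, hy]
  have hs := B.restriction i k hk.symm (Function.update y k ((H k).bd h)) 1 h e₁ (by simp)
  have b : AgreeOff k (B.p (B.s i y 1 hy))
      (B.p (B.s i (Function.update y k ((H k).bd h)) 1 e₁)) := by
    intro l hl
    rw [B.p_s, B.p_s, Function.update_of_ne hl]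
  rw [← B.mul_s k _ (Function.update y k ((H k).bd h)) h (by simp) (by rwa [← hs]),
    B.mul_congr rfl hs.symm (by rwa [← hs]) b, B.s_mul_other i k hk _ _ 1 hy e₁ b
      (by rw [Function.update_of_ne hk.symm, hy])]
  exact B.s_congr (by rw [Function.update_self]) rfl _ _

theorem shiftList_s_one {i : Fin n} (hγ : γ i = 1) : ∀ (l : List (Fin n)) (y : ∀ k, Sec (H k).G₀ S)
    (hy : y i = (H i).bd 1), ∃ y' hy', B.shiftList γ l (B.s i y 1 hy) = B.s i y' 1 hy'
  | [], y, hy => ⟨y, hy, rfl⟩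
  | k :: l, y, hy => by
    rw [shiftList]
    rcases eq_or_ne k i with rfl | hk
    · rw [hγ, B.shift_one]
      exact shiftList_s_one hγ l y hy
    · rw [B.shift_s_one hk _ _ _ (by rw [Function.update_of_ne hk.symm, hy])]
      exact shiftList_s_one hγ l _ _

end ShiftList

/-- Transport of the elements of a butterfly along a morphism `γ` of the base. -/
def transport (γ : ∀ k, Sec (H k).G₁ S) (e : B.El S) : B.El S :=
  B.shiftList γ (List.finRange n) e

theorem p_transport (γ : ∀ k, Sec (H k).G₁ S) (e : B.El S) (k : Fin n) :
    B.p (B.transport γ e) k = B.p e k * (H k).bd (γ k) :=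
  B.p_shiftList_of_mem γ (List.nodup_finRange n) (List.mem_finRange k) e

theorem j_transport (γ : ∀ k, Sec (H k).G₁ S) (e : B.El S) : B.j (B.transport γ e) = B.j e :=
  B.j_shiftList γ _ e

theorem transport_act (γ : ∀ k, Sec (H k).G₁ S) (e : B.El S) (g : Sec G.G₁ S) :
    B.transport γ (B.act e g) = B.act (B.transport γ e) g :=
  B.shiftList_act γ g _ e

theorem map_transport (f : T ⟶ S) (γ : ∀ k, Sec (H k).G₁ S) (e : B.El S) :
    B.E.map f.op (B.transport γ e) =
      B.transport (fun k => res (H k).G₁ f (γ k)) (B.E.map f.op e) :=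
  B.map_shiftList γ f _ e

theorem transport_transport (γ γ' : ∀ k, Sec (H k).G₁ S) (e : B.El S) :
    B.transport γ' (B.transport γ e) = B.transport (fun k => γ k * γ' k) e :=
  B.shiftList_shiftList γ γ' (List.nodup_finRange n) e

theorem transport_one {γ : ∀ k, Sec (H k).G₁ S} (h : ∀ k, γ k = 1) (e : B.El S) :
    B.transport γ e = e :=
  B.shiftList_eq_self (fun k _ => h k) e

theorem transport_eq_shift {γ : ∀ k, Sec (H k).G₁ S} {i : Fin n} (h : ∀ k, k ≠ i → γ k = 1)
    (e : B.El S) : B.transport γ e = B.shift i (γ i) e :=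
  B.shiftList_eq_shift (List.nodup_finRange n) (List.mem_finRange i) h e

theorem mul_transport {γ γ' γ'' : ∀ k, Sec (H k).G₁ S} {i : Fin n} {e e' : B.El S}
    (h₁ : ∀ k, k ≠ i → γ k = γ' k) (h₂ : ∀ k, k ≠ i → γ'' k = γ k)
    (h₃ : γ'' i = (H i).act (γ i) (B.p e' i) * γ' i) (a : AgreeOff i (B.p e) (B.p e'))
    (a' : AgreeOff i (B.p (B.transport γ e)) (B.p (B.transport γ' e'))) :
    B.mul i (B.transport γ e) (B.transport γ' e') a' = B.transport γ'' (B.mul i e e' a) :=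
  B.mul_shiftList h₁ h₂ (List.nodup_finRange n) (fun _ => h₃) a a'

theorem transport_s_one {i : Fin n} {γ : ∀ k, Sec (H k).G₁ S} (hγ : γ i = 1)
    (y y' : ∀ k, Sec (H k).G₀ S) (hy : y i = (H i).bd 1) (hy' : y' i = (H i).bd 1)
    (h : ∀ k, y' k = y k * (H k).bd (γ k)) :
    B.transport γ (B.s i y 1 hy) = B.s i y' 1 hy' := by
  obtain ⟨y'', hy'', e⟩ := B.shiftList_s_one γ hγ (List.finRange n) y hy
  refine e.trans (B.s_congr (funext fun k => ?_) rfl _ _)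
  rw [h k, ← congrFun (B.p_s i y'' 1 hy'') k, ← e]
  exact (B.p_transport γ _ k).trans (by rw [B.p_s])

theorem s_one_mul (i : Fin n) (y : ∀ k, Sec (H k).G₀ S) (hy : y i = (H i).bd 1) (e : B.El S)
    (a : AgreeOff i (B.p (B.s i y 1 hy)) (B.p e)) : B.mul i (B.s i y 1 hy) e a = e := by
  have h₁ : (H i).act (1 : Sec (H i).G₁ S) (B.p e i) = 1 := (H i).one_act _
  have a' := B.agreeOff_s i ((H i).act 1 (B.p e i)) e
  refine (B.compatibility i y _ 1 e hy (by simp) a a').trans ?_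
  rw [B.mul_s, h₁, B.shift_one]

theorem mul_s_one (i : Fin n) (y : ∀ k, Sec (H k).G₀ S) (hy : y i = (H i).bd 1) (e : B.El S)
    (a : AgreeOff i (B.p e) (B.p (B.s i y 1 hy))) : B.mul i e (B.s i y 1 hy) a = e := by
  rw [B.mul_s, B.shift_one]

/-- `(γ, g)` is a morphism from `e'` to `e` over `r`: the restriction of `e` is the transport of
`e'` along `γ`, translated by `g`. -/
def IsArr (r : T ⟶ S) (e' : B.El T) (e : B.El S) (γ : ∀ k, Sec (H k).G₁ T) (g : Sec G.G₁ T) :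
    Prop :=
  B.E.map r.op e = B.act (B.transport γ e') g

namespace IsArr

variable {B} {r : T ⟶ S} {e' : B.El T} {e : B.El S} {γ : ∀ k, Sec (H k).G₁ T} {g : Sec G.G₁ T}

theorem p_eq (a : B.IsArr r e' e γ g) (k : Fin n) :
    res (H k).G₀ r (B.p e k) = B.p e' k * (H k).bd (γ k) := by
  rw [← B.p_res, a, B.p_act, B.p_transport]

theorem j_eq (a : B.IsArr r e' e γ g) : res G.G₀ r (B.j e) = B.j e' * G.bd g := by
  rw [← B.j_res, a, B.j_act, B.j_transport]

theorem comp {R : C} {r' : R ⟶ T} {e'' : B.El R} {γ' : ∀ k, Sec (H k).G₁ R} {g' : Sec G.G₁ R}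
    (a' : B.IsArr r' e'' e' γ' g') (a : B.IsArr r e' e γ g) :
    B.IsArr (r' ≫ r) e'' e (fun k => γ' k * res (H k).G₁ r' (γ k)) (g' * res G.G₁ r' g) := by
  rw [IsArr, B.map_comp, a, B.act_res, B.map_transport, a', B.transport_act,
    B.transport_transport, B.act_mul]

theorem exists_of (e' : B.El T) (e : B.El S) {γ : ∀ k, Sec (H k).G₁ T}
    (h : ∀ k, res (H k).G₀ r (B.p e k) = B.p e' k * (H k).bd (γ k)) : ∃ g, B.IsArr r e' e γ g := by
  obtain ⟨g, hg⟩ := B.exists_act (e := B.transport γ e') (e' := B.E.map r.op e)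
    (funext fun k => by rw [B.p_transport, B.p_res, h])
  exact ⟨g, hg.symm⟩

theorem unique {g' : Sec G.G₁ T} (a : B.IsArr r e' e γ g) (a' : B.IsArr r e' e γ g') : g = g' :=
  B.act_inj (a.symm.trans a')

theorem mul {d' : B.El T} {d : B.El S} {δ ε : ∀ k, Sec (H k).G₁ T} {k : Sec G.G₁ T}
    (a : B.IsArr r e' e γ g) (b : B.IsArr r d' d δ k) {i : Fin n}
    (c' : AgreeOff i (B.p e') (B.p d')) (c : AgreeOff i (B.p e) (B.p d))
    (h₁ : ∀ k, k ≠ i → γ k = δ k) (h₂ : ∀ k, k ≠ i → ε k = γ k)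
    (h₃ : ε i = (H i).act (γ i) (B.p d' i) * δ i) :
    B.IsArr r (B.mul i e' d' c') (B.mul i e d c) ε (G.act g (B.j d') * k) := by
  have c₁ : AgreeOff i (B.p (B.E.map r.op e)) (B.p (B.E.map r.op d)) := by
    intro k hk
    rw [B.p_res, B.p_res, c k hk]
  have c₂ : AgreeOff i (B.p (B.transport γ e')) (B.p (B.transport δ d')) := by
    intro k hk
    rw [B.p_transport, B.p_transport, c' k hk, h₁ k hk]
  rw [IsArr, B.mul_res r i e d c c₁,
    B.mul_congr a b c₁ (by simpa only [B.p_act] using c₂), B.mul_act_act i _ _ _ _ _ c₂,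
    B.mul_transport h₁ h₂ h₃ c', B.j_transport]

end IsArr

end NButterfly

/-! ## Heterogeneous equality of morphisms in fibered categories -/

namespace FibGpd

variable {C : Type u} [Category.{v} C] {𝓧 : FibGpd.{o, h} C}

theorem comp_heq {R S T : C} {f : R ⟶ S} {g : S ⟶ T} {k : R ⟶ T} {x x' : 𝓧.Ob R} {y y' : 𝓧.Ob S}
    {z z' : 𝓧.Ob T} {φ : 𝓧.Hom f x y} {φ' : 𝓧.Hom f x' y'} {ψ : 𝓧.Hom g y z} {ψ' : 𝓧.Hom g y' z'}
    (hx : x = x') (hy : y = y') (hz : z = z') (hφ : HEq φ φ') (hψ : HEq ψ ψ') (w : f ≫ g = k) :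
    HEq (𝓧.comp φ ψ w) (𝓧.comp φ' ψ' w) := by
  subst hx hy hz hφ hψ
  rfl

theorem pre_heq_of_id {S T : C} {f : S ⟶ T} {x x' : 𝓧.Ob S} {z : 𝓧.Ob T} {a : x' ⟶ x}
    (hx : x' = x) (ha : HEq a (𝟙 x')) (φ : 𝓧.Hom f x z) : HEq (𝓧.pre a φ) φ := by
  subst hx ha
  rw [id_pre]

theorem exists_heq {S T : C} {f : S ⟶ T} {x x' : 𝓧.Ob S} {y y' : 𝓧.Ob T} (hx : x' = x)
    (hy : y' = y) (φ : 𝓧.Hom f x y) : ∃ φ' : 𝓧.Hom f x' y', HEq φ' φ := by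
  subst hx hy
  exact ⟨φ, HEq.rfl⟩

end FibGpd

theorem GrStack.tens_heq {C : Type u} [Category.{v} C] {J : GrothendieckTopology C}
    {𝓧 : GrStack.{o, h} J} {S T : C} {f : S ⟶ T} {x x' z z' : 𝓧.fib.Ob S} {y y' t t' : 𝓧.fib.Ob T}
    {φ : 𝓧.fib.Hom f x y} {φ' : 𝓧.fib.Hom f x' y'} {ψ : 𝓧.fib.Hom f z t} {ψ' : 𝓧.fib.Hom f z' t'}
    (hx : x = x') (hy : y = y') (hz : z = z') (ht : t = t') (hφ : HEq φ φ') (hψ : HEq ψ ψ') :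
    HEq (𝓧.tens φ ψ) (𝓧.tens φ' ψ') := by
  subst hx hy hz ht hφ hψ
  rfl

theorem exists_tuple {n : ℕ} {P : Fin n → Type w} (i : Fin n) (c : P i) (f : ∀ k, k ≠ i → P k) :
    ∃ φ : ∀ k, P k, φ i = c ∧ ∀ k (hk : k ≠ i), φ k = f k hk :=
  ⟨fun k => if hk : k = i then hk ▸ c else f k hk, by simp, fun k hk => by simp [hk]⟩

section

variable {C : Type u} [Category.{v} C] {J : GrothendieckTopology C} {n : ℕ}

theorem exists_prodAt (𝓗 : Fin n → GrStack.{o, h} J) {S : C} (i : Fin n)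
    {x y : ∀ k, (𝓗 k).fib.Ob S} (a : ∀ k, k ≠ i → x k = y k) : ∃ z, ProdAt 𝓗 i x y z := by
  refine ⟨Function.update x i (x i ⊗ y i), fun k hk => ?_, fun k hk => ?_, ?_⟩
  · rw [Function.update_of_ne hk]
  · rw [Function.update_of_ne hk, a k hk]
  · rw [Function.update_self]

end

/-! ## Additive functors on the objects that come from the presentations -/

namespace NAdditive

variable {C : Type u} [Category.{v} C] {J : GrothendieckTopology C} {n : ℕ}
  {H : Fin n → CrossedModule.{w} J} {G : BraidedCrossedModule.{w} J}
  {𝓗 : Fin n → GrStack.{o₁, h₁} J} {𝓖 : BraidedGrStack.{o₂, h} J}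
  (F : NAdditive 𝓗 𝓖) (πH : ∀ k, Presentation (H k) (𝓗 k))

/-- The value of `F` at a tuple of sections of the `(H k)₀`. -/
abbrev val {S : C} (y : ∀ k, Sec (H k).G₀ S) : 𝓖.gr.fib.Ob S := F.obj fun k => (πH k).obj (y k)

/-- The effect of `F` on a morphism of tuples of sections. -/
def mapP {T S : C} (f : T ⟶ S) (y : ∀ k, Sec (H k).G₀ T) (y' : ∀ k, Sec (H k).G₀ S)
    (γ : ∀ k, Sec (H k).G₁ T) (hγ : ∀ k, res (H k).G₀ f (y' k) = y k * (H k).bd (γ k)) :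
    𝓖.gr.fib.Hom f (F.val πH y) (F.val πH y') :=
  F.map fun k => (πH k).map f (y k) (y' k) (γ k) (hγ k)

/-- The effect of `F` on a morphism of tuples of sections over the same object. -/
def mapV {S : C} (y y' : ∀ k, Sec (H k).G₀ S) (γ : ∀ k, Sec (H k).G₁ S)
    (hγ : ∀ k, y' k = y k * (H k).bd (γ k)) : F.val πH y ⟶ F.val πH y' :=
  F.map fun k => (πH k).vert (y k) (y' k) (γ k) (hγ k)

theorem comp_mapP {R T S : C} {f : R ⟶ T} {f' : T ⟶ S} {k : R ⟶ S} {y : ∀ k, Sec (H k).G₀ R}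
    {y' : ∀ k, Sec (H k).G₀ T} {y'' : ∀ k, Sec (H k).G₀ S} {γ : ∀ k, Sec (H k).G₁ R}
    {γ' : ∀ k, Sec (H k).G₁ T} {h h'} (w : f ≫ f' = k) {γ'' : ∀ k, Sec (H k).G₁ R}
    (hγ : ∀ k, γ'' k = γ k * res (H k).G₁ f (γ' k)) (h'') :
    𝓖.gr.fib.comp (F.mapP πH f y y' γ h) (F.mapP πH f' y' y'' γ' h') w =
      F.mapP πH k y y'' γ'' h'' := by
  rw [mapP, mapP, ← F.map_comp]
  exact congrArg F.map (funext fun k => (πH k).comp_map w (hγ k) (h'' k))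

theorem mapV_comp {S : C} {y y' y'' : ∀ k, Sec (H k).G₀ S} {γ γ' : ∀ k, Sec (H k).G₁ S} {h h'}
    {γ'' : ∀ k, Sec (H k).G₁ S} (hγ : ∀ k, γ'' k = γ k * γ' k) (h'') :
    F.mapV πH y y' γ h ≫ F.mapV πH y' y'' γ' h' = F.mapV πH y y'' γ'' h'' :=
  F.comp_mapP πH _ (fun k => by rw [hγ, res_id]) _

theorem mapV_one {S : C} {y : ∀ k, Sec (H k).G₀ S} {γ : ∀ k, Sec (H k).G₁ S}
    (e : ∀ k, γ k = 1) (h) : F.mapV πH y y γ h = 𝟙 _ := by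
  obtain rfl : γ = fun _ => 1 := funext e
  exact (congrArg F.map (funext fun k => (πH k).vert_one (y k) (h k))).trans (F.map_id _)

theorem ident_self {S : C} (y : ∀ k, Sec (H k).G₀ S) (e : y = y) : F.ident πH y y e = 𝟙 _ :=
  F.mapV_one πH (fun _ => rfl) _

theorem ident_comp_ident {S : C} {y y' y'' : ∀ k, Sec (H k).G₀ S} (e : y = y') (e' : y' = y'') :
    F.ident πH y y' e ≫ F.ident πH y' y'' e' = F.ident πH y y'' (e.trans e') := by
  subst e e'
  rw [ident_self, Category.id_comp]

/-- The effect of `F` on morphisms of a fibre. -/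
def mapF {S : C} {x y : ∀ k, (𝓗 k).fib.Ob S} (φ : ∀ k, x k ⟶ y k) : F.obj x ⟶ F.obj y :=
  F.map φ

theorem map_comp_fiber {S : C} {x y z : ∀ k, (𝓗 k).fib.Ob S} (φ : ∀ k, x k ⟶ y k)
    (ψ : ∀ k, y k ⟶ z k) :
    F.mapF φ ≫ F.mapF ψ = F.mapF fun k => φ k ≫ ψ k :=
  (F.map_comp φ ψ _).symm

theorem hom_naturality_fiber {F F' : NAdditive 𝓗 𝓖} (η : F ⟶ F') {S : C}
    {x y : ∀ k, (𝓗 k).fib.Ob S} (φ : ∀ k, x k ⟶ y k) :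
    F.mapF φ ≫ Hom.app η y = Hom.app η x ≫ F'.mapF φ :=
  Hom.naturality η φ

end NAdditive

namespace Comparison

variable {C : Type u} [Category.{v} C] {J : GrothendieckTopology C} {n : ℕ}
  {H : Fin n → CrossedModule.{w} J} {G : BraidedCrossedModule.{w} J}
  {𝓗 : Fin n → GrStack.{o₁, h₁} J} {𝓖 : BraidedGrStack.{o₂, h} J}
  {πH : ∀ k, Presentation (H k) (𝓗 k)} {πG : BraidedPresentation G 𝓖}
  {B : NButterfly H G} {F : NAdditive 𝓗 𝓖} (c : Comparison πH πG B F)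

/-- The value of the comparison at a point `e`, as a morphism between prescribed objects. -/
def appAt {S : C} (e : B.El S) {y : ∀ k, Sec (H k).G₀ S} {x : Sec G.G₀ S} (hp : B.p e = y)
    (hj : B.j e = x) : πG.obj x ⟶ F.val πH y :=
  πG.ident x (B.j e) hj.symm ≫ c.app e ≫ F.ident πH (B.p e) y hp

theorem appAt_rfl {S : C} (e : B.El S) : c.appAt e rfl rfl = c.app e := by
  rw [appAt, πG.ident_self, F.ident_self, Category.id_comp, Category.comp_id]

theorem appAt_congr {S : C} {e e' : B.El S} (h : e = e') {y : ∀ k, Sec (H k).G₀ S}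
    {x : Sec G.G₀ S} (hp : B.p e = y) (hj : B.j e = x) (hp' : B.p e' = y) (hj' : B.j e' = x) :
    c.appAt e hp hj = c.appAt e' hp' hj' := by
  subst h
  rfl

theorem appAt_shift {S : C} (i : Fin n) (e : B.El S) {γ : ∀ k, Sec (H k).G₁ S}
    (h : ∀ k, k ≠ i → γ k = 1) {y y' : ∀ k, Sec (H k).G₀ S} {x : Sec G.G₀ S} (hp : B.p e = y)
    (hj : B.j e = x) (hp' : B.p (B.shift i (γ i) e) = y') (hj' : B.j (B.shift i (γ i) e) = x)
    (hγ : ∀ k, y' k = y k * (H k).bd (γ k)) :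
    c.appAt e hp hj ≫ F.mapV πH y y' γ hγ = c.appAt (B.shift i (γ i) e) hp' hj' := by
  subst hp hj hp'
  have := c.app_s i e _ (γ i) _ (B.agreeOff_s i (γ i) e) γ hγ rfl h
  rw [appAt_rfl, appAt, F.ident_self, Category.comp_id]
  exact this

theorem appAt_shiftList {S : C} (γ δ : ∀ k, Sec (H k).G₁ S) {l : List (Fin n)} (hl : l.Nodup)
    (h₁ : ∀ k ∈ l, δ k = γ k) (h₂ : ∀ k, k ∉ l → δ k = 1) (e : B.El S)
    {y y' : ∀ k, Sec (H k).G₀ S} {x : Sec G.G₀ S} (hp : B.p e = y)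
    (hj : B.j e = x) (hp' : B.p (B.shiftList γ l e) = y') (hj' : B.j (B.shiftList γ l e) = x)
    (hδ : ∀ k, y' k = y k * (H k).bd (δ k)) :
    c.appAt e hp hj ≫ F.mapV πH y y' δ hδ = c.appAt (B.shiftList γ l e) hp' hj' := by
  induction l generalizing δ e y with
  | nil =>
    obtain rfl : y = y' := hp.symm.trans hp'
    rw [F.mapV_one πH (fun k => h₂ k List.not_mem_nil) hδ, Category.comp_id]
    rfl
  | cons i l ih =>
    rw [List.nodup_cons] at hl
    obtain ⟨α, hα, hα'⟩ := exists_tuple (P := fun k => Sec (H k).G₁ S) i (γ i) fun _ _ => 1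
    obtain ⟨β, hβ, hβ'⟩ := exists_tuple (P := fun k => Sec (H k).G₁ S) i 1 fun k _ => δ k
    have e₃ : ∀ k, δ k = α k * β k := by
      intro k
      rcases eq_or_ne k i with rfl | hk
      · rw [hα, hβ, mul_one, h₁ k List.mem_cons_self]
      · rw [hα' k hk, hβ' k hk, one_mul]
    have e₁ : ∀ k, B.p (B.shift i (α i) e) k = y k * (H k).bd (α k) := by
      intro k
      rcases eq_or_ne k i with rfl | hk
      · rw [B.p_shift_self, hp]
      · rw [B.p_shift_of_ne hk, hα' k hk, map_one, mul_one, hp]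
    have e₂ : ∀ k, y' k = B.p (B.shift i (α i) e) k * (H k).bd (β k) := by
      intro k
      rw [hδ, e₁, e₃, map_mul, mul_assoc]
    have e₅ : B.shiftList γ (i :: l) e = B.shiftList γ l (B.shift i (α i) e) := by
      rw [hα]
      rfl
    rw [← F.mapV_comp πH (h := e₁) (h' := e₂) e₃, ← Category.assoc,
      c.appAt_shift i e hα' hp hj rfl ((B.j_shift _ _ _).trans hj) e₁,
      c.appAt_congr e₅ hp' hj' (by rw [← e₅, hp']) (by rw [← e₅, hj'])]
    refine ih β hl.2 (fun k hk => ?_) (fun k hk => ?_) (B.shift i (α i) e) _ _ _ _ e₂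
    · rw [hβ' k fun e => hl.1 (e ▸ hk), h₁ k (List.mem_cons_of_mem _ hk)]
    · rcases eq_or_ne k i with rfl | hki
      · exact hβ
      · rw [hβ' k hki, h₂ k (by simp [hk, hki])]

theorem appAt_transport {S : C} (γ : ∀ k, Sec (H k).G₁ S) (e : B.El S)
    {y y' : ∀ k, Sec (H k).G₀ S} {x : Sec G.G₀ S} (hp : B.p e = y)
    (hj : B.j e = x) (hp' : B.p (B.transport γ e) = y') (hj' : B.j (B.transport γ e) = x)
    (hγ : ∀ k, y' k = y k * (H k).bd (γ k)) :
    c.appAt e hp hj ≫ F.mapV πH y y' γ hγ = c.appAt (B.transport γ e) hp' hj' :=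
  c.appAt_shiftList γ γ (List.nodup_finRange n) (fun _ _ => rfl)
    (fun k hk => (hk (List.mem_finRange k)).elim) e hp hj hp' hj' hγ

theorem appAt_act {S : C} (e : B.El S) (g : Sec G.G₁ S) {y : ∀ k, Sec (H k).G₀ S}
    {x x' : Sec G.G₀ S} (hp : B.p e = y) (hj : B.j e = x) (hp' : B.p (B.act e g) = y)
    (hj' : B.j (B.act e g) = x') (hx : x' = x * G.bd g) :
    πG.vert x x' g hx ≫ c.appAt (B.act e g) hp' hj' = c.appAt e hp hj := by
  subst hp hj hj'
  have h := c.app_act e g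
  rw [appAt, πG.ident_self, Category.id_comp, reassoc_of% h, F.ident_comp_ident, F.ident_self,
    Category.comp_id, appAt_rfl]

theorem appAt_arr {T S : C} {r : T ⟶ S} {e' : B.El T} {e : B.El S} {γ : ∀ k, Sec (H k).G₁ T}
    {g : Sec G.G₁ T} (a : B.IsArr r e' e γ g) {y' : ∀ k, Sec (H k).G₀ T}
    {y : ∀ k, Sec (H k).G₀ S} {x' : Sec G.G₀ T} {x : Sec G.G₀ S} (hp' : B.p e' = y')
    (hj' : B.j e' = x') (hp : B.p e = y) (hj : B.j e = x) (hx : res G.G₀ r x = x' * G.bd g)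
    (hy : ∀ k, res (H k).G₀ r (y k) = y' k * (H k).bd (γ k)) :
    𝓖.gr.fib.post (πG.map r x' x g hx) (c.appAt e hp hj) =
      𝓖.gr.fib.pre (c.appAt e' hp' hj') (F.mapP πH r y' y γ hy) := by
  subst hp hj hp' hj'
  have e₁ : res G.G₀ r (B.j e) = B.j (B.E.map r.op e) := (B.j_res r e).symm
  have e₂ : ∀ k, res (H k).G₀ r (B.p e k) = B.p (B.E.map r.op e) k := fun k => (B.p_res r e k).symm
  have e₃ : B.j (B.E.map r.op e) = B.j e' * G.bd g := by rw [← e₁, hx]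
  have e₄ : ∀ k, B.p (B.E.map r.op e) k = B.p e' k * (H k).bd (γ k) := fun k => by rw [← e₂, hy]
  have h₁ : πG.map r (B.j e') (B.j e) g hx =
      𝓖.gr.fib.pre (πG.vert (B.j e') (B.j (B.E.map r.op e)) g e₃)
        (πG.cart r (B.j (B.E.map r.op e)) (B.j e) e₁) :=
    (πG.comp_map _ (by rw [map_one, mul_one]) _).symm
  have h₂ : F.mapP πH r (B.p e') (B.p e) γ hy =
      𝓖.gr.fib.pre (F.mapV πH (B.p e') (B.p (B.E.map r.op e)) γ e₄)
        (F.map fun k => (πH k).cart r (B.p (B.E.map r.op e) k) (B.p e k) (e₂ k)) :=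
    (F.comp_mapP πH (γ' := fun _ => 1) _ (fun k => by rw [map_one, mul_one]) _).symm
  have p₁ : B.p (B.transport γ e') = B.p (B.E.map r.op e) := by
    funext k
    rw [B.p_transport, e₄]
  have p₂ : B.p (B.act (B.transport γ e') g) = B.p (B.E.map r.op e) := by rw [B.p_act, p₁]
  have h₃ : πG.vert (B.j e') (B.j (B.E.map r.op e)) g e₃ ≫ c.app (B.E.map r.op e) =
      c.app e' ≫ F.mapV πH (B.p e') (B.p (B.E.map r.op e)) γ e₄ := by
    rw [← c.appAt_rfl e', c.appAt_transport γ e' rfl rfl p₁ (B.j_transport γ e'),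
      ← c.appAt_act _ g p₁ (B.j_transport γ e') p₂ (by rw [B.j_act, B.j_transport, e₃]) e₃,
      ← c.appAt_rfl, c.appAt_congr a rfl rfl p₂]
  rw [h₁, h₂, 𝓖.gr.fib.pre_post, appAt_rfl, appAt_rfl, c.app_res, ← 𝓖.gr.fib.comp_pre, h₃,
    𝓖.gr.fib.comp_pre]

end Comparison

/-! ## Charts of the values of an additive functor -/

section Points

variable {C : Type u} [Category.{v} C] {J : GrothendieckTopology C} {n : ℕ}
  {H : Fin n → CrossedModule.{w} J} {G : BraidedCrossedModule.{w} J}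
  {𝓗 : Fin n → GrStack.{o₁, h₁} J} {𝓖 : BraidedGrStack.{o₂, h} J}
  (πH : ∀ k, Presentation (H k) (𝓗 k)) (πG : BraidedPresentation G 𝓖)
  (B : NButterfly H G)

/-- A chart at the tuple `X`, over `f`: a tuple `y` of sections of the `(H k)₀` with a morphism
`π y ⟶ X` over `f` and a point of the butterfly over `y`. -/
structure Pt {T S : C} (X : ∀ k, (𝓗 k).fib.Ob S) (f : T ⟶ S) where
  y : ∀ k, Sec (H k).G₀ T
  a : ∀ k, (𝓗 k).fib.Hom f ((πH k).obj (y k)) (X k)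
  e : B.El T
  he : B.p e = y

variable {πH B}

/-- The image of a chart under a morphism of tuples. -/
abbrev Pt.push {T S S' : C} {X : ∀ k, (𝓗 k).fib.Ob S} {X' : ∀ k, (𝓗 k).fib.Ob S'} {f : T ⟶ S}
    {s : S ⟶ S'} {f' : T ⟶ S'} (q : Pt πH B X f) (Φ : ∀ k, (𝓗 k).fib.Hom s (X k) (X' k))
    (w : f ≫ s = f') : Pt πH B X' f' :=
  ⟨q.y, fun k => (𝓗 k).fib.comp (q.a k) (Φ k) w, q.e, q.he⟩

/-- `(γ, g)` is a morphism of charts over `r`. -/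
structure Pt.IsArr {T' T S : C} {X : ∀ k, (𝓗 k).fib.Ob S} {f : T ⟶ S} {f' : T' ⟶ S}
    (r : T' ⟶ T) (w : r ≫ f = f') (q' : Pt πH B X f') (q : Pt πH B X f)
    (γ : ∀ k, Sec (H k).G₁ T') (g : Sec G.G₁ T') : Prop where
  arr : B.IsArr r q'.e q.e γ g
  comp : ∀ k h, (𝓗 k).fib.comp ((πH k).map r (q'.y k) (q.y k) (γ k) h) (q.a k) w = q'.a k

theorem Pt.IsArr.y_eq {T' T S : C} {X : ∀ k, (𝓗 k).fib.Ob S} {f : T ⟶ S} {f' : T' ⟶ S}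
    {r : T' ⟶ T} {w : r ≫ f = f'} {q' : Pt πH B X f'} {q : Pt πH B X f}
    {γ : ∀ k, Sec (H k).G₁ T'} {g : Sec G.G₁ T'} (a : Pt.IsArr r w q' q γ g) (k : Fin n) :
    res (H k).G₀ r (q.y k) = q'.y k * (H k).bd (γ k) := by
  rw [← q.he, ← q'.he, a.arr.p_eq]

theorem Pt.exists_isArr {T' T S : C} {X : ∀ k, (𝓗 k).fib.Ob S} {f : T ⟶ S} {f' : T' ⟶ S}
    (r : T' ⟶ T) (w : r ≫ f = f') (q' : Pt πH B X f') (q : Pt πH B X f) :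
    ∃ γ g, Pt.IsArr r w q' q γ g := by
  choose φ hφ using fun k => ((𝓗 k).fib.cartesian (q.a k) (q'.a k) w).exists
  choose γ hγ hγ' using fun k => (πH k).exists_map (φ k)
  obtain ⟨g, hg⟩ := NButterfly.IsArr.exists_of (r := r) q'.e q.e (γ := γ)
    (fun k => by rw [q.he, q'.he, hγ])
  exact ⟨γ, g, hg, fun k h => by rw [hγ', hφ]⟩

theorem Pt.IsArr.unique {T' T S : C} {X : ∀ k, (𝓗 k).fib.Ob S} {f : T ⟶ S} {f' : T' ⟶ S}
    {r : T' ⟶ T} {w : r ≫ f = f'} {q' : Pt πH B X f'} {q : Pt πH B X f}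
    {γ γ' : ∀ k, Sec (H k).G₁ T'} {g g' : Sec G.G₁ T'} (a : Pt.IsArr r w q' q γ g)
    (a' : Pt.IsArr r w q' q γ' g') : γ = γ' ∧ g = g' := by
  obtain rfl : γ = γ' := funext fun k => (πH k).map_inj (FibGpd.comp_cancel
    ((a.comp k (a.y_eq k)).trans (a'.comp k (a'.y_eq k)).symm))
  exact ⟨rfl, a.arr.unique a'.arr⟩

/-- The chart `q''` is the product of the charts `q` and `q'` in the variable `i`. -/
structure PtMul {T S : C} {x y z : ∀ k, (𝓗 k).fib.Ob S} {f : T ⟶ S} (i : Fin n)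
    (q : Pt πH B x f) (q' : Pt πH B y f) (q'' : Pt πH B z f) : Prop where
  agree : AgreeOff i (B.p q.e) (B.p q'.e)
  e_eq : q''.e = B.mul i q.e q'.e agree
  left : ∀ k, k ≠ i → HEq (q.a k) (q''.a k)
  right : ∀ k, k ≠ i → HEq (q'.a k) (q''.a k)
  prod : ∀ h : q.y i * q'.y i = q''.y i,
    HEq ((𝓗 i).fib.pre ((πH i).mu (q.y i) (q'.y i) ≫ (πH i).ident _ _ h) (q''.a i))
      ((𝓗 i).tens (q.a i) (q'.a i))

namespace PtMul

variable {T S : C} {x y z : ∀ k, (𝓗 k).fib.Ob S} {f : T ⟶ S} {i : Fin n}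
  {q : Pt πH B x f} {q' : Pt πH B y f} {q'' : Pt πH B z f}

theorem agree_y (h : PtMul i q q' q'') : AgreeOff i q.y q'.y := by
  rw [← q.he, ← q'.he]
  exact h.agree

theorem y_self (h : PtMul i q q' q'') : q.y i * q'.y i = q''.y i := by
  rw [← q''.he, h.e_eq, B.p_mul, Function.update_self, ← q.he, ← q'.he]

theorem y_left (h : PtMul i q q' q'') (k : Fin n) (hk : k ≠ i) : q.y k = q''.y k := by
  rw [← q''.he, h.e_eq, B.p_mul, Function.update_of_ne hk, ← q.he]

theorem y_right (h : PtMul i q q' q'') (k : Fin n) (hk : k ≠ i) : q'.y k = q''.y k := by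
  rw [← h.y_left k hk, h.agree_y k hk]

theorem j_eq (h : PtMul i q q' q'') : B.j q.e * B.j q'.e = B.j q''.e := by
  rw [h.e_eq, B.j_mul]

end PtMul

theorem pre_mu_heq {T S : C} {f : T ⟶ S} {i : Fin n} {b c d : Sec (H i).G₀ T}
    {X Z : (𝓗 i).fib.Ob S} (hZ : Z = X) (h : b * c = d)
    {t : (𝓗 i).fib.Hom f ((πH i).obj b ⊗ (πH i).obj c) X} {a : (𝓗 i).fib.Hom f ((πH i).obj d) Z}
    (ha : HEq a ((𝓗 i).fib.pre (inv ((πH i).mu b c)) t)) :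
    HEq ((𝓗 i).fib.pre ((πH i).mu b c ≫ (πH i).ident _ _ h) a) t := by
  subst h hZ
  obtain rfl := eq_of_heq ha
  rw [(πH i).ident_self, Category.comp_id, ← FibGpd.comp_pre, IsIso.hom_inv_id, FibGpd.id_pre]

theorem exists_ptMul {T S : C} {x y z : ∀ k, (𝓗 k).fib.Ob S} {f : T ⟶ S} {i : Fin n}
    (P : ProdAt 𝓗 i x y z) (q : Pt πH B x f) (q' : Pt πH B y f) (hy : AgreeOff i q.y q'.y)
    (ha : ∀ k, k ≠ i → HEq (q.a k) (q'.a k)) : ∃ q'' : Pt πH B z f, PtMul i q q' q'' := by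
  have agree : AgreeOff i (B.p q.e) (B.p q'.e) := by rwa [q.he, q'.he]
  obtain ⟨b, hb⟩ := FibGpd.exists_heq (𝓧 := (𝓗 i).fib) (x' := (πH i).obj
      (Function.update q.y i (q.y i * q'.y i) i)) (y' := z i) (by rw [Function.update_self]) P.prod
    ((𝓗 i).fib.pre (inv ((πH i).mu (q.y i) (q'.y i))) ((𝓗 i).tens (q.a i) (q'.a i)))
  choose c hc using fun k (hk : k ≠ i) => FibGpd.exists_heq (𝓧 := (𝓗 k).fib) (x' := (πH k).obj
      (Function.update q.y i (q.y i * q'.y i) k)) (y' := z k) (by rw [Function.update_of_ne hk])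
    (P.left k hk).symm (q.a k)
  obtain ⟨a, ha₁, ha₂⟩ := exists_tuple i b c
  refine ⟨⟨_, a, B.mul i q.e q'.e agree, ?_⟩, agree, rfl, fun k hk => ?_, fun k hk => ?_,
    fun h => ?_⟩
  · rw [B.p_mul, q.he, q'.he]
  · exact (hc k hk).symm.trans (heq_of_eq (ha₂ k hk).symm)
  · exact ((ha k hk).symm.trans (hc k hk).symm).trans (heq_of_eq (ha₂ k hk).symm)
  · exact pre_mu_heq P.prod h ((heq_of_eq ha₁).trans hb)

/-- A chart over the restriction of a tuple of sections. -/
def Pt.ofRes {R T S : C} {X : ∀ k, (𝓗 k).fib.Ob S} {f : T ⟶ S} (y : ∀ k, Sec (H k).G₀ T)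
    (a : ∀ k, (𝓗 k).fib.Hom f ((πH k).obj (y k)) (X k)) (r : R ⟶ T) (e : B.El R)
    (he : B.p e = fun k => res (H k).G₀ r (y k)) : Pt πH B X (r ≫ f) :=
  ⟨_, fun k => (𝓗 k).fib.comp ((πH k).cart r _ (y k) rfl) (a k) rfl, e, he⟩

theorem cart_comp_heq {R T S : C} {f : T ⟶ S} {k : Fin n} (r : R ⟶ T) {b b' : Sec (H k).G₀ T}
    {X X' : (𝓗 k).fib.Ob S} (hb : b = b') (hX : X = X') {a : (𝓗 k).fib.Hom f ((πH k).obj b) X}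
    {a' : (𝓗 k).fib.Hom f ((πH k).obj b') X'} (ha : HEq a a') :
    HEq ((𝓗 k).fib.comp ((πH k).cart r _ b rfl) a rfl)
      ((𝓗 k).fib.comp ((πH k).cart r _ b' rfl) a' rfl) := by
  subst hb hX ha
  rfl

variable (πH B)

theorem loc_exists_tuple {S : C} (X : ∀ k, (𝓗 k).fib.Ob S) : Loc J S fun T f =>
    ∃ y : ∀ k, Sec (H k).G₀ T, Nonempty (∀ k, (𝓗 k).fib.Hom f ((πH k).obj (y k)) (X k)) := by
  refine (Loc.forall_fin fun k => (πH k).locally_surjective (X k)).mono fun T f h => ?_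
  choose y a using h
  exact ⟨y, ⟨fun k => (a k).some⟩⟩

theorem loc_pt {S : C} (X : ∀ k, (𝓗 k).fib.Ob S) :
    Loc J S fun _ f => Nonempty (Pt πH B X f) := by
  refine (loc_exists_tuple πH X).bind fun T f ⟨y, ⟨a⟩⟩ => ?_
  exact Loc.mono (B.locally_nonempty y) fun R r ⟨e, he⟩ => ⟨Pt.ofRes y a r e he⟩

variable {πH B}

theorem exists_update {T S : C} {f : T ⟶ S} {i : Fin n} {X X' : ∀ k, (𝓗 k).fib.Ob S}
    (hX : ∀ k, k ≠ i → X' k = X k) {y : ∀ k, Sec (H k).G₀ T}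
    (a : ∀ k, (𝓗 k).fib.Hom f ((πH k).obj (y k)) (X k)) {b : Sec (H i).G₀ T}
    (c : (𝓗 i).fib.Hom f ((πH i).obj b) (X' i)) :
    ∃ (y' : ∀ k, Sec (H k).G₀ T) (a' : ∀ k, (𝓗 k).fib.Hom f ((πH k).obj (y' k)) (X' k)),
      y' i = b ∧ (∀ k, k ≠ i → y' k = y k) ∧ HEq (a' i) c ∧ ∀ k, k ≠ i → HEq (a' k) (a k) := by
  obtain ⟨y', rfl, hy'⟩ := exists_tuple i b fun k _ => y k
  choose d hd using fun k (hk : k ≠ i) => FibGpd.exists_heq (𝓧 := (𝓗 k).fib)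
    (x' := (πH k).obj (y' k)) (y' := X' k) (by rw [hy' k hk]) (hX k hk) (a k)
  obtain ⟨a', ha₁, ha₂⟩ := exists_tuple i c d
  refine ⟨y', a', rfl, hy', ?_, fun k hk => ?_⟩
  · rw [ha₁]
  · rw [ha₂ k hk]
    exact hd k hk

theorem loc_ptMul {S : C} {i : Fin n} {x y z : ∀ k, (𝓗 k).fib.Ob S} (P : ProdAt 𝓗 i x y z) :
    Loc J S fun _ f => ∃ (q : Pt πH B x f) (q' : Pt πH B y f) (q'' : Pt πH B z f),
      PtMul i q q' q'' := by
  have hX : ∀ k, k ≠ i → y k = x k := fun k hk => (P.right k hk).trans (P.left k hk).symm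
  refine ((loc_exists_tuple πH x).and (loc_exists_tuple πH y)).bind ?_
  rintro T f ⟨⟨y₁, ⟨a₁⟩⟩, ⟨y₀, ⟨a₀⟩⟩⟩
  obtain ⟨y₂, a₂, h₁, h₂, h₃, h₄⟩ := exists_update hX a₁ (a₀ i)
  refine (Loc.and (B.locally_nonempty y₁) (B.locally_nonempty y₂)).mono ?_
  rintro R r ⟨⟨e₁, he₁⟩, ⟨e₂, he₂⟩⟩
  obtain ⟨q, hq⟩ := exists_ptMul P (Pt.ofRes y₁ a₁ r e₁ he₁) (Pt.ofRes y₂ a₂ r e₂ he₂)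
    (fun k hk => congrArg _ (h₂ k hk).symm)
    (fun k hk => cart_comp_heq r (h₂ k hk).symm (hX k hk).symm (h₄ k hk).symm)
  exact ⟨_, _, q, hq⟩

theorem hom_ext_of_pt {S S' : C} {g : S ⟶ S'} {X : ∀ k, (𝓗 k).fib.Ob S} {Z : 𝓖.gr.fib.Ob S}
    {W : 𝓖.gr.fib.Ob S'}
    (θ : ∀ {T : C} {f : T ⟶ S} (q : Pt πH B X f), 𝓖.gr.fib.Hom f (πG.obj (B.j q.e)) Z)
    {k k' : 𝓖.gr.fib.Hom g Z W} (h : ∀ {T : C} {f : T ⟶ S} (q : Pt πH B X f),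
      𝓖.gr.fib.comp (θ q) k rfl = 𝓖.gr.fib.comp (θ q) k' rfl) : k = k' :=
  𝓖.gr.isStack.hom_ext ((loc_pt πH B X).mono fun _ _ ⟨q⟩ => ⟨_, θ q, h q⟩)

end Points

/-! ## The universal property of a comparison -/

theorem FibGpd.IsStack.fiber_hom_ext {C : Type u} [Category.{v} C] {𝓧 : FibGpd.{o, h} C}
    {J : GrothendieckTopology C} (hst : 𝓧.IsStack J) {S : C} {Z W : 𝓧.Ob S} {k k' : Z ⟶ W}
    (e : Loc J S fun T f => ∃ (P : 𝓧.Ob T) (θ : 𝓧.Hom f P Z), 𝓧.post θ k = 𝓧.post θ k') : k = k' :=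
  hst.hom_ext (e.mono fun _ _ ⟨P, θ, h⟩ => ⟨P, θ, comp_eq_comp h⟩)

theorem GrStack.tens_pre {C : Type u} [Category.{v} C] {J : GrothendieckTopology C}
    {𝓧 : GrStack.{o, h} J} {S T : C} {f : S ⟶ T} {x x' y y' : 𝓧.fib.Ob S} {z z' : 𝓧.fib.Ob T}
    (a : x ⟶ y) (φ : 𝓧.fib.Hom f y z) (b : x' ⟶ y') (ψ : 𝓧.fib.Hom f y' z') :
    𝓧.tens (𝓧.fib.pre a φ) (𝓧.fib.pre b ψ) = 𝓧.fib.pre (a ⊗ₘ b) (𝓧.tens φ ψ) := by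
  rw [← 𝓧.tens_fiber]
  exact 𝓧.tens_comp _ _ _ _ _

theorem GrStack.tens_post {C : Type u} [Category.{v} C] {J : GrothendieckTopology C}
    {𝓧 : GrStack.{o, h} J} {S T : C} {f : S ⟶ T} {x x' : 𝓧.fib.Ob S} {y y' z z' : 𝓧.fib.Ob T}
    (φ : 𝓧.fib.Hom f x y) (a : y ⟶ z) (ψ : 𝓧.fib.Hom f x' y') (b : y' ⟶ z') :
    𝓧.tens (𝓧.fib.post φ a) (𝓧.fib.post ψ b) = 𝓧.fib.post (𝓧.tens φ ψ) (a ⊗ₘ b) := by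
  rw [← 𝓧.tens_fiber]
  exact 𝓧.tens_comp _ _ _ _ _

namespace NAdditive

variable {C : Type u} [Category.{v} C] {J : GrothendieckTopology C} {n : ℕ}
  {𝓗 : Fin n → GrStack.{o₁, h₁} J} {𝓖 : BraidedGrStack.{o₂, h} J}

/-- A natural transformation that is compatible with the additivity isomorphisms is compatible with
the unit isomorphisms. -/
theorem app_eps_of_app_lam {F F' : NAdditive 𝓗 𝓖}
    (app : ∀ {S : C} (x : ∀ k, (𝓗 k).fib.Ob S), F.obj x ⟶ F'.obj x)
    (naturality : ∀ {S : C} {x y : ∀ k, (𝓗 k).fib.Ob S} (φ : ∀ k, x k ⟶ y k),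
      F.mapF φ ≫ app y = app x ≫ F'.mapF φ)
    (app_lam : ∀ {S : C} (i : Fin n) (x y z : ∀ k, (𝓗 k).fib.Ob S) (e : ProdAt 𝓗 i x y z),
      F.lam i x y z e ≫ app z = (app x ⊗ₘ app y) ≫ F'.lam i x y z e)
    {S : C} (i : Fin n) (x : ∀ k, (𝓗 k).fib.Ob S) (e : x i = 𝟙_ ((𝓗 i).fib.Ob S)) :
    app x ≫ F'.eps i x e = F.eps i x e := by
  obtain ⟨z, P⟩ := exists_prodAt 𝓗 i (x := x) (y := x) fun _ _ => rfl
  obtain ⟨b, hb⟩ := FibGpd.exists_heq (𝓧 := (𝓗 i).fib) (x' := z i) (y' := x i)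
    (by rw [P.prod, e]) rfl (λ_ (x i)).hom
  choose c hc using fun k (hk : k ≠ i) => FibGpd.exists_heq (𝓧 := (𝓗 k).fib) (x' := z k)
    (y' := x k) (P.left k hk).symm rfl (𝟙 (x k))
  obtain ⟨L, rfl, hL⟩ := exists_tuple i b c
  have h₁ := F.left_unit i x x z e P L (fun k hk => by rw [hL k hk]; exact hc k hk) hb
  have h₂ := F'.left_unit i x x z e P L (fun k hk => by rw [hL k hk]; exact hc k hk) hb
  have h₃ : F.lam i x x z P ≫ F.mapF L ≫ app x =
      (app x ⊗ₘ app x) ≫ F'.lam i x x z P ≫ F'.mapF L := by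
    rw [naturality, reassoc_of% app_lam]
  change F.lam i x x z P ≫ F.mapF L = _ at h₁
  change F'.lam i x x z P ≫ F'.mapF L = _ at h₂
  have h₄ : (app x ⊗ₘ app x) ≫ (F'.eps i x e ▷ F'.obj x) ≫ (λ_ (F'.obj x)).hom =
      ((app x ≫ F'.eps i x e) ▷ F.obj x) ≫ (λ_ (F.obj x)).hom ≫ app x := by
    rw [tensorHom_def'_assoc, ← comp_whiskerRight_assoc, whisker_exchange_assoc,
      leftUnitor_naturality]
  rw [reassoc_of% h₁, h₂, h₄, cancel_mono] at h₃
  have := 𝓖.gr.translation_right (F.obj x)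
  exact (tensorRight (F.obj x)).map_injective h₃.symm

end NAdditive

section Universal

variable {C : Type u} [Category.{v} C] {J : GrothendieckTopology C} {n : ℕ}
  {H : Fin n → CrossedModule.{w} J} {G : BraidedCrossedModule.{w} J}
  {𝓗 : Fin n → GrStack.{o₁, h₁} J} {𝓖 : BraidedGrStack.{o₂, h} J}
  {πH : ∀ k, Presentation (H k) (𝓗 k)} {πG : BraidedPresentation G 𝓖}
  {B : NButterfly H G} {F F' : NAdditive 𝓗 𝓖}

namespace Comparison

variable (c : Comparison πH πG B F)

/-- The chart of a value of `F` given by a comparison. -/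
def chart {T S : C} {X : ∀ k, (𝓗 k).fib.Ob S} {f : T ⟶ S} (q : Pt πH B X f) :
    𝓖.gr.fib.Hom f (πG.obj (B.j q.e)) (F.obj X) :=
  𝓖.gr.fib.pre (c.appAt q.e q.he rfl) (F.map q.a)

theorem chart_push {T S S' : C} {X : ∀ k, (𝓗 k).fib.Ob S} {X' : ∀ k, (𝓗 k).fib.Ob S'} {f : T ⟶ S}
    {s : S ⟶ S'} {f' : T ⟶ S'} (q : Pt πH B X f) (Φ : ∀ k, (𝓗 k).fib.Hom s (X k) (X' k))
    (w : f ≫ s = f') : 𝓖.gr.fib.comp (c.chart q) (F.map Φ) w = c.chart (q.push Φ w) := by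
  unfold chart FibGpd.pre
  rw [𝓖.gr.fib.assoc _ _ _ (Category.id_comp f) w w (Category.id_comp f'), ← F.map_comp]

theorem chart_arr {T' T S : C} {X : ∀ k, (𝓗 k).fib.Ob S} {f : T ⟶ S} {f' : T' ⟶ S}
    {r : T' ⟶ T} {w : r ≫ f = f'} {q' : Pt πH B X f'} {q : Pt πH B X f}
    {γ : ∀ k, Sec (H k).G₁ T'} {g : Sec G.G₁ T'} (a : Pt.IsArr r w q' q γ g) :
    𝓖.gr.fib.comp (πG.map r (B.j q'.e) (B.j q.e) g a.arr.j_eq) (c.chart q) w = c.chart q' := by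
  have h₁ := c.appAt_arr a.arr q'.he rfl q.he rfl a.arr.j_eq a.y_eq
  have h₂ : F.map q'.a = 𝓖.gr.fib.comp (F.mapP πH r q'.y q.y γ a.y_eq) (F.map q.a) w := by
    rw [NAdditive.mapP, ← F.map_comp]
    exact congrArg F.map (funext fun k => (a.comp k (a.y_eq k)).symm)
  unfold chart FibGpd.pre
  unfold FibGpd.post FibGpd.pre at h₁
  rw [h₂, ← 𝓖.gr.fib.assoc _ _ _ (Category.id_comp r) w w (Category.id_comp f'), ← h₁,
    𝓖.gr.fib.assoc _ _ _ (Category.comp_id r) w (Category.id_comp f) w]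

theorem chart_mul {T S : C} {i : Fin n} {x y z : ∀ k, (𝓗 k).fib.Ob S} (P : ProdAt 𝓗 i x y z)
    {f : T ⟶ S} {q : Pt πH B x f} {q' : Pt πH B y f} {q'' : Pt πH B z f} (h : PtMul i q q' q'') :
    𝓖.gr.fib.post (𝓖.gr.tens (c.chart q) (c.chart q')) (F.lam i x y z P) =
      𝓖.gr.fib.pre (πG.mu (B.j q.e) (B.j q'.e) ≫ πG.ident _ _ h.j_eq) (c.chart q'') := by
  obtain ⟨y₁, a₁, e₁, he₁⟩ := q
  obtain ⟨y₂, a₂, e₂, he₂⟩ := q'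
  obtain ⟨y₃, a₃, e₃, he₃⟩ := q''
  obtain ⟨agree, e_eq, left, right, prod⟩ := h
  dsimp only at agree e_eq left right prod ⊢
  subst he₁ he₂ he₃ e_eq
  have hp : ∀ k, k ≠ i → (πH k).obj (B.p e₁ k) =
      (πH k).obj (B.p (B.mul i e₁ e₂ agree) k) := fun k hk => by
    rw [B.p_mul, Function.update_of_ne hk]
  have hpi : B.p e₁ i * B.p e₂ i = B.p (B.mul i e₁ e₂ agree) i := by
    rw [B.p_mul, Function.update_self]
  obtain ⟨z₀, P₀⟩ := exists_prodAt 𝓗 i (x := fun k => (πH k).obj (B.p e₁ k))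
    (y := fun k => (πH k).obj (B.p e₂ k)) fun k hk => by rw [agree k hk]
  obtain ⟨b, hb⟩ := FibGpd.exists_heq (𝓧 := (𝓗 i).fib) (x' := z₀ i)
    (y' := (πH i).obj (B.p (B.mul i e₁ e₂ agree) i)) P₀.prod (by rw [hpi])
    ((πH i).mu (B.p e₁ i) (B.p e₂ i))
  choose c' hc' using fun k (hk : k ≠ i) => FibGpd.exists_heq (𝓧 := (𝓗 k).fib) (x' := z₀ k)
    (y' := (πH k).obj (B.p (B.mul i e₁ e₂ agree) k)) rfl ((hp k hk).symm.trans (P₀.left k hk))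
      (𝟙 (z₀ k))
  obtain ⟨m, hm, hm'⟩ := exists_tuple i b c'
  have hm₁ : ∀ k, k ≠ i → HEq (m k) (𝟙 (z₀ k)) := fun k hk => by
    rw [hm' k hk]
    exact hc' k hk
  have hm₂ : HEq (m i) ((πH i).mu (B.p e₁ i) (B.p e₂ i)) := by
    rw [hm]
    exact hb
  have h₁ := c.app_mul i e₁ e₂ agree z₀ P₀ m hm₁ hm₂
  have hχ : ∀ k, k ≠ i → HEq ((𝓗 k).fib.pre (m k) (a₃ k)) (a₃ k) := fun k hk =>
    FibGpd.pre_heq_of_id ((P₀.left k hk).symm.trans (hp k hk)) (hm₁ k hk) _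
  have h₂ := F.lam_naturality i _ _ z₀ x y z P₀ P a₁ a₂ (fun k => (𝓗 k).fib.pre (m k) (a₃ k))
    ⟨fun k hk => (left k hk).trans (hχ k hk).symm, fun k hk => (right k hk).trans (hχ k hk).symm, by
      refine HEq.trans ?_ (prod hpi)
      have : HEq (m i) ((πH i).mu (B.p e₁ i) (B.p e₂ i) ≫ (πH i).ident _ _ hpi) := by
        refine hm₂.trans ?_
        revert hpi
        generalize B.p (B.mul i e₁ e₂ agree) i = d
        rintro rfl
        rw [(πH i).ident_self, Category.comp_id]
      exact FibGpd.comp_heq P₀.prod rfl rfl this HEq.rfl _⟩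
  have h₃ : F.map (fun k => (𝓗 k).fib.pre (m k) (a₃ k)) =
      𝓖.gr.fib.pre (F.mapF m) (F.map a₃) := F.map_comp m a₃ _
  change (c.app e₁ ⊗ₘ c.app e₂) ≫ F.lam i _ _ z₀ P₀ ≫ F.mapF m = _ at h₁
  simp only [chart, appAt_rfl]
  rw [GrStack.tens_pre, FibGpd.pre_post, h₂, h₃, ← FibGpd.comp_pre, ← FibGpd.comp_pre,
    ← FibGpd.comp_pre, Category.assoc, h₁, Category.assoc]

theorem hom_unique (c : Comparison πH πG B F) {η η' : F ⟶ F'}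
    (h : ∀ {S : C} (e : B.El S), c.app e ≫ NAdditive.Hom.app η (fun k => (πH k).obj (B.p e k)) =
      c.app e ≫ NAdditive.Hom.app η' (fun k => (πH k).obj (B.p e k))) : η = η' := by
  refine NAdditive.hom_ext fun x => 𝓖.gr.isStack.fiber_hom_ext ((loc_pt πH B x).mono ?_)
  rintro T f ⟨y, a, e, rfl⟩
  refine ⟨_, c.chart ⟨_, a, e, rfl⟩, ?_⟩
  simp only [chart, appAt_rfl]
  rw [FibGpd.pre_post, FibGpd.pre_post, NAdditive.Hom.naturality, NAdditive.Hom.naturality,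
    ← FibGpd.comp_pre, ← FibGpd.comp_pre, h]

/-- Two comparisons with the same butterfly differ by a morphism of additive functors. -/
theorem exists_hom (c : Comparison πH πG B F) (c' : Comparison πH πG B F') :
    ∃ η : F ⟶ F', ∀ {S : C} (e : B.El S),
      c.app e ≫ NAdditive.Hom.app η (fun k => (πH k).obj (B.p e k)) = c'.app e := by
  have ex : ∀ {S : C} (X : ∀ k, (𝓗 k).fib.Ob S), ∃ η : F.obj X ⟶ F'.obj X,
      ∀ {T : C} {f : T ⟶ S} (q : Pt πH B X f), 𝓖.gr.fib.post (c.chart q) η = c'.chart q := by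
    intro S X
    obtain ⟨η, hη, -⟩ := 𝓖.gr.isStack.glue (𝟙 S) (F.obj X) (F'.obj X) (fun f => Pt πH B X f) _
      c.chart (fun {T f} q => 𝓖.gr.fib.comp (c'.chart q) (𝓖.gr.fib.id (F'.obj X)) rfl)
      (loc_pt πH B X) (by
        rintro T' T r f f' rfl q q'
        obtain ⟨γ, g, a⟩ := Pt.exists_isArr r rfl q' q
        refine ⟨_, c.chart_arr a, ?_⟩
        rw [← c'.chart_arr a]
        exact (𝓖.gr.fib.assoc _ _ _ _ _ _ _).symm)
    exact ⟨η, fun q => (FibGpd.comp_eq_comp (hη q)).trans (𝓖.gr.fib.comp_id _)⟩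
  choose η hη using @ex
  have nat : ∀ {S T : C} {s : S ⟶ T} {x : ∀ k, (𝓗 k).fib.Ob S} {y : ∀ k, (𝓗 k).fib.Ob T}
      (φ : ∀ k, (𝓗 k).fib.Hom s (x k) (y k)),
      𝓖.gr.fib.post (F.map φ) (η y) = 𝓖.gr.fib.pre (η x) (F'.map φ) := by
    intro S T s x y φ
    refine hom_ext_of_pt πG c.chart fun {R f} q => ?_
    refine (𝓖.gr.fib.assoc _ _ _ rfl (Category.comp_id _) (Category.comp_id _) rfl).symm.trans
      (Eq.trans ?_ (𝓖.gr.fib.assoc _ _ _ (Category.comp_id _) rfl (Category.id_comp _) rfl))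
    have h₁ := hη x q
    unfold FibGpd.post at h₁
    rw [h₁, c.chart_push, c'.chart_push]
    exact hη _ _
  have lam : ∀ {S : C} (i : Fin n) (x y z : ∀ k, (𝓗 k).fib.Ob S) (e : ProdAt 𝓗 i x y z),
      F.lam i x y z e ≫ η z = (η x ⊗ₘ η y) ≫ F'.lam i x y z e := by
    intro S i x y z P
    refine 𝓖.gr.isStack.fiber_hom_ext ((loc_ptMul (πH := πH) (B := B) P).mono ?_)
    rintro T f ⟨q, q', q'', h⟩
    refine ⟨_, 𝓖.gr.tens (c.chart q) (c.chart q'), ?_⟩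
    rw [FibGpd.post_comp, c.chart_mul P h, FibGpd.pre_post, hη, FibGpd.post_comp,
      ← GrStack.tens_post, hη, hη, c'.chart_mul P h]
  refine ⟨⟨η, nat, lam, NAdditive.app_eps_of_app_lam η (fun φ => nat φ) lam⟩, fun {S} e => ?_⟩
  have h := hη (fun k => (πH k).obj (B.p e k))
    (⟨B.p e, fun k => (𝓗 k).fib.id _, e, rfl⟩ : Pt πH B _ (𝟙 S))
  simp only [chart, appAt_rfl] at h
  rw [F.map_id, F'.map_id] at h
  have h₂ : (c.app e ≫ 𝟙 _) ≫ η _ = c'.app e ≫ 𝟙 _ := h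
  rwa [Category.comp_id, Category.comp_id] at h₂

end Comparison

end Universal

theorem FibGpd.post_heq_of_id {C : Type u} [Category.{v} C] {𝓧 : FibGpd.{o, h} C} {S T : C}
    {f : S ⟶ T} {x : 𝓧.Ob S} {z z' : 𝓧.Ob T} {a : z ⟶ z'} (hz : z = z') (ha : HEq a (𝟙 z))
    (φ : 𝓧.Hom f x z) : HEq (𝓧.post φ a) φ := by
  subst hz ha
  rw [post_id]

/-! ## Morphisms of tuples that are concentrated at one place -/

/-- The morphism `m` of tuples is `φ` at the place `i` and the identity elsewhere. -/
structure OnlyAt {C : Type u} [Category.{v} C] {J : GrothendieckTopology C} {n : ℕ}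
    {𝓗 : Fin n → GrStack.{o, h} J} {S : C} (i : Fin n) {x y : ∀ k, (𝓗 k).fib.Ob S}
    (m : ∀ k, x k ⟶ y k) {a b : (𝓗 i).fib.Ob S} (φ : a ⟶ b) : Prop where
  src : x i = a
  tgt : y i = b
  eq : HEq (m i) φ
  off_eq : ∀ k, k ≠ i → x k = y k
  off : ∀ k, k ≠ i → HEq (m k) (𝟙 (x k))

namespace OnlyAt

variable {C : Type u} [Category.{v} C] {J : GrothendieckTopology C} {n : ℕ}
  {𝓗 : Fin n → GrStack.{o, h} J} {S : C} {i : Fin n} {x y z : ∀ k, (𝓗 k).fib.Ob S}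
  {m : ∀ k, x k ⟶ y k} {m' : ∀ k, y k ⟶ z k} {a b c : (𝓗 i).fib.Ob S} {φ : a ⟶ b} {φ' : b ⟶ c}

theorem exists_of (i : Fin n) {x y : ∀ k, (𝓗 k).fib.Ob S} {a b : (𝓗 i).fib.Ob S} (φ : a ⟶ b)
    (hx : x i = a) (hy : y i = b) (h : ∀ k, k ≠ i → x k = y k) :
    ∃ m : ∀ k, x k ⟶ y k, OnlyAt i m φ := by
  obtain ⟨b, hb⟩ := FibGpd.exists_heq (𝓧 := (𝓗 i).fib) hx hy φ
  choose c hc using fun k (hk : k ≠ i) =>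
    FibGpd.exists_heq (𝓧 := (𝓗 k).fib) (x' := x k) (y' := y k) rfl (h k hk).symm (𝟙 (x k))
  obtain ⟨m, hm, hm'⟩ := exists_tuple i b c
  exact ⟨m, hx, hy, by rw [hm]; exact hb, h, fun k hk => by rw [hm' k hk]; exact hc k hk⟩

theorem unique (h : OnlyAt i m φ) {m' : ∀ k, x k ⟶ y k} (h' : OnlyAt i m' φ) : m = m' := by
  funext k
  rcases eq_or_ne k i with rfl | hk
  · exact eq_of_heq (h.eq.trans h'.eq.symm)
  · exact eq_of_heq ((h.off k hk).trans (h'.off k hk).symm)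

theorem comp (h : OnlyAt i m φ) (h' : OnlyAt i m' φ') :
    OnlyAt i (fun k => m k ≫ m' k) (φ ≫ φ') where
  src := h.src
  tgt := h'.tgt
  eq := FibGpd.comp_heq h.src h.tgt h'.tgt h.eq h'.eq _
  off_eq k hk := (h.off_eq k hk).trans (h'.off_eq k hk)
  off k hk := (FibGpd.pre_heq_of_id (h.off_eq k hk) (h.off k hk) (m' k)).trans
    ((h'.off k hk).trans (by rw [h.off_eq k hk]))

theorem congr_right {φ₁ : a ⟶ b} (h : OnlyAt i m φ) (e : φ = φ₁) : OnlyAt i m φ₁ := e ▸ h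

theorem off_heq {x' y' : ∀ k, (𝓗 k).fib.Ob S} {m' : ∀ k, x' k ⟶ y' k} {b' c' : (𝓗 i).fib.Ob S}
    {ψ : b' ⟶ c'} (h : OnlyAt i m φ) (h' : OnlyAt i m' ψ) {k : Fin n} (hk : k ≠ i)
    (hx : x k = x' k) : HEq (m k) (m' k) :=
  (h.off k hk).trans (HEq.trans (by rw [hx]) (h'.off k hk).symm)

/-- Tensor product at the same place. -/
theorem homProd {x' y' z z' : ∀ k, (𝓗 k).fib.Ob S} {m₁ : ∀ k, x k ⟶ x' k}
    {m₂ : ∀ k, y k ⟶ y' k} {m₃ : ∀ k, z k ⟶ z' k} {a b a' b' : (𝓗 i).fib.Ob S} {φ : a ⟶ a'}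
    {ψ : b ⟶ b'} (h₁ : OnlyAt i m₁ φ) (h₂ : OnlyAt i m₂ ψ) (h₃ : OnlyAt i m₃ (φ ⊗ₘ ψ))
    (P : ProdAt 𝓗 i x y z) : HomProdAt 𝓗 i m₁ m₂ m₃ where
  left _ hk := h₁.off_heq h₃ hk (P.left _ hk)
  right _ hk := h₂.off_heq h₃ hk (P.right _ hk)
  prod := h₃.eq.trans (by
    rw [← (𝓗 i).tens_fiber]
    exact (GrStack.tens_heq h₁.src h₁.tgt h₂.src h₂.tgt h₁.eq h₂.eq).symm)

theorem tens_id_heq {𝓧 : GrStack.{o, h} J} {S : C} {a b c d e f : 𝓧.fib.Ob S} {φ : a ⟶ b}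
    {ψ : c ⟶ d} {χ : e ⟶ f} (h₁ : a = b) (h₂ : c = d) (h₃ : e = f) (hφ : HEq φ (𝟙 a))
    (hψ : HEq ψ (𝟙 c)) (hχ : HEq χ (𝟙 e)) (h : e = a ⊗ c) : HEq χ (𝓧.tens φ ψ) := by
  subst h₁ h₂ h₃ hφ hψ hχ h
  have := 𝓧.tens_fiber (𝟙 a) (𝟙 c)
  rw [id_tensorHom_id] at this
  rw [this]

/-- Tensor product at another place. -/
theorem homProd_of_ne {k : Fin n} (hk : k ≠ i) {x' y' z z' : ∀ k, (𝓗 k).fib.Ob S}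
    {m₁ : ∀ k, x k ⟶ x' k} {m₂ : ∀ k, y k ⟶ y' k} {m₃ : ∀ k, z k ⟶ z' k}
    (h₁ : OnlyAt i m₁ φ) (h₂ : OnlyAt i m₂ φ) (h₃ : OnlyAt i m₃ φ)
    (P : ProdAt 𝓗 k x y z) : HomProdAt 𝓗 k m₁ m₂ m₃ where
  left l hl := by
    rcases eq_or_ne l i with rfl | hli
    · exact h₁.eq.trans h₃.eq.symm
    · exact h₁.off_heq h₃ hli (P.left l hl)
  right l hl := by
    rcases eq_or_ne l i with rfl | hli
    · exact h₂.eq.trans h₃.eq.symm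
    · exact h₂.off_heq h₃ hli (P.right l hl)
  prod := tens_id_heq (h₁.off_eq k hk) (h₂.off_eq k hk) (h₃.off_eq k hk) (h₁.off k hk)
    (h₂.off k hk) (h₃.off k hk) P.prod

end OnlyAt

/-! ## The additivity isomorphisms on tuples of sections -/

section LamV

variable {C : Type u} [Category.{v} C] {J : GrothendieckTopology C} {n : ℕ}
  {H : Fin n → CrossedModule.{w} J} {G : BraidedCrossedModule.{w} J}
  {𝓗 : Fin n → GrStack.{o₁, h₁} J} {𝓖 : BraidedGrStack.{o₂, h} J}

/-- The tuple `z` is the product of `x` and `y` in the variable `i`. -/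
structure MulAt {S : C} (i : Fin n) (x y z : ∀ k, Sec (H k).G₀ S) : Prop where
  left : ∀ k, k ≠ i → x k = z k
  right : ∀ k, k ≠ i → y k = z k
  prod : x i * y i = z i

theorem MulAt.agree {S : C} {i : Fin n} {x y z : ∀ k, Sec (H k).G₀ S} (h : MulAt i x y z) (k : Fin n)
    (hk : k ≠ i) : x k = y k :=
  (h.left k hk).trans (h.right k hk).symm

theorem MulAt.update {S : C} {i : Fin n} {x y : ∀ k, Sec (H k).G₀ S} (h : AgreeOff i x y) :
    MulAt i x y (Function.update x i (x i * y i)) where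
  left k hk := by rw [Function.update_of_ne hk]
  right k hk := by rw [Function.update_of_ne hk, h k hk]
  prod := by rw [Function.update_self]

theorem MulAt.eq_update {S : C} {i : Fin n} {x y z : ∀ k, Sec (H k).G₀ S} (h : MulAt i x y z) :
    Function.update x i (x i * y i) = z := by
  funext k
  rcases eq_or_ne k i with rfl | hk
  · rw [Function.update_self, h.prod]
  · rw [Function.update_of_ne hk, h.left k hk]

theorem ProdAt.unique {S : C} {i : Fin n} {x y z z' : ∀ k, (𝓗 k).fib.Ob S}
    (h : ProdAt 𝓗 i x y z) (h' : ProdAt 𝓗 i x y z') : z = z' := by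
  funext k
  rcases eq_or_ne k i with rfl | hk
  · exact h.prod.trans h'.prod.symm
  · exact (h.left k hk).symm.trans (h'.left k hk)

namespace NAdditive

variable (F : NAdditive 𝓗 𝓖) (πH : ∀ k, Presentation (H k) (𝓗 k))

theorem mul_obj_eq {S : C} {i : Fin n} {x y z : ∀ k, Sec (H k).G₀ S} (h : MulAt i x y z)
    {t : ∀ k, (𝓗 k).fib.Ob S}
    (P : ProdAt 𝓗 i (fun k => (πH k).obj (x k)) (fun k => (πH k).obj (y k)) t) (k : Fin n)
    (hk : k ≠ i) : t k = (πH k).obj (z k) := by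
  rw [← P.left k hk, h.left k hk]

theorem exists_lamV {S : C} {i : Fin n} {x y z : ∀ k, Sec (H k).G₀ S} (h : MulAt i x y z) :
    ∃ L : F.val πH x ⊗ F.val πH y ⟶ F.val πH z, ∀ (t : ∀ k, (𝓗 k).fib.Ob S)
      (P : ProdAt 𝓗 i (fun k => (πH k).obj (x k)) (fun k => (πH k).obj (y k)) t)
      (m : ∀ k, t k ⟶ (πH k).obj (z k)), OnlyAt i m ((πH i).mu (x i) (y i)) →
      F.lam i _ _ t P ≫ F.mapF m = L := by
  obtain ⟨t, P⟩ := exists_prodAt 𝓗 i (x := fun k => (πH k).obj (x k))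
    (y := fun k => (πH k).obj (y k)) fun k hk => by rw [h.agree k hk]
  obtain ⟨m, hm⟩ := OnlyAt.exists_of i ((πH i).mu (x i) (y i)) P.prod
    (y := fun k => (πH k).obj (z k)) (by rw [h.prod]) (mul_obj_eq πH h P)
  refine ⟨F.lam i _ _ t P ≫ F.mapF m, fun t' P' m' hm' => ?_⟩
  obtain rfl := P.unique P'
  rw [hm.unique hm']

/-- The additivity isomorphism `F (π x) ⊗ F (π y) ⟶ F (π z)` if `z` is the product of `x` and `y`
in the variable `i`. -/
noncomputable def lamV {S : C} (i : Fin n) (x y z : ∀ k, Sec (H k).G₀ S) (h : MulAt i x y z) :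
    F.val πH x ⊗ F.val πH y ⟶ F.val πH z :=
  (F.exists_lamV πH h).choose

theorem lamV_eq {S : C} {i : Fin n} {x y z : ∀ k, Sec (H k).G₀ S} (h : MulAt i x y z)
    {t : ∀ k, (𝓗 k).fib.Ob S}
    (P : ProdAt 𝓗 i (fun k => (πH k).obj (x k)) (fun k => (πH k).obj (y k)) t)
    {m : ∀ k, t k ⟶ (πH k).obj (z k)} (hm : OnlyAt i m ((πH i).mu (x i) (y i))) :
    F.lamV πH i x y z h = F.lam i _ _ t P ≫ F.mapF m :=
  ((F.exists_lamV πH h).choose_spec t P m hm).symm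

theorem exists_lamV_eq {S : C} {i : Fin n} {x y z : ∀ k, Sec (H k).G₀ S} (h : MulAt i x y z) :
    ∃ (t : ∀ k, (𝓗 k).fib.Ob S)
      (P : ProdAt 𝓗 i (fun k => (πH k).obj (x k)) (fun k => (πH k).obj (y k)) t)
      (m : ∀ k, t k ⟶ (πH k).obj (z k)), OnlyAt i m ((πH i).mu (x i) (y i)) ∧
      F.lamV πH i x y z h = F.lam i _ _ t P ≫ F.mapF m := by
  obtain ⟨t, P⟩ := exists_prodAt 𝓗 i (x := fun k => (πH k).obj (x k))
    (y := fun k => (πH k).obj (y k)) fun k hk => by rw [h.agree k hk]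
  obtain ⟨m, hm⟩ := OnlyAt.exists_of i ((πH i).mu (x i) (y i)) P.prod
    (y := fun k => (πH k).obj (z k)) (by rw [h.prod]) (mul_obj_eq πH h P)
  exact ⟨t, P, m, hm, F.lamV_eq πH h P hm⟩

theorem map_heq {T S : C} {f : T ⟶ S} {k : Fin n} {x x' : Sec (H k).G₀ T} {y y' : Sec (H k).G₀ S}
    {γ γ' : Sec (H k).G₁ T} (hx : x = x') (hy : y = y') (hγ : γ = γ') (h h') :
    HEq ((πH k).map f x y γ h) ((πH k).map f x' y' γ' h') := by
  subst hx hy hγ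
  rfl

theorem lamV_mapP {T S : C} {f : T ⟶ S} {i : Fin n} {x y z : ∀ k, Sec (H k).G₀ T}
    {x' y' z' : ∀ k, Sec (H k).G₀ S} (h : MulAt i x y z) (h' : MulAt i x' y' z')
    {α β γ : ∀ k, Sec (H k).G₁ T} (hα hβ hγ) (h₁ : ∀ k, k ≠ i → α k = γ k)
    (h₂ : ∀ k, k ≠ i → β k = γ k) (h₃ : γ i = (H i).act (α i) (y i) * β i) :
    𝓖.gr.fib.post (𝓖.gr.tens (F.mapP πH f x x' α hα) (F.mapP πH f y y' β hβ))
        (F.lamV πH i x' y' z' h') =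
      𝓖.gr.fib.pre (F.lamV πH i x y z h) (F.mapP πH f z z' γ hγ) := by
  obtain ⟨t, P, m, hm, e⟩ := F.exists_lamV_eq πH h
  obtain ⟨t', P', m', hm', e'⟩ := F.exists_lamV_eq πH h'
  obtain ⟨b, hb⟩ := FibGpd.exists_heq (𝓧 := (𝓗 i).fib) (x' := t i) (y' := t' i) P.prod P'.prod
    ((𝓗 i).tens ((πH i).map f (x i) (x' i) (α i) (hα i)) ((πH i).map f (y i) (y' i) (β i) (hβ i)))
  choose d hd using fun k (hk : k ≠ i) => FibGpd.exists_heq (𝓧 := (𝓗 k).fib) (x' := t k)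
    (y' := t' k) (P.left k hk).symm (P'.left k hk).symm
    ((πH k).map f (x k) (x' k) (α k) (hα k))
  obtain ⟨χ, hχ, hχ'⟩ := exists_tuple i b d
  have hP : HomProdAt 𝓗 i (fun k => (πH k).map f (x k) (x' k) (α k) (hα k))
      (fun k => (πH k).map f (y k) (y' k) (β k) (hβ k)) χ := by
    refine ⟨fun k hk => ?_, fun k hk => ?_, ?_⟩
    · rw [hχ' k hk]
      exact (hd k hk).symm
    · rw [hχ' k hk]
      exact (map_heq πH (h.agree k hk).symm (h'.agree k hk).symm
        ((h₂ k hk).trans (h₁ k hk).symm) _ _).trans (hd k hk).symm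
    · rw [hχ]
      exact hb
  have hn := F.lam_naturality i _ _ t _ _ t' P P' _ _ χ hP
  rw [e, e', FibGpd.post_comp]
  refine (congrArg (fun a => 𝓖.gr.fib.post a _) hn).trans ?_
  rw [FibGpd.pre_post, FibGpd.comp_pre]
  congr 1
  refine (F.map_comp χ m' _).symm.trans (Eq.trans (congrArg F.map (funext fun k => ?_))
    (F.map_comp m (fun k => (πH k).map f (z k) (z' k) (γ k) (hγ k)) _))
  rcases eq_or_ne k i with rfl | hk
  · have hz := h.prod
    have hz' := h'.prod
    have e₁ : res (H k).G₀ f (x' k * y' k) = x k * y k * (H k).bd ((H k).act (α k) (y k) * β k) := by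
      rw [hz', hz, hγ, h₃]
    have := (πH k).mu_naturality f (x k) (y k) (x' k) (y' k) (α k) (β k) (hα k) (hβ k) e₁
    refine eq_of_heq (HEq.trans (FibGpd.comp_heq P.prod P'.prod (by rw [hz'])
      (hP.prod) hm'.eq _) ((heq_of_eq this).trans ?_))
    exact FibGpd.comp_heq P.prod.symm (by rw [hz]) (by rw [hz']) hm.eq.symm
      (map_heq πH hz hz' h₃.symm _ _) _
  · refine eq_of_heq ((FibGpd.post_heq_of_id (hm'.off_eq k hk) (hm'.off k hk) (χ k)).trans
      (HEq.trans ?_ (FibGpd.pre_heq_of_id (hm.off_eq k hk) (hm.off k hk) _).symm))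
    exact (hP.left k hk).symm.trans (map_heq πH (h.left k hk) (h'.left k hk) (h₁ k hk) _ _)

theorem lam_naturality_fiber {S : C} {i : Fin n} {x y z x' y' z' : ∀ k, (𝓗 k).fib.Ob S}
    (P : ProdAt 𝓗 i x y z) (P' : ProdAt 𝓗 i x' y' z') {φ : ∀ k, x k ⟶ x' k} {ψ : ∀ k, y k ⟶ y' k}
    {χ : ∀ k, z k ⟶ z' k} (h : HomProdAt 𝓗 i φ ψ χ) :
    (F.mapF φ ⊗ₘ F.mapF ψ) ≫ F.lam i x' y' z' P' = F.lam i x y z P ≫ F.mapF χ := by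
  rw [← 𝓖.gr.tens_fiber]
  exact F.lam_naturality i x y z x' y' z' P P' φ ψ χ h

theorem mapF_id {S : C} (x : ∀ k, (𝓗 k).fib.Ob S) : F.mapF (fun k => 𝟙 (x k)) = 𝟙 (F.obj x) :=
  F.map_id x

theorem onlyAt_id {S : C} (i : Fin n) (x : ∀ k, (𝓗 k).fib.Ob S) :
    OnlyAt i (fun k => 𝟙 (x k)) (𝟙 (x i)) :=
  ⟨rfl, rfl, HEq.rfl, fun _ _ => rfl, fun _ _ => HEq.rfl⟩

theorem onlyAt_ident {S : C} {i : Fin n} {x y : ∀ k, (𝓗 k).fib.Ob S} {m : ∀ k, x k ⟶ y k}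
    {a : (𝓗 i).fib.Ob S} {u u' : Sec (H i).G₀ S} {φ : a ⟶ (πH i).obj u} (h : OnlyAt i m φ)
    (e : u = u') : OnlyAt i m (φ ≫ (πH i).ident u u' e) := by
  subst e
  rwa [(πH i).ident_self, Category.comp_id]

theorem lamV_assoc {S : C} {i : Fin n} {x y z xy yz t : ∀ k, Sec (H k).G₀ S}
    (h₁ : MulAt i x y xy) (h₂ : MulAt i xy z t) (h₃ : MulAt i y z yz) (h₄ : MulAt i x yz t) :
    (F.lamV πH i x y xy h₁ ▷ F.val πH z) ≫ F.lamV πH i xy z t h₂ =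
      (α_ (F.val πH x) (F.val πH y) (F.val πH z)).hom ≫ (F.val πH x ◁ F.lamV πH i y z yz h₃) ≫
        F.lamV πH i x yz t h₄ := by
  obtain ⟨t₁, P₁, m₁, hm₁, e₁⟩ := F.exists_lamV_eq πH h₁
  obtain ⟨t₂, P₂, m₂, hm₂, e₂⟩ := F.exists_lamV_eq πH h₂
  obtain ⟨t₃, P₃, m₃, hm₃, e₃⟩ := F.exists_lamV_eq πH h₃
  obtain ⟨t₄, P₄, m₄, hm₄, e₄⟩ := F.exists_lamV_eq πH h₄
  obtain ⟨l, Pl⟩ := exists_prodAt 𝓗 i (x := t₁) (y := fun k => (πH k).obj (z k)) fun k hk => by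
    rw [← P₁.left k hk, h₁.agree k hk, h₃.agree k hk]
  obtain ⟨r, Pr⟩ := exists_prodAt 𝓗 i (x := fun k => (πH k).obj (x k)) (y := t₃) fun k hk => by
    rw [← P₃.left k hk, h₁.agree k hk]
  obtain ⟨A, hA⟩ := OnlyAt.exists_of i (x := l) (y := r)
    (α_ ((πH i).obj (x i)) ((πH i).obj (y i)) ((πH i).obj (z i))).hom
    (by rw [Pl.prod, P₁.prod]) (by rw [Pr.prod, P₃.prod])
    (fun k hk => by rw [← Pl.left k hk, ← Pr.left k hk, P₁.left k hk])
  obtain ⟨n₁, hn₁⟩ := OnlyAt.exists_of i (x := l) (y := t₂)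
    ((πH i).mu (x i) (y i) ⊗ₘ 𝟙 ((πH i).obj (z i))) (by rw [Pl.prod, P₁.prod])
    (by rw [P₂.prod, h₁.prod]) (fun k hk => by rw [← Pl.right k hk, ← P₂.right k hk])
  obtain ⟨n₂, hn₂⟩ := OnlyAt.exists_of i (x := r) (y := t₄)
    (𝟙 ((πH i).obj (x i)) ⊗ₘ (πH i).mu (y i) (z i)) (by rw [Pr.prod, P₃.prod])
    (by rw [P₄.prod, h₃.prod]) (fun k hk => by rw [← Pr.left k hk, ← P₄.left k hk])
  have E₁ := F.lam_naturality_fiber Pl P₂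
    (hm₁.homProd (onlyAt_id i fun k => (πH k).obj (z k)) hn₁ Pl)
  have E₂ := F.lam_naturality_fiber Pr P₄
    ((onlyAt_id i fun k => (πH k).obj (x k)).homProd hm₃ hn₂ Pr)
  rw [F.mapF_id, tensorHom_id] at E₁
  rw [F.mapF_id, id_tensorHom] at E₂
  have E₃ := F.lam_assoc i _ _ _ _ _ l r P₁ Pl P₃ Pr A hA.off hA.eq
  change _ ≫ _ ≫ F.mapF A = _ at E₃
  have hmu := (πH i).mu_assoc (x i) (y i) (z i)
  rw [← h₁.prod] at hm₂
  rw [← h₃.prod] at hm₄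
  have E₄ : (fun k => n₁ k ≫ m₂ k) = fun k => A k ≫ n₂ k ≫ m₄ k := by
    refine (hn₁.comp (onlyAt_ident πH hm₂ (mul_assoc _ _ _))).unique
      ((hA.comp (hn₂.comp hm₄)).congr_right ?_)
    rw [tensorHom_id, id_tensorHom, hmu]
  rw [e₁, e₂, e₃, e₄, comp_whiskerRight, Category.assoc, reassoc_of% E₁, F.map_comp_fiber, E₄,
    whiskerLeft_comp, Category.assoc, reassoc_of% E₂, ← reassoc_of% E₃, F.map_comp_fiber,
    F.map_comp_fiber]

theorem lamV_interchange {S : C} {i k : Fin n} (hik : i < k)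
    {u u' v v' uu vv uv uv' t : ∀ k, Sec (H k).G₀ S}
    (h₁ : MulAt i u u' uu) (h₂ : MulAt i v v' vv) (h₃ : MulAt k uu vv t) (h₄ : MulAt k u v uv)
    (h₅ : MulAt k u' v' uv') (h₆ : MulAt i uv uv' t) :
    (F.lamV πH i u u' uu h₁ ⊗ₘ F.lamV πH i v v' vv h₂) ≫ F.lamV πH k uu vv t h₃ =
      tensorμ (F.val πH u) (F.val πH u') (F.val πH v) (F.val πH v') ≫
        (F.lamV πH k u v uv h₄ ⊗ₘ F.lamV πH k u' v' uv' h₅) ≫ F.lamV πH i uv uv' t h₆ := by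
  have hki : k ≠ i := hik.ne'
  obtain ⟨t₁, P₁, m₁, hm₁, e₁⟩ := F.exists_lamV_eq πH h₁
  obtain ⟨t₂, P₂, m₂, hm₂, e₂⟩ := F.exists_lamV_eq πH h₂
  obtain ⟨t₃, P₃, m₃, hm₃, e₃⟩ := F.exists_lamV_eq πH h₃
  obtain ⟨t₄, P₄, m₄, hm₄, e₄⟩ := F.exists_lamV_eq πH h₄
  obtain ⟨t₅, P₅, m₅, hm₅, e₅⟩ := F.exists_lamV_eq πH h₅
  obtain ⟨t₆, P₆, m₆, hm₆, e₆⟩ := F.exists_lamV_eq πH h₆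
  rw [← h₄.agree i hik.ne, ← h₅.agree i hik.ne] at hm₂
  rw [← h₁.agree k hki, ← h₂.agree k hki] at hm₅
  rw [← h₁.left k hki, ← h₂.left k hki] at hm₃
  rw [← h₄.left i hik.ne, ← h₅.left i hik.ne] at hm₆
  have a₁ : ∀ l, l ≠ k → t₁ l = t₂ l := fun l hl => by
    rcases eq_or_ne l i with rfl | hli
    · rw [P₁.prod, P₂.prod, h₄.agree l hl, h₅.agree l hl]
    · rw [← P₁.left l hli, ← P₂.left l hli, h₄.agree l hl]
  obtain ⟨s, Q⟩ := exists_prodAt 𝓗 k a₁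
  have Q' : ProdAt 𝓗 i t₄ t₅ s := by
    refine ⟨fun l hl => ?_, fun l hl => ?_, ?_⟩
    · rcases eq_or_ne l k with rfl | hlk
      · rw [P₄.prod, Q.prod, ← P₁.left l hl, ← P₂.left l hl]
      · rw [← P₄.left l hlk, ← Q.left l hlk, ← P₁.left l hl]
    · rcases eq_or_ne l k with rfl | hlk
      · rw [P₅.prod, Q.prod, ← P₁.right l hl, ← P₂.right l hl]
      · rw [← P₅.left l hlk, ← Q.left l hlk, ← P₁.right l hl]
    · rw [← Q.left i hik.ne, P₁.prod, ← P₄.left i hik.ne, ← P₅.left i hik.ne]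
  obtain ⟨n₁, hn₁⟩ := OnlyAt.exists_of i (x := s) (y := t₃) ((πH i).mu (u i) (u' i))
    (by rw [← Q.left i hik.ne, P₁.prod]) (by rw [← P₃.left i hik.ne, h₁.prod])
    (fun l hl => by
      rcases eq_or_ne l k with rfl | hlk
      · rw [Q.prod, P₃.prod, ← P₁.left l hl, ← P₂.left l hl, h₁.left l hl, h₂.left l hl]
      · rw [← Q.left l hlk, ← P₃.left l hlk, ← P₁.left l hl, h₁.left l hl])
  obtain ⟨n₂, hn₂⟩ := OnlyAt.exists_of k (x := s) (y := t₆) ((πH k).mu (u k) (v k))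
    (by rw [← Q'.left k hki, P₄.prod]) (by rw [← P₆.left k hki, h₄.prod])
    (fun l hl => by
      rcases eq_or_ne l i with rfl | hlk
      · rw [Q'.prod, P₆.prod, ← P₄.left l hl, ← P₅.left l hl, h₄.left l hl, h₅.left l hl]
      · rw [← Q'.left l hlk, ← P₆.left l hlk, ← P₄.left l hl, h₄.left l hl])
  have E₁ := F.lam_naturality_fiber Q P₃ (OnlyAt.homProd_of_ne hki hm₁ hm₂ hn₁ Q)
  have E₂ := F.lam_naturality_fiber Q' P₆ (OnlyAt.homProd_of_ne hki.symm hm₄ hm₅ hn₂ Q')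
  have E₃ := F.interchange i k hik _ _ _ _ _ _ _ _ s P₁ P₂ Q P₄ P₅ Q'
  have E₄ : (fun l => n₁ l ≫ m₃ l) = fun l => n₂ l ≫ m₆ l := by
    funext l
    by_cases hi : l = i
    · subst hi
      refine eq_of_heq ((FibGpd.post_heq_of_id (hm₃.off_eq l hki.symm) (hm₃.off l hki.symm) _).trans
        (HEq.trans ?_ (FibGpd.pre_heq_of_id (hn₂.off_eq l hki.symm) (hn₂.off l hki.symm) _).symm))
      exact hn₁.eq.trans hm₆.eq.symm
    · by_cases hk : l = k
      · subst hk
        refine eq_of_heq ((FibGpd.pre_heq_of_id (hn₁.off_eq l hi) (hn₁.off l hi) _).trans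
          (HEq.trans ?_ (FibGpd.post_heq_of_id (hm₆.off_eq l hi) (hm₆.off l hi) _).symm))
        exact hm₃.eq.trans hn₂.eq.symm
      · refine eq_of_heq ((FibGpd.pre_heq_of_id (hn₁.off_eq l hi) (hn₁.off l hi) _).trans
          (HEq.trans ?_ (FibGpd.pre_heq_of_id (hn₂.off_eq l hk) (hn₂.off l hk) _).symm))
        refine (hm₃.off l hk).trans (HEq.trans ?_ (hm₆.off l hi).symm)
        rw [← hn₁.off_eq l hi, ← hn₂.off_eq l hk]
  rw [e₁, e₂, e₃, e₄, e₅, e₆, ← tensorHom_comp_tensorHom, ← tensorHom_comp_tensorHom]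
  simp only [Category.assoc]
  rw [reassoc_of% E₁, reassoc_of% E₂, F.map_comp_fiber, F.map_comp_fiber, E₄, reassoc_of% E₃]

end NAdditive

end LamV

/-! ## The unit isomorphisms on tuples of sections -/

section TrivV

variable {C : Type u} [Category.{v} C] {J : GrothendieckTopology C} {n : ℕ}
  {H : Fin n → CrossedModule.{w} J} {G : BraidedCrossedModule.{w} J}
  {𝓗 : Fin n → GrStack.{o₁, h₁} J} {𝓖 : BraidedGrStack.{o₂, h} J}

namespace NAdditive

variable (F : NAdditive 𝓗 𝓖) (πH : ∀ k, Presentation (H k) (𝓗 k))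

/-- The morphism `I ⟶ π y` given by `h` with `y = ∂h`. -/
def unitVert {𝓧 : GrStack.{o, h} J} {K : CrossedModule.{w} J} (π : Presentation K 𝓧) {S : C}
    (y : Sec K.G₀ S) (h : Sec K.G₁ S) (hy : y = K.bd h) : 𝟙_ (𝓧.fib.Ob S) ⟶ π.obj y :=
  π.eta S ≫ π.vert 1 y h (by rw [one_mul, hy])

theorem unitVert_comp_vert {𝓧 : GrStack.{o, h} J} {K : CrossedModule.{w} J} (π : Presentation K 𝓧)
    {T S : C} {f : T ⟶ S} {y : Sec K.G₀ T} {y' : Sec K.G₀ S} {k : Sec K.G₁ T} {k' : Sec K.G₁ S}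
    {γ : Sec K.G₁ T} (hy : y = K.bd k) (hy' : y' = K.bd k') (hγ : res K.G₀ f y' = y * K.bd γ)
    (e : res K.G₁ f k' = k * γ) :
    𝓧.fib.post (𝓧.unitMap f) (unitVert π y' k' hy') =
      𝓧.fib.pre (unitVert π y k hy) (π.map f y y' γ hγ) := by
  have e₁ : res K.G₀ f y' = 1 * K.bd (k * γ) := by rw [hγ, map_mul, hy, one_mul]
  have h₁ : 𝓧.fib.post (π.cart f 1 1 (map_one _)) (π.vert 1 y' k' (by rw [one_mul, hy'])) =
      π.map f 1 y' (k * γ) e₁ := π.comp_map _ (by rw [e, one_mul]) _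
  have h₂ : 𝓧.fib.pre (π.vert 1 y k (by rw [one_mul, hy])) (π.map f y y' γ hγ) =
      π.map f 1 y' (k * γ) e₁ := π.comp_map _ (by rw [res_id]) _
  rw [unitVert, unitVert, FibGpd.post_comp, π.eta_naturality, FibGpd.pre_post, h₁,
    FibGpd.comp_pre, h₂]

theorem unitVert_mu {𝓧 : GrStack.{o, h} J} {K : CrossedModule.{w} J} (π : Presentation K 𝓧)
    {S : C} {x y : Sec K.G₀ S} {k : Sec K.G₁ S} (hx : x = K.bd k)
    (e : x * y = y * K.bd (K.act k y)) :
    (unitVert π x k hx ▷ π.obj y) ≫ π.mu x y = (λ_ _).hom ≫ π.vert y (x * y) (K.act k y) e := by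
  rw [unitVert, comp_whiskerRight, Category.assoc, π.whiskerRight_mu _ _ (by rw [e, one_mul]),
    ← π.left_unit, Category.assoc, Category.assoc, π.ident_comp_vert]

theorem mu_unitVert {𝓧 : GrStack.{o, h} J} {K : CrossedModule.{w} J} (π : Presentation K 𝓧)
    {S : C} {x y : Sec K.G₀ S} {k : Sec K.G₁ S} (hx : x = K.bd k) (e : y * x = y * K.bd k) :
    (π.obj y ◁ unitVert π x k hx) ≫ π.mu y x = (ρ_ _).hom ≫ π.vert y (y * x) k e := by
  rw [unitVert, whiskerLeft_comp, Category.assoc, π.whiskerLeft_mu _ _ (by rw [e, mul_one]),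
    ← π.right_unit, Category.assoc, Category.assoc, π.ident_comp_vert]

theorem exists_unit_tuple {S : C} (i : Fin n) (y : ∀ k, Sec (H k).G₀ S) (h : Sec (H i).G₁ S)
    (hy : y i = (H i).bd h) : ∃ (x : ∀ k, (𝓗 k).fib.Ob S) (_ : x i = 𝟙_ ((𝓗 i).fib.Ob S))
      (τ : ∀ k, x k ⟶ (πH k).obj (y k)), OnlyAt i τ (unitVert (πH i) (y i) h hy) := by
  obtain ⟨x, hx, hx'⟩ := exists_tuple (P := fun k => (𝓗 k).fib.Ob S) i (𝟙_ _)
    fun k _ => (πH k).obj (y k)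
  exact ⟨x, hx, OnlyAt.exists_of i _ hx rfl hx'⟩

theorem exists_trivV {S : C} (i : Fin n) (y : ∀ k, Sec (H k).G₀ S) (h : Sec (H i).G₁ S)
    (hy : y i = (H i).bd h) : ∃ E : 𝟙_ (𝓖.gr.fib.Ob S) ⟶ F.val πH y,
      ∀ (x : ∀ k, (𝓗 k).fib.Ob S) (e : x i = 𝟙_ ((𝓗 i).fib.Ob S))
      (τ : ∀ k, x k ⟶ (πH k).obj (y k)), OnlyAt i τ (unitVert (πH i) (y i) h hy) →
      F.eps i x e ≫ E = F.mapF τ := by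
  obtain ⟨x, e, τ, hτ⟩ := exists_unit_tuple πH i y h hy
  refine ⟨inv (F.eps i x e) ≫ F.mapF τ, fun x' e' τ' hτ' => ?_⟩
  obtain rfl : x = x' := funext fun k => by
    rcases eq_or_ne k i with rfl | hk
    · rw [e, e']
    · rw [hτ.off_eq k hk, hτ'.off_eq k hk]
  rw [IsIso.hom_inv_id_assoc, hτ.unique hτ']

/-- The isomorphism `I ⟶ F (π y)` given by `h` with `y i = ∂h`. -/
noncomputable def trivV {S : C} (i : Fin n) (y : ∀ k, Sec (H k).G₀ S) (h : Sec (H i).G₁ S)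
    (hy : y i = (H i).bd h) : 𝟙_ (𝓖.gr.fib.Ob S) ⟶ F.val πH y :=
  (F.exists_trivV πH i y h hy).choose

theorem eps_trivV {S : C} {i : Fin n} {y : ∀ k, Sec (H k).G₀ S} {h : Sec (H i).G₁ S}
    (hy : y i = (H i).bd h) {x : ∀ k, (𝓗 k).fib.Ob S} (e : x i = 𝟙_ ((𝓗 i).fib.Ob S))
    {τ : ∀ k, x k ⟶ (πH k).obj (y k)} (hτ : OnlyAt i τ (unitVert (πH i) (y i) h hy)) :
    F.eps i x e ≫ F.trivV πH i y h hy = F.mapF τ :=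
  (F.exists_trivV πH i y h hy).choose_spec x e τ hτ

theorem trivV_mapP {T S : C} {f : T ⟶ S} {i : Fin n} {y : ∀ k, Sec (H k).G₀ T}
    {y' : ∀ k, Sec (H k).G₀ S} {h : Sec (H i).G₁ T} {h' : Sec (H i).G₁ S}
    {γ : ∀ k, Sec (H k).G₁ T} (hy : y i = (H i).bd h) (hy' : y' i = (H i).bd h')
    (hγ : ∀ k, res (H k).G₀ f (y' k) = y k * (H k).bd (γ k))
    (e : res (H i).G₁ f h' = h * γ i) :
    𝓖.gr.fib.post (𝓖.gr.unitMap f) (F.trivV πH i y' h' hy') =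
      𝓖.gr.fib.pre (F.trivV πH i y h hy) (F.mapP πH f y y' γ hγ) := by
  obtain ⟨x, u, τ, hτ⟩ := exists_unit_tuple πH i y h hy
  obtain ⟨x', u', τ', hτ'⟩ := exists_unit_tuple πH i y' h' hy'
  obtain ⟨b, hb⟩ := FibGpd.exists_heq (𝓧 := (𝓗 i).fib) (x' := x i) (y' := x' i) u u'
    ((𝓗 i).unitMap f)
  choose d hd using fun k (hk : k ≠ i) => FibGpd.exists_heq (𝓧 := (𝓗 k).fib) (x' := x k)
    (y' := x' k) (hτ.off_eq k hk) (hτ'.off_eq k hk) ((πH k).map f (y k) (y' k) (γ k) (hγ k))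
  obtain ⟨φ, hφ, hφ'⟩ := exists_tuple i b d
  have hφ₁ : HEq (φ i) ((𝓗 i).unitMap f) := by
    rw [hφ]
    exact hb
  have hφ₂ : ∀ k, k ≠ i → HEq (φ k) ((πH k).map f (y k) (y' k) (γ k) (hγ k)) := fun k hk => by
    rw [hφ' k hk]
    exact hd k hk
  have E₁ := F.eps_naturality i x x' u u' φ hφ₁
  have E₂ := F.eps_trivV πH hy u hτ
  have E₃ := F.eps_trivV πH hy' u' hτ'
  have E₄ : 𝓖.gr.fib.post (F.map φ) (F.mapF τ') =
      𝓖.gr.fib.pre (F.mapF τ) (F.mapP πH f y y' γ hγ) := by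
    refine (F.map_comp φ τ' _).symm.trans (Eq.trans (congrArg F.map (funext fun k => ?_))
      (F.map_comp τ (fun k => (πH k).map f (y k) (y' k) (γ k) (hγ k)) _))
    rcases eq_or_ne k i with rfl | hk
    · refine eq_of_heq (HEq.trans (FibGpd.comp_heq u u' rfl hφ₁ hτ'.eq _)
        ((heq_of_eq (unitVert_comp_vert (πH k) hy hy' (hγ k) e)).trans ?_))
      exact FibGpd.comp_heq u.symm rfl rfl hτ.eq.symm HEq.rfl _
    · exact eq_of_heq ((FibGpd.post_heq_of_id (hτ'.off_eq k hk) (hτ'.off k hk) (φ k)).trans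
        ((hφ₂ k hk).trans (FibGpd.pre_heq_of_id (hτ.off_eq k hk) (hτ.off k hk) _).symm))
  rw [← E₂, ← E₃, FibGpd.post_comp, E₁, FibGpd.pre_post, FibGpd.comp_pre] at E₄
  have := congrArg (𝓖.gr.fib.pre (inv (F.eps i x u))) E₄
  rwa [← FibGpd.comp_pre, ← FibGpd.comp_pre, IsIso.inv_hom_id, FibGpd.id_pre, FibGpd.id_pre] at this

theorem onlyAt_vert {S : C} {i : Fin n} {y y' : ∀ k, Sec (H k).G₀ S} {γ : ∀ k, Sec (H k).G₁ S}
    (hγ : ∀ k, y' k = y k * (H k).bd (γ k)) (h : ∀ k, k ≠ i → γ k = 1) :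
    OnlyAt i (fun k => (πH k).vert (y k) (y' k) (γ k) (hγ k))
      ((πH i).vert (y i) (y' i) (γ i) (hγ i)) := by
  have e : ∀ k, k ≠ i → y k = y' k := fun k hk => by rw [hγ, h k hk, map_one, mul_one]
  refine ⟨rfl, rfl, HEq.rfl, fun k hk => by rw [e k hk], fun k hk => ?_⟩
  rw [← (πH k).vert_one (y k) (by simp)]
  exact map_heq πH rfl (e k hk).symm (h k hk) _ _

theorem trivV_lamV {S : C} {i : Fin n} {x y z : ∀ k, Sec (H k).G₀ S} {h : Sec (H i).G₁ S}
    (hx : x i = (H i).bd h) (hm : MulAt i x y z) {γ : ∀ k, Sec (H k).G₁ S}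
    (hγ : ∀ k, z k = y k * (H k).bd (γ k)) (h₁ : ∀ k, k ≠ i → γ k = 1)
    (h₂ : γ i = (H i).act h (y i)) :
    (F.trivV πH i x h hx ▷ F.val πH y) ≫ F.lamV πH i x y z hm =
      (λ_ _).hom ≫ F.mapV πH y z γ hγ := by
  obtain ⟨x₀, u, τ, hτ⟩ := exists_unit_tuple πH i x h hx
  obtain ⟨t, P, m, hm', e⟩ := F.exists_lamV_eq πH hm
  obtain ⟨t₀, P₀⟩ := exists_prodAt 𝓗 i (x := x₀) (y := fun k => (πH k).obj (y k)) fun k hk => by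
    rw [hτ.off_eq k hk, hm.agree k hk]
  obtain ⟨m₀, hm₀⟩ := OnlyAt.exists_of i (x := t₀) (y := t)
    (unitVert (πH i) (x i) h hx ⊗ₘ 𝟙 ((πH i).obj (y i))) (by rw [P₀.prod, u]) P.prod
    (fun k hk => by rw [← P₀.right k hk, ← P.right k hk])
  obtain ⟨L, hL⟩ := OnlyAt.exists_of i (x := t₀) (y := fun k => (πH k).obj (y k))
    (λ_ ((πH i).obj (y i))).hom (by rw [P₀.prod, u]) rfl (fun k hk => (P₀.right k hk).symm)
  have E₁ := F.lam_naturality_fiber P₀ P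
    (hτ.homProd (onlyAt_id i fun k => (πH k).obj (y k)) hm₀ P₀)
  rw [F.mapF_id, tensorHom_id] at E₁
  have E₂ := F.left_unit i x₀ _ t₀ u P₀ L
    (fun k hk => (hL.off k hk).trans (by rw [hL.off_eq k hk])) hL.eq
  change _ ≫ F.mapF L = _ at E₂
  have hz := hm.prod
  have E₃ : (fun k => m₀ k ≫ m k) = fun k => L k ≫ (πH k).vert (y k) (z k) (γ k) (hγ k) := by
    refine (hm₀.comp (onlyAt_ident πH hm' hz)).unique
      ((hL.comp (onlyAt_vert πH hγ h₁)).congr_right ?_)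
    have e₁ : x i * y i = y i * (H i).bd ((H i).act h (y i)) := by rw [hz, hγ, h₂]
    rw [tensorHom_id, reassoc_of% (unitVert_mu (πH i) hx e₁), (πH i).vert_comp_ident]
    exact congrArg _ ((πH i).vert_congr h₂ _ _)
  have E₄ := F.eps_trivV πH hx u hτ
  rw [← cancel_epi (F.eps i x₀ u ▷ F.val πH y), ← comp_whiskerRight_assoc, E₄, e, reassoc_of% E₁,
    F.map_comp_fiber, E₃, ← F.map_comp_fiber, reassoc_of% E₂]
  rfl

theorem lamV_trivV {S : C} {i : Fin n} {x y z : ∀ k, Sec (H k).G₀ S} {h : Sec (H i).G₁ S}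
    (hx : x i = (H i).bd h) (hm : MulAt i y x z) {γ : ∀ k, Sec (H k).G₁ S}
    (hγ : ∀ k, z k = y k * (H k).bd (γ k)) (h₁ : ∀ k, k ≠ i → γ k = 1) (h₂ : γ i = h) :
    (F.val πH y ◁ F.trivV πH i x h hx) ≫ F.lamV πH i y x z hm =
      (ρ_ _).hom ≫ F.mapV πH y z γ hγ := by
  obtain ⟨x₀, u, τ, hτ⟩ := exists_unit_tuple πH i x h hx
  obtain ⟨t, P, m, hm', e⟩ := F.exists_lamV_eq πH hm
  obtain ⟨t₀, P₀⟩ := exists_prodAt 𝓗 i (x := fun k => (πH k).obj (y k)) (y := x₀) fun k hk => by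
    rw [hτ.off_eq k hk, hm.agree k hk]
  obtain ⟨m₀, hm₀⟩ := OnlyAt.exists_of i (x := t₀) (y := t)
    (𝟙 ((πH i).obj (y i)) ⊗ₘ unitVert (πH i) (x i) h hx) (by rw [P₀.prod, u]) P.prod
    (fun k hk => by rw [← P₀.left k hk, ← P.left k hk])
  obtain ⟨L, hL⟩ := OnlyAt.exists_of i (x := t₀) (y := fun k => (πH k).obj (y k))
    (ρ_ ((πH i).obj (y i))).hom (by rw [P₀.prod, u]) rfl (fun k hk => (P₀.left k hk).symm)
  have E₁ := F.lam_naturality_fiber P₀ P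
    ((onlyAt_id i fun k => (πH k).obj (y k)).homProd hτ hm₀ P₀)
  rw [F.mapF_id, id_tensorHom] at E₁
  have E₂ := F.right_unit i _ x₀ t₀ u P₀ L
    (fun k hk => (hL.off k hk).trans (by rw [hL.off_eq k hk])) hL.eq
  change _ ≫ F.mapF L = _ at E₂
  have hz := hm.prod
  have E₃ : (fun k => m₀ k ≫ m k) = fun k => L k ≫ (πH k).vert (y k) (z k) (γ k) (hγ k) := by
    refine (hm₀.comp (onlyAt_ident πH hm' hz)).unique
      ((hL.comp (onlyAt_vert πH hγ h₁)).congr_right ?_)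
    have e₁ : y i * x i = y i * (H i).bd h := by rw [hx]
    rw [id_tensorHom, reassoc_of% (mu_unitVert (πH i) hx e₁), (πH i).vert_comp_ident]
    exact congrArg _ ((πH i).vert_congr h₂ _ _)
  have E₄ := F.eps_trivV πH hx u hτ
  rw [← cancel_epi (F.val πH y ◁ F.eps i x₀ u), ← whiskerLeft_comp_assoc, E₄, e, reassoc_of% E₁,
    F.map_comp_fiber, E₃, ← F.map_comp_fiber, reassoc_of% E₂]
  rfl

theorem trivV_restriction {S : C} {i k : Fin n} (hik : i ≠ k) {y : ∀ k, Sec (H k).G₀ S}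
    {h : Sec (H i).G₁ S} {h' : Sec (H k).G₁ S} (hy : y i = (H i).bd h) (hy' : y k = (H k).bd h') :
    F.trivV πH i y h hy = F.trivV πH k y h' hy' := by
  obtain ⟨x, u, τ, hτ⟩ := exists_unit_tuple πH i y h hy
  obtain ⟨x', u', τ', hτ'⟩ := exists_unit_tuple πH k y h' hy'
  obtain ⟨w, hw, hw'⟩ := exists_tuple (P := fun k => (𝓗 k).fib.Ob S) i (𝟙_ _) fun l _ => x' l
  have wk : w k = 𝟙_ _ := by rw [hw' k hik.symm, u']
  have hwl : ∀ l, l ≠ k → w l = x l := fun l hl => by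
    rcases eq_or_ne l i with rfl | hli
    · rw [hw, u]
    · rw [hw' l hli, hτ.off_eq l hli, hτ'.off_eq l hl]
  obtain ⟨σ, hσ⟩ := OnlyAt.exists_of k (x := w) (y := x) (unitVert (πH k) (y k) h' hy') wk
    (hτ.off_eq k hik.symm) hwl
  obtain ⟨σ', hσ'⟩ := OnlyAt.exists_of i (x := w) (y := x') (unitVert (πH i) (y i) h hy) hw
    (hτ'.off_eq i hik) hw'
  have heq : ∀ {l : Fin n} {a b : (𝓗 l).fib.Ob S} {φ : a ⟶ b}, a = b → HEq φ (𝟙 a) → a = 𝟙_ _ →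
      HEq φ ((𝓗 l).unitMap (𝟙 S)) := by
    rintro l a b φ rfl hφ rfl
    rw [(𝓗 l).unitMap_id]
    exact hφ
  have E₁ := F.eps_naturality i w x hw u σ (heq (hσ.off_eq i hik) (hσ.off i hik) hw)
  have E₂ := F.eps_naturality k w x' wk u' σ'
    (heq (hσ'.off_eq k hik.symm) (hσ'.off k hik.symm) wk)
  rw [𝓖.gr.unitMap_id] at E₁ E₂
  have E₁' : F.mapF σ ≫ F.eps i x u = F.eps i w hw := E₁.trans (𝓖.gr.fib.comp_id _)
  have E₂' : F.mapF σ' ≫ F.eps k x' u' = F.eps k w wk := E₂.trans (𝓖.gr.fib.comp_id _)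
  have E₃ := F.eps_trivV πH hy u hτ
  have E₄ := F.eps_trivV πH hy' u' hτ'
  have E₅ : (fun l => σ l ≫ τ l) = fun l => σ' l ≫ τ' l := by
    funext l
    by_cases hi : l = i
    · subst hi
      refine eq_of_heq ((FibGpd.pre_heq_of_id (hσ.off_eq l hik) (hσ.off l hik) _).trans
        (HEq.trans ?_ (FibGpd.post_heq_of_id (hτ'.off_eq l hik) (hτ'.off l hik) _).symm))
      exact hτ.eq.trans hσ'.eq.symm
    · refine eq_of_heq ((FibGpd.post_heq_of_id (hτ.off_eq l hi) (hτ.off l hi) _).trans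
        (HEq.trans ?_ (FibGpd.pre_heq_of_id (hσ'.off_eq l hi) (hσ'.off l hi) _).symm))
      by_cases hk : l = k
      · subst hk
        exact hσ.eq.trans hτ'.eq.symm
      · refine (hσ.off l hk).trans (HEq.trans ?_ (hτ'.off l hk).symm)
        rw [hσ'.off_eq l hi]
  rw [← cancel_epi (F.eps i w hw), ← E₁', Category.assoc, E₃, F.map_comp_fiber, E₅,
    ← F.map_comp_fiber, ← E₄, reassoc_of% E₂', ← F.eps_eq i k w hw wk, ← E₁', Category.assoc]

end NAdditive

end TrivV

/-! ## The butterfly of an additive functor -/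

section FrameDef

variable {C : Type u} [Category.{v} C] {J : GrothendieckTopology C} {n : ℕ}
  {H : Fin n → CrossedModule.{w} J} {G : BraidedCrossedModule.{w} J}
  {𝓗 : Fin n → GrStack.{o₁, h₁} J} {𝓖 : BraidedGrStack.{o₂, h} J}

theorem NAdditive.mapP_id (F : NAdditive 𝓗 𝓖) (πH : ∀ k, Presentation (H k) (𝓗 k)) {S : C}
    {y : ∀ k, Sec (H k).G₀ S} {γ : ∀ k, Sec (H k).G₁ S} (e : ∀ k, γ k = 1) (h) :
    F.mapP πH (𝟙 S) y y γ h = 𝓖.gr.fib.id (F.val πH y) := by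
  obtain rfl : γ = fun _ => 1 := funext e
  exact F.mapV_one πH (fun _ => rfl) (fun k => by rw [map_one, mul_one])

/-- An isomorphism of an object of the form `π x` with a value `F (π y)`. -/
structure Frame (πH : ∀ k, Presentation (H k) (𝓗 k)) (πG : BraidedPresentation G 𝓖)
    (F : NAdditive 𝓗 𝓖) (S : C) where
  y : ∀ k, Sec (H k).G₀ S
  x : Sec G.G₀ S
  φ : πG.obj x ⟶ F.val πH y

variable {πH : ∀ k, Presentation (H k) (𝓗 k)} {πG : BraidedPresentation G 𝓖}
  {F : NAdditive 𝓗 𝓖}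

namespace Frame

/-- `(γ, g)` is a morphism of frames over `r`. -/
structure Arr {T S : C} (r : T ⟶ S) (e' : Frame πH πG F T) (e : Frame πH πG F S)
    (γ : ∀ k, Sec (H k).G₁ T) (g : Sec G.G₁ T) : Prop where
  hy : ∀ k, res (H k).G₀ r (e.y k) = e'.y k * (H k).bd (γ k)
  hx : res G.G₀ r e.x = e'.x * G.bd g
  eq : 𝓖.gr.fib.post (πG.map r e'.x e.x g hx) e.φ = 𝓖.gr.fib.pre e'.φ (F.mapP πH r e'.y e.y γ hy)

theorem Arr.congr {T S : C} {r : T ⟶ S} {e' : Frame πH πG F T} {e : Frame πH πG F S}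
    {γ γ' : ∀ k, Sec (H k).G₁ T} {g g' : Sec G.G₁ T} (a : Arr r e' e γ g) (hγ : ∀ k, γ k = γ' k)
    (hg : g = g') : Arr r e' e γ' g' := by
  obtain rfl : γ = γ' := funext hγ
  exact hg ▸ a

theorem Arr.source_unique {T S : C} {r : T ⟶ S} {d e' : Frame πH πG F T} {e : Frame πH πG F S}
    {γ : ∀ k, Sec (H k).G₁ T} {g : Sec G.G₁ T} (a : Arr r e' e γ g) (b : Arr r d e γ g) :
    e' = d := by
  obtain ⟨y, x, φ⟩ := e'
  obtain ⟨y', x', φ'⟩ := d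
  obtain ⟨hy, hx, h⟩ := a
  obtain ⟨hy', hx', h'⟩ := b
  dsimp only at hy hx h hy' hx' h'
  obtain rfl : y = y' := funext fun k => mul_right_cancel ((hy k).symm.trans (hy' k))
  obtain rfl : x = x' := mul_right_cancel (hx.symm.trans hx')
  obtain rfl : φ = φ' := FibGpd.comp_cancel (h.symm.trans h')
  rfl

theorem Arr.target_unique {S : C} {e e' d : Frame πH πG F S} {γ : ∀ k, Sec (H k).G₁ S}
    {g : Sec G.G₁ S} (a : Arr (𝟙 S) e e' γ g) (b : Arr (𝟙 S) e d γ g) : e' = d := by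
  obtain ⟨y, x, φ⟩ := e'
  obtain ⟨y', x', φ'⟩ := d
  obtain ⟨hy, hx, h⟩ := a
  obtain ⟨hy', hx', h'⟩ := b
  dsimp only at hy hx h hy' hx' h'
  obtain rfl : y = y' := funext fun k => by
    have := (hy k).trans (hy' k).symm
    rwa [res_id, res_id] at this
  obtain rfl : x = x' := by
    have := hx.trans hx'.symm
    rwa [res_id, res_id] at this
  obtain rfl : φ = φ' := by
    have := h.trans h'.symm
    exact (cancel_epi (C := 𝓖.gr.fib.Ob S) (πG.map (𝟙 S) e.x x g hx :
      πG.obj e.x ⟶ πG.obj x)).1 this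
  rfl

theorem Arr.refl {S : C} (e : Frame πH πG F S) : Arr (𝟙 S) e e (fun _ => 1) 1 where
  hy k := by rw [res_id, map_one, mul_one]
  hx := by rw [res_id, map_one, mul_one]
  eq := by
    have h₁ := πG.map_id e.x (by rw [res_id, map_one, mul_one])
    rw [h₁, F.mapP_id πH fun _ => rfl]
    exact (𝓖.gr.fib.id_comp _).trans (𝓖.gr.fib.comp_id _).symm

theorem Arr.comp {R T S : C} {r' : R ⟶ T} {r : T ⟶ S} {e'' : Frame πH πG F R}
    {e' : Frame πH πG F T} {e : Frame πH πG F S} {γ' : ∀ k, Sec (H k).G₁ R}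
    {γ : ∀ k, Sec (H k).G₁ T} {g' : Sec G.G₁ R} {g : Sec G.G₁ T} (a' : Arr r' e'' e' γ' g')
    (a : Arr r e' e γ g) : Arr (r' ≫ r) e'' e (fun k => γ' k * res (H k).G₁ r' (γ k))
      (g' * res G.G₁ r' g) := by
  have hy : ∀ k, res (H k).G₀ (r' ≫ r) (e.y k) =
      e''.y k * (H k).bd (γ' k * res (H k).G₁ r' (γ k)) := fun k => by
    rw [res_comp, a.hy, map_mul, map_mul, a'.hy, mul_assoc, (H k).res_bd]
  have hx : res G.G₀ (r' ≫ r) e.x = e''.x * G.bd (g' * res G.G₁ r' g) := by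
    rw [res_comp, a.hx, map_mul, map_mul, a'.hx, mul_assoc, G.res_bd]
  refine ⟨hy, hx, ?_⟩
  rw [← πG.comp_map rfl rfl (e := a'.hx) (e' := a.hx),
    ← F.comp_mapP πH rfl (fun _ => rfl) (h := a'.hy) (h' := a.hy)]
  have h := a.eq
  have h' := a'.eq
  unfold FibGpd.post FibGpd.pre at h h' ⊢
  rw [𝓖.gr.fib.assoc _ _ _ rfl _ (Category.comp_id r) rfl, h,
    ← 𝓖.gr.fib.assoc _ _ _ (Category.comp_id r') rfl (Category.id_comp r) rfl, h',
    𝓖.gr.fib.assoc _ _ _ (Category.id_comp r') rfl rfl (Category.id_comp _)]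

theorem Arr.comp_of_eq {R T S : C} {r' : R ⟶ T} {r : T ⟶ S} {k : R ⟶ S} {e'' : Frame πH πG F R}
    {e' : Frame πH πG F T} {e : Frame πH πG F S} {γ' : ∀ k, Sec (H k).G₁ R}
    {γ : ∀ k, Sec (H k).G₁ T} {g' : Sec G.G₁ R} {g : Sec G.G₁ T} (a' : Arr r' e'' e' γ' g')
    (a : Arr r e' e γ g) (w : r' ≫ r = k) {δ : ∀ k, Sec (H k).G₁ R} {d : Sec G.G₁ R}
    (hδ : ∀ k, γ' k * res (H k).G₁ r' (γ k) = δ k) (hd : g' * res G.G₁ r' g = d) :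
    Arr k e'' e δ d := by
  subst w
  exact (a'.comp a).congr hδ hd

theorem arr_id_iff {S : C} {e e' : Frame πH πG F S} {γ : ∀ k, Sec (H k).G₁ S} {g : Sec G.G₁ S} :
    Arr (𝟙 S) e e' γ g ↔ ∃ (hy : ∀ k, e'.y k = e.y k * (H k).bd (γ k)) (hx : e'.x = e.x * G.bd g),
      πG.vert e.x e'.x g hx ≫ e'.φ = e.φ ≫ F.mapV πH e.y e'.y γ hy := by
  constructor
  · rintro ⟨hy, hx, h⟩
    exact ⟨fun k => by rw [← hy, res_id], by rw [← hx, res_id], h⟩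
  · rintro ⟨hy, hx, h⟩
    exact ⟨fun k => by rw [← hy, res_id], by rw [← hx, res_id], h⟩

theorem Arr.symm {S : C} {e e' : Frame πH πG F S} {γ : ∀ k, Sec (H k).G₁ S} {g : Sec G.G₁ S}
    (a : Arr (𝟙 S) e e' γ g) : Arr (𝟙 S) e' e (fun k => (γ k)⁻¹) g⁻¹ := by
  rw [arr_id_iff] at a ⊢
  obtain ⟨hy, hx, h⟩ := a
  refine ⟨fun k => by simp [hy], by simp [hx], ?_⟩
  rw [← cancel_epi (πG.vert e.x e'.x g hx), ← Category.assoc, πG.vert_comp_vert_inv _ _ rfl,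
    Category.id_comp, reassoc_of% h, F.mapV_comp πH (γ'' := fun _ => 1) (fun k => by simp)
      (fun k => by simp), F.mapV_one πH fun _ => rfl, Category.comp_id]

theorem exists_res {T S : C} (f : T ⟶ S) (e : Frame πH πG F S) :
    ∃ e' : Frame πH πG F T, Arr f e' e (fun _ => 1) 1 := by
  obtain ⟨φ, hφ, -⟩ := 𝓖.gr.fib.cartesian (F.mapP πH f (fun k => res (H k).G₀ f (e.y k)) e.y
    (fun _ => 1) (fun k => by rw [map_one, mul_one]))
    (𝓖.gr.fib.post (πG.map f (res G.G₀ f e.x) e.x 1 (by rw [map_one, mul_one])) e.φ)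
    (Category.id_comp f)
  exact ⟨⟨_, _, φ⟩, fun k => by rw [map_one, mul_one], by rw [map_one, mul_one], hφ.symm⟩

/-- Restriction of frames. -/
noncomputable def res' {T S : C} (f : T ⟶ S) (e : Frame πH πG F S) : Frame πH πG F T :=
  (e.exists_res f).choose

theorem arr_res {T S : C} (f : T ⟶ S) (e : Frame πH πG F S) : Arr f (e.res' f) e (fun _ => 1) 1 :=
  (e.exists_res f).choose_spec

theorem Arr.eq_res {T S : C} {f : T ⟶ S} {e : Frame πH πG F S} {e' : Frame πH πG F T}
    (a : Arr f e' e (fun _ => 1) 1) : e' = e.res' f :=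
  a.source_unique (e.arr_res f)

theorem res_y {T S : C} (f : T ⟶ S) (e : Frame πH πG F S) (k : Fin n) :
    (e.res' f).y k = res (H k).G₀ f (e.y k) := by
  rw [(e.arr_res f).hy, map_one, mul_one]

theorem res_x {T S : C} (f : T ⟶ S) (e : Frame πH πG F S) : (e.res' f).x = res G.G₀ f e.x := by
  rw [(e.arr_res f).hx, map_one, mul_one]

/-- The right action of `G₁` on frames. -/
noncomputable def act {S : C} (e : Frame πH πG F S) (g : Sec G.G₁ S) : Frame πH πG F S :=
  ⟨e.y, e.x * G.bd g, πG.vert (e.x * G.bd g) e.x g⁻¹ (by simp) ≫ e.φ⟩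

theorem arr_act {S : C} (e : Frame πH πG F S) (g : Sec G.G₁ S) :
    Arr (𝟙 S) e (e.act g) (fun _ => 1) g where
  hy k := by rw [res_id, map_one, mul_one]; rfl
  hx := res_id _ _
  eq := by
    refine Eq.trans ?_ (congrArg (𝓖.gr.fib.pre e.φ) (F.mapP_id πH (y := e.y) (fun _ => rfl) _).symm)
    change πG.vert e.x (e.x * G.bd g) g rfl ≫ πG.vert (e.x * G.bd g) e.x g⁻¹ _ ≫ e.φ = e.φ ≫ 𝟙 _
    rw [← Category.assoc, πG.vert_comp_vert_inv _ _ rfl, Category.id_comp, Category.comp_id]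

/-- The frame `e''` is the product of `e` and `e'` in the variable `i`. -/
structure IsMul {S : C} (i : Fin n) (e e' e'' : Frame πH πG F S) : Prop where
  hy : MulAt i e.y e'.y e''.y
  hx : e.x * e'.x = e''.x
  eq : πG.mu e.x e'.x ≫ πG.ident _ _ hx ≫ e''.φ = (e.φ ⊗ₘ e'.φ) ≫ F.lamV πH i e.y e'.y e''.y hy

theorem exists_mul {S : C} {i : Fin n} {e e' : Frame πH πG F S} (h : AgreeOff i e.y e'.y) :
    ∃ e'', IsMul i e e' e'' := by
  refine ⟨⟨_, e.x * e'.x, inv (πG.mu e.x e'.x) ≫ (e.φ ⊗ₘ e'.φ) ≫ F.lamV πH i e.y e'.y _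
    (MulAt.update h)⟩, MulAt.update h, rfl, ?_⟩
  rw [πG.ident_self, Category.id_comp, IsIso.hom_inv_id_assoc]

theorem IsMul.unique {S : C} {i : Fin n} {e e' m m' : Frame πH πG F S} (h : IsMul i e e' m)
    (h' : IsMul i e e' m') : m = m' := by
  obtain ⟨y, x, φ⟩ := m
  obtain ⟨y', x', φ'⟩ := m'
  obtain ⟨hy, hx, h⟩ := h
  obtain ⟨hy', hx', h'⟩ := h'
  dsimp only at hy hx h hy' hx' h'
  obtain rfl : y = y' := hy.eq_update.symm.trans hy'.eq_update
  subst hx hx'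
  have := h.trans h'.symm
  rw [cancel_epi, cancel_epi] at this
  rw [this]

theorem Arr.mul {T S : C} {r : T ⟶ S} {i : Fin n} {e' d' m' : Frame πH πG F T}
    {e d m : Frame πH πG F S} {γ δ ε : ∀ k, Sec (H k).G₁ T} {g k : Sec G.G₁ T}
    (a : Arr r e' e γ g) (b : Arr r d' d δ k) (hm' : IsMul i e' d' m') (hm : IsMul i e d m)
    (h₁ : ∀ k, k ≠ i → γ k = ε k) (h₂ : ∀ k, k ≠ i → δ k = ε k)
    (h₃ : ε i = (H i).act (γ i) (d'.y i) * δ i) : Arr r m' m ε (G.act g d'.x * k) := by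
  obtain ⟨y', x', φ'⟩ := m'
  obtain ⟨y, x, φ⟩ := m
  obtain ⟨hy', hx', h'⟩ := hm'
  obtain ⟨hy, hx, h⟩ := hm
  dsimp only at hy hx h hy' hx' h'
  subst hx hx'
  rw [πG.ident_self, Category.id_comp] at h h'
  have e₁ : ∀ k, res (H k).G₀ r (y k) = y' k * (H k).bd (ε k) := by
    intro k
    rcases eq_or_ne k i with rfl | hk
    · rw [← hy.prod, ← hy'.prod, h₃, map_mul, map_mul, a.hy, b.hy, (H k).bd_act']
      group
    · rw [← hy.left k hk, ← hy'.left k hk, a.hy, h₁ k hk]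
  have e₂ : res G.G₀ r (e.x * d.x) = e'.x * d'.x * G.bd (G.act g d'.x * k) := by
    rw [map_mul, map_mul, a.hx, b.hx, G.bd_act']
    group
  refine ⟨e₁, e₂, ?_⟩
  have key : 𝓖.gr.fib.pre (πG.mu e'.x d'.x)
      (𝓖.gr.fib.post (πG.map r (e'.x * d'.x) (e.x * d.x) (G.act g d'.x * k) e₂) φ) =
      𝓖.gr.fib.pre (πG.mu e'.x d'.x) (𝓖.gr.fib.pre φ' (F.mapP πH r y' y ε e₁)) := by
    rw [← FibGpd.pre_post, ← πG.mu_naturality r _ _ _ _ g k a.hx b.hx e₂, ← FibGpd.post_comp, h,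
      FibGpd.post_comp, ← GrStack.tens_post, a.eq, b.eq, GrStack.tens_pre, FibGpd.pre_post,
      F.lamV_mapP πH hy' hy a.hy b.hy e₁ h₁ h₂ h₃, ← FibGpd.comp_pre, ← h', FibGpd.comp_pre]
  have := congrArg (𝓖.gr.fib.pre (inv (πG.mu e'.x d'.x))) key
  rwa [← FibGpd.comp_pre, ← FibGpd.comp_pre, IsIso.inv_hom_id, FibGpd.id_pre, FibGpd.id_pre] at this

theorem IsMul.assoc {S : C} {i : Fin n} {e e' e'' m m' t : Frame πH πG F S} (h₁ : IsMul i e e' m)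
    (h₂ : IsMul i e' e'' m') (h₃ : IsMul i e m' t) : IsMul i m e'' t := by
  obtain ⟨y₁, x₁, φ₁⟩ := m
  obtain ⟨y₂, x₂, φ₂⟩ := m'
  obtain ⟨y₃, x₃, φ₃⟩ := t
  obtain ⟨hy₁, hx₁, h₁⟩ := h₁
  obtain ⟨hy₂, hx₂, h₂⟩ := h₂
  obtain ⟨hy₃, hx₃, h₃⟩ := h₃
  dsimp only at hy₁ hx₁ h₁ hy₂ hx₂ h₂ hy₃ hx₃ h₃
  subst hx₁ hx₂ hx₃
  rw [πG.ident_self, Category.id_comp] at h₁ h₂ h₃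
  have hy : MulAt i y₁ e''.y y₃ := by
    refine ⟨fun k hk => ?_, fun k hk => ?_, ?_⟩
    · rw [← hy₁.left k hk, hy₃.left k hk]
    · rw [← hy₂.agree k hk, ← hy₁.agree k hk, hy₃.left k hk]
    · rw [← hy₁.prod, mul_assoc, hy₂.prod, hy₃.prod]
  refine ⟨hy, mul_assoc _ _ _, ?_⟩
  dsimp only
  rw [← cancel_epi (πG.mu e.x e'.x ▷ πG.obj e''.x), reassoc_of% (πG.mu_assoc e.x e'.x e''.x), h₃,
    whiskerRight_comp_tensorHom_assoc, h₁, whiskerLeft_comp_tensorHom_assoc, h₂,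
    ← tensorHom_comp_whiskerRight_assoc, F.lamV_assoc πH hy₁ hy hy₂ hy₃,
    ← tensorHom_comp_whiskerLeft_assoc, associator_naturality_assoc]

theorem IsMul.interchange {S : C} {i k : Fin n} (hik : i < k)
    {e e' d d' m₁ m₂ t n₁ n₂ t' : Frame πH πG F S} (h₁ : IsMul i e e' m₁) (h₂ : IsMul i d d' m₂)
    (h₃ : IsMul k m₁ m₂ t) (h₄ : IsMul k e d n₁) (h₅ : IsMul k e' d' n₂) (h₆ : IsMul i n₁ n₂ t') :
    Arr (𝟙 S) t t' (fun _ => 1) (G.act (G.br e'.x d.x) d'.x) := by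
  obtain ⟨z₁, x₁, φ₁⟩ := m₁
  obtain ⟨z₂, x₂, φ₂⟩ := m₂
  obtain ⟨z₃, x₃, φ₃⟩ := t
  obtain ⟨z₄, x₄, φ₄⟩ := n₁
  obtain ⟨z₅, x₅, φ₅⟩ := n₂
  obtain ⟨z₆, x₆, φ₆⟩ := t'
  obtain ⟨hy₁, hx₁, h₁⟩ := h₁
  obtain ⟨hy₂, hx₂, h₂⟩ := h₂
  obtain ⟨hy₃, hx₃, h₃⟩ := h₃
  obtain ⟨hy₄, hx₄, h₄⟩ := h₄
  obtain ⟨hy₅, hx₅, h₅⟩ := h₅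
  obtain ⟨hy₆, hx₆, h₆⟩ := h₆
  dsimp only at hy₁ hx₁ h₁ hy₂ hx₂ h₂ hy₃ hx₃ h₃ hy₄ hx₄ h₄ hy₅ hx₅ h₅ hy₆ hx₆ h₆
  subst hx₁ hx₂ hx₃ hx₄ hx₅ hx₆
  rw [πG.ident_self, Category.id_comp] at h₁ h₂ h₃ h₄ h₅ h₆
  obtain rfl : z₃ = z₆ := by
    funext l
    by_cases hi : l = i
    · subst hi
      rw [← hy₃.left l hik.ne, ← hy₁.prod, ← hy₆.prod, ← hy₄.left l hik.ne, ← hy₅.left l hik.ne]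
    · by_cases hk : l = k
      · subst hk
        rw [← hy₃.prod, ← hy₁.left l hi, ← hy₂.left l hi, hy₄.prod, hy₆.left l hi]
      · rw [← hy₃.left l hk, ← hy₁.left l hi, ← hy₆.left l hi, hy₄.left l hk]
  have e₁ : e.x * d.x * (e'.x * d'.x) =
      e.x * e'.x * (d.x * d'.x) * G.bd (G.act (G.br e'.x d.x) d'.x) := by
    rw [G.bd_act', G.bd_br]
    group
  refine ⟨fun k => by rw [res_id, map_one, mul_one], by rw [res_id]; exact e₁, ?_⟩
  refine Eq.trans ?_ (congrArg (𝓖.gr.fib.pre φ₃) (F.mapP_id πH (y := z₃) (fun _ => rfl) _).symm)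
  change πG.vert (e.x * e'.x * (d.x * d'.x)) (e.x * d.x * (e'.x * d'.x)) _ e₁ ≫ φ₆ = φ₃ ≫ 𝟙 _
  have h₇ : ((πG.mu e.x e'.x ⊗ₘ πG.mu d.x d'.x) ≫ (φ₁ ⊗ₘ φ₂)) =
      ((e.φ ⊗ₘ e'.φ) ⊗ₘ (d.φ ⊗ₘ d'.φ)) ≫
        (F.lamV πH i e.y e'.y z₁ hy₁ ⊗ₘ F.lamV πH i d.y d'.y z₂ hy₂) := by
    rw [tensorHom_comp_tensorHom, tensorHom_comp_tensorHom, h₁, h₂]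
  have h₈ : ((πG.mu e.x d.x ⊗ₘ πG.mu e'.x d'.x) ≫ (φ₄ ⊗ₘ φ₅)) =
      ((e.φ ⊗ₘ d.φ) ⊗ₘ (e'.φ ⊗ₘ d'.φ)) ≫
        (F.lamV πH k e.y d.y z₄ hy₄ ⊗ₘ F.lamV πH k e'.y d'.y z₅ hy₅) := by
    rw [tensorHom_comp_tensorHom, tensorHom_comp_tensorHom, h₄, h₅]
  rw [Category.comp_id, ← cancel_epi (πG.mu (e.x * e'.x) (d.x * d'.x)), h₃,
    ← cancel_epi (πG.mu e.x e'.x ⊗ₘ πG.mu d.x d'.x), reassoc_of% h₇,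
    F.lamV_interchange πH hik hy₁ hy₂ hy₃ hy₄ hy₅ hy₆, tensorμ_natural_assoc, ← reassoc_of% h₈, ← h₆,
    reassoc_of% (πG.tensorμ_mu e.x e'.x d.x d'.x e₁)]

end Frame

end FrameDef

section FrameSheaf

variable {C : Type u} [Category.{v} C] {J : GrothendieckTopology C} {n : ℕ}
  {H : Fin n → CrossedModule.{w} J} {G : BraidedCrossedModule.{w} J}
  {𝓗 : Fin n → GrStack.{o₁, h₁} J} {𝓖 : BraidedGrStack.{o₂, w} J}
  (πH : ∀ k, Presentation (H k) (𝓗 k)) (πG : BraidedPresentation G 𝓖) (F : NAdditive 𝓗 𝓖)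

theorem CrossedModule.ext_of_loc₀ (K : CrossedModule.{w} J) {S : C} {x y : Sec K.G₀ S}
    (h : Loc J S fun _ f => res K.G₀ f x = res K.G₀ f y) : x = y := by
  obtain ⟨R, hR, h⟩ := h
  exact (K.isSheaf₀ R hR).isSeparatedFor.ext fun T f hf => h f hf

theorem CrossedModule.exists_glue₀ (K : CrossedModule.{w} J) {S : C} {R : Sieve S} (hR : R ∈ J S)
    (x : ∀ {T : C} (f : T ⟶ S), R f → Sec K.G₀ T)
    (hx : ∀ {T' T : C} (r : T' ⟶ T) (f : T ⟶ S) (hf : R f) (hf' : R (r ≫ f)),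
      res K.G₀ r (x f hf) = x (r ≫ f) hf') :
    ∃ t : Sec K.G₀ S, ∀ {T : C} (f : T ⟶ S) (hf : R f), res K.G₀ f t = x f hf := by
  obtain ⟨t, ht, -⟩ := K.isSheaf₀ R hR (fun T f hf => x f hf)
    ((Presieve.compatible_iff_sieveCompatible _).2 fun T T' f g hf => (hx g f hf _).symm)
  exact ⟨t, fun f hf => ht f hf⟩

namespace Frame

/-- The presheaf of frames. -/
noncomputable def presheaf : Cᵒᵖ ⥤ Type w where
  obj S := Frame πH πG F S.unop
  map f := ↾fun e => e.res' f.unop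
  map_id S := by
    ext e
    exact ((Arr.refl e).eq_res).symm
  map_comp f g := by
    ext e
    exact ((((Frame.arr_res g.unop _).comp (e.arr_res f.unop)).congr (fun k => by simp)
      (by simp)).eq_res).symm

variable {πH πG F}

theorem ext_of_loc {S : C} {e e' : Frame πH πG F S}
    (h : Loc J S fun _ f => e.res' f = e'.res' f) : e = e' := by
  have hy : e.y = e'.y := funext fun k => (H k).ext_of_loc₀ (h.mono fun T f h => by
    rw [← res_y, h, res_y])
  have hx : e.x = e'.x := G.ext_of_loc₀ (h.mono fun T f h => by rw [← res_x, h, res_x])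
  obtain ⟨y, x, φ⟩ := e
  obtain ⟨y', x', φ'⟩ := e'
  dsimp only at hy hx
  subst hy hx
  obtain rfl : φ = φ' := 𝓖.gr.isStack.fiber_hom_ext (h.mono fun T f h =>
    ⟨_, πG.map f _ x 1 (arr_res f ⟨y, x, φ⟩).hx, by
      have h₁ := arr_res f ⟨y, x, φ⟩
      have h₂ := arr_res f ⟨y, x, φ'⟩
      rw [← h] at h₂
      exact h₁.eq.trans h₂.eq.symm⟩)
  rfl

theorem exists_glue {S : C} {R : Sieve S} (hR : R ∈ J S)
    (e : ∀ {T : C} (f : T ⟶ S), R f → Frame πH πG F T)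
    (he : ∀ {T' T : C} (r : T' ⟶ T) (f : T ⟶ S) (hf : R f) (hf' : R (r ≫ f)),
      (e f hf).res' r = e (r ≫ f) hf') :
    ∃ t : Frame πH πG F S, ∀ {T : C} (f : T ⟶ S) (hf : R f), t.res' f = e f hf := by
  choose y hy using fun k => (H k).exists_glue₀ hR (fun f hf => (e f hf).y k)
    (fun r f hf hf' => by rw [← he r f hf hf', res_y])
  obtain ⟨x, hx⟩ := G.exists_glue₀ hR (fun f hf => (e f hf).x)
    (fun r f hf hf' => by rw [← he r f hf hf', res_x])
  have hy₁ : ∀ {T : C} (f : T ⟶ S) (hf : R f) (k : Fin n),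
      res (H k).G₀ f (y k) = (e f hf).y k * (H k).bd 1 := fun f hf k => by
    rw [map_one, mul_one, hy]
  have hx₁ : ∀ {T : C} (f : T ⟶ S) (hf : R f), res G.G₀ f x = (e f hf).x * G.bd 1 := fun f hf => by
    rw [map_one, mul_one, hx]
  obtain ⟨φ, hφ, -⟩ := 𝓖.gr.isStack.glue (𝟙 S) (πG.obj x) (F.val πH y) (fun f => PLift (R f))
    (fun {T f} i => πG.obj (e f i.down).x) (fun {T f} i => πG.map f _ x 1 (hx₁ f i.down))
    (fun {T f} i => 𝓖.gr.fib.comp (e f i.down).φ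
      (F.mapP πH f _ y (fun _ => 1) (hy₁ f i.down)) (by rw [Category.id_comp, Category.comp_id]))
    ⟨R, hR, fun T f hf => ⟨⟨hf⟩⟩⟩ (by
      rintro T' T r f _ rfl ⟨hf⟩ ⟨hf'⟩
      have a := arr_res r (e f hf)
      rw [he r f hf hf'] at a
      refine ⟨πG.map r _ _ 1 a.hx, πG.comp_map rfl (by simp) _, ?_⟩
      have h := a.eq
      unfold FibGpd.post FibGpd.pre at h
      rw [← 𝓖.gr.fib.assoc _ _ _ (Category.comp_id r) (by simp) (by simp), h,
        𝓖.gr.fib.assoc _ _ _ _ _ rfl (by simp)]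
      rw [F.comp_mapP πH rfl (γ'' := fun _ => 1) (fun k => by simp) (hy₁ _ hf')])
  refine ⟨⟨y, x, φ⟩, fun f hf => Eq.symm (Arr.eq_res ⟨hy₁ f hf, hx₁ f hf, ?_⟩)⟩
  exact FibGpd.comp_eq_comp (hφ (⟨hf⟩ : PLift (R f)))

variable (πH πG F) in
theorem presheaf_isSheaf : Presieve.IsSheaf J (presheaf πH πG F) := by
  intro S R hR x hx
  rw [Presieve.compatible_iff_sieveCompatible] at hx
  obtain ⟨t, ht⟩ := exists_glue (πH := πH) (πG := πG) (F := F) hR (fun f hf => x f hf)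
    (fun r f hf hf' => (hx f r hf).symm)
  refine ⟨t, fun T f hf => ht f hf, fun t' ht' => ext_of_loc ⟨R, hR, fun T f hf => ?_⟩⟩
  exact (ht' f hf).trans (ht f hf).symm

/-- The product of frames. -/
noncomputable def mul {S : C} (i : Fin n) (e e' : Frame πH πG F S) (h : AgreeOff i e.y e'.y) :
    Frame πH πG F S :=
  (exists_mul h).choose

theorem isMul_mul {S : C} {i : Fin n} {e e' : Frame πH πG F S} (h : AgreeOff i e.y e'.y) :
    IsMul i e e' (mul i e e' h) :=
  (exists_mul h).choose_spec

theorem exists_unique_act {S : C} (e e' : Frame πH πG F S) (h : e.y = e'.y) :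
    ∃! g : Sec G.G₁ S, e.act g = e' := by
  obtain ⟨y, x, φ⟩ := e
  obtain ⟨y', x', φ'⟩ := e'
  dsimp only at h
  subst h
  obtain ⟨g, hg, e₁⟩ := πG.exists_vert (φ ≫ inv φ')
  refine ⟨g, ?_, fun g' hg' => ?_⟩
  · refine (arr_act _ g).target_unique (arr_id_iff.2 ⟨fun k => by simp, hg, ?_⟩)
    rw [F.mapV_one πH fun _ => rfl]
    change πG.vert x x' g hg ≫ φ' = φ ≫ 𝟙 _
    rw [e₁, Category.assoc, IsIso.inv_hom_id]
  · have a := arr_act (πH := πH) ⟨y, x, φ⟩ g'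
    rw [hg', arr_id_iff] at a
    obtain ⟨hy, hx, h⟩ := a
    rw [F.mapV_one πH fun _ => rfl] at h
    refine πG.vert_inj (e := hx) (e' := hg) ?_
    rw [e₁, ← cancel_mono φ', Category.assoc, IsIso.inv_hom_id]
    exact h

theorem loc_exists {S : C} (y : ∀ k, Sec (H k).G₀ S) : Loc J S fun T f =>
    ∃ e : Frame πH πG F T, e.y = fun k => res (H k).G₀ f (y k) := by
  obtain ⟨R, hR, h⟩ := πG.locally_surjective (F.val πH y)
  refine ⟨R, hR, fun T f hf => ?_⟩
  obtain ⟨x, ⟨ψ⟩⟩ := h f hf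
  obtain ⟨φ, -⟩ := (𝓖.gr.fib.cartesian (F.mapP πH f (fun k => res (H k).G₀ f (y k)) y
    (fun _ => 1) (fun k => by rw [map_one, mul_one])) ψ (Category.id_comp f)).exists
  exact ⟨⟨_, x, φ⟩, rfl⟩

theorem IsMul.res {T S : C} (f : T ⟶ S) {i : Fin n} {e e' m : Frame πH πG F S}
    (h : IsMul i e e' m) : IsMul i (e.res' f) (e'.res' f) (m.res' f) := by
  have a : AgreeOff i (e.res' f).y (e'.res' f).y := fun k hk => by
    rw [res_y, res_y, h.hy.agree k hk]
  rw [← (((e.arr_res f).mul (e'.arr_res f) (isMul_mul a) h (ε := fun _ => 1) (fun _ _ => rfl)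
    (fun _ _ => rfl) (by rw [(H i).one_act, one_mul])).congr (fun _ => rfl)
      (by rw [G.one_act, one_mul])).eq_res]
  exact isMul_mul a

variable (πH πG F) in
/-- The extension of frames of an additive functor. -/
noncomputable def extension : NExtension J (fun k => (H k).G₀) G where
  E := presheaf πH πG F
  isSheaf := presheaf_isSheaf πH πG F
  p e := e.y
  p_res f e k := res_y f e k
  act e g := e.act g
  act_res {T S} f e g := by
    refine (Arr.eq_res ?_).symm
    exact (arr_act (e.res' f) (res G.G₁ f g)).symm.comp_of_eq
      ((e.arr_res f).comp_of_eq (arr_act e g) (Category.comp_id f) (fun _ => rfl) rfl)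
      (Category.id_comp f) (fun k => by simp) (by simp [res_id])
  act_one e := ((Frame.arr_act e 1).target_unique (Arr.refl e))
  act_mul e g g' := (Frame.arr_act e (g * g')).target_unique
    ((Frame.arr_act e g).comp_of_eq (Frame.arr_act (e.act g) g') (Category.comp_id _)
      (fun k => by simp) (by rw [res_id]))
  p_act _ _ := rfl
  simply_transitive e e' h := exists_unique_act e e' h
  locally_nonempty y := loc_exists y
  j e := e.x
  j_res f e := res_x f e
  j_act _ _ := rfl
  mul i e e' a := mul i e e' a
  mul_res f i e e' a a' := ((isMul_mul a).res f).unique (isMul_mul a')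
  p_mul i e e' a := (isMul_mul a).hy.eq_update.symm
  mul_act_right i e e' g a a' := ((Arr.refl e).mul (arr_act e' g) (isMul_mul a) (isMul_mul a')
    (ε := fun _ => 1) (fun _ _ => rfl) (fun _ _ => rfl)
    (by rw [(H i).one_act, one_mul])).target_unique
      ((arr_act _ g).congr (fun _ => rfl) (by rw [G.one_act, one_mul]))
  act_mul_left i e e' g a a' := by
    have h₁ := (arr_act e g).mul (Arr.refl e') (isMul_mul (e := e) (e' := e') a) (isMul_mul a)
      (ε := fun _ => 1) (fun _ _ => rfl) (fun _ _ => rfl) (by rw [(H i).one_act, one_mul])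
    have h₂ := (Arr.refl e).mul (arr_act e' (G.act g e'.x)) (isMul_mul (e := e) (e' := e') a)
      (isMul_mul a') (ε := fun _ => 1) (fun _ _ => rfl) (fun _ _ => rfl)
      (by rw [(H i).one_act, one_mul])
    exact h₁.target_unique (h₂.congr (fun _ => rfl) (by rw [G.one_act, one_mul, mul_one]))
  j_mul i e e' a := (isMul_mul a).hx.symm
  mul_assoc i e e' e'' a b a' b' :=
    (isMul_mul b).unique ((isMul_mul a).assoc (isMul_mul a') (isMul_mul b'))
  interchange i k hik e e' d d' a b c a' b' c' := by
    have h := (isMul_mul a).interchange hik (isMul_mul b) (isMul_mul c) (isMul_mul a')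
      (isMul_mul b') (isMul_mul c')
    exact h.symm.target_unique ((arr_act _ _).congr (fun _ => by simp) (by rw [G.inv_act]))

end Frame

end FrameSheaf

section FrameButterfly

variable {C : Type u} [Category.{v} C] {J : GrothendieckTopology C} {n : ℕ}
  {H : Fin n → CrossedModule.{w} J} {G : BraidedCrossedModule.{w} J}
  {𝓗 : Fin n → GrStack.{o₁, h₁} J} {𝓖 : BraidedGrStack.{o₂, w} J}
  {πH : ∀ k, Presentation (H k) (𝓗 k)} {πG : BraidedPresentation G 𝓖} {F : NAdditive 𝓗 𝓖}

namespace Frame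

/-- The frame given by a trivialization. -/
noncomputable def triv {S : C} (i : Fin n) (y : ∀ k, Sec (H k).G₀ S) (h : Sec (H i).G₁ S)
    (hy : y i = (H i).bd h) : Frame πH πG F S :=
  ⟨y, 1, inv (πG.eta S) ≫ F.trivV πH i y h hy⟩

theorem arr_triv {T S : C} {f : T ⟶ S} {i : Fin n} {y : ∀ k, Sec (H k).G₀ T}
    {y' : ∀ k, Sec (H k).G₀ S} {h : Sec (H i).G₁ T} {h' : Sec (H i).G₁ S}
    {γ : ∀ k, Sec (H k).G₁ T} (hy : y i = (H i).bd h) (hy' : y' i = (H i).bd h')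
    (hγ : ∀ k, res (H k).G₀ f (y' k) = y k * (H k).bd (γ k)) (e : res (H i).G₁ f h' = h * γ i) :
    Arr f (triv (πH := πH) (πG := πG) (F := F) i y h hy) (triv i y' h' hy') γ 1 := by
  refine ⟨hγ, by simp [triv], ?_⟩
  have h₁ := πG.eta_naturality f
  have key : 𝓖.gr.fib.pre (πG.eta T) (𝓖.gr.fib.post (πG.cart f 1 1 (map_one _))
      (inv (πG.eta S) ≫ F.trivV πH i y' h' hy')) = 𝓖.gr.fib.pre (πG.eta T)
        (𝓖.gr.fib.pre (inv (πG.eta T) ≫ F.trivV πH i y h hy) (F.mapP πH f y y' γ hγ)) := by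
    rw [← FibGpd.pre_post, ← h₁, ← FibGpd.post_comp, IsIso.hom_inv_id_assoc, ← FibGpd.comp_pre,
      IsIso.hom_inv_id_assoc, F.trivV_mapP πH hy hy' hγ e]
  have := congrArg (𝓖.gr.fib.pre (inv (πG.eta T))) key
  rwa [← FibGpd.comp_pre, ← FibGpd.comp_pre, IsIso.inv_hom_id, FibGpd.id_pre, FibGpd.id_pre] at this

theorem IsMul.arr_of_triv_left {S : C} {i : Fin n} {y : ∀ k, Sec (H k).G₀ S} {h : Sec (H i).G₁ S}
    {hy : y i = (H i).bd h} {e m : Frame πH πG F S} (hm : IsMul i (triv i y h hy) e m)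
    {γ : ∀ k, Sec (H k).G₁ S} (h₁ : ∀ k, k ≠ i → γ k = 1) (h₂ : γ i = (H i).act h (e.y i)) :
    Arr (𝟙 S) e m γ 1 := by
  obtain ⟨y', x', φ'⟩ := m
  obtain ⟨hy', hx', h'⟩ := hm
  dsimp only [triv] at hy' hx' h'
  subst hx'
  rw [πG.ident_self, Category.id_comp] at h'
  have hγ : ∀ k, y' k = e.y k * (H k).bd (γ k) := fun k => by
    rcases eq_or_ne k i with rfl | hk
    · rw [← hy'.prod, hy, h₂, (H k).bd_act']
      group
    · rw [h₁ k hk, map_one, mul_one, hy'.right k hk]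
  refine arr_id_iff.2 ⟨hγ, by simp, ?_⟩
  have h₃ : (πG.eta S ▷ πG.obj e.x) ≫ πG.mu 1 e.x ≫ φ' =
      (λ_ _).hom ≫ e.φ ≫ F.mapV πH e.y y' γ hγ := by
    rw [h', whiskerRight_comp_tensorHom_assoc, IsIso.hom_inv_id_assoc, tensorHom_def'_assoc,
      F.trivV_lamV πH hy hy' hγ h₁ h₂, leftUnitor_naturality_assoc]
  rw [← cancel_epi (λ_ (πG.obj e.x)).hom, ← h₃, ← πG.left_unit, Category.assoc, Category.assoc]
  congr 2
  change πG.ident (1 * e.x) e.x _ ≫ πG.ident e.x (1 * e.x) (one_mul _).symm ≫ φ' = φ'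
  rw [← Category.assoc, πG.ident_comp_ident, πG.ident_self, Category.id_comp]

theorem IsMul.arr_of_triv_right {S : C} {i : Fin n} {y : ∀ k, Sec (H k).G₀ S}
    {h : Sec (H i).G₁ S} {hy : y i = (H i).bd h} {e m : Frame πH πG F S}
    (hm : IsMul i e (triv i y h hy) m) {γ : ∀ k, Sec (H k).G₁ S} (h₁ : ∀ k, k ≠ i → γ k = 1)
    (h₂ : γ i = h) : Arr (𝟙 S) e m γ 1 := by
  obtain ⟨y', x', φ'⟩ := m
  obtain ⟨hy', hx', h'⟩ := hm
  dsimp only [triv] at hy' hx' h'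
  subst hx'
  rw [πG.ident_self, Category.id_comp] at h'
  have hγ : ∀ k, y' k = e.y k * (H k).bd (γ k) := fun k => by
    rcases eq_or_ne k i with rfl | hk
    · rw [← hy'.prod, hy, h₂]
    · rw [h₁ k hk, map_one, mul_one, hy'.left k hk]
  refine arr_id_iff.2 ⟨hγ, by simp, ?_⟩
  have h₃ : (πG.obj e.x ◁ πG.eta S) ≫ πG.mu e.x 1 ≫ φ' =
      (ρ_ _).hom ≫ e.φ ≫ F.mapV πH e.y y' γ hγ := by
    rw [h', whiskerLeft_comp_tensorHom_assoc, IsIso.hom_inv_id_assoc, tensorHom_def_assoc,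
      F.lamV_trivV πH hy hy' hγ h₁ h₂, rightUnitor_naturality_assoc]
  rw [← cancel_epi (ρ_ (πG.obj e.x)).hom, ← h₃, ← πG.right_unit, Category.assoc, Category.assoc]
  congr 2
  change πG.ident (e.x * 1) e.x _ ≫ πG.ident e.x (e.x * 1) (mul_one _).symm ≫ φ' = φ'
  rw [← Category.assoc, πG.ident_comp_ident, πG.ident_self, Category.id_comp]

theorem mul_left_cancel {S : C} {i : Fin n} {e d d' m : Frame πH πG F S} (h : IsMul i e d m)
    (h' : IsMul i e d' m) (hy : d.y = d'.y) : d = d' := by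
  obtain ⟨g, rfl, -⟩ := exists_unique_act d d' hy
  have h₁ := (Arr.refl e).mul (arr_act d g) h h' (ε := fun _ => 1) (fun _ _ => rfl)
    (fun _ _ => rfl) (by rw [(H i).one_act, one_mul])
  have h₂ := h₁.target_unique ((arr_act m (G.act 1 d.x * g)))
  have h₃ : G.act 1 d.x * g = 1 := (exists_unique_act m m rfl).unique h₂.symm
    ((arr_act m 1).target_unique (Arr.refl m))
  rw [G.one_act, one_mul] at h₃
  rw [h₃]
  exact ((arr_act d 1).target_unique (Arr.refl d)).symm

theorem isMul_triv_one {S : C} {i : Fin n} {y : ∀ k, Sec (H k).G₀ S} (hy : y i = (H i).bd 1)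
    (e : Frame πH πG F S) (a : AgreeOff i e.y y) : IsMul i e (triv i y 1 hy) e := by
  have h := isMul_mul (πH := πH) (πG := πG) (F := F) (e := e) (e' := triv i y 1 hy) a
  have h₁ := h.arr_of_triv_right (γ := fun _ => 1) (fun _ _ => rfl) rfl
  rwa [h₁.target_unique (Arr.refl e)] at h

theorem Arr.one_br {S : C} {e e' : Frame πH πG F S}
    {x : Sec G.G₀ S} (h : Arr (𝟙 S) e e' (fun _ => 1) (G.act (G.br 1 1) x)) : e = e' := by
  have h₁ : G.br (1 : Sec G.G₀ S) 1 = 1 := by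
    have := G.br_bd (1 : Sec G.G₀ S) 1
    rwa [map_one, inv_one, one_mul, G.act_one] at this
  rw [h₁, G.one_act] at h
  exact (Arr.refl e).target_unique h

theorem triv_mul_triv_one {S : C} {i k : Fin n} (hik : k ≠ i) {y y' z : ∀ k, Sec (H k).G₀ S}
    {hy : y i = (H i).bd 1} {hy' : y' i = (H i).bd 1} (hz : z i = (H i).bd 1)
    {m : Frame πH πG F S} (hm : IsMul k (triv i y 1 hy) (triv i y' 1 hy') m) (e : m.y = z) :
    m = triv i z 1 hz := by
  subst e
  have a : ∀ (t : ∀ k, Sec (H k).G₀ S) (ht : t i = (H i).bd 1),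
      IsMul i (triv (πH := πH) (πG := πG) (F := F) i t 1 ht) (triv i t 1 ht) (triv i t 1 ht) :=
    fun t ht => isMul_triv_one ht _ fun _ _ => rfl
  have hmi : m.y i = 1 := by rw [hz, map_one]
  refine mul_left_cancel (i := i) (e := m) (m := m) ?_ (isMul_triv_one hz _ fun _ _ => rfl) rfl
  have h₁ := isMul_mul (πH := πH) (πG := πG) (F := F) (i := i) (e := m) (e' := m) fun _ _ => rfl
  rcases lt_or_gt_of_ne hik with h | h
  · have := (hm.interchange h hm h₁ (a y hy) (a y' hy') hm).one_br
    rwa [this] at h₁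
  · have := ((a y hy).interchange h (a y' hy') hm hm hm h₁).one_br
    rwa [← this] at h₁

variable (πH πG F) in
/-- The butterfly of frames of an additive functor. -/
noncomputable def butterfly : NButterfly H G where
  toNExtension := extension πH πG F
  s i y h e := triv i y h e
  s_res f i y h e e' := ((arr_triv (γ := fun _ => 1) e' e (fun k => by simp) (by simp)).eq_res).symm
  p_s _ _ _ _ := rfl
  j_s _ _ _ _ := rfl
  s_mul_same {S} i y y' h h' e e' a e'' := by
    obtain ⟨γ, hγ, hγ'⟩ := exists_tuple (P := fun k => Sec (H k).G₁ S) i h' fun _ _ => 1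
    refine ((isMul_mul a).arr_of_triv_right hγ' hγ).target_unique
      (arr_triv e e'' (fun k => ?_) (by rw [res_id, hγ]))
    rw [res_id]
    rcases eq_or_ne k i with rfl | hk
    · rw [Function.update_self, hγ, e']
    · rw [Function.update_of_ne hk, hγ' k hk, map_one, mul_one]
  s_mul_other {S} i k hik y y' h e e' a e'' := by
    obtain ⟨γ, hγ, hγ'⟩ := exists_tuple (P := fun k => Sec (H k).G₁ S) i h fun _ _ => 1
    have eta : ∀ (t : ∀ k, Sec (H k).G₀ S), t i = (H i).bd h →
        ∃ t₀ : ∀ k, Sec (H k).G₀ S, t₀ i = (H i).bd 1 ∧ (∀ k, k ≠ i → t₀ k = t k) ∧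
          ∀ k, res (H k).G₀ (𝟙 S) (t k) = t₀ k * (H k).bd (γ k) := by
      intro t ht
      obtain ⟨t₀, h₀, h₀'⟩ := exists_tuple (P := fun k => Sec (H k).G₀ S) i 1 fun k _ => t k
      refine ⟨t₀, by rw [h₀, map_one], h₀', fun k => ?_⟩
      rw [res_id]
      rcases eq_or_ne k i with rfl | hk
      · rw [h₀, one_mul, hγ, ht]
      · rw [h₀' k hk, hγ' k hk, map_one, mul_one]
    obtain ⟨y₀, h₁, h₁', h₁''⟩ := eta y e
    obtain ⟨y₀', h₂, h₂', h₂''⟩ := eta y' e'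
    obtain ⟨z₀, h₃, h₃', h₃''⟩ := eta _ e''
    have a₀ : AgreeOff k y₀ y₀' := fun l hl => by
      rcases eq_or_ne l i with rfl | hli
      · rw [h₁, h₂]
      · rw [h₁' l hli, h₂' l hli]
        exact a l hl
    have hm := isMul_mul (πH := πH) (πG := πG) (F := F) (e := triv i y₀ 1 h₁)
      (e' := triv i y₀' 1 h₂) a₀
    have hz : (mul k (triv (πH := πH) (πG := πG) (F := F) i y₀ 1 h₁) (triv i y₀' 1 h₂) a₀).y =
        z₀ := by
      rw [← hm.hy.eq_update]
      funext l
      change Function.update y₀ k (y₀ k * y₀' k) l = z₀ l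
      rcases eq_or_ne l k with rfl | hl
      · rw [Function.update_self, h₁' l hik, h₂' l hik, h₃' l hik, Function.update_self]
      · rw [Function.update_of_ne hl]
        rcases eq_or_ne l i with rfl | hli
        · rw [h₁, h₃]
        · rw [h₁' l hli, h₃' l hli, Function.update_of_ne hl]
    have a₁ := (arr_triv (πH := πH) (πG := πG) (F := F) (h' := h) h₁ e h₁''
      (by rw [res_id, hγ, one_mul])).mul
      (arr_triv (h' := h) h₂ e' h₂'' (by rw [res_id, hγ, one_mul])) hm (isMul_mul a) (ε := γ)
      (fun _ _ => rfl) (fun _ _ => rfl) (by rw [hγ' k hik, (H k).one_act, one_mul])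
    rw [triv_mul_triv_one hik h₃ hm hz] at a₁
    exact (a₁.congr (fun _ => rfl) (by rw [G.one_act, one_mul])).target_unique
      (arr_triv h₃ e'' h₃'' (by rw [res_id, hγ, one_mul]))
  restriction i k hik y h h' e e' := by
    unfold triv
    rw [F.trivV_restriction πH hik e e']
  compatibility {S} i y y' h x e e' a a' := by
    obtain ⟨γ, hγ, hγ'⟩ := exists_tuple (P := fun k => Sec (H k).G₁ S) i
      ((H i).act h (Frame.y x i)) fun _ _ => 1
    exact ((isMul_mul a).arr_of_triv_left hγ' hγ).target_unique
      ((isMul_mul a').arr_of_triv_right hγ' hγ)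

variable (πH πG F) in
/-- The comparison of an additive functor and its butterfly of frames. -/
noncomputable def comparison : Comparison πH πG (butterfly πH πG F) F where
  app e := e.φ
  app_res f e := (Frame.arr_res f e).eq
  app_act e g := by
    obtain ⟨hy, hx, h⟩ := arr_id_iff.1 (arr_act e g)
    exact h
  app_mul i e e' a z hz m hm hm' := by
    have h := isMul_mul (πH := πH) (πG := πG) (F := F) a
    have hm₁ : OnlyAt i m ((πH i).mu (e.y i) (e'.y i)) :=
      ⟨hz.prod, by rw [h.hy.prod]; rfl, hm', NAdditive.mul_obj_eq πH h.hy hz, hm⟩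
    exact (congrArg (fun t => _ ≫ t) (F.lamV_eq πH h.hy hz hm₁).symm).trans h.eq.symm
  app_s i e y h hy a γ hγ hγ₁ hγ₂ := by
    obtain ⟨hy, hx, h⟩ := arr_id_iff.1 ((isMul_mul a).arr_of_triv_right hγ₂ hγ₁)
    exact h.symm

end Frame

end FrameButterfly

/-! ## Morphisms of butterflies are isomorphisms -/

namespace NButterfly

variable {C : Type u} [Category.{v} C] {J : GrothendieckTopology C} {n : ℕ}
  {H : Fin n → CrossedModule.{w} J} {G : BraidedCrossedModule.{w} J} {B B' : NButterfly H G}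

theorem comp_hom_app {B'' : NButterfly H G} (ψ : B ⟶ B') (ψ' : B' ⟶ B'') {S : C} (e : B.El S) :
    (ψ ≫ ψ').hom.app (op S) e = ψ'.hom.app (op S) (ψ.hom.app (op S) e) :=
  rfl

theorem id_hom_app {S : C} (e : B.El S) : (Hom.hom (𝟙 B)).app (op S) e = e :=
  rfl

theorem hom_ext {ψ ψ' : B ⟶ B'}
    (h : ∀ {S : C} (e : B.El S), ψ.hom.app (op S) e = ψ'.hom.app (op S) e) : ψ = ψ' :=
  Hom.ext (by ext S e; exact h e)

theorem hom_res (ψ : B ⟶ B') {T S : C} (f : T ⟶ S) (e : B.El S) :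
    ψ.hom.app (op T) (B.E.map f.op e) = B'.E.map f.op (ψ.hom.app (op S) e) :=
  NatTrans.naturality_apply ψ.hom f.op e

theorem hom_injective (ψ : B ⟶ B') {S : C} : Function.Injective (ψ.hom.app (op S)) := by
  intro e e' h
  have hp : B.p e = B.p e' := by rw [← ψ.p_hom, h, ψ.p_hom]
  obtain ⟨g, rfl⟩ := B.exists_act hp
  rw [ψ.act_hom] at h
  rw [B'.eq_one_of_act h.symm, B.act_one]

theorem hom_surjective (ψ : B ⟶ B') {S : C} : Function.Surjective (ψ.hom.app (op S)) := by
  intro e'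
  obtain ⟨R, hR, h⟩ := B.locally_nonempty (B'.p e')
  have h' : ∀ (T : C) (f : T ⟶ S) (_ : R f), ∃ e : B.El T, ψ.hom.app (op T) e = B'.E.map f.op e' := by
    intro T f hf
    obtain ⟨e, he⟩ := h f hf
    obtain ⟨g, hg⟩ := B'.exists_act (e := ψ.hom.app (op T) e) (e' := B'.E.map f.op e')
      (funext fun k => by rw [ψ.p_hom, he, B'.p_res])
    exact ⟨B.act e g, by rw [ψ.act_hom, hg]⟩
  choose d hd using h'
  obtain ⟨e, he, -⟩ := B.isSheaf R hR d ((Presieve.compatible_iff_sieveCompatible _).2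
    fun T T' f g hf => hom_injective ψ (by
      rw [hd, B'.map_comp, ← hd T f hf]
      exact (hom_res ψ g (d T f hf)).symm))
  refine ⟨e, B'.ext_of_loc ⟨R, hR, fun T f hf => ?_⟩⟩
  exact (hom_res ψ f e).symm.trans ((congrArg _ (he f hf)).trans (hd T f hf))

instance isGroupoid : IsGroupoid (NButterfly H G) where
  all_isIso {B B'} ψ := by
    have h : ∀ {S : C} (e' : B'.El S), ∃ e, ψ.hom.app (op S) e = e' :=
      fun {S} e' => hom_surjective ψ e'
    choose i hi using @h
    have inj : ∀ {S : C} {e e' : B.El S}, ψ.hom.app (op S) e = ψ.hom.app (op S) e' → e = e' :=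
      fun h => hom_injective ψ h
    let χ : B' ⟶ B :=
      { hom :=
          { app := fun S => ↾fun e' => i (S := S.unop) e'
            naturality := fun S T f => by
              ext e'
              apply inj (S := T.unop)
              exact (hi (S := T.unop) (B'.E.map f e')).trans
                ((congrArg (B'.E.map f) (hi (S := S.unop) e').symm).trans
                  (hom_res ψ f.unop (i (S := S.unop) e')).symm) }
        p_hom := fun {S} e => by
          change B.p (i e) = _
          rw [← ψ.p_hom, hi]
        act_hom := fun {S} e g => by
          apply inj
          change ψ.hom.app (op S) (i (B'.act e g)) = ψ.hom.app (op S) (B.act (i e) g)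
          rw [ψ.act_hom, hi, hi]
        j_hom := fun {S} e => by
          change B.j (i e) = _
          rw [← ψ.j_hom, hi]
        mul_hom := fun {S} k e e' a a' => by
          apply inj
          change AgreeOff k (B.p (i e)) (B.p (i e')) at a'
          have a'' : AgreeOff k (B'.p (ψ.hom.app (op S) (i e))) (B'.p (ψ.hom.app (op S) (i e'))) := by
            rwa [hi, hi]
          change ψ.hom.app (op S) (i (B'.mul k e e' a)) =
            ψ.hom.app (op S) (B.mul k (i e) (i e') a')
          rw [ψ.mul_hom k _ _ a' a'', hi]
          exact B'.mul_congr (hi _).symm (hi _).symm _ _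
        s_hom := fun {S} k y h e => by
          apply inj
          change ψ.hom.app (op S) (i (B'.s k y h e)) = ψ.hom.app (op S) (B.s k y h e)
          rw [ψ.s_hom, hi] }
    exact ⟨χ, hom_ext fun e => inj (hi _), hom_ext fun e => hi _⟩

theorem inv_hom_app (ψ : B ⟶ B') {S : C} (e : B'.El S) :
    ψ.hom.app (op S) ((inv ψ).hom.app (op S) e) = e := by
  rw [← comp_hom_app, IsIso.inv_hom_id]
  rfl

end NButterfly

/-! ## Comparisons and morphisms to the butterfly of frames -/

section Lift

variable {C : Type u} [Category.{v} C] {J : GrothendieckTopology C} {n : ℕ}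
  {H : Fin n → CrossedModule.{w} J} {G : BraidedCrossedModule.{w} J}
  {𝓗 : Fin n → GrStack.{o₁, h₁} J} {𝓖 : BraidedGrStack.{o₂, w} J}
  {πH : ∀ k, Presentation (H k) (𝓗 k)} {πG : BraidedPresentation G 𝓖}
  {B B' : NButterfly H G} {F : NAdditive 𝓗 𝓖}

theorem NButterfly.mulAt_p {S : C} {i : Fin n} {e e' : B.El S} (a : AgreeOff i (B.p e) (B.p e')) :
    MulAt i (B.p e) (B.p e') (B.p (B.mul i e e' a)) := by
  rw [B.p_mul]
  exact MulAt.update a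

/-- A frame with prescribed source and target. -/
theorem Frame.mk_eq {S : C} (e : Frame πH πG F S) {y : ∀ k, Sec (H k).G₀ S} {x : Sec G.G₀ S}
    (hy : e.y = y) (hx : x = e.x) :
    (⟨y, x, πG.ident _ _ hx ≫ e.φ ≫ F.ident πH _ _ hy⟩ : Frame πH πG F S) = e := by
  subst hy hx
  rw [πG.ident_self, F.ident_self, Category.comp_id, Category.id_comp]

theorem Frame.φ_eq_of_eq {S : C} {e e' : Frame πH πG F S} (h : e = e') (hy : e'.y = e.y)
    (hx : e.x = e'.x) : e.φ = πG.ident _ _ hx ≫ e'.φ ≫ F.ident πH _ _ hy := by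
  subst h
  rw [πG.ident_self, F.ident_self, Category.comp_id, Category.id_comp]

namespace Comparison

/-- The frame at a point. -/
def frame (c : Comparison πH πG B F) {S : C} (e : B.El S) : Frame πH πG F S :=
  ⟨B.p e, B.j e, c.app e⟩

variable (c : Comparison πH πG B F)

theorem frame_res {T S : C} (f : T ⟶ S) (e : B.El S) :
    Frame.Arr f (c.frame (B.E.map f.op e)) (c.frame e) (fun _ => 1) 1 :=
  ⟨fun k => by simp [frame, B.p_res], by simp [frame, B.j_res], c.app_res f e⟩

theorem frame_act {S : C} (e : B.El S) (g : Sec G.G₁ S) :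
    c.frame (B.act e g) = (c.frame e).act g :=
  Frame.Arr.target_unique (e := c.frame e) (Frame.arr_id_iff.2
    ⟨fun k => by simp [frame, B.p_act], B.j_act e g, c.app_act e g⟩) (Frame.arr_act _ g)

theorem frame_mul {S : C} (i : Fin n) (e e' : B.El S) (a : AgreeOff i (B.p e) (B.p e')) :
    Frame.IsMul i (c.frame e) (c.frame e') (c.frame (B.mul i e e' a)) := by
  have h := NButterfly.mulAt_p a
  refine ⟨h, (B.j_mul i e e' a).symm, ?_⟩
  obtain ⟨t, P, m, hm, e₁⟩ := F.exists_lamV_eq πH h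
  exact (c.app_mul i e e' a t P m hm.off hm.eq).symm.trans (congrArg (fun t => _ ≫ t) e₁.symm)

theorem frame_mul_s {S : C} (i : Fin n) (e : B.El S) {y : ∀ k, Sec (H k).G₀ S}
    {h : Sec (H i).G₁ S} (hy : y i = (H i).bd h) (a : AgreeOff i (B.p e) (B.p (B.s i y h hy)))
    {γ : ∀ k, Sec (H k).G₁ S} (h₁ : ∀ k, k ≠ i → γ k = 1) (h₂ : γ i = h) :
    Frame.Arr (𝟙 S) (c.frame e) (c.frame (B.mul i e (B.s i y h hy) a)) γ 1 := by
  have hγ : ∀ k, B.p (B.mul i e (B.s i y h hy) a) k = B.p e k * (H k).bd (γ k) := fun k => by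
    rw [B.p_mul, B.p_s]
    rcases eq_or_ne k i with rfl | hk
    · rw [Function.update_self, h₂, hy]
    · rw [Function.update_of_ne hk, h₁ k hk, map_one, mul_one]
  exact Frame.arr_id_iff.2 ⟨hγ, by simp [frame, B.j_mul, B.j_s],
    (c.app_s i e y h hy a γ hγ h₂ h₁).symm⟩

/-- A comparison is a morphism to the butterfly of frames. -/
noncomputable def toFrames : B ⟶ Frame.butterfly πH πG F :=
  NButterfly.Hom.mk (B' := Frame.butterfly πH πG F)
    { app := fun S => ↾fun e => c.frame (S := S.unop) e
      naturality := fun S T f => by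
        ext e
        exact (c.frame_res f.unop e).eq_res }
    (fun _ => rfl) (fun e g => c.frame_act e g) (fun _ => rfl)
    (fun i e e' a a' => (c.frame_mul i e e' a).unique (Frame.isMul_mul a'))
    (fun {S} i y h hy => by
      obtain ⟨γ, hγ, hγ'⟩ := exists_tuple (P := fun k => Sec (H k).G₁ S) i h fun _ _ => 1
      have a : AgreeOff i (B.p (B.s i y h hy)) (B.p (B.s i y h hy)) := fun _ _ => rfl
      have h₁ := c.frame_mul i _ _ a
      have h₂ : AgreeOff i (c.frame (B.s i y h hy)).y
          (Frame.triv (πH := πH) (πG := πG) (F := F) i y h hy).y := fun k _ =>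
        congrFun (B.p_s i y h hy) k
      have h₃ := Frame.isMul_mul h₂
      rw [← (c.frame_mul_s i _ hy a hγ' hγ).target_unique (h₃.arr_of_triv_right hγ' hγ)] at h₃
      exact Frame.mul_left_cancel h₁ h₃ (B.p_s i y h hy))

/-- Comparisons of two butterflies with the same functor differ by a morphism of butterflies. -/
theorem exists_lift (c : Comparison πH πG B F) (c' : Comparison πH πG B' F) :
    ∃ ψ : B ⟶ B', ∀ {S : C} (e : B.El S), c'.frame (ψ.hom.app (op S) e) = c.frame e :=
  ⟨c.toFrames ≫ inv c'.toFrames, fun e => NButterfly.inv_hom_app c'.toFrames (c.frame e)⟩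

theorem frame_injective (c : Comparison πH πG B F) {S : C} {e e' : B.El S}
    (h : c.frame e = c.frame e') : e = e' :=
  NButterfly.hom_injective c.toFrames h

theorem lift_unique (c : Comparison πH πG B' F) {ψ ψ' : B ⟶ B'}
    (h : ∀ {S : C} (e : B.El S),
      c.frame (ψ.hom.app (op S) e) = c.frame (ψ'.hom.app (op S) e)) : ψ = ψ' :=
  NButterfly.hom_ext fun e => c.frame_injective (h e)

end Comparison

namespace Frame

variable (κ : B ⟶ butterfly πH πG F)

/-- The frame at a point given by a morphism to the butterfly of frames. -/
noncomputable def ofHom {S : C} (e : B.El S) : Frame πH πG F S :=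
  ⟨B.p e, B.j e, πG.ident _ _ (κ.j_hom e).symm ≫ φ (κ.hom.app (op S) e) ≫
    F.ident πH _ _ (κ.p_hom e)⟩

theorem ofHom_eq {S : C} (e : B.El S) : ofHom κ e = κ.hom.app (op S) e :=
  mk_eq (κ.hom.app (op S) e) (κ.p_hom e) (κ.j_hom e).symm

/-- Morphisms to the butterfly of frames are comparisons. -/
noncomputable def comparisonOfHom : Comparison πH πG B F where
  app e := (ofHom κ e).φ
  app_res {T S} f e := by
    have a : Arr f (ofHom κ (B.E.map f.op e)) (ofHom κ e) (fun _ => 1) 1 := by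
      rw [ofHom_eq, ofHom_eq, NButterfly.hom_res κ]
      exact arr_res f _
    exact a.eq
  app_act {S} e g := by
    have a : Arr (𝟙 S) (ofHom κ e) (ofHom κ (B.act e g)) (fun _ => 1) g := by
      rw [ofHom_eq, ofHom_eq, κ.act_hom]
      exact arr_act _ g
    obtain ⟨hy, hx, h⟩ := arr_id_iff.1 a
    exact h
  app_mul {S} i e e' a z hz m hm hm' := by
    have h : IsMul i (ofHom κ e) (ofHom κ e') (ofHom κ (B.mul i e e' a)) := by
      have a' : AgreeOff i (y (κ.hom.app (op S) e)) (y (κ.hom.app (op S) e')) := by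
        intro k hk
        have h₁ := congrFun (κ.p_hom e) k
        have h₂ := congrFun (κ.p_hom e') k
        exact h₁.trans ((a k hk).trans h₂.symm)
      rw [ofHom_eq, ofHom_eq, ofHom_eq, κ.mul_hom i e e' a a']
      exact isMul_mul a'
    have hm₁ : OnlyAt i m ((πH i).mu (B.p e i) (B.p e' i)) :=
      ⟨hz.prod, by rw [B.p_mul, Function.update_self], hm', NAdditive.mul_obj_eq πH h.hy hz, hm⟩
    exact (congrArg (fun t => _ ≫ t) (F.lamV_eq πH h.hy hz hm₁).symm).trans h.eq.symm
  app_s {S} i e y h hy a γ hγ hγ₁ hγ₂ := by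
    have h : Arr (𝟙 S) (ofHom κ e) (ofHom κ (B.mul i e (B.s i y h hy) a)) γ 1 := by
      have a' : AgreeOff i (Frame.y (κ.hom.app (op S) e))
          (Frame.y (κ.hom.app (op S) (B.s i y h hy))) := by
        intro k hk
        have h₁ := congrFun (κ.p_hom e) k
        have h₂ := congrFun (κ.p_hom (B.s i y h hy)) k
        exact h₁.trans ((a k hk).trans h₂.symm)
      rw [ofHom_eq, ofHom_eq, κ.mul_hom i _ _ a a']
      have h₃ := isMul_mul a'
      change Arr (𝟙 S) _ (mul i (κ.hom.app (op S) e) (κ.hom.app (op S) (B.s i y h hy)) a') γ 1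
      generalize mul i (κ.hom.app (op S) e) (κ.hom.app (op S) (B.s i y h hy)) a' = m at h₃ ⊢
      rw [κ.s_hom] at h₃
      exact h₃.arr_of_triv_right hγ₂ hγ₁
    obtain ⟨hy, hx, h⟩ := arr_id_iff.1 h
    exact h.symm

end Frame

namespace Comparison

/-- The composite of a comparison with a morphism of butterflies. -/
noncomputable def precomp (c : Comparison πH πG B' F) (ψ : B ⟶ B') : Comparison πH πG B F :=
  Frame.comparisonOfHom (ψ ≫ c.toFrames)

theorem frame_precomp (c : Comparison πH πG B' F) (ψ : B ⟶ B') {S : C} (e : B.El S) :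
    (c.precomp ψ).frame e = c.frame (ψ.hom.app (op S) e) :=
  Frame.ofHom_eq (ψ ≫ c.toFrames) e

end Comparison

end Lift

/-! ## Operations on charts -/

section Places

variable {C : Type u} [Category.{v} C] {J : GrothendieckTopology C} {𝓧 : GrStack.{o, h} J}
  {K : CrossedModule.{w} J} (π : Presentation K 𝓧)

theorem FibGpd.pre_cancel {𝓨 : FibGpd.{o, h} C} {S T : C} {f : S ⟶ T} {x y : 𝓨.Ob S}
    {z : 𝓨.Ob T} (a : x ⟶ y) {φ ψ : 𝓨.Hom f y z} (e : 𝓨.pre a φ = 𝓨.pre a ψ) : φ = ψ := by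
  have := congrArg (𝓨.pre (inv a)) e
  rwa [← comp_pre, ← comp_pre, IsIso.inv_hom_id, id_pre, id_pre] at this

theorem FibGpd.comp_pre_assoc {𝓨 : FibGpd.{o, h} C} {R S T : C} {f : R ⟶ S} {g : S ⟶ T} {k : R ⟶ T}
    {x y : 𝓨.Ob R} {z : 𝓨.Ob S} {t : 𝓨.Ob T} (a : x ⟶ y) (φ : 𝓨.Hom f y z) (ψ : 𝓨.Hom g z t)
    (w : f ≫ g = k) : 𝓨.pre a (𝓨.comp φ ψ w) = 𝓨.comp (𝓨.pre a φ) ψ w :=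
  (𝓨.assoc _ _ _ _ _ _ _).symm

theorem FibGpd.post_comp_assoc {𝓨 : FibGpd.{o, h} C} {R S T : C} {f : R ⟶ S} {g : S ⟶ T} {k : R ⟶ T}
    {x : 𝓨.Ob R} {y z : 𝓨.Ob S} {t : 𝓨.Ob T} (φ : 𝓨.Hom f x y) (a : y ⟶ z) (ψ : 𝓨.Hom g z t)
    (w : f ≫ g = k) : 𝓨.comp (𝓨.post φ a) ψ w = 𝓨.comp φ (𝓨.pre a ψ) w :=
  𝓨.assoc _ _ _ _ _ _ _

theorem Presentation.prod_arr {T' T S : C} {r : T' ⟶ T} {f : T ⟶ S} {f' : T' ⟶ S} {w : r ≫ f = f'}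
    {X Y Z : 𝓧.fib.Ob S} (hZ : Z = X ⊗ Y) {u v m : Sec K.G₀ T} {u' v' m' : Sec K.G₀ T'}
    {hm : u * v = m} {hm' : u' * v' = m'} {a : 𝓧.fib.Hom f (π.obj u) X}
    {b : 𝓧.fib.Hom f (π.obj v) Y} {c : 𝓧.fib.Hom f (π.obj m) Z} {a' : 𝓧.fib.Hom f' (π.obj u') X}
    {b' : 𝓧.fib.Hom f' (π.obj v') Y} {c' : 𝓧.fib.Hom f' (π.obj m') Z}
    (hc : HEq (𝓧.fib.pre (π.mu u v ≫ π.ident _ _ hm) c) (𝓧.tens a b))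
    (hc' : HEq (𝓧.fib.pre (π.mu u' v' ≫ π.ident _ _ hm') c') (𝓧.tens a' b'))
    {γ δ ε : Sec K.G₁ T'} (e₁) (e₂) (e₃) (h₁ : 𝓧.fib.comp (π.map r u' u γ e₁) a w = a')
    (h₂ : 𝓧.fib.comp (π.map r v' v δ e₂) b w = b') (hε : ε = K.act γ v' * δ) :
    𝓧.fib.comp (π.map r m' m ε e₃) c w = c' := by
  subst hZ hm hm' hε
  rw [π.ident_self, Category.comp_id] at hc hc'
  have hc := eq_of_heq hc
  have hc' := eq_of_heq hc'
  refine FibGpd.pre_cancel (π.mu u' v') ?_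
  rw [FibGpd.comp_pre_assoc, ← π.mu_naturality r _ _ _ _ γ δ e₁ e₂ e₃, FibGpd.post_comp_assoc, hc,
    hc', ← 𝓧.tens_comp, h₁, h₂]

theorem Presentation.arr_of_heq {T' T S : C} {r : T' ⟶ T} {f : T ⟶ S} {f' : T' ⟶ S}
    {w : r ≫ f = f'} {X X₁ : 𝓧.fib.Ob S} (hX : X = X₁) {u u₁ : Sec K.G₀ T} {u' u₁' : Sec K.G₀ T'}
    (hu : u = u₁) (hu' : u' = u₁') {a : 𝓧.fib.Hom f (π.obj u) X} {a' : 𝓧.fib.Hom f' (π.obj u') X}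
    {a₁ : 𝓧.fib.Hom f (π.obj u₁) X₁} {a₁' : 𝓧.fib.Hom f' (π.obj u₁') X₁} (ha : HEq a a₁)
    (ha' : HEq a' a₁') {γ γ₁ : Sec K.G₁ T'} {e₁} {e₂}
    (h : 𝓧.fib.comp (π.map r u' u γ e₁) a w = a') :
    𝓧.fib.comp (π.map r u₁' u₁ γ₁ e₂) a₁ w = a₁' ↔ γ = γ₁ := by
  subst hX hu hu' ha ha'
  constructor
  · intro h'
    exact π.map_inj (FibGpd.comp_cancel (h.trans h'.symm))
  · rintro rfl
    exact h

theorem Presentation.prod_assoc {T S : C} {f : T ⟶ S} {X Y Z XY YZ L R : 𝓧.fib.Ob S}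
    (h₁ : XY = X ⊗ Y) (h₂ : YZ = Y ⊗ Z) (h₃ : L = XY ⊗ Z) (h₄ : R = X ⊗ YZ)
    {u v t uv vt m : Sec K.G₀ T}
    {huv : u * v = uv} {hvt : v * t = vt} {hm : uv * t = m} {hm' : u * vt = m}
    {a : 𝓧.fib.Hom f (π.obj u) X} {b : 𝓧.fib.Hom f (π.obj v) Y} {c : 𝓧.fib.Hom f (π.obj t) Z}
    {ab : 𝓧.fib.Hom f (π.obj uv) XY} {bc : 𝓧.fib.Hom f (π.obj vt) YZ}
    {l : 𝓧.fib.Hom f (π.obj m) L} {A : L ⟶ R} (hA : HEq A (α_ X Y Z).hom)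
    (e₁ : HEq (𝓧.fib.pre (π.mu u v ≫ π.ident _ _ huv) ab) (𝓧.tens a b))
    (e₂ : HEq (𝓧.fib.pre (π.mu v t ≫ π.ident _ _ hvt) bc) (𝓧.tens b c))
    (e₃ : HEq (𝓧.fib.pre (π.mu uv t ≫ π.ident _ _ hm) l) (𝓧.tens ab c)) :
    HEq (𝓧.fib.pre (π.mu u vt ≫ π.ident _ _ hm') (𝓧.fib.post l A)) (𝓧.tens a bc) := by
  subst h₁ h₂ h₃ h₄ huv hvt hA hm
  rw [π.ident_self, Category.comp_id] at e₁ e₂ e₃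
  have e₁ := eq_of_heq e₁
  have e₂ := eq_of_heq e₂
  have e₃ := eq_of_heq e₃
  refine heq_of_eq (FibGpd.pre_cancel (π.obj u ◁ π.mu v t) ?_)
  have e₄ : 𝓧.fib.pre (π.obj u ◁ π.mu v t) (𝓧.tens a bc) = 𝓧.tens a (𝓧.tens b c) := by
    rw [← id_tensorHom, ← GrStack.tens_pre, FibGpd.id_pre, e₂]
  have e₅ : 𝓧.fib.pre (π.mu u v ▷ π.obj t) (𝓧.tens ab c) = 𝓧.tens (𝓧.tens a b) c := by
    rw [← tensorHom_id, ← GrStack.tens_pre, FibGpd.id_pre, e₁]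
  rw [e₄]
  refine FibGpd.pre_cancel (α_ _ _ _).hom ?_
  rw [← 𝓧.associator_naturality, ← e₅, ← e₃, ← FibGpd.comp_pre, ← FibGpd.comp_pre,
    ← FibGpd.comp_pre, FibGpd.pre_post]
  congr 1
  rw [π.mu_assoc_left]
  simp only [Category.assoc]

theorem Presentation.prod_inj {T S : C} {f : T ⟶ S} {X Y Z X' Y' Z' : 𝓧.fib.Ob S} (hX : X = X')
    (hY : Y = Y') (hZ : Z = X ⊗ Y) (hZ' : Z' = X' ⊗ Y') {u v m u' v' m' : Sec K.G₀ T} (hu : u = u')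
    (hv : v = v') {hm : u * v = m} {hm' : u' * v' = m'} {a : 𝓧.fib.Hom f (π.obj u) X}
    {b : 𝓧.fib.Hom f (π.obj v) Y} {c : 𝓧.fib.Hom f (π.obj m) Z} {a' : 𝓧.fib.Hom f (π.obj u') X'}
    {b' : 𝓧.fib.Hom f (π.obj v') Y'} {c' : 𝓧.fib.Hom f (π.obj m') Z'} (ha : HEq a a')
    (hb : HEq b b') (hc : HEq (𝓧.fib.pre (π.mu u v ≫ π.ident _ _ hm) c) (𝓧.tens a b))
    (hc' : HEq (𝓧.fib.pre (π.mu u' v' ≫ π.ident _ _ hm') c') (𝓧.tens a' b')) : HEq c c' := by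
  subst hX hY hZ hZ' hu hv hm hm' ha hb
  exact heq_of_eq (FibGpd.pre_cancel _ (eq_of_heq (hc.trans hc'.symm)))

theorem Presentation.unit_arr {T' T S : C} {r : T' ⟶ T} {f : T ⟶ S} {f' : T' ⟶ S} {w : r ≫ f = f'}
    {X : 𝓧.fib.Ob S} (hX : X = 𝟙_ _) {u : Sec K.G₀ T} {u' : Sec K.G₀ T'} {hu : 1 = u} {hu' : 1 = u'}
    {a : 𝓧.fib.Hom f (π.obj u) X} {a' : 𝓧.fib.Hom f' (π.obj u') X}
    (ha : HEq (𝓧.fib.pre (π.eta T ≫ π.ident _ _ hu) a) (𝓧.unitMap f))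
    (ha' : HEq (𝓧.fib.pre (π.eta T' ≫ π.ident _ _ hu') a') (𝓧.unitMap f')) {γ : Sec K.G₁ T'} {e}
    (h : 𝓧.fib.comp (π.map r u' u γ e) a w = a') : γ = 1 := by
  subst hX hu hu'
  rw [π.ident_self, Category.comp_id] at ha ha'
  have ha := eq_of_heq ha
  have ha' := eq_of_heq ha'
  have h' : 𝓧.fib.comp (π.cart r 1 1 (map_one _)) a w = a' := by
    refine FibGpd.pre_cancel (π.eta T') ?_
    rw [FibGpd.comp_pre_assoc, ← π.eta_naturality, FibGpd.post_comp_assoc, ha, ha', 𝓧.unitMap_comp]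
  exact π.map_inj (FibGpd.comp_cancel (h.trans h'.symm))

theorem Presentation.unit_prod_left {T S : C} {f : T ⟶ S} {X Y Z : 𝓧.fib.Ob S} (hX : X = 𝟙_ _)
    (hZ : Z = X ⊗ Y) {u v m : Sec K.G₀ T} {hu : 1 = u} {hm : u * v = m}
    {a : 𝓧.fib.Hom f (π.obj u) X} {b : 𝓧.fib.Hom f (π.obj v) Y} {c : 𝓧.fib.Hom f (π.obj m) Z}
    (ha : HEq (𝓧.fib.pre (π.eta T ≫ π.ident _ _ hu) a) (𝓧.unitMap f))
    (hc : HEq (𝓧.fib.pre (π.mu u v ≫ π.ident _ _ hm) c) (𝓧.tens a b)) {L : Z ⟶ Y}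
    (hL : HEq L (λ_ Y).hom) (e : v = m) :
    𝓧.fib.pre (π.ident v m e) (𝓧.fib.post c L) = b := by
  subst hX hZ hu hL
  subst hm
  rw [π.ident_self, Category.comp_id] at ha hc
  have ha := eq_of_heq ha
  have hc := eq_of_heq hc
  refine FibGpd.pre_cancel (λ_ _).hom ?_
  have e₅ := 𝓧.leftUnitor_naturality b
  rw [← ha] at e₅
  refine Eq.trans ?_ e₅
  have e₄ : 𝓧.tens (𝓧.fib.pre (π.eta T) a) b = 𝓧.fib.pre (π.eta T ▷ π.obj v) (𝓧.tens a b) := by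
    rw [← tensorHom_id, ← GrStack.tens_pre, FibGpd.id_pre]
  rw [e₄, ← hc, ← π.left_unit, FibGpd.pre_post, FibGpd.pre_post, ← FibGpd.comp_pre,
    ← FibGpd.comp_pre]
  congr 1
  rw [Category.assoc, Category.assoc, π.ident_comp_ident, π.ident_self, Category.comp_id]

theorem Presentation.unit_prod_right {T S : C} {f : T ⟶ S} {X Y Z : 𝓧.fib.Ob S} (hY : Y = 𝟙_ _)
    (hZ : Z = X ⊗ Y) {u v m : Sec K.G₀ T} {hv : 1 = v} {hm : u * v = m}
    {a : 𝓧.fib.Hom f (π.obj u) X} {b : 𝓧.fib.Hom f (π.obj v) Y} {c : 𝓧.fib.Hom f (π.obj m) Z}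
    (hb : HEq (𝓧.fib.pre (π.eta T ≫ π.ident _ _ hv) b) (𝓧.unitMap f))
    (hc : HEq (𝓧.fib.pre (π.mu u v ≫ π.ident _ _ hm) c) (𝓧.tens a b)) {L : Z ⟶ X}
    (hL : HEq L (ρ_ X).hom) (e : u = m) :
    𝓧.fib.pre (π.ident u m e) (𝓧.fib.post c L) = a := by
  subst hY hZ hv hL
  subst hm
  rw [π.ident_self, Category.comp_id] at hb hc
  have hb := eq_of_heq hb
  have hc := eq_of_heq hc
  refine FibGpd.pre_cancel (ρ_ _).hom ?_
  have e₅ := 𝓧.rightUnitor_naturality a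
  rw [← hb] at e₅
  refine Eq.trans ?_ e₅
  have e₄ : 𝓧.tens a (𝓧.fib.pre (π.eta T) b) = 𝓧.fib.pre (π.obj u ◁ π.eta T) (𝓧.tens a b) := by
    rw [← id_tensorHom, ← GrStack.tens_pre, FibGpd.id_pre]
  rw [e₄, ← hc, ← π.right_unit, FibGpd.pre_post, FibGpd.pre_post, ← FibGpd.comp_pre,
    ← FibGpd.comp_pre]
  congr 1
  rw [Category.assoc, Category.assoc, π.ident_comp_ident, π.ident_self, Category.comp_id]

end Places

section ChartOperations

variable {C : Type u} [Category.{v} C] {J : GrothendieckTopology C} {n : ℕ}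
  {H : Fin n → CrossedModule.{w} J} {G : BraidedCrossedModule.{w} J}
  {𝓗 : Fin n → GrStack.{o₁, h₁} J}
  {πH : ∀ k, Presentation (H k) (𝓗 k)} {B : NButterfly H G}

theorem PreMorphism.pre_ident {K : CrossedModule.{w} J} {𝓧 : FibGpd.{o, h} C} (π : PreMorphism K 𝓧)
    {T S : C} {f : T ⟶ S} {X X' : 𝓧.Ob S} (hX : X = X') {u u' : Sec K.G₀ T} (e : u = u')
    {a : 𝓧.Hom f (π.obj u) X} {a' : 𝓧.Hom f (π.obj u') X'} (ha : HEq a' a) :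
    HEq (𝓧.pre (π.ident u u' e) a') a := by
  subst hX e ha
  rw [π.ident_self, FibGpd.id_pre]

theorem Presentation.eta_ident_heq {K : CrossedModule.{w} J} {𝓧 : GrStack.{o, h} J}
    (π : Presentation K 𝓧) {S : C} {u : Sec K.G₀ S} (e : 1 = u) :
    HEq (π.eta S ≫ π.ident 1 u e) (π.eta S) := by
  subst e
  rw [π.ident_self, Category.comp_id]

namespace Pt

variable {T' T S : C} {X : ∀ k, (𝓗 k).fib.Ob S} {f : T ⟶ S} {f' : T' ⟶ S}

theorem isArr_id {q' q : Pt πH B X f} (hy : q'.y = q.y) {g : Sec G.G₁ T}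
    (ha : ∀ k, HEq ((𝓗 k).fib.pre ((πH k).ident (q'.y k) (q.y k) (congrFun hy k)) (q.a k)) (q'.a k))
    (he : q.e = B.act q'.e g) (w) : IsArr (𝟙 T) w q' q (fun _ => 1) g := by
  refine ⟨?_, fun k h => eq_of_heq (ha k)⟩
  rw [NButterfly.IsArr, B.map_id, B.transport_one fun _ => rfl, he]

theorem IsArr.refl (q : Pt πH B X f) (w) : IsArr (𝟙 T) w q q (fun _ => 1) 1 :=
  isArr_id rfl (fun k => (πH k).pre_ident rfl _ HEq.rfl) (B.act_one _).symm w

theorem IsArr.trans {T'' : C} {f'' : T'' ⟶ S} {r' : T'' ⟶ T'} {r : T' ⟶ T} {r'' : T'' ⟶ T} {w} {w'}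
    {q : Pt πH B X f} {q' : Pt πH B X f'} {q'' : Pt πH B X f''} {γ' γ} {g' g}
    (a' : IsArr r' w' q'' q' γ' g') (a : IsArr r w q' q γ g) (er : r' ≫ r = r'')
    (w'' : r'' ≫ f = f'') :
    IsArr r'' w'' q'' q (fun k => γ' k * res (H k).G₁ r' (γ k)) (g' * res G.G₁ r' g) := by
  subst er
  refine ⟨a'.arr.comp a.arr, fun k h => ?_⟩
  rw [← (πH k).map_comp r' r _ _ _ _ _ (a'.y_eq k) (a.y_eq k), (𝓗 k).fib.assoc _ _ _ _ _ w w',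
    a.comp, a'.comp]

theorem IsArr.push {S' : C} {X' : ∀ k, (𝓗 k).fib.Ob S'} {r : T' ⟶ T} {w} {q : Pt πH B X f}
    {q' : Pt πH B X f'} {γ} {g} (a : IsArr r w q' q γ g) {s : S ⟶ S'}
    (Φ : ∀ k, (𝓗 k).fib.Hom s (X k) (X' k)) {k : T ⟶ S'} {k' : T' ⟶ S'} (w₁ : f ≫ s = k)
    (w₂ : f' ≫ s = k') (w₃ : r ≫ k = k') :
    IsArr r w₃ (q'.push Φ w₂) (q.push Φ w₁) γ g := by
  refine ⟨a.arr, fun k h => ?_⟩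
  exact ((𝓗 k).fib.assoc _ _ _ w w₂ w₁ w₃).symm.trans
    (congrArg (fun φ => (𝓗 k).fib.comp φ (Φ k) w₂) (a.comp k h))

end Pt

namespace PtMul

variable {T' T S : C} {x y z : ∀ k, (𝓗 k).fib.Ob S} {f : T ⟶ S} {f' : T' ⟶ S} {i : Fin n}

theorem isArr (P : ProdAt 𝓗 i x y z) {q : Pt πH B x f} {p : Pt πH B y f} {m : Pt πH B z f}
    (h : PtMul i q p m) {q' : Pt πH B x f'} {p' : Pt πH B y f'} {m' : Pt πH B z f'}
    (h' : PtMul i q' p' m') {r : T' ⟶ T} {w} {γ δ} {g k} (a : Pt.IsArr r w q' q γ g)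
    (b : Pt.IsArr r w p' p δ k) : ∃ ε, Pt.IsArr r w m' m ε (G.act g (B.j p'.e) * k) := by
  have hγ : ∀ l, l ≠ i → γ l = δ l := fun l hl =>
    ((πH l).arr_of_heq ((P.left l hl).trans (P.right l hl).symm) (h.agree_y l hl)
      (h'.agree_y l hl) ((h.left l hl).trans (h.right l hl).symm)
      ((h'.left l hl).trans (h'.right l hl).symm) (a.comp l (a.y_eq l))).1 (b.comp l (b.y_eq l))
  obtain ⟨ε, hε, hε'⟩ := exists_tuple i ((H i).act (γ i) (p'.y i) * δ i) fun l _ => γ l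
  refine ⟨ε, ?_, fun l hl => ?_⟩
  · rw [h.e_eq, h'.e_eq]
    exact a.arr.mul b.arr _ _ hγ hε' (by rw [hε, p'.he])
  · rcases eq_or_ne l i with rfl | hli
    · exact (πH l).prod_arr P.prod (h.prod h.y_self) (h'.prod h'.y_self) (a.y_eq l) (b.y_eq l) hl
        (a.comp l _) (b.comp l _) hε
    · exact ((πH l).arr_of_heq (P.left l hli) (h.y_left l hli) (h'.y_left l hli) (h.left l hli)
        (h'.left l hli) (a.comp l (a.y_eq l))).2 (hε' l hli).symm

theorem push {S' : C} (P : ProdAt 𝓗 i x y z) {x' y' z' : ∀ k, (𝓗 k).fib.Ob S'}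
    (P' : ProdAt 𝓗 i x' y' z') {q : Pt πH B x f} {p : Pt πH B y f} {m : Pt πH B z f}
    (h : PtMul i q p m) {s : S ⟶ S'} {k : T ⟶ S'} {φ : ∀ k, (𝓗 k).fib.Hom s (x k) (x' k)}
    {ψ : ∀ k, (𝓗 k).fib.Hom s (y k) (y' k)} {χ : ∀ k, (𝓗 k).fib.Hom s (z k) (z' k)}
    (hχ : HomProdAt 𝓗 i φ ψ χ) (w : f ≫ s = k) :
    PtMul i (q.push φ w) (p.push ψ w) (m.push χ w) := by
  refine ⟨h.agree, h.e_eq, fun l hl => ?_, fun l hl => ?_, fun e => ?_⟩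
  · exact FibGpd.comp_heq (congrArg (πH l).obj (h.y_left l hl)) (P.left l hl) (P'.left l hl)
      (h.left l hl) (hχ.left l hl) _
  · exact FibGpd.comp_heq (congrArg (πH l).obj (h.y_right l hl)) (P.right l hl) (P'.right l hl)
      (h.right l hl) (hχ.right l hl) _
  · refine HEq.trans (heq_of_eq (FibGpd.comp_pre_assoc _ _ _ _)) ?_
    refine HEq.trans ?_ (heq_of_eq ((𝓗 i).tens_comp _ _ _ _ _).symm)
    exact FibGpd.comp_heq rfl P.prod P'.prod (h.prod e) hχ.prod _

theorem assoc {x₁ x₂ x₃ x₁₂ x₂₃ l r : ∀ k, (𝓗 k).fib.Ob S}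
    (P₁ : ProdAt 𝓗 i x₁ x₂ x₁₂) (P₂ : ProdAt 𝓗 i x₁₂ x₃ l) (P₃ : ProdAt 𝓗 i x₂ x₃ x₂₃)
    (P₄ : ProdAt 𝓗 i x₁ x₂₃ r) {A : ∀ k, l k ⟶ r k} (hA : ∀ k, k ≠ i → HEq (A k) (𝟙 (l k)))
    (hA' : HEq (A i) (α_ (x₁ i) (x₂ i) (x₃ i)).hom) {q₁ : Pt πH B x₁ f} {q₂ : Pt πH B x₂ f}
    {q₃ : Pt πH B x₃ f} {q₁₂ : Pt πH B x₁₂ f} {q₂₃ : Pt πH B x₂₃ f} {q : Pt πH B l f}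
    (h₁ : PtMul i q₁ q₂ q₁₂) (h₂ : PtMul i q₁₂ q₃ q) (h₃ : PtMul i q₂ q₃ q₂₃) (w) :
    PtMul i q₁ q₂₃ (q.push A w : Pt πH B r f) := by
  have hoff : ∀ k, k ≠ i → HEq (((q.push A w : Pt πH B r f)).a k) (q.a k) := fun k hk =>
    FibGpd.post_heq_of_id (((P₂.left k hk).symm.trans (P₁.left k hk).symm).trans (P₄.left k hk))
      (hA k hk) _
  have agree : AgreeOff i (B.p q₁.e) (B.p q₂₃.e) := fun k hk => by
    rw [q₁.he, q₂₃.he, h₁.agree_y k hk, h₃.y_left k hk]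
  refine ⟨agree, ?_, fun k hk => ?_, fun k hk => ?_, fun e => ?_⟩
  · change q.e = _
    have agree' : AgreeOff i (B.p q₁.e) (B.p (B.mul i q₂.e q₃.e h₃.agree)) := by
      rw [← h₃.e_eq]
      exact agree
    have agree'' : AgreeOff i (B.p (B.mul i q₁.e q₂.e h₁.agree)) (B.p q₃.e) := by
      rw [← h₁.e_eq]
      exact h₂.agree
    rw [h₂.e_eq]
    exact (B.mul_congr h₁.e_eq rfl _ agree'').trans ((B.mul_assoc i _ _ _ _ _ h₃.agree agree').trans
      (B.mul_congr rfl h₃.e_eq.symm _ _))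
  · exact ((h₁.left k hk).trans (h₂.left k hk)).trans (hoff k hk).symm
  · exact (((h₃.left k hk).symm.trans (h₁.right k hk)).trans (h₂.left k hk)).trans (hoff k hk).symm
  · exact (πH i).prod_assoc P₁.prod P₃.prod P₂.prod P₄.prod hA' (h₁.prod h₁.y_self)
      (h₃.prod h₃.y_self) (h₂.prod h₂.y_self)

theorem interchange {i k : Fin n} (hik : i < k) {x x' y y' xx yy xy xy' t : ∀ k, (𝓗 k).fib.Ob S}
    (P₁ : ProdAt 𝓗 i x x' xx) (P₂ : ProdAt 𝓗 i y y' yy) (P₃ : ProdAt 𝓗 k xx yy t)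
    (P₄ : ProdAt 𝓗 k x y xy) (P₅ : ProdAt 𝓗 k x' y' xy') (P₆ : ProdAt 𝓗 i xy xy' t)
    {q : Pt πH B x f} {q' : Pt πH B x' f} {p : Pt πH B y f} {p' : Pt πH B y' f}
    {qq : Pt πH B xx f} {pp : Pt πH B yy f} {qp : Pt πH B xy f} {qp' : Pt πH B xy' f}
    {m m' : Pt πH B t f} (h₁ : PtMul i q q' qq) (h₂ : PtMul i p p' pp) (h₃ : PtMul k qq pp m)
    (h₄ : PtMul k q p qp) (h₅ : PtMul k q' p' qp') (h₆ : PtMul i qp qp' m') (w) :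
    Pt.IsArr (𝟙 T) w m' m (fun _ => 1) (G.act (G.br (B.j q'.e) (B.j p.e))⁻¹ (B.j p'.e)) := by
  have hi := hik.ne
  have hk := hik.ne'
  have hy : m'.y = m.y := by
    funext l
    rcases eq_or_ne l i with rfl | hli
    · rw [← h₆.y_self, ← h₃.y_left l hi, ← h₁.y_self, h₄.y_left l hi, h₅.y_left l hi]
    · rcases eq_or_ne l k with rfl | hlk
      · rw [← h₆.y_left l hk, ← h₃.y_self, ← h₄.y_self, h₁.y_left l hk, h₂.y_left l hk]
      · rw [← h₆.y_left l hli, ← h₄.y_left l hlk, h₁.y_left l hli, h₃.y_left l hlk]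
  refine Pt.isArr_id hy (fun l => (πH l).pre_ident rfl _ ?_) ?_ w
  · rcases eq_or_ne l i with rfl | hli
    · exact (h₃.left l hi).symm.trans ((πH l).prod_inj (P₄.left l hi) (P₅.left l hi) P₁.prod P₆.prod
        (h₄.y_left l hi) (h₅.y_left l hi) (h₄.left l hi) (h₅.left l hi) (h₁.prod h₁.y_self)
        (h₆.prod h₆.y_self))
    · rcases eq_or_ne l k with rfl | hlk
      · exact ((πH l).prod_inj (P₁.left l hk).symm (P₂.left l hk).symm P₃.prod P₄.prod
          (h₁.y_left l hk).symm (h₂.y_left l hk).symm (h₁.left l hk).symm (h₂.left l hk).symm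
          (h₃.prod h₃.y_self) (h₄.prod h₄.y_self)).trans (h₆.left l hk)
      · exact ((h₃.left l hlk).symm.trans (h₁.left l hli).symm).trans
          ((h₄.left l hlk).trans (h₆.left l hli))
  · obtain ⟨a₁, e₁, -, -, -⟩ := h₁
    obtain ⟨a₂, e₂, -, -, -⟩ := h₂
    obtain ⟨a₃, e₃, -, -, -⟩ := h₃
    obtain ⟨a₄, e₄, -, -, -⟩ := h₄
    obtain ⟨a₅, e₅, -, -, -⟩ := h₅
    obtain ⟨a₆, e₆, -, -, -⟩ := h₆
    obtain ⟨_, _, e, rfl⟩ := qq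
    obtain ⟨_, _, e', rfl⟩ := pp
    obtain ⟨_, _, d, rfl⟩ := qp
    obtain ⟨_, _, d', rfl⟩ := qp'
    dsimp only at *
    subst e₁ e₂ e₄ e₅
    rw [e₃, e₆]
    exact B.interchange i k hik _ _ _ _ _ _ _ _ _ _

end PtMul

/-- The chart `q` at a tuple with entry the unit object at the place `i` is given by the
trivialization `s i` at `1`. -/
structure UnitPt {T S : C} {X : ∀ k, (𝓗 k).fib.Ob S} {f : T ⟶ S} (i : Fin n) (q : Pt πH B X f) :
    Prop where
  y_eq : 1 = q.y i
  e_eq : ∀ h, q.e = B.s i q.y 1 h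
  a_eq : HEq ((𝓗 i).fib.pre ((πH i).eta T ≫ (πH i).ident _ _ y_eq) (q.a i)) ((𝓗 i).unitMap f)

namespace UnitPt

variable {T' T S : C} {x y z : ∀ k, (𝓗 k).fib.Ob S} {f : T ⟶ S} {f' : T' ⟶ S} {i : Fin n}

theorem y_eq_bd {q : Pt πH B x f} (h : UnitPt i q) : q.y i = (H i).bd 1 := by
  rw [map_one, h.y_eq]

theorem j_eq {q : Pt πH B x f} (h : UnitPt i q) : 1 = B.j q.e := by
  rw [h.e_eq h.y_eq_bd, B.j_s]

theorem exists_agree (hx : x i = 𝟙_ _) (hxy : ∀ k, k ≠ i → x k = y k) (p : Pt πH B y f) :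
    ∃ q : Pt πH B x f, UnitPt i q ∧ AgreeOff i q.y p.y ∧ ∀ k, k ≠ i → HEq (q.a k) (p.a k) := by
  obtain ⟨b, hb⟩ := FibGpd.exists_heq (𝓧 := (𝓗 i).fib) (x' := (πH i).obj 1) (y' := x i) rfl hx
    ((𝓗 i).fib.pre (inv ((πH i).eta T)) ((𝓗 i).unitMap f))
  obtain ⟨y', a', h₁, h₂, h₃, h₄⟩ := exists_update hxy p.a b
  refine ⟨⟨y', a', B.s i y' 1 (by rw [h₁, map_one]), B.p_s _ _ _ _⟩, ⟨h₁.symm, fun _ => rfl, ?_⟩,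
    h₂, h₄⟩
  refine HEq.trans (FibGpd.comp_heq (φ' := (πH i).eta T) rfl (congrArg (πH i).obj h₁) hx
    ((πH i).eta_ident_heq h₁.symm) (h₃.trans hb) _) ?_
  refine heq_of_eq ((FibGpd.comp_pre _ _ _ _).symm.trans ?_)
  rw [IsIso.hom_inv_id, FibGpd.id_pre]

theorem isArr {hx : x i = 𝟙_ _} {q : Pt πH B x f} {q' : Pt πH B x f'} (h : UnitPt i q)
    (h' : UnitPt i q') {r : T' ⟶ T} {w} {γ} {g} (a : Pt.IsArr r w q' q γ g) : g = 1 := by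
  have hγ : γ i = 1 := (πH i).unit_arr hx h.a_eq h'.a_eq (a.comp i (a.y_eq i))
  have e : res (H i).G₀ r (q.y i) = (H i).bd (res (H i).G₁ r 1) := by
    rw [← h.y_eq, map_one, map_one, map_one]
  have e' : res (H i).G₀ r (q.y i) = (H i).bd 1 := by rw [← h.y_eq, map_one, map_one]
  have h₁ := a.arr
  rw [NButterfly.IsArr, h.e_eq h.y_eq_bd, h'.e_eq h'.y_eq_bd, B.s_res _ _ _ _ _ e,
    B.transport_s_one hγ _ (fun k => res (H k).G₀ r (q.y k)) _ e' a.y_eq,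
    B.s_congr rfl (map_one _) e e'] at h₁
  exact B.eq_one_of_act h₁.symm

theorem push {S' : C} (hx : x i = 𝟙_ _) {x' : ∀ k, (𝓗 k).fib.Ob S'} (hx' : x' i = 𝟙_ _)
    {q : Pt πH B x f} (h : UnitPt i q) {s : S ⟶ S'} {k : T ⟶ S'}
    {Φ : ∀ k, (𝓗 k).fib.Hom s (x k) (x' k)} (hΦ : HEq (Φ i) ((𝓗 i).unitMap s)) (w : f ≫ s = k) :
    UnitPt i (q.push Φ w) := by
  refine ⟨h.y_eq, h.e_eq, HEq.trans (heq_of_eq (FibGpd.comp_pre_assoc _ _ _ _)) ?_⟩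
  refine HEq.trans (FibGpd.comp_heq rfl hx hx' h.a_eq hΦ _) (heq_of_eq ((𝓗 i).unitMap_comp w))

theorem isArr_mul_left (P : ProdAt 𝓗 i x y z) (hx : x i = 𝟙_ _) {q : Pt πH B x f} {p : Pt πH B y f}
    {m : Pt πH B z f} (hq : UnitPt i q) (h : PtMul i q p m) {L : ∀ k, z k ⟶ y k}
    (hL : ∀ k, k ≠ i → HEq (L k) (𝟙 (y k))) (hL' : HEq (L i) (λ_ (y i)).hom) (w w') :
    Pt.IsArr (𝟙 T) w' p (m.push L w : Pt πH B y f) (fun _ => 1) 1 := by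
  have e : m.e = p.e := by
    have e₀ := hq.e_eq hq.y_eq_bd
    have e₁ : AgreeOff i (B.p (B.s i q.y 1 hq.y_eq_bd)) (B.p p.e) := by
      rw [← e₀]
      exact h.agree
    rw [h.e_eq, B.mul_congr e₀ rfl _ e₁, B.s_one_mul]
  have hy : p.y = m.y := by rw [← p.he, ← m.he, e]
  refine Pt.isArr_id hy (fun k => ?_) (by rw [B.act_one]; exact e) w'
  rcases eq_or_ne k i with rfl | hk
  · exact heq_of_eq ((πH k).unit_prod_left hx P.prod hq.a_eq (h.prod h.y_self) hL' _)
  · refine (πH k).pre_ident rfl _ ?_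
    refine HEq.trans (FibGpd.post_heq_of_id (P.right k hk).symm ?_ _) (h.right k hk).symm
    exact (hL k hk).trans (by rw [P.right k hk])

theorem isArr_mul_right (P : ProdAt 𝓗 i x y z) (hy : y i = 𝟙_ _) {q : Pt πH B x f}
    {p : Pt πH B y f} {m : Pt πH B z f} (hp : UnitPt i p) (h : PtMul i q p m) {L : ∀ k, z k ⟶ x k}
    (hL : ∀ k, k ≠ i → HEq (L k) (𝟙 (x k))) (hL' : HEq (L i) (ρ_ (x i)).hom) (w w') :
    Pt.IsArr (𝟙 T) w' q (m.push L w : Pt πH B x f) (fun _ => 1) 1 := by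
  have e : m.e = q.e := by
    have e₀ := hp.e_eq hp.y_eq_bd
    have e₁ : AgreeOff i (B.p q.e) (B.p (B.s i p.y 1 hp.y_eq_bd)) := by
      rw [← e₀]
      exact h.agree
    rw [h.e_eq, B.mul_congr rfl e₀ _ e₁, B.mul_s_one]
  have hy' : q.y = m.y := by rw [← q.he, ← m.he, e]
  refine Pt.isArr_id hy' (fun k => ?_) (by rw [B.act_one]; exact e) w'
  rcases eq_or_ne k i with rfl | hk
  · exact heq_of_eq ((πH k).unit_prod_right hy P.prod hp.a_eq (h.prod h.y_self) hL' _)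
  · refine (πH k).pre_ident rfl _ ?_
    refine HEq.trans (FibGpd.post_heq_of_id (P.left k hk).symm ?_ _) (h.left k hk).symm
    exact (hL k hk).trans (by rw [P.left k hk])

/-- Charts at a tuple with two unit entries that are given by both trivializations. -/
theorem exists_both {k : Fin n} (hik : i ≠ k) (hi : x i = 𝟙_ _) (hk : x k = 𝟙_ _)
    (p : Pt πH B x f) : ∃ q : Pt πH B x f, UnitPt i q ∧ UnitPt k q := by
  obtain ⟨q, hq, -, -⟩ := exists_agree hk (fun _ _ => rfl) p
  obtain ⟨q', hq', hy, ha⟩ := exists_agree hi (fun _ _ => rfl) q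
  have h₁ : 1 = q'.y k := by rw [hy k hik.symm, ← hq.y_eq]
  refine ⟨q', hq', h₁, fun h => ?_, HEq.trans ?_ hq.a_eq⟩
  · rw [hq'.e_eq hq'.y_eq_bd, B.restriction i k hik]
  · exact FibGpd.comp_heq rfl (congrArg (πH k).obj (hy k hik.symm)) rfl
      (((πH k).eta_ident_heq h₁).trans ((πH k).eta_ident_heq hq.y_eq).symm) (ha k hik.symm) _

end UnitPt

end ChartOperations

/-! ## The additive functor of a butterfly -/

theorem FibGpd.IsStack.glue_fiber {C : Type u} [Category.{v} C] {𝓧 : FibGpd.{o, h} C}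
    {J : GrothendieckTopology C} (hst : 𝓧.IsStack J) {S : C}
    (Z W : 𝓧.Ob S) (I : ∀ {T : C}, (T ⟶ S) → Type w)
    (P : ∀ {T : C} {f : T ⟶ S}, I f → 𝓧.Ob T)
    (θ : ∀ {T : C} {f : T ⟶ S} (i : I f), 𝓧.Hom f (P i) Z)
    (m : ∀ {T : C} {f : T ⟶ S} (i : I f), 𝓧.Hom f (P i) W)
    (loc : Loc J S fun _ f => Nonempty (I f))
    (compat : ∀ {T' T : C} (r : T' ⟶ T) (f : T ⟶ S) (f' : T' ⟶ S) (e : r ≫ f = f') (i : I f)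
      (j : I f'), ∃ ω : 𝓧.Hom r (P j) (P i), 𝓧.comp ω (θ i) e = θ j ∧ 𝓧.comp ω (m i) e = m j) :
    ∃ k : Z ⟶ W, ∀ {T : C} {f : T ⟶ S} (i : I f), 𝓧.post (θ i) k = m i := by
  obtain ⟨k, hk, -⟩ := hst.glue (𝟙 S) Z W I P θ (fun i => 𝓧.comp (m i) (𝓧.id W) rfl) loc (by
    intro T' T r f f' e i j
    obtain ⟨ω, h₁, h₂⟩ := compat r f f' e i j
    refine ⟨ω, h₁, ?_⟩
    rw [← h₂]
    exact (𝓧.assoc _ _ _ _ _ _ _).symm)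
  exact ⟨k, fun i => (comp_eq_comp (hk i)).trans (𝓧.comp_id _)⟩

theorem Presentation.tens_map_mu {C : Type u} [Category.{v} C] {J : GrothendieckTopology C}
    {𝓧 : GrStack.{o, h} J} {K : CrossedModule.{w} J} (π : Presentation K 𝓧) {T S : C} (r : T ⟶ S)
    {u v m : Sec K.G₀ S} {u' v' m' : Sec K.G₀ T} (hm : u * v = m) (hm' : u' * v' = m')
    {γ δ : Sec K.G₁ T} (e₁ e₂ e₃) :
    𝓧.fib.post (𝓧.tens (π.map r u' u γ e₁) (π.map r v' v δ e₂)) (π.mu u v ≫ π.ident _ _ hm) =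
      𝓧.fib.pre (π.mu u' v' ≫ π.ident _ _ hm') (π.map r m' m (K.act γ v' * δ) e₃) := by
  subst hm hm'
  rw [π.ident_self, π.ident_self, Category.comp_id, Category.comp_id, π.mu_naturality]

theorem Presentation.unitMap_eta {C : Type u} [Category.{v} C] {J : GrothendieckTopology C}
    {𝓧 : GrStack.{o, h} J} {K : CrossedModule.{w} J} (π : Presentation K 𝓧) {T S : C} (r : T ⟶ S)
    {u : Sec K.G₀ S} {u' : Sec K.G₀ T} (hu : 1 = u) (hu' : 1 = u') {γ : Sec K.G₁ T} (hγ : γ = 1)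
    (e) :
    𝓧.fib.post (𝓧.unitMap r) (π.eta S ≫ π.ident _ _ hu) =
      𝓧.fib.pre (π.eta T ≫ π.ident _ _ hu') (π.map r u' u γ e) := by
  subst hu hu' hγ
  rw [π.ident_self, π.ident_self, Category.comp_id, Category.comp_id, π.eta_naturality]
  rfl

section Construction

variable {C : Type u} [Category.{v} C] {J : GrothendieckTopology C} {n : ℕ}
  {H : Fin n → CrossedModule.{w} J} {G : BraidedCrossedModule.{w} J}
  {𝓗 : Fin n → GrStack.{o₁, h₁} J} {𝓖 : BraidedGrStack.{o₂, h} J}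
  (πH : ∀ k, Presentation (H k) (𝓗 k)) (πG : BraidedPresentation G 𝓖)
  (B : NButterfly H G)

theorem UnitPt.loc_exists {S : C} {i : Fin n} {x : ∀ k, (𝓗 k).fib.Ob S} (hx : x i = 𝟙_ _) :
    Loc J S fun _ f => ∃ q : Pt πH B x f, UnitPt i q :=
  (loc_pt πH B x).mono fun _ _ ⟨p⟩ =>
    let ⟨q, hq, _⟩ := UnitPt.exists_agree hx (fun _ _ => rfl) p
    ⟨q, hq⟩

/-- Objects of `𝓖` with the charts that are given by the points of the butterfly. -/
structure Atlas where
  obj : ∀ {S : C}, (∀ k, (𝓗 k).fib.Ob S) → 𝓖.gr.fib.Ob S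
  chart : ∀ {T S : C} {X : ∀ k, (𝓗 k).fib.Ob S} {f : T ⟶ S} (q : Pt πH B X f),
    𝓖.gr.fib.Hom f (πG.obj (B.j q.e)) (obj X)
  chart_arr : ∀ {T' T S : C} {X : ∀ k, (𝓗 k).fib.Ob S} {f : T ⟶ S} {f' : T' ⟶ S}
    {r : T' ⟶ T} {w : r ≫ f = f'} {q' : Pt πH B X f'} {q : Pt πH B X f}
    {γ : ∀ k, Sec (H k).G₁ T'} {g : Sec G.G₁ T'} (a : Pt.IsArr r w q' q γ g),
    𝓖.gr.fib.comp (πG.map r (B.j q'.e) (B.j q.e) g a.arr.j_eq) (chart q) w = chart q'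

theorem nonempty_atlas : Nonempty (Atlas πH πG B) := by
  have ex : ∀ {S : C} (X : ∀ k, (𝓗 k).fib.Ob S), ∃ (Z : 𝓖.gr.fib.Ob S)
      (θ : ∀ {T : C} {f : T ⟶ S} (q : Pt πH B X f), 𝓖.gr.fib.Hom f (πG.obj (B.j q.e)) Z),
      ∀ {T' T : C} {f : T ⟶ S} {f' : T' ⟶ S}
        {r : T' ⟶ T} {w : r ≫ f = f'} {q' : Pt πH B X f'} {q : Pt πH B X f}
        {γ : ∀ k, Sec (H k).G₁ T'} {g : Sec G.G₁ T'} (a : Pt.IsArr r w q' q γ g),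
        𝓖.gr.fib.comp (πG.map r (B.j q'.e) (B.j q.e) g a.arr.j_eq) (θ q) w = θ q' := by
    intro S X
    choose γ g hg using fun {T' T : C} (r : T' ⟶ T) {f : T ⟶ S} {f' : T' ⟶ S} (e : r ≫ f = f')
      (q : Pt πH B X f) (q' : Pt πH B X f') => Pt.exists_isArr r e q' q
    obtain ⟨Z, θ, hθ⟩ := 𝓖.gr.isStack.glue_charts (fun f => Pt πH B X f)
      (fun q => πG.obj (B.j q.e))
      (fun r _ _ e q q' => πG.map r (B.j q'.e) (B.j q.e) (g r e q q') (hg r e q q').arr.j_eq)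
      (loc_pt πH B X) (by
        intro T f q
        have h := ((hg (𝟙 T) (Category.id_comp f) q q).unique (Pt.IsArr.refl q _)).2
        rw [πG.map_congr h _ (by simp [res_id])]
        exact πG.map_id _ _) (by
        intro T'' T' T r' r r'' f f' f'' e e' e'' er q q' q''
        have h := ((hg r' e' q' q'').trans (hg r e q q') er e'').unique (hg r'' e'' q q'')
        exact πG.comp_map er h.2.symm _)
    refine ⟨Z, θ, fun {T' T f f' r w q' q γ' g'} a => ?_⟩
    have h := (a.unique (hg r w q q')).2
    refine Eq.trans ?_ (hθ r w q q')
    rw [πG.map_congr h]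
  choose obj chart chart_arr using @ex
  exact ⟨⟨obj, fun {T S X f} q => chart X q, fun {_ _ _ X} _ _ _ _ _ _ _ _ a => chart_arr X a⟩⟩

variable {πH πG B} in
theorem Pt.push_push {R S S' S'' : C} {X : ∀ k, (𝓗 k).fib.Ob S} {X' : ∀ k, (𝓗 k).fib.Ob S'}
    {X'' : ∀ k, (𝓗 k).fib.Ob S''} {f : R ⟶ S} {s : S ⟶ S'} {s' : S' ⟶ S''} {f' : R ⟶ S'}
    {f'' : R ⟶ S''} {t : S ⟶ S''} (q : Pt πH B X f) (Φ : ∀ k, (𝓗 k).fib.Hom s (X k) (X' k))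
    (Ψ : ∀ k, (𝓗 k).fib.Hom s' (X' k) (X'' k)) (w : f ≫ s = f') (w' : f' ≫ s' = f'')
    (e : s ≫ s' = t) (w'' : f ≫ t = f'') :
    (q.push Φ w).push Ψ w' = q.push (fun k => (𝓗 k).fib.comp (Φ k) (Ψ k) e) w'' := by
  unfold Pt.push
  congr 1
  funext k
  exact (𝓗 k).fib.assoc _ _ _ _ _ _ _

/-- An atlas with the morphisms between its objects that are required of an additive functor. -/
structure FullAtlas extends Atlas πH πG B where
  map : ∀ {S T : C} {s : S ⟶ T} {x : ∀ k, (𝓗 k).fib.Ob S} {y : ∀ k, (𝓗 k).fib.Ob T},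
    (∀ k, (𝓗 k).fib.Hom s (x k) (y k)) → 𝓖.gr.fib.Hom s (obj x) (obj y)
  chart_map : ∀ {R S T : C} {s : S ⟶ T} {x : ∀ k, (𝓗 k).fib.Ob S} {y : ∀ k, (𝓗 k).fib.Ob T}
    (φ : ∀ k, (𝓗 k).fib.Hom s (x k) (y k)) {f : R ⟶ S} (q : Pt πH B x f) {f' : R ⟶ T}
    (w : f ≫ s = f'), 𝓖.gr.fib.comp (chart q) (map φ) w = chart (q.push φ w)
  lam : ∀ {S : C} {i : Fin n} {x y z : ∀ k, (𝓗 k).fib.Ob S}, ProdAt 𝓗 i x y z →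
    (obj x ⊗ obj y ⟶ obj z)
  chart_lam : ∀ {S : C} {i : Fin n} {x y z : ∀ k, (𝓗 k).fib.Ob S} (P : ProdAt 𝓗 i x y z) {T : C}
    {f : T ⟶ S} {q : Pt πH B x f} {p : Pt πH B y f} {m : Pt πH B z f} (h : PtMul i q p m),
    𝓖.gr.fib.post (𝓖.gr.tens (chart q) (chart p)) (lam P) =
      𝓖.gr.fib.pre (πG.mu (B.j q.e) (B.j p.e) ≫ πG.ident _ _ h.j_eq) (chart m)
  eps : ∀ {S : C} {i : Fin n} {x : ∀ k, (𝓗 k).fib.Ob S}, x i = 𝟙_ ((𝓗 i).fib.Ob S) →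
    (obj x ⟶ 𝟙_ (𝓖.gr.fib.Ob S))
  chart_eps : ∀ {S : C} {i : Fin n} {x : ∀ k, (𝓗 k).fib.Ob S} (e : x i = 𝟙_ ((𝓗 i).fib.Ob S))
    {T : C} {f : T ⟶ S} {q : Pt πH B x f} (h : UnitPt i q),
    𝓖.gr.fib.post (chart q) (eps e) =
      𝓖.gr.fib.pre (inv (πG.eta T ≫ πG.ident _ _ h.j_eq)) (𝓖.gr.unitMap f)

variable {πH πG B} in
theorem Atlas.exists_full (A : Atlas πH πG B) : Nonempty (FullAtlas πH πG B) := by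
  have ex₁ : ∀ {S T : C} {s : S ⟶ T} {x : ∀ k, (𝓗 k).fib.Ob S} {y : ∀ k, (𝓗 k).fib.Ob T}
      (φ : ∀ k, (𝓗 k).fib.Hom s (x k) (y k)), ∃ m : 𝓖.gr.fib.Hom s (A.obj x) (A.obj y),
      ∀ {R : C} {f : R ⟶ S} (q : Pt πH B x f) {f' : R ⟶ T}
        (w : f ≫ s = f'), 𝓖.gr.fib.comp (A.chart q) m w = A.chart (q.push φ w) := by
    intro S T s x y φ
    obtain ⟨m, hm, -⟩ := 𝓖.gr.isStack.glue s (A.obj x) (A.obj y) (fun f => Pt πH B x f) _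
      A.chart (fun q => A.chart (q.push φ rfl)) (loc_pt πH B x) (by
        intro T' T r f f' e q q'
        obtain ⟨γ, g, a⟩ := Pt.exists_isArr r e q' q
        exact ⟨_, A.chart_arr a, A.chart_arr (a.push φ rfl rfl _)⟩)
    refine ⟨m, fun q f' w => ?_⟩
    subst w
    exact hm q
  have ex₂ : ∀ {S : C} {i : Fin n} {x y z : ∀ k, (𝓗 k).fib.Ob S} (P : ProdAt 𝓗 i x y z),
      ∃ l : A.obj x ⊗ A.obj y ⟶ A.obj z, ∀ {T : C}
      {f : T ⟶ S} {q : Pt πH B x f} {p : Pt πH B y f} {m : Pt πH B z f} (h : PtMul i q p m),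
      𝓖.gr.fib.post (𝓖.gr.tens (A.chart q) (A.chart p)) l =
        𝓖.gr.fib.pre (πG.mu (B.j q.e) (B.j p.e) ≫ πG.ident _ _ h.j_eq) (A.chart m) := by
    intro S i x y z P
    obtain ⟨l, hl⟩ := 𝓖.gr.isStack.glue_fiber (A.obj x ⊗ A.obj y) (A.obj z)
      (fun f => { t : Pt πH B x f × Pt πH B y f × Pt πH B z f // PtMul i t.1 t.2.1 t.2.2 }) _
      (fun t => 𝓖.gr.tens (A.chart t.1.1) (A.chart t.1.2.1))
      (fun t => 𝓖.gr.fib.pre (πG.mu _ _ ≫ πG.ident _ _ t.2.j_eq) (A.chart t.1.2.2))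
      ((loc_ptMul P).mono fun _ _ ⟨q, p, m, h⟩ => ⟨⟨(q, p, m), h⟩⟩) (by
        rintro T' T r f f' e ⟨⟨q, p, m⟩, h⟩ ⟨⟨q', p', m'⟩, h'⟩
        obtain ⟨γ, g, a⟩ := Pt.exists_isArr r e q' q
        obtain ⟨δ, k, b⟩ := Pt.exists_isArr r e p' p
        obtain ⟨ε, c⟩ := h.isArr P h' a b
        dsimp only at h h' ⊢
        refine ⟨𝓖.gr.tens (πG.map r _ _ g a.arr.j_eq) (πG.map r _ _ k b.arr.j_eq), ?_, ?_⟩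
        · rw [← 𝓖.gr.tens_comp, A.chart_arr a, A.chart_arr b]
        · rw [← FibGpd.post_comp_assoc, πG.tens_map_mu r h.j_eq h'.j_eq _ _ c.arr.j_eq,
            ← FibGpd.comp_pre_assoc, A.chart_arr c])
    exact ⟨l, fun h => hl ⟨(_, _, _), h⟩⟩
  have ex₃ : ∀ {S : C} {i : Fin n} {x : ∀ k, (𝓗 k).fib.Ob S} (e : x i = 𝟙_ ((𝓗 i).fib.Ob S)),
      ∃ ε : A.obj x ⟶ 𝟙_ (𝓖.gr.fib.Ob S),
      ∀ {T : C} {f : T ⟶ S} {q : Pt πH B x f} (h : UnitPt i q),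
      𝓖.gr.fib.post (A.chart q) ε =
        𝓖.gr.fib.pre (inv (πG.eta T ≫ πG.ident _ _ h.j_eq)) (𝓖.gr.unitMap f) := by
    intro S i x hx
    obtain ⟨l, hl⟩ := 𝓖.gr.isStack.glue_fiber (A.obj x) (𝟙_ (𝓖.gr.fib.Ob S))
      (fun f => { q : Pt πH B x f // UnitPt i q }) _
      (fun q => A.chart q.1)
      (fun {T f} q => 𝓖.gr.fib.pre (inv (πG.eta T ≫ πG.ident _ _ q.2.j_eq)) (𝓖.gr.unitMap f))
      ((UnitPt.loc_exists πH B hx).mono fun _ _ ⟨q, h⟩ => ⟨⟨q, h⟩⟩) (by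
        rintro T' T r f f' e ⟨q, h⟩ ⟨q', h'⟩
        obtain ⟨γ, g, a⟩ := Pt.exists_isArr r e q' q
        dsimp only at h h' ⊢
        refine ⟨_, A.chart_arr a, ?_⟩
        have e₁ := πG.unitMap_eta r h.j_eq h'.j_eq (h.isArr (hx := hx) h' a) a.arr.j_eq
        refine FibGpd.pre_cancel (πG.eta T' ≫ πG.ident _ _ h'.j_eq) ?_
        rw [FibGpd.comp_pre_assoc, ← e₁, FibGpd.post_comp_assoc, ← FibGpd.comp_pre,
          ← FibGpd.comp_pre, IsIso.hom_inv_id, IsIso.hom_inv_id, FibGpd.id_pre, FibGpd.id_pre,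
          𝓖.gr.unitMap_comp])
    exact ⟨l, fun h => hl ⟨_, h⟩⟩
  choose map chart_map using @ex₁
  choose lam chart_lam using @ex₂
  choose eps chart_eps using @ex₃
  exact ⟨⟨A, map, fun φ _ q => chart_map φ q, lam, chart_lam, eps, chart_eps⟩⟩

end Construction

theorem inv_heq_of_id {D : Type o} [Category.{h} D] {x y : D} {m : x ⟶ y} [IsIso m] (e : x = y)
    (hm : HEq m (𝟙 x)) : HEq (inv m) (𝟙 x) := by
  subst e hm
  rw [IsIso.inv_id]

section

variable {C : Type u} [Category.{v} C] {J : GrothendieckTopology C}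

theorem Presentation.mu_assoc_ident {𝓧 : GrStack.{o, h} J} {K : CrossedModule.{w} J}
    (π : Presentation K 𝓧) {S : C} {u v t uv vt m : Sec K.G₀ S} (huv : u * v = uv)
    (hvt : v * t = vt) (hm : uv * t = m) (hm' : u * vt = m) :
    ((π.mu u v ≫ π.ident _ _ huv) ▷ π.obj t) ≫ π.mu uv t ≫ π.ident _ _ hm =
      (α_ (π.obj u) (π.obj v) (π.obj t)).hom ≫ (π.obj u ◁ (π.mu v t ≫ π.ident _ _ hvt)) ≫
        π.mu u vt ≫ π.ident _ _ hm' := by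
  subst huv hvt hm
  simp only [π.ident_self, Category.comp_id]
  rw [π.mu_assoc_left]

theorem Presentation.mu_unit_left {𝓧 : GrStack.{o, h} J} {K : CrossedModule.{w} J}
    (π : Presentation K 𝓧) {S : C} {u v m : Sec K.G₀ S} (hu : 1 = u) (hm : u * v = m) (e : v = m) :
    π.mu u v ≫ π.ident _ _ hm =
      (inv (π.eta S ≫ π.ident _ _ hu) ▷ π.obj v) ≫ (λ_ (π.obj v)).hom ≫ π.ident v m e := by
  subst hu e
  rw [← cancel_epi ((π.eta S ≫ π.ident _ _ rfl) ▷ π.obj v), ← comp_whiskerRight_assoc,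
    IsIso.hom_inv_id, id_whiskerRight, Category.id_comp, π.ident_self, π.ident_self,
    Category.comp_id, Category.comp_id, ← π.left_unit]

theorem Presentation.mu_unit_right {𝓧 : GrStack.{o, h} J} {K : CrossedModule.{w} J}
    (π : Presentation K 𝓧) {S : C} {u v m : Sec K.G₀ S} (hv : 1 = v) (hm : u * v = m) (e : u = m) :
    π.mu u v ≫ π.ident _ _ hm =
      (π.obj u ◁ inv (π.eta S ≫ π.ident _ _ hv)) ≫ (ρ_ (π.obj u)).hom ≫ π.ident u m e := by
  subst hv e
  rw [← cancel_epi (π.obj u ◁ (π.eta S ≫ π.ident _ _ rfl)),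
    ← MonoidalCategory.whiskerLeft_comp_assoc,
    IsIso.hom_inv_id, MonoidalCategory.whiskerLeft_id, Category.id_comp, π.ident_self, π.ident_self,
    Category.comp_id, Category.comp_id, ← π.right_unit]

theorem Presentation.pre_mu_inv {𝓧 : GrStack.{o, h} J} {K : CrossedModule.{w} J}
    (π : Presentation K 𝓧) {S : C} {u v m : Sec K.G₀ S} (hm : u * v = m) {Z : 𝓧.fib.Ob S}
    (hZ : Z = π.obj u ⊗ π.obj v) {a : Z ⟶ π.obj m} (ha : HEq a (π.mu u v)) :
    HEq (𝓧.fib.pre (π.mu u v ≫ π.ident _ _ hm) (inv a))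
      (𝓧.tens (𝓧.fib.id (π.obj u)) (𝓧.fib.id (π.obj v))) := by
  subst hm hZ ha
  rw [π.ident_self, Category.comp_id]
  exact heq_of_eq ((IsIso.hom_inv_id (π.mu u v)).trans
    ((id_tensorHom_id _ _).symm.trans (𝓧.tens_fiber (𝟙 _) (𝟙 _)).symm))

theorem BraidedPresentation.tensorμ_mu_ident {G : BraidedCrossedModule.{w} J}
    {𝓖 : BraidedGrStack.{o, h} J} (π : BraidedPresentation G 𝓖) {S : C}
    {x x' z z' xx zz xz xz' m m' : Sec G.G₀ S} (h₁ : x * x' = xx) (h₂ : z * z' = zz)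
    (h₃ : xx * zz = m) (h₄ : x * z = xz) (h₅ : x' * z' = xz') (h₆ : xz * xz' = m')
    (e : m = m' * G.bd (G.act (G.br x' z)⁻¹ z')) :
    ((π.mu x x' ≫ π.ident _ _ h₁) ⊗ₘ (π.mu z z' ≫ π.ident _ _ h₂)) ≫ π.mu xx zz ≫
        π.ident _ _ h₃ =
      tensorμ (π.obj x) (π.obj x') (π.obj z) (π.obj z') ≫
        ((π.mu x z ≫ π.ident _ _ h₄) ⊗ₘ (π.mu x' z' ≫ π.ident _ _ h₅)) ≫ π.mu xz xz' ≫
          π.ident _ _ h₆ ≫ π.vert m' m _ e := by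
  subst h₁ h₂ h₃ h₄ h₅ h₆
  simp only [π.ident_self, Category.comp_id, Category.id_comp]
  have e' : x * z * (x' * z') = x * x' * (z * z') * G.bd (G.act (G.br x' z) z') := by
    rw [e, G.inv_act, map_inv, inv_mul_cancel_right]
  rw [reassoc_of% (π.tensorμ_mu x x' z z' e'), π.vert_comp (g'' := 1) (by rw [G.inv_act]; simp)
    (by simp), π.vert_one, Category.comp_id]

end

namespace GrStack

variable {C : Type u} [Category.{v} C] {J : GrothendieckTopology C} {𝓧 : GrStack.{o, h} J} {S T : C}
  {f : S ⟶ T}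

theorem tens_pre_left {x x' y : 𝓧.fib.Ob S} {z z' : 𝓧.fib.Ob T}
    (a : x ⟶ y) (φ : 𝓧.fib.Hom f y z) (ψ : 𝓧.fib.Hom f x' z') :
    𝓧.tens (𝓧.fib.pre a φ) ψ = 𝓧.fib.pre (a ▷ x') (𝓧.tens φ ψ) := by
  rw [← tensorHom_id, ← tens_pre, FibGpd.id_pre]

theorem tens_pre_right {x x' y : 𝓧.fib.Ob S} {z z' : 𝓧.fib.Ob T}
    (a : x ⟶ y) (φ : 𝓧.fib.Hom f y z) (ψ : 𝓧.fib.Hom f x' z') :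
    𝓧.tens ψ (𝓧.fib.pre a φ) = 𝓧.fib.pre (x' ◁ a) (𝓧.tens ψ φ) := by
  rw [← id_tensorHom, ← tens_pre, FibGpd.id_pre]

theorem tens_post_left {x x' : 𝓧.fib.Ob S} {y z z' : 𝓧.fib.Ob T} (φ : 𝓧.fib.Hom f x y)
    (a : y ⟶ z) (ψ : 𝓧.fib.Hom f x' z') :
    𝓧.tens (𝓧.fib.post φ a) ψ = 𝓧.fib.post (𝓧.tens φ ψ) (a ▷ z') := by
  rw [← tensorHom_id, ← tens_post, FibGpd.post_id]

theorem tens_post_right {x x' : 𝓧.fib.Ob S} {y z z' : 𝓧.fib.Ob T} (φ : 𝓧.fib.Hom f x y)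
    (a : y ⟶ z) (ψ : 𝓧.fib.Hom f x' z') :
    𝓧.tens ψ (𝓧.fib.post φ a) = 𝓧.fib.post (𝓧.tens ψ φ) (z' ◁ a) := by
  rw [← id_tensorHom, ← tens_post, FibGpd.post_id]

end GrStack

section Construction

variable {C : Type u} [Category.{v} C] {J : GrothendieckTopology C} {n : ℕ}
  {H : Fin n → CrossedModule.{w} J} {G : BraidedCrossedModule.{w} J}
  {𝓗 : Fin n → GrStack.{o₁, h₁} J} {𝓖 : BraidedGrStack.{o₂, h} J}
  {πH : ∀ k, Presentation (H k) (𝓗 k)} {πG : BraidedPresentation G 𝓖}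
  {B : NButterfly H G}

theorem loc_ptMul_assoc {S : C} {i : Fin n} {x y z xy yz l : ∀ k, (𝓗 k).fib.Ob S}
    (P₁ : ProdAt 𝓗 i x y xy) (P₂ : ProdAt 𝓗 i xy z l) (P₃ : ProdAt 𝓗 i y z yz) :
    Loc J S fun _ f => ∃ (q₁ : Pt πH B x f) (q₂ : Pt πH B y f) (q₃ : Pt πH B z f)
      (q₁₂ : Pt πH B xy f) (q₂₃ : Pt πH B yz f) (q : Pt πH B l f),
      PtMul i q₁ q₂ q₁₂ ∧ PtMul i q₁₂ q₃ q ∧ PtMul i q₂ q₃ q₂₃ := by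
  have hy : ∀ k, k ≠ i → y k = x k := fun k hk => (P₁.right k hk).trans (P₁.left k hk).symm
  have hz : ∀ k, k ≠ i → z k = x k := fun k hk =>
    ((P₃.right k hk).trans (P₃.left k hk).symm).trans (hy k hk)
  refine (((loc_exists_tuple πH x).and (loc_exists_tuple πH y)).and
    (loc_exists_tuple πH z)).bind ?_
  rintro T f ⟨⟨⟨y₁, ⟨a₁⟩⟩, ⟨y₀, ⟨a₀⟩⟩⟩, ⟨y₀', ⟨a₀'⟩⟩⟩
  obtain ⟨y₂, a₂, -, h₂, -, h₂'⟩ := exists_update hy a₁ (a₀ i)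
  obtain ⟨y₃, a₃, -, h₃, -, h₃'⟩ := exists_update hz a₁ (a₀' i)
  refine (Loc.and (Loc.and (B.locally_nonempty y₁) (B.locally_nonempty y₂))
    (B.locally_nonempty y₃)).mono ?_
  rintro R r ⟨⟨⟨e₁, he₁⟩, ⟨e₂, he₂⟩⟩, ⟨e₃, he₃⟩⟩
  obtain ⟨q₁₂, h₁₂⟩ := exists_ptMul P₁ (Pt.ofRes y₁ a₁ r e₁ he₁) (Pt.ofRes y₂ a₂ r e₂ he₂)
    (fun k hk => congrArg _ (h₂ k hk).symm)
    (fun k hk => cart_comp_heq r (h₂ k hk).symm (hy k hk).symm (h₂' k hk).symm)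
  obtain ⟨q₂₃, h₂₃⟩ := exists_ptMul P₃ (Pt.ofRes y₂ a₂ r e₂ he₂) (Pt.ofRes y₃ a₃ r e₃ he₃)
    (fun k hk => congrArg _ ((h₂ k hk).trans (h₃ k hk).symm))
    (fun k hk => cart_comp_heq r ((h₂ k hk).trans (h₃ k hk).symm) ((hy k hk).trans (hz k hk).symm)
      ((h₂' k hk).trans (h₃' k hk).symm))
  obtain ⟨q, h⟩ := exists_ptMul P₂ q₁₂ (Pt.ofRes y₃ a₃ r e₃ he₃)
    (fun k hk => (h₁₂.y_right k hk).symm.trans (h₂₃.agree_y k hk))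
    (fun k hk => (h₁₂.right k hk).symm.trans ((h₂₃.left k hk).trans (h₂₃.right k hk).symm))
  exact ⟨_, _, _, _, _, q, h₁₂, h, h₂₃⟩

theorem loc_ptMul_interchange {S : C} {i k : Fin n} (hik : i ≠ k)
    {x x' y y' xx yy xy xy' t : ∀ k, (𝓗 k).fib.Ob S}
    (P₁ : ProdAt 𝓗 i x x' xx) (P₂ : ProdAt 𝓗 i y y' yy) (P₃ : ProdAt 𝓗 k xx yy t)
    (P₄ : ProdAt 𝓗 k x y xy) (P₅ : ProdAt 𝓗 k x' y' xy') (P₆ : ProdAt 𝓗 i xy xy' t) :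
    Loc J S fun _ f => ∃ (q : Pt πH B x f) (q' : Pt πH B x' f) (p : Pt πH B y f)
      (p' : Pt πH B y' f) (qq : Pt πH B xx f) (pp : Pt πH B yy f) (qp : Pt πH B xy f)
      (qp' : Pt πH B xy' f) (m m' : Pt πH B t f), PtMul i q q' qq ∧ PtMul i p p' pp ∧
        PtMul k qq pp m ∧ PtMul k q p qp ∧ PtMul k q' p' qp' ∧ PtMul i qp qp' m' := by
  have hx' : ∀ l, l ≠ i → x' l = x l := fun l hl => (P₁.right l hl).trans (P₁.left l hl).symm
  have hy : ∀ l, l ≠ k → y l = x l := fun l hl => (P₄.right l hl).trans (P₄.left l hl).symm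
  have hy' : ∀ l, l ≠ i → y' l = y l := fun l hl => (P₂.right l hl).trans (P₂.left l hl).symm
  have hi : y' i = x' i := (P₅.right i hik).trans (P₅.left i hik).symm
  refine (((loc_exists_tuple πH x).and (loc_exists_tuple πH x')).and
    (loc_exists_tuple πH y)).bind ?_
  rintro T f ⟨⟨⟨y₁, ⟨a₁⟩⟩, ⟨y₀, ⟨a₀⟩⟩⟩, ⟨y₀', ⟨a₀'⟩⟩⟩
  obtain ⟨y₂, a₂, h₂i, h₂, ha₂i, ha₂⟩ := exists_update hx' a₁ (a₀ i)
  obtain ⟨y₃, a₃, -, h₃, -, ha₃⟩ := exists_update hy a₁ (a₀' k)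
  obtain ⟨b, hb⟩ := FibGpd.exists_heq (𝓧 := (𝓗 i).fib) (x' := (πH i).obj (y₀ i)) (y' := y' i) rfl
    hi (a₀ i)
  obtain ⟨y₄, a₄, h₄i, h₄, ha₄i, ha₄⟩ := exists_update hy' a₃ b
  have h₂₄ : ∀ l, l ≠ k → y₂ l = y₄ l := fun l hl => by
    rcases eq_or_ne l i with rfl | hli
    · rw [h₂i, h₄i]
    · rw [h₂ l hli, h₄ l hli, h₃ l hl]
  have ha₂₄ : ∀ l, l ≠ k → HEq (a₂ l) (a₄ l) := fun l hl => by
    rcases eq_or_ne l i with rfl | hli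
    · exact ha₂i.trans (hb.symm.trans ha₄i.symm)
    · exact (ha₂ l hli).trans ((ha₃ l hl).symm.trans (ha₄ l hli).symm)
  refine (Loc.and (Loc.and (B.locally_nonempty y₁) (B.locally_nonempty y₂))
    (Loc.and (B.locally_nonempty y₃) (B.locally_nonempty y₄))).mono ?_
  rintro R r ⟨⟨⟨e₁, he₁⟩, ⟨e₂, he₂⟩⟩, ⟨⟨e₃, he₃⟩, ⟨e₄, he₄⟩⟩⟩
  obtain ⟨qq, h₁⟩ := exists_ptMul P₁ (Pt.ofRes y₁ a₁ r e₁ he₁) (Pt.ofRes y₂ a₂ r e₂ he₂)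
    (fun l hl => congrArg _ (h₂ l hl).symm)
    (fun l hl => cart_comp_heq r (h₂ l hl).symm (hx' l hl).symm (ha₂ l hl).symm)
  obtain ⟨pp, h₂⟩ := exists_ptMul P₂ (Pt.ofRes y₃ a₃ r e₃ he₃) (Pt.ofRes y₄ a₄ r e₄ he₄)
    (fun l hl => congrArg _ (h₄ l hl).symm)
    (fun l hl => cart_comp_heq r (h₄ l hl).symm (hy' l hl).symm (ha₄ l hl).symm)
  obtain ⟨qp, h₃⟩ := exists_ptMul P₄ (Pt.ofRes y₁ a₁ r e₁ he₁) (Pt.ofRes y₃ a₃ r e₃ he₃)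
    (fun l hl => congrArg _ (h₃ l hl).symm)
    (fun l hl => cart_comp_heq r (h₃ l hl).symm (hy l hl).symm (ha₃ l hl).symm)
  obtain ⟨qp', h₇⟩ := exists_ptMul P₅ (Pt.ofRes y₂ a₂ r e₂ he₂) (Pt.ofRes y₄ a₄ r e₄ he₄)
    (fun l hl => congrArg _ (h₂₄ l hl))
    (fun l hl => cart_comp_heq r (h₂₄ l hl) ((P₅.left l hl).trans (P₅.right l hl).symm) (ha₂₄ l hl))
  have hy₅ : AgreeOff k qq.y pp.y := fun l hl => by
    rcases eq_or_ne l i with rfl | hli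
    · rw [← h₁.y_self, ← h₂.y_self, h₃.agree_y l hl, h₇.agree_y l hl]
    · rw [← h₁.y_left l hli, ← h₂.y_left l hli, h₃.agree_y l hl]
  have hy₆ : AgreeOff i qp.y qp'.y := fun l hl => by
    rcases eq_or_ne l k with rfl | hlk
    · rw [← h₃.y_self, ← h₇.y_self, h₁.agree_y l hl, h₂.agree_y l hl]
    · rw [← h₃.y_left l hlk, ← h₇.y_left l hlk, h₁.agree_y l hl]
  obtain ⟨m, h₅⟩ := exists_ptMul P₃ qq pp hy₅ (fun l hl => by
    rcases eq_or_ne l i with rfl | hli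
    · exact (πH l).prod_inj ((P₄.left l hl).trans (P₄.right l hl).symm)
        ((P₅.left l hl).trans (P₅.right l hl).symm) P₁.prod P₂.prod (h₃.agree_y l hl)
        (h₇.agree_y l hl) ((h₃.left l hl).trans (h₃.right l hl).symm)
        ((h₇.left l hl).trans (h₇.right l hl).symm) (h₁.prod h₁.y_self) (h₂.prod h₂.y_self)
    · exact (h₁.left l hli).symm.trans (((h₃.left l hl).trans (h₃.right l hl).symm).trans
        (h₂.left l hli)))
  obtain ⟨m', h₆⟩ := exists_ptMul P₆ qp qp' hy₆ (fun l hl => by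
    rcases eq_or_ne l k with rfl | hlk
    · exact (πH l).prod_inj ((P₁.left l hl).trans (P₁.right l hl).symm)
        ((P₂.left l hl).trans (P₂.right l hl).symm) P₄.prod P₅.prod (h₁.agree_y l hl)
        (h₂.agree_y l hl) ((h₁.left l hl).trans (h₁.right l hl).symm)
        ((h₂.left l hl).trans (h₂.right l hl).symm) (h₃.prod h₃.y_self) (h₇.prod h₇.y_self)
    · exact (h₃.left l hlk).symm.trans (((h₁.left l hl).trans (h₁.right l hl).symm).trans
        (h₇.left l hlk)))
  exact ⟨_, _, _, _, qq, pp, qp, qp', m, m', h₁, h₂, h₅, h₃, h₇, h₆⟩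

namespace FullAtlas

variable (A : FullAtlas πH πG B)

theorem map_id {S : C} (x : ∀ k, (𝓗 k).fib.Ob S) :
    A.map (fun k => (𝓗 k).fib.id (x k)) = 𝓖.gr.fib.id (A.obj x) := by
  refine 𝓖.gr.isStack.fiber_hom_ext ((loc_pt πH B x).mono fun T f ⟨q⟩ => ⟨_, A.chart q, ?_⟩)
  refine (A.chart_map _ q _).trans (Eq.trans ?_ (𝓖.gr.fib.comp_id _).symm)
  congr 1
  unfold Pt.push
  congr 1
  funext k
  exact (𝓗 k).fib.comp_id _

theorem map_comp {R S T : C} {f : R ⟶ S} {g : S ⟶ T} {k : R ⟶ T} {x : ∀ k, (𝓗 k).fib.Ob R}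
    {y : ∀ k, (𝓗 k).fib.Ob S} {z : ∀ k, (𝓗 k).fib.Ob T}
    (φ : ∀ k, (𝓗 k).fib.Hom f (x k) (y k)) (ψ : ∀ k, (𝓗 k).fib.Hom g (y k) (z k))
    (e : f ≫ g = k) :
    A.map (fun k => (𝓗 k).fib.comp (φ k) (ψ k) e) = 𝓖.gr.fib.comp (A.map φ) (A.map ψ) e := by
  refine hom_ext_of_pt πG A.chart fun {T f} q => ?_
  rw [A.chart_map, ← 𝓖.gr.fib.assoc _ _ _ rfl (by rw [← e, Category.assoc]), A.chart_map,
    A.chart_map]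
  congr 1
  exact (Pt.push_push _ _ _ _ _ e _).symm

theorem lam_naturality {S T : C} {f : S ⟶ T} (i : Fin n) (x y z : ∀ k, (𝓗 k).fib.Ob S)
    (x' y' z' : ∀ k, (𝓗 k).fib.Ob T) (e : ProdAt 𝓗 i x y z) (e' : ProdAt 𝓗 i x' y' z')
    (φ : ∀ k, (𝓗 k).fib.Hom f (x k) (x' k)) (ψ : ∀ k, (𝓗 k).fib.Hom f (y k) (y' k))
    (χ : ∀ k, (𝓗 k).fib.Hom f (z k) (z' k)) (hχ : HomProdAt 𝓗 i φ ψ χ) :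
    𝓖.gr.fib.post (𝓖.gr.tens (A.map φ) (A.map ψ)) (A.lam e') =
      𝓖.gr.fib.pre (A.lam e) (A.map χ) := by
  refine 𝓖.gr.isStack.hom_ext ((loc_ptMul (πH := πH) (B := B) e).mono ?_)
  rintro R s ⟨q, p, m, h⟩
  refine ⟨_, 𝓖.gr.tens (A.chart q) (A.chart p), ?_⟩
  rw [← FibGpd.post_comp_assoc, A.chart_lam e h, ← FibGpd.comp_pre_assoc, A.chart_map]
  refine (𝓖.gr.fib.assoc _ _ _ rfl (Category.comp_id _) _ _).symm.trans ?_
  rw [← 𝓖.gr.tens_comp, A.chart_map, A.chart_map]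
  exact A.chart_lam e' (h.push e e' hχ rfl)

theorem lam_assoc {S : C} (i : Fin n) (x y z xy yz l r : ∀ k, (𝓗 k).fib.Ob S)
    (e₁ : ProdAt 𝓗 i x y xy) (e₂ : ProdAt 𝓗 i xy z l) (e₃ : ProdAt 𝓗 i y z yz)
    (e₄ : ProdAt 𝓗 i x yz r) (a : ∀ k, l k ⟶ r k) (ha : ∀ k, k ≠ i → HEq (a k) (𝟙 (l k)))
    (ha' : HEq (a i) (α_ (x i) (y i) (z i)).hom) :
    (A.lam e₁ ▷ A.obj z) ≫ A.lam e₂ ≫ (A.map a : A.obj l ⟶ A.obj r) =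
      (α_ (A.obj x) (A.obj y) (A.obj z)).hom ≫ (A.obj x ◁ A.lam e₃) ≫ A.lam e₄ := by
  refine 𝓖.gr.isStack.fiber_hom_ext
    ((loc_ptMul_assoc (πH := πH) (B := B) e₁ e₂ e₃).mono ?_)
  rintro T f ⟨q₁, q₂, q₃, q₁₂, q₂₃, q, h₁, h₂, h₃⟩
  have h₄ := PtMul.assoc e₁ e₂ e₃ e₄ ha ha' h₁ h₂ h₃ (Category.comp_id f)
  have h₅ : 𝓖.gr.fib.post (A.chart q) (A.map a) = A.chart (q.push a (Category.comp_id f)) :=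
    A.chart_map a q _
  refine ⟨_, 𝓖.gr.tens (𝓖.gr.tens (A.chart q₁) (A.chart q₂)) (A.chart q₃), ?_⟩
  rw [FibGpd.post_comp, ← GrStack.tens_post_left, A.chart_lam e₁ h₁, GrStack.tens_pre_left,
    FibGpd.post_comp, FibGpd.pre_post, A.chart_lam e₂ h₂, FibGpd.pre_post, FibGpd.pre_post, h₅,
    FibGpd.post_comp, 𝓖.gr.associator_naturality, FibGpd.pre_post, FibGpd.post_comp,
    ← GrStack.tens_post_right, A.chart_lam e₃ h₃, GrStack.tens_pre_right, FibGpd.pre_post,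
    A.chart_lam e₄ h₄, ← FibGpd.comp_pre, ← FibGpd.comp_pre, ← FibGpd.comp_pre]
  congr 1
  exact (πG.mu_assoc_ident h₁.j_eq h₃.j_eq h₂.j_eq h₄.j_eq).trans (Category.assoc _ _ _).symm

theorem eps_naturality {S T : C} {f : S ⟶ T} (i : Fin n) (x : ∀ k, (𝓗 k).fib.Ob S)
    (x' : ∀ k, (𝓗 k).fib.Ob T) (e : x i = 𝟙_ ((𝓗 i).fib.Ob S)) (e' : x' i = 𝟙_ ((𝓗 i).fib.Ob T))
    (φ : ∀ k, (𝓗 k).fib.Hom f (x k) (x' k)) (hφ : HEq (φ i) ((𝓗 i).unitMap f)) :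
    𝓖.gr.fib.post (A.map φ) (A.eps e') = 𝓖.gr.fib.pre (A.eps e) (𝓖.gr.unitMap f) := by
  refine 𝓖.gr.isStack.hom_ext ((UnitPt.loc_exists πH B e).mono ?_)
  rintro R s ⟨q, h⟩
  refine ⟨_, A.chart q, ?_⟩
  rw [← FibGpd.post_comp_assoc, A.chart_eps e h, ← FibGpd.comp_pre_assoc, 𝓖.gr.unitMap_comp]
  refine (𝓖.gr.fib.assoc _ _ _ rfl (Category.comp_id _) _ _).symm.trans ?_
  rw [A.chart_map]
  exact A.chart_eps e' (h.push e e' hφ rfl)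

theorem left_unit {S : C} (i : Fin n) (x y z : ∀ k, (𝓗 k).fib.Ob S)
    (e : x i = 𝟙_ ((𝓗 i).fib.Ob S)) (e' : ProdAt 𝓗 i x y z) (L : ∀ k, z k ⟶ y k)
    (hL : ∀ k, k ≠ i → HEq (L k) (𝟙 (y k))) (hL' : HEq (L i) (λ_ (y i)).hom) :
    A.lam e' ≫ (A.map L : A.obj z ⟶ A.obj y) = (A.eps e ▷ A.obj y) ≫ (λ_ (A.obj y)).hom := by
  refine 𝓖.gr.isStack.fiber_hom_ext ((loc_pt πH B y).mono ?_)
  rintro T f ⟨p⟩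
  obtain ⟨q, hq, hy, ha⟩ := UnitPt.exists_agree e
    (fun k hk => (e'.left k hk).trans (e'.right k hk).symm) p
  obtain ⟨m, h⟩ := exists_ptMul e' q p hy ha
  have h₁ := A.chart_arr (hq.isArr_mul_left e' e h hL hL' (Category.comp_id f) (Category.id_comp f))
  have h₅ : 𝓖.gr.fib.post (A.chart m) (A.map L) = A.chart (m.push L (Category.comp_id f)) :=
    A.chart_map L m _
  have h₆ : B.j p.e = B.j m.e := by rw [← h.j_eq, ← hq.j_eq, one_mul]
  change 𝓖.gr.fib.pre (πG.ident (B.j p.e) (B.j m.e) h₆) _ = _ at h₁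
  refine ⟨_, 𝓖.gr.tens (A.chart q) (A.chart p), ?_⟩
  rw [FibGpd.post_comp, A.chart_lam e' h, FibGpd.pre_post, h₅, FibGpd.post_comp,
    ← GrStack.tens_post_left, A.chart_eps e hq, GrStack.tens_pre_left, FibGpd.pre_post, 𝓖.gr.leftUnitor_naturality, ← h₁,
    ← FibGpd.comp_pre, ← FibGpd.comp_pre]
  congr 1
  exact (πG.mu_unit_left hq.j_eq h.j_eq h₆).trans (Category.assoc _ _ _).symm

theorem right_unit {S : C} (i : Fin n) (x y z : ∀ k, (𝓗 k).fib.Ob S)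
    (e : y i = 𝟙_ ((𝓗 i).fib.Ob S)) (e' : ProdAt 𝓗 i x y z) (L : ∀ k, z k ⟶ x k)
    (hL : ∀ k, k ≠ i → HEq (L k) (𝟙 (x k))) (hL' : HEq (L i) (ρ_ (x i)).hom) :
    A.lam e' ≫ (A.map L : A.obj z ⟶ A.obj x) = (A.obj x ◁ A.eps e) ≫ (ρ_ (A.obj x)).hom := by
  refine 𝓖.gr.isStack.fiber_hom_ext ((loc_pt πH B x).mono ?_)
  rintro T f ⟨p⟩
  obtain ⟨q, hq, hy, ha⟩ := UnitPt.exists_agree e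
    (fun k hk => (e'.right k hk).trans (e'.left k hk).symm) p
  obtain ⟨m, h⟩ := exists_ptMul e' p q (fun k hk => (hy k hk).symm) (fun k hk => (ha k hk).symm)
  have h₁ := A.chart_arr
    (hq.isArr_mul_right e' e h hL hL' (Category.comp_id f) (Category.id_comp f))
  have h₅ : 𝓖.gr.fib.post (A.chart m) (A.map L) = A.chart (m.push L (Category.comp_id f)) :=
    A.chart_map L m _
  have h₆ : B.j p.e = B.j m.e := by rw [← h.j_eq, ← hq.j_eq, mul_one]
  change 𝓖.gr.fib.pre (πG.ident (B.j p.e) (B.j m.e) h₆) _ = _ at h₁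
  refine ⟨_, 𝓖.gr.tens (A.chart p) (A.chart q), ?_⟩
  rw [FibGpd.post_comp, A.chart_lam e' h, FibGpd.pre_post, h₅, FibGpd.post_comp,
    ← GrStack.tens_post_right, A.chart_eps e hq, GrStack.tens_pre_right, FibGpd.pre_post, 𝓖.gr.rightUnitor_naturality, ← h₁,
    ← FibGpd.comp_pre, ← FibGpd.comp_pre]
  congr 1
  exact (πG.mu_unit_right hq.j_eq h.j_eq h₆).trans (Category.assoc _ _ _).symm

theorem interchange {S : C} (i k : Fin n) (hik : i < k)
    (x x' y y' xx yy xy xy' t : ∀ k, (𝓗 k).fib.Ob S)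
    (e₁ : ProdAt 𝓗 i x x' xx) (e₂ : ProdAt 𝓗 i y y' yy) (e₃ : ProdAt 𝓗 k xx yy t)
    (e₄ : ProdAt 𝓗 k x y xy) (e₅ : ProdAt 𝓗 k x' y' xy') (e₆ : ProdAt 𝓗 i xy xy' t) :
    (A.lam e₁ ⊗ₘ A.lam e₂) ≫ A.lam e₃ =
      tensorμ (A.obj x) (A.obj x') (A.obj y) (A.obj y') ≫
        (A.lam e₄ ⊗ₘ A.lam e₅) ≫ A.lam e₆ := by
  refine 𝓖.gr.isStack.fiber_hom_ext
    ((loc_ptMul_interchange (πH := πH) (B := B) hik.ne e₁ e₂ e₃ e₄ e₅ e₆).mono ?_)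
  rintro T f ⟨q, q', p, p', qq, pp, qp, qp', m, m', h₁, h₂, h₃, h₄, h₅, h₆⟩
  have a := PtMul.interchange hik e₁ e₂ e₃ e₄ e₅ e₆ h₁ h₂ h₃ h₄ h₅ h₆ (Category.id_comp f)
  have h := A.chart_arr a
  have h₇ : B.j m.e = B.j m'.e * G.bd (G.act (G.br (B.j q'.e) (B.j p.e))⁻¹ (B.j p'.e)) := by
    rw [← a.arr.j_eq, res_id]
  change 𝓖.gr.fib.pre (πG.vert (B.j m'.e) (B.j m.e) _ h₇) _ = _ at h
  refine ⟨_, 𝓖.gr.tens (𝓖.gr.tens (A.chart q) (A.chart q')) (𝓖.gr.tens (A.chart p) (A.chart p')), ?_⟩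
  have sq : 𝓖.gr.fib.post _ _ = 𝓖.gr.fib.pre _ _ :=
    BraidedGrStack.sq_tensorμ (A.chart q) (A.chart q') (A.chart p) (A.chart p')
  rw [FibGpd.post_comp, ← GrStack.tens_post, A.chart_lam e₁ h₁, A.chart_lam e₂ h₂,
    GrStack.tens_pre, FibGpd.pre_post, A.chart_lam e₃ h₃, FibGpd.post_comp, sq, FibGpd.pre_post,
    FibGpd.post_comp, ← GrStack.tens_post, A.chart_lam e₄ h₄, A.chart_lam e₅ h₅,
    GrStack.tens_pre, FibGpd.pre_post, A.chart_lam e₆ h₆, ← h, ← FibGpd.comp_pre,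
    ← FibGpd.comp_pre, ← FibGpd.comp_pre, ← FibGpd.comp_pre]
  congr 1
  rw [πG.tensorμ_mu_ident h₁.j_eq h₂.j_eq h₃.j_eq h₄.j_eq h₅.j_eq h₆.j_eq h₇]
  simp only [Category.assoc]

theorem eps_eq {S : C} (i k : Fin n) (x : ∀ k, (𝓗 k).fib.Ob S) (e : x i = 𝟙_ ((𝓗 i).fib.Ob S))
    (e' : x k = 𝟙_ ((𝓗 k).fib.Ob S)) : A.eps e = A.eps e' := by
  rcases eq_or_ne i k with rfl | hik
  · rfl
  refine 𝓖.gr.isStack.fiber_hom_ext ((loc_pt πH B x).mono ?_)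
  rintro T f ⟨p⟩
  obtain ⟨q, h, h'⟩ := UnitPt.exists_both hik e e' p
  exact ⟨_, A.chart q, (A.chart_eps e h).trans (A.chart_eps e' h').symm⟩

/-- The additive functor given by an atlas. -/
def functor : NAdditive 𝓗 𝓖 where
  obj := A.obj
  map := A.map
  map_id := A.map_id
  map_comp := A.map_comp
  lam _ _ _ _ := A.lam
  lam_naturality := A.lam_naturality
  lam_assoc := A.lam_assoc
  eps _ _ := A.eps
  eps_naturality := A.eps_naturality
  left_unit := A.left_unit
  right_unit := A.right_unit
  interchange := A.interchange
  eps_eq := A.eps_eq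

/-- The chart of the value at `π y` given by a point over `y`. -/
abbrev pt {S : C} (e : B.El S) : Pt πH B (fun k => (πH k).obj (B.p e k)) (𝟙 S) :=
  ⟨B.p e, fun _ => (𝓗 _).fib.id _, e, rfl⟩

theorem ptMul_pt {S : C} (i : Fin n) (e e' : B.El S) (a : AgreeOff i (B.p e) (B.p e'))
    (z : ∀ k, (𝓗 k).fib.Ob S)
    (hz : ProdAt 𝓗 i (fun k => (πH k).obj (B.p e k)) (fun k => (πH k).obj (B.p e' k)) z)
    (m : ∀ k, z k ⟶ (πH k).obj (B.p (B.mul i e e' a) k))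
    (hm : ∀ k, k ≠ i → HEq (m k) (𝟙 (z k))) (hm' : HEq (m i) ((πH i).mu (B.p e i) (B.p e' i))) :
    PtMul i (pt e) (pt e') (⟨_, fun k => inv (m k), B.mul i e e' a, rfl⟩ : Pt πH B z (𝟙 S)) := by
  have hp : ∀ k, k ≠ i → z k = (πH k).obj (B.p (B.mul i e e' a) k) := fun k hk => by
    rw [B.p_mul, Function.update_of_ne hk, ← hz.left k hk]
  refine ⟨a, rfl, fun k hk => ?_, fun k hk => ?_, fun h => ?_⟩
  · refine HEq.trans ?_ (inv_heq_of_id (hp k hk) (hm k hk)).symm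
    rw [← hz.left k hk]
    rfl
  · refine HEq.trans ?_ (inv_heq_of_id (hp k hk) (hm k hk)).symm
    rw [← hz.right k hk]
    rfl
  · exact (πH i).pre_mu_inv h hz.prod hm'

/-- The comparison of the butterfly with the additive functor given by an atlas. -/
def comparison : Comparison πH πG B A.functor where
  app e := A.chart (pt e)
  app_res {T S} f e := by
    refine (A.chart_arr (q := pt e) (q' := (pt (B.E.map f.op e)).push (fun k => (πH k).cart f
      (B.p (B.E.map f.op e) k) (B.p e k) (B.p_res f e k).symm) (Category.id_comp f))
      (w := Category.comp_id f) (γ := fun _ => 1) (g := 1)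
      ⟨?_, fun k h => ?_⟩).trans (A.chart_map _ (pt (B.E.map f.op e)) _).symm
    · rw [NButterfly.IsArr, B.transport_one fun _ => rfl, B.act_one]
    · exact ((𝓗 k).fib.comp_id _).trans ((𝓗 k).fib.id_comp _).symm
  app_act {S} e g := by
    refine (A.chart_arr (q := pt (B.act e g)) (q' := (pt e).push (fun k => (πH k).ident
      (B.p e k) (B.p (B.act e g) k) (congrFun (B.p_act e g).symm k)) (Category.comp_id _))
      (w := Category.comp_id _) (γ := fun _ => 1) (g := g)
      ⟨?_, fun k h => ?_⟩).trans (A.chart_map _ (pt e) _).symm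
    · rw [NButterfly.IsArr, B.transport_one fun _ => rfl, B.map_id]
    · exact ((𝓗 k).fib.comp_id _).trans ((𝓗 k).fib.id_comp _).symm
  app_mul {S} i e e' a z hz m hm hm' := by
    have h := ptMul_pt (πH := πH) i e e' a z hz m hm hm'
    have h₁ := A.chart_lam hz h
    have h₂ : 𝓖.gr.fib.post (A.chart ⟨_, fun k => inv (m k), B.mul i e e' a, rfl⟩) (A.map m) =
        A.chart (pt (B.mul i e e' a)) := by
      refine (A.chart_map m _ _).trans ?_
      congr 1
      unfold Pt.push
      congr 1
      funext k
      exact IsIso.inv_hom_id (m k)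
    have h₃ : (A.chart (pt e) ⊗ₘ A.chart (pt e')) ≫ A.lam hz =
        (πG.mu (B.j e) (B.j e') ≫ πG.ident _ _ h.j_eq) ≫
          A.chart ⟨_, fun k => inv (m k), B.mul i e e' a, rfl⟩ := by
      rw [← 𝓖.gr.tens_fiber]
      exact h₁
    refine (Category.assoc _ _ _).symm.trans ((congrArg (· ≫ _) h₃).trans ?_)
    exact (Category.assoc _ _ _).trans ((congrArg (_ ≫ ·) h₂).trans (Category.assoc _ _ _))
  app_s {S} i e y h hy a γ hγ hi hk := by
    refine (A.chart_map _ (pt e) _).trans (A.chart_arr (q := pt (B.mul i e (B.s i y h hy) a))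
      (q' := (pt e).push (fun k => (πH k).vert (B.p e k) (B.p (B.mul i e (B.s i y h hy) a) k) (γ k)
        (hγ k)) (Category.comp_id _))
      (w := Category.comp_id _) (γ := γ) (g := 1)
      ⟨?_, fun k h => ?_⟩).symm
    · rw [NButterfly.IsArr, B.transport_eq_shift hk, B.map_id, B.act_one, hi]
      exact B.mul_s _ _ _ _ _ _
    · exact ((𝓗 k).fib.comp_id _).trans ((𝓗 k).fib.id_comp _).symm

end FullAtlas

theorem exists_comparison (πH : ∀ k, Presentation (H k) (𝓗 k)) (πG : BraidedPresentation G 𝓖)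
    (B : NButterfly H G) : ∃ F : NAdditive 𝓗 𝓖, Nonempty (Comparison πH πG B F) := by
  obtain ⟨A⟩ := nonempty_atlas πH πG B
  obtain ⟨A⟩ := A.exists_full
  exact ⟨A.functor, ⟨A.comparison⟩⟩

end Construction

/-! ## The equivalence -/

section Trivial

variable {C : Type u} [Category.{v} C] {J : GrothendieckTopology C}

namespace NAdditive

variable {K : CrossedModule.{w} J} {𝓧 : GrStack.{o, h} J} (π : Presentation K 𝓧)

theorem unitVert_vert {S : C} {u v : Sec K.G₀ S} {g g' g'' : Sec K.G₁ S} (e : u = K.bd g)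
    (e' : v = u * K.bd g') (e'' : v = K.bd g'') (hg : g'' = g * g') :
    unitVert π u g e ≫ π.vert u v g' e' = unitVert π v g'' e'' := by
  rw [unitVert, unitVert, Category.assoc, π.vert_comp hg]

theorem unitVert_mu_unitVert {S : C} {u v m : Sec K.G₀ S} {g k l : Sec K.G₁ S} (hm : u * v = m)
    (hl : l = g * k) (e₁ : u = K.bd g)
    (e₂ : v = K.bd k) (e₃ : m = K.bd l) :
    (unitVert π u g e₁ ⊗ₘ unitVert π v k e₂) ≫ π.mu u v ≫ π.ident _ _ hm =
      (λ_ (𝟙_ (𝓧.fib.Ob S))).hom ≫ unitVert π m l e₃ := by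
  have h₁ : u = 1 * K.bd g := by rw [one_mul, e₁]
  have h₂ : v = 1 * K.bd k := by rw [one_mul, e₂]
  have h₃ : u * v = 1 * 1 * K.bd (K.act g 1 * k) := by
    rw [K.act_one, ← hl, hm, e₃, one_mul, one_mul]
  have h₄ : (π.eta S ⊗ₘ π.eta S) ≫ π.mu 1 1 ≫ π.ident (1 * 1) 1 (one_mul 1) =
      (λ_ (𝟙_ (𝓧.fib.Ob S))).hom ≫ π.eta S := by
    rw [tensorHom_def', Category.assoc, π.left_unit, leftUnitor_naturality]
  unfold unitVert
  rw [← tensorHom_comp_tensorHom, Category.assoc, reassoc_of% (π.vert_mu h₁ h₂ h₃),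
    ← reassoc_of% h₄, π.vert_comp_ident, π.ident_comp_vert]
  congr 2
  exact π.vert_congr (by rw [K.act_one, hl]) _ _

/-- The inverse of `unitVert`. -/
noncomputable def unitInv {S : C} (u : Sec K.G₀ S) (g : Sec K.G₁ S) (e : u = K.bd g) :
    π.obj u ⟶ 𝟙_ (𝓧.fib.Ob S) :=
  inv (unitVert π u g e)

theorem unitInv_naturality {T S : C} (f : T ⟶ S) {u : Sec K.G₀ T} {v : Sec K.G₀ S}
    {g : Sec K.G₁ T} {k : Sec K.G₁ S} (e : u = K.bd g) (e' : v = K.bd k) (h)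
    (hg : res K.G₁ f k = g) :
    𝓧.fib.Sq (π.cart f u v h) (𝓧.unitMap f) (unitInv π u g e) (unitInv π v k e') :=
  FibGpd.Sq.inv (a := asIso (unitVert π u g e)) (b := asIso (unitVert π v k e'))
    (unitVert_comp_vert π e e' _ (hg.trans (mul_one _).symm))

theorem vert_unitInv {S : C} {u v : Sec K.G₀ S} {g g' g'' : Sec K.G₁ S} (e : u = K.bd g)
    (e' : v = u * K.bd g') (e'' : v = K.bd g'') (hg : g'' = g * g') :
    π.vert u v g' e' ≫ unitInv π v g'' e'' = unitInv π u g e := by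
  rw [unitInv, unitInv, IsIso.comp_inv_eq, IsIso.eq_inv_comp]
  exact unitVert_vert π e e' e'' hg

theorem unitInv_mu {S : C} {u v m : Sec K.G₀ S} {g k l : Sec K.G₁ S} (hm : u * v = m)
    (hl : l = g * k) (e₁ : u = K.bd g) (e₂ : v = K.bd k) (e₃ : m = K.bd l) :
    (unitInv π u g e₁ ⊗ₘ unitInv π v k e₂) ≫ (λ_ (𝟙_ (𝓧.fib.Ob S))).hom =
      π.mu u v ≫ π.ident _ _ hm ≫ unitInv π m l e₃ := by
  have h := unitVert_mu_unitVert π hm hl e₁ e₂ e₃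
  simp only [unitInv]
  rw [← Category.assoc (π.mu _ _), IsIso.eq_comp_inv, Category.assoc, ← h,
    tensorHom_comp_tensorHom_assoc, IsIso.inv_hom_id, IsIso.inv_hom_id, id_tensorHom_id,
    Category.id_comp]

theorem eta_unitInv {S : C} {u : Sec K.G₀ S} {g : Sec K.G₁ S} (e : u = K.bd g) (hg : g = 1) (h) :
    π.eta S ≫ π.ident 1 u h ≫ unitInv π u g e = 𝟙 _ := by
  have h₁ : unitVert π u g e = π.eta S ≫ π.ident 1 u h :=
    congrArg (_ ≫ ·) (π.vert_congr hg _ _)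
  rw [unitInv, ← Category.assoc, ← h₁, IsIso.hom_inv_id]

end NAdditive

end Trivial

section Equivalence

variable {C : Type u} [Category.{v} C] {J : GrothendieckTopology C} {n : ℕ}
  {H : Fin n → CrossedModule.{w} J} {G : BraidedCrossedModule.{w} J}
  {𝓗 : Fin n → GrStack.{o₁, h₁} J} {𝓖 : BraidedGrStack.{o₂, h} J}
  (πH : ∀ k, Presentation (H k) (𝓗 k)) (πG : BraidedPresentation G 𝓖)

theorem NAdditive.trivial_map {S : C} {x y : ∀ k, (𝓗 k).fib.Ob S} (φ : ∀ k, x k ⟶ y k) :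
    (NAdditive.trivial 𝓗 𝓖).map φ = 𝟙 (𝟙_ (𝓖.gr.fib.Ob S)) :=
  𝓖.gr.unitMap_id S

/-- The comparison of the trivial butterfly and the trivial functor. -/
noncomputable def trivialComparison :
    Comparison πH πG (NButterfly.trivial H G) (NAdditive.trivial 𝓗 𝓖) where
  app {S} o := NAdditive.unitInv πG.toPresentation (S := S) _ o.2 rfl
  app_res {T S} f o :=
    NAdditive.unitInv_naturality πG.toPresentation f rfl rfl _ rfl
  app_act {S} o g := by
    have h := NAdditive.vert_unitInv πG.toPresentation (S := S) (g := o.2) (g' := g)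
      (u := (NButterfly.trivial H G).j o) rfl ((NButterfly.trivial H G).j_act o g) rfl rfl
    exact h.trans ((Category.comp_id _).symm.trans
      (congrArg (NAdditive.unitInv πG.toPresentation _ o.2 rfl ≫ ·) (NAdditive.trivial_map _).symm))
  app_mul {S} i o o' a z hz m hm hm' := by
    have h := NAdditive.unitInv_mu πG.toPresentation
      ((NButterfly.trivial H G).j_mul i o o' a).symm
      (l := ((NButterfly.trivial H G).mul i o o' a).2) rfl rfl rfl rfl
    exact (congrArg (fun t => _ ≫ (λ_ (𝟙_ (𝓖.gr.fib.Ob S))).hom ≫ t)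
      (NAdditive.trivial_map m)).trans
        ((congrArg (fun t => _ ≫ t) (Category.comp_id _)).trans h)
  app_s {S} i o y h hy a γ hγ hγ₁ hγ₂ := by
    have h := NAdditive.vert_unitInv πG.toPresentation (S := S) (g := o.2) (g' := 1)
      (u := (NButterfly.trivial H G).j o)
      (v := (NButterfly.trivial H G).j ((NButterfly.trivial H G).mul i o _ a)) rfl
      (((NButterfly.trivial H G).j_mul i o _ a).trans rfl) rfl rfl
    exact (congrArg (NAdditive.unitInv πG.toPresentation _ o.2 rfl ≫ ·)
      (NAdditive.trivial_map _)).trans ((Category.comp_id _).trans h.symm)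

instance NAdditive.isGroupoid : IsGroupoid (NAdditive 𝓗 𝓖) where
  all_isIso η :=
    (inferInstance : IsIso (NAdditive.mkIso (fun x => asIso (NAdditive.Hom.app η x))
      (NAdditive.Hom.naturality η) (NAdditive.Hom.app_lam η) (NAdditive.Hom.app_eps η)).hom)

variable {πH πG} {B B' B'' : NButterfly H G} {F F' F'' : NAdditive 𝓗 𝓖}

/-- The image of a frame under a morphism of additive functors. -/
def Frame.map {S : C} (d : Frame πH πG F S) (η : F ⟶ F') : Frame πH πG F' S :=
  ⟨d.y, d.x, d.φ ≫ NAdditive.Hom.app η _⟩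

theorem Frame.map_id {S : C} (d : Frame πH πG F S) : d.map (𝟙 F) = d := by
  obtain ⟨y, x, φ⟩ := d
  exact congrArg (Frame.mk y x) (Category.comp_id φ)

theorem Frame.map_comp {S : C} (d : Frame πH πG F S) (η : F ⟶ F') (η' : F' ⟶ F'') :
    d.map (η ≫ η') = (d.map η).map η' := by
  obtain ⟨y, x, φ⟩ := d
  exact congrArg (Frame.mk y x) (Category.assoc _ _ _).symm

namespace Comparison

/-- The composite of a comparison with a morphism of additive functors. -/
def postcomp (c : Comparison πH πG B F) (η : F ⟶ F') : Comparison πH πG B F' where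
  app e := c.app e ≫ NAdditive.Hom.app η _
  app_res f e := by
    rw [FibGpd.post_comp, c.app_res, FibGpd.pre_post, NAdditive.Hom.naturality, ← FibGpd.comp_pre]
  app_act e g := by
    rw [← Category.assoc, c.app_act, Category.assoc, Category.assoc]
    exact congrArg (c.app e ≫ ·) (NAdditive.hom_naturality_fiber η _)
  app_mul i e e' a z hz m hm hm' := by
    have h := c.app_mul i e e' a z hz m hm hm'
    have h₁ := NAdditive.hom_naturality_fiber η m
    rw [← Category.assoc (πG.ident _ _ _), ← Category.assoc (πG.mu _ _), ← h,
      ← tensorHom_comp_tensorHom, Category.assoc, ← reassoc_of% (NAdditive.Hom.app_lam η)]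
    simp only [Category.assoc]
    exact congrArg (fun t => _ ≫ _ ≫ t) h₁.symm
  app_s i e y h hy a γ hγ hγ₁ hγ₂ := by
    rw [← Category.assoc (πG.ident _ _ _), ← c.app_s i e y h hy a γ hγ hγ₁ hγ₂, Category.assoc,
      Category.assoc]
    exact congrArg (c.app e ≫ ·) (NAdditive.hom_naturality_fiber η _).symm

end Comparison

end Equivalence

/-! ## The functor from butterflies to additive functors -/

section ToAdditive

variable {C : Type u} [Category.{v} C] {J : GrothendieckTopology C} {n : ℕ}
  {H : Fin n → CrossedModule.{w} J} {G : BraidedCrossedModule.{w} J}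
  {𝓗 : Fin n → GrStack.{o₁, h₁} J} {𝓖 : BraidedGrStack.{o₂, w} J}

theorem Frame.φ_injective {πH : ∀ k, Presentation (H k) (𝓗 k)} {πG : BraidedPresentation G 𝓖}
    {F : NAdditive 𝓗 𝓖} {S : C} {y : ∀ k, Sec (H k).G₀ S} {x : Sec G.G₀ S}
    {φ φ' : πG.obj x ⟶ F.val πH y} (h : (⟨y, x, φ⟩ : Frame πH πG F S) = ⟨y, x, φ'⟩) : φ = φ' := by
  injection h

namespace Comparison

variable {πH : ∀ k, Presentation (H k) (𝓗 k)} {πG : BraidedPresentation G 𝓖}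
  {B B' : NButterfly H G} {F F' : NAdditive 𝓗 𝓖}

theorem exists_map (c : Comparison πH πG B F) (c' : Comparison πH πG B' F') (ψ : B ⟶ B') :
    ∃ η : F ⟶ F', ∀ {S : C} (e : B.El S), (c.frame e).map η = c'.frame (ψ.hom.app (op S) e) := by
  obtain ⟨η, hη⟩ := exists_hom c (c'.precomp ψ)
  refine ⟨η, fun e => ?_⟩
  rw [← c'.frame_precomp]
  exact congrArg (Frame.mk (B.p e) (B.j e)) (hη e)

theorem map_unique (c : Comparison πH πG B F) {η η' : F ⟶ F'}
    (h : ∀ {S : C} (e : B.El S), (c.frame e).map η = (c.frame e).map η') : η = η' := by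
  exact hom_unique c fun e => Frame.φ_injective (h e)

end Comparison

namespace NButterfly

variable (πH : ∀ k, Presentation (H k) (𝓗 k)) (πG : BraidedPresentation G 𝓖)

/-- The additive functor of a butterfly. -/
noncomputable def additive (B : NButterfly H G) : NAdditive 𝓗 𝓖 :=
  (exists_comparison πH πG B).choose

/-- The values of `additive`. -/
noncomputable def additiveComparison (B : NButterfly H G) : Comparison πH πG B (B.additive πH πG) :=
  (exists_comparison πH πG B).choose_spec.some

variable {B B' : NButterfly H G}

/-- The natural transformation given by a morphism of butterflies. -/
noncomputable def additiveMap (ψ : B ⟶ B') : B.additive πH πG ⟶ B'.additive πH πG :=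
  ((B.additiveComparison πH πG).exists_map (B'.additiveComparison πH πG) ψ).choose

theorem frame_additiveMap (ψ : B ⟶ B') {S : C} (e : B.El S) :
    ((B.additiveComparison πH πG).frame e).map (additiveMap πH πG ψ) =
      (B'.additiveComparison πH πG).frame (ψ.hom.app (op S) e) :=
  ((B.additiveComparison πH πG).exists_map (B'.additiveComparison πH πG) ψ).choose_spec e

/-- The functor from butterflies to additive functors. -/
noncomputable def toAdditive : NButterfly H G ⥤ NAdditive 𝓗 𝓖 where
  obj B := B.additive πH πG
  map ψ := additiveMap πH πG ψ
  map_id B := (B.additiveComparison πH πG).map_unique fun e => by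
    rw [frame_additiveMap, Frame.map_id, id_hom_app]
  map_comp {B B' B''} ψ ψ' := (B.additiveComparison πH πG).map_unique fun e => by
    rw [frame_additiveMap, Frame.map_comp, frame_additiveMap, frame_additiveMap, comp_hom_app]

/-- The values of the additive functor of a butterfly. -/
noncomputable def comparison (B : NButterfly H G) :
    Comparison πH πG B ((toAdditive πH πG).obj B) :=
  B.additiveComparison πH πG

theorem frame_toAdditive_map (ψ : B ⟶ B') {S : C} (e : B.El S) :
    ((B.comparison πH πG).frame e).map ((toAdditive πH πG).map ψ) =
      (B'.comparison πH πG).frame (ψ.hom.app (op S) e) :=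
  frame_additiveMap πH πG ψ e

instance toAdditive_faithful : (toAdditive πH πG).Faithful where
  map_injective {B B' ψ ψ'} h := (B'.comparison πH πG).lift_unique fun e => by
    rw [← frame_toAdditive_map, ← frame_toAdditive_map, h]

instance toAdditive_full : (toAdditive πH πG).Full where
  map_surjective {B B'} η := by
    obtain ⟨ψ, hψ⟩ := Comparison.exists_lift ((B.comparison πH πG).postcomp η)
      (B'.comparison πH πG)
    refine ⟨ψ, (B.comparison πH πG).map_unique fun e => ?_⟩
    rw [frame_toAdditive_map, hψ]
    rfl

/-- The isomorphism of an additive functor compared with `B` and the additive functor of `B`. -/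
theorem exists_iso {F : NAdditive 𝓗 𝓖} (c : Comparison πH πG B F) :
    ∃ η : (toAdditive πH πG).obj B ≅ F, ∀ {S : C} (e : B.El S),
      ((B.comparison πH πG).frame e).map η.hom = c.frame e := by
  obtain ⟨η, hη⟩ := (B.comparison πH πG).exists_map c (𝟙 B)
  exact ⟨asIso η, fun e => by rw [asIso_hom, hη, id_hom_app]⟩

instance toAdditive_essSurj : (toAdditive πH πG).EssSurj where
  mem_essImage F :=
    have ⟨η, _⟩ := exists_iso πH πG (Frame.comparison πH πG F)
    ⟨_, ⟨η⟩⟩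

instance toAdditive_isEquivalence : (toAdditive πH πG).IsEquivalence where

theorem comparison_naturality (ψ : B ⟶ B') {S : C} (e : B.El S) :
    (B.comparison πH πG).app e ≫ NAdditive.Hom.app ((toAdditive πH πG).map ψ) _ =
      πG.ident (B.j e) (B'.j (ψ.hom.app (op S) e)) (ψ.j_hom e).symm ≫
        (B'.comparison πH πG).app (ψ.hom.app (op S) e) ≫
          ((toAdditive πH πG).obj B').ident πH _ (B.p e) (ψ.p_hom e) :=
  Frame.φ_eq_of_eq (frame_toAdditive_map πH πG ψ e) _ _

theorem exists_toAdditive_trivial :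
    ∃ ι : (toAdditive πH πG).obj (NButterfly.trivial H G) ≅ NAdditive.trivial 𝓗 𝓖,
      ∀ {S : C} (o : (NButterfly.trivial H G).El S),
        (((NButterfly.trivial H G).comparison πH πG).frame o).map ι.hom =
          (trivialComparison πH πG).frame o :=
  exists_iso πH πG _

theorem eta_frame_trivial {ι : (toAdditive πH πG).obj (NButterfly.trivial H G) ≅ NAdditive.trivial 𝓗 𝓖}
    (hι : ∀ {S : C} (o : (NButterfly.trivial H G).El S),
      (((NButterfly.trivial H G).comparison πH πG).frame o).map ι.hom =
        (trivialComparison πH πG).frame o) {S : C} (o : (NButterfly.trivial H G).El S)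
    (h : 1 = (NButterfly.trivial H G).j o) (ho : o.2 = 1) :
    πG.eta S ≫ πG.ident 1 ((NButterfly.trivial H G).j o) h ≫
        ((NButterfly.trivial H G).comparison πH πG).app o ≫ NAdditive.Hom.app ι.hom
          (fun k => (πH k).obj ((NButterfly.trivial H G).p o k)) =
      𝟙 (𝟙_ (𝓖.gr.fib.Ob S)) := by
  exact (congrArg (fun t => πG.eta S ≫ πG.ident 1 _ h ≫ t) (Frame.φ_injective (hι o))).trans
    (NAdditive.eta_unitInv πG.toPresentation _ ho h)

end NButterfly

end ToAdditive

/-! ## Products of frames -/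

section Wedge

variable {C : Type u} [Category.{v} C] {J : GrothendieckTopology C} {n : ℕ}
  {H : Fin n → CrossedModule.{w} J} {G : BraidedCrossedModule.{w} J}
  {𝓗 : Fin n → GrStack.{o₁, h₁} J} {𝓖 : BraidedGrStack.{o₂, w} J} (hs : 𝓖.IsSymmetric)

namespace Presentation

variable {K : CrossedModule.{w} J} {𝓧 : GrStack.{o, h} J} (π : Presentation K 𝓧) {S : C}

theorem eta_mu_eta (S : C) :
    (π.eta S ⊗ₘ π.eta S) ≫ π.mu 1 1 ≫ π.ident (1 * 1) 1 (one_mul 1) =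
      (λ_ (𝟙_ (𝓧.fib.Ob S))).hom ≫ π.eta S := by
  rw [tensorHom_def', Category.assoc, π.left_unit, leftUnitor_naturality]

/-- The inverse of the unit isomorphism. -/
noncomputable def etaInv (S : C) : π.obj (1 : Sec K.G₀ S) ⟶ 𝟙_ (𝓧.fib.Ob S) :=
  inv (π.eta S)

variable {x x' x'' : Sec K.G₀ S} {a b c : 𝓧.fib.Ob S}

/-- The tensor product of isomorphisms `π x ⟶ a` and `π x' ⟶ b`. -/
noncomputable def wedge (φ : π.obj x ⟶ a) (φ' : π.obj x' ⟶ b) : π.obj (x * x') ⟶ a ⊗ b :=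
  inv (π.mu x x') ≫ (φ ⊗ₘ φ')

theorem mu_wedge (φ : π.obj x ⟶ a) (φ' : π.obj x' ⟶ b) : π.mu x x' ≫ π.wedge φ φ' = (φ ⊗ₘ φ') :=
  IsIso.hom_inv_id_assoc _ _

theorem wedge_comp {a' b' : 𝓧.fib.Ob S} (φ : π.obj x ⟶ a) (φ' : π.obj x' ⟶ b) (f : a ⟶ a')
    (f' : b ⟶ b') : π.wedge φ φ' ≫ (f ⊗ₘ f') = π.wedge (φ ≫ f) (φ' ≫ f') := by
  rw [wedge, wedge, Category.assoc, tensorHom_comp_tensorHom]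

theorem wedge_etaInv {E : 𝟙_ (𝓧.fib.Ob S) ⟶ a} {E' : 𝟙_ (𝓧.fib.Ob S) ⟶ b}
    {D : 𝟙_ (𝓧.fib.Ob S) ⟶ a ⊗ b} (h : (λ_ (𝟙_ (𝓧.fib.Ob S))).hom ≫ D = (E ⊗ₘ E')) :
    π.ident (1 * 1) 1 (one_mul 1) ≫ π.etaInv S ≫ D = π.wedge (π.etaInv S ≫ E) (π.etaInv S ≫ E') := by
  simp only [etaInv, wedge]
  rw [IsIso.eq_inv_comp, ← cancel_epi (π.eta S ⊗ₘ π.eta S), tensorHom_comp_tensorHom,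
    IsIso.hom_inv_id_assoc, IsIso.hom_inv_id_assoc, reassoc_of% (π.eta_mu_eta S),
    IsIso.hom_inv_id_assoc, h]

theorem wedge_assoc (φ : π.obj x ⟶ a) (φ' : π.obj x' ⟶ b) (φ'' : π.obj x'' ⟶ c) :
    π.ident _ _ (mul_assoc x x' x'') ≫ π.wedge φ (π.wedge φ' φ'') =
      π.wedge (π.wedge φ φ') φ'' ≫ (α_ a b c).hom := by
  have h₁ := π.mu_assoc x x' x''
  simp only [wedge]
  rw [Category.assoc, IsIso.eq_inv_comp, ← cancel_epi (π.mu x x' ▷ π.obj x''), reassoc_of% h₁,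
    IsIso.hom_inv_id_assoc, ← tensorHom_id, ← id_tensorHom, tensorHom_comp_tensorHom_assoc,
    tensorHom_comp_tensorHom, IsIso.hom_inv_id_assoc, IsIso.hom_inv_id_assoc, Category.id_comp,
    Category.id_comp, associator_naturality]

theorem etaInv_wedge (φ : π.obj x ⟶ a) :
    π.ident _ _ (one_mul x) ≫ φ = π.wedge (π.etaInv S) φ ≫ (λ_ a).hom := by
  simp only [wedge, etaInv]
  rw [Category.assoc, IsIso.eq_inv_comp, ← cancel_epi (π.eta S ▷ π.obj x),
    reassoc_of% (π.left_unit x), ← tensorHom_id, tensorHom_comp_tensorHom_assoc, IsIso.hom_inv_id,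
    Category.id_comp, id_tensorHom, leftUnitor_naturality]

theorem wedge_etaInv_right (φ : π.obj x ⟶ a) :
    π.ident _ _ (mul_one x) ≫ φ = π.wedge φ (π.etaInv S) ≫ (ρ_ a).hom := by
  simp only [wedge, etaInv]
  rw [Category.assoc, IsIso.eq_inv_comp, ← cancel_epi (π.obj x ◁ π.eta S),
    reassoc_of% (π.right_unit x), ← id_tensorHom, tensorHom_comp_tensorHom_assoc, IsIso.hom_inv_id,
    Category.id_comp, tensorHom_id, rightUnitor_naturality]

end Presentation

namespace NAdditive

variable (F F' : NAdditive 𝓗 𝓖) (πH : ∀ k, Presentation (H k) (𝓗 k))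

theorem mul_mapF {S : C} {x y : ∀ k, (𝓗 k).fib.Ob S} (φ : ∀ k, x k ⟶ y k) :
    (mul hs F F').mapF φ = MonoidalCategoryStruct.tensorHom (C := 𝓖.gr.fib.Ob S)
      (F.mapF φ) (F'.mapF φ) :=
  𝓖.gr.tens_fiber (F.mapF φ) (F'.mapF φ)

theorem mul_lamV {S : C} {i : Fin n} {x y z : ∀ k, Sec (H k).G₀ S} (h : MulAt i x y z) :
    (mul hs F F').lamV πH i x y z h =
      tensorμ (F.val πH x) (F'.val πH x) (F.val πH y) (F'.val πH y) ≫
        (F.lamV πH i x y z h ⊗ₘ F'.lamV πH i x y z h) := by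
  obtain ⟨t, P, m, hm, e⟩ := F.exists_lamV_eq πH h
  rw [e, F'.lamV_eq πH h P hm, (mul hs F F').lamV_eq πH h P hm, ← tensorHom_comp_tensorHom]
  exact (congrArg (fun t => _ ≫ t) (mul_mapF hs F F' m)).trans (Category.assoc _ _ _)

theorem mul_trivV {S : C} {i : Fin n} {y : ∀ k, Sec (H k).G₀ S} {h : Sec (H i).G₁ S}
    (hy : y i = (H i).bd h) :
    (λ_ (𝟙_ (𝓖.gr.fib.Ob S))).hom ≫ (mul hs F F').trivV πH i y h hy =
      MonoidalCategoryStruct.tensorHom (C := 𝓖.gr.fib.Ob S)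
        (F.trivV πH i y h hy) (F'.trivV πH i y h hy) := by
  obtain ⟨x, e, τ, hτ⟩ := exists_unit_tuple πH i y h hy
  have h₁ := (mul hs F F').eps_trivV πH hy e hτ
  have h₂ : ∀ E : 𝟙_ (𝓖.gr.fib.Ob S) ⟶ F.val πH y ⊗ F'.val πH y,
      ((F.eps i x e ⊗ₘ F'.eps i x e) ≫ (λ_ _).hom) ≫ E = (F.mapF τ ⊗ₘ F'.mapF τ) →
      (λ_ _).hom ≫ E = (F.trivV πH i y h hy ⊗ₘ F'.trivV πH i y h hy) := fun E hE => by
    rw [← cancel_epi (F.eps i x e ⊗ₘ F'.eps i x e), tensorHom_comp_tensorHom,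
      F.eps_trivV πH hy e hτ, F'.eps_trivV πH hy e hτ, ← hE, Category.assoc]
  exact h₂ _ (h₁.trans (mul_mapF hs F F' τ))

end NAdditive

namespace Frame

variable {πH : ∀ k, Presentation (H k) (𝓗 k)} {πG : BraidedPresentation G 𝓖}
  {F F' F'' : NAdditive 𝓗 𝓖}

theorem mk_eq_mk {S : C} {y : ∀ k, Sec (H k).G₀ S} {x x' : Sec G.G₀ S} (hx : x = x')
    {φ : πG.obj x ⟶ F.val πH y} {φ' : πG.obj x' ⟶ F.val πH y} (h : πG.ident x x' hx ≫ φ' = φ) :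
    (⟨y, x, φ⟩ : Frame πH πG F S) = ⟨y, x', φ'⟩ := by
  subst hx h
  rw [πG.ident_self, Category.id_comp]

/-- The product of frames of `F` and `F'`. -/
noncomputable def wedge {S : C} (d : Frame πH πG F S) (d' : Frame πH πG F' S) (h : d.y = d'.y) :
    Frame πH πG (NAdditive.mul hs F F') S :=
  ⟨d.y, d.x * d'.x, πG.wedge d.φ (d'.φ ≫ F'.ident πH _ _ h.symm)⟩

theorem wedge_mk {S : C} {y : ∀ k, Sec (H k).G₀ S} {x x' : Sec G.G₀ S}
    (φ : πG.obj x ⟶ F.val πH y) (φ' : πG.obj x' ⟶ F'.val πH y) :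
    wedge hs ⟨y, x, φ⟩ ⟨y, x', φ'⟩ rfl = ⟨y, x * x', πG.wedge φ φ'⟩ := by
  unfold wedge
  dsimp only
  rw [F'.ident_self, Category.comp_id]

theorem wedge_congr {S : C} {d₁ d₂ : Frame πH πG F S} {d₁' d₂' : Frame πH πG F' S} (h₁ : d₁ = d₂)
    (h₂ : d₁' = d₂') (h) : wedge hs d₁ d₁' h = wedge hs d₂ d₂' (h₁ ▸ h₂ ▸ h) := by
  subst h₁ h₂
  rfl

theorem Arr.wedge {T S : C} {r : T ⟶ S} {d₁ : Frame πH πG F T} {d₁' : Frame πH πG F' T}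
    {d₂ : Frame πH πG F S} {d₂' : Frame πH πG F' S} {γ : ∀ k, Sec (H k).G₁ T} {g g' : Sec G.G₁ T}
    (a : Arr r d₁ d₂ γ g) (a' : Arr r d₁' d₂' γ g') (h₁ : d₁.y = d₁'.y) (h₂ : d₂.y = d₂'.y) :
    Arr r (wedge hs d₁ d₁' h₁) (wedge hs d₂ d₂' h₂) γ (G.act g d₁'.x * g') := by
  obtain ⟨y₁, x₁, φ₁⟩ := d₁
  obtain ⟨y₁', x₁', φ₁'⟩ := d₁'
  obtain ⟨y₂, x₂, φ₂⟩ := d₂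
  obtain ⟨y₂', x₂', φ₂'⟩ := d₂'
  obtain ⟨hy, hx, h⟩ := a
  obtain ⟨hy', hx', h'⟩ := a'
  dsimp only at h₁ h₂ hy hx h hy' hx' h'
  subst h₁ h₂
  rw [wedge_mk, wedge_mk]
  have e : res G.G₀ r (x₂ * x₂') = x₁ * x₁' * G.bd (G.act g x₁' * g') := by
    rw [map_mul, hx, hx', map_mul, G.bd_act']
    group
  refine ⟨hy, e, ?_⟩
  have s₁ : 𝓖.gr.fib.Sq (πG.map r _ _ _ e) (𝓖.gr.tens (πG.map r _ _ _ hx) (πG.map r _ _ _ hx'))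
      (inv (πG.mu x₁ x₁')) (inv (πG.mu x₂ x₂')) :=
    FibGpd.Sq.inv (a := asIso (πG.mu x₁ x₁')) (b := asIso (πG.mu x₂ x₂'))
      (πG.mu_naturality r x₁ x₁' x₂ x₂' g g' hx hx' e)
  exact FibGpd.Sq.comp s₁ (GrStack.sq_tens h h')

theorem IsMul.wedge {S : C} {i : Fin n} {e d m : Frame πH πG F S} {e' d' m' : Frame πH πG F' S}
    {t : Frame πH πG (NAdditive.mul hs F F') S} (h : IsMul i e d m) (h' : IsMul i e' d' m')
    (he : e.y = e'.y) (hd : d.y = d'.y) (hm : m.y = m'.y)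
    (ht : IsMul i (wedge hs e e' he) (wedge hs d d' hd) t) :
    Arr (𝟙 S) t (wedge hs m m' hm) (fun _ => 1) (G.act (G.br e'.x d.x) d'.x) := by
  obtain ⟨y₁, x₁, φ₁⟩ := e
  obtain ⟨y₁', x₁', φ₁'⟩ := e'
  obtain ⟨y₂, x₂, φ₂⟩ := d
  obtain ⟨y₂', x₂', φ₂'⟩ := d'
  obtain ⟨y₃, x₃, φ₃⟩ := m
  obtain ⟨y₃', x₃', φ₃'⟩ := m'
  obtain ⟨y₄, x₄, φ₄⟩ := t
  dsimp only at he hd hm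
  subst he hd hm
  rw [wedge_mk, wedge_mk] at ht
  rw [wedge_mk]
  obtain ⟨hy₁, hx₁, h₁⟩ := h
  obtain ⟨hy₂, hx₂, h₂⟩ := h'
  obtain ⟨hy₃, hx₃, h₃⟩ := ht
  dsimp only at hy₁ hx₁ h₁ hy₂ hx₂ h₂ hy₃ hx₃ h₃
  obtain rfl : y₃ = y₄ := hy₁.eq_update.symm.trans hy₃.eq_update
  subst hx₁ hx₂ hx₃
  rw [πG.ident_self, Category.id_comp] at h₁ h₂ h₃
  have e₁ : x₁ * x₂ * (x₁' * x₂') =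
      x₁ * x₁' * (x₂ * x₂') * G.bd (G.act (G.br x₁' x₂) x₂') := by
    rw [G.bd_act', G.bd_br]
    group
  refine arr_id_iff.2 ⟨fun k => by rw [map_one, mul_one], e₁, ?_⟩
  rw [NAdditive.mapV_one _ _ fun _ => rfl]
  refine Eq.trans ?_ (Category.comp_id _).symm
  rw [← cancel_epi (πG.mu (x₁ * x₁') (x₂ * x₂'))]
  refine Eq.trans ?_ h₃.symm
  rw [NAdditive.mul_lamV, ← cancel_epi (πG.mu x₁ x₁' ⊗ₘ πG.mu x₂ x₂')]
  have h₄ : ((πG.mu x₁ x₁' ⊗ₘ πG.mu x₂ x₂') ≫ (πG.wedge φ₁ φ₁' ⊗ₘ πG.wedge φ₂ φ₂')) =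
      ((φ₁ ⊗ₘ φ₁') ⊗ₘ (φ₂ ⊗ₘ φ₂')) := by
    rw [tensorHom_comp_tensorHom, πG.mu_wedge, πG.mu_wedge]
  refine Eq.trans ?_ ((Category.assoc _ _ _).symm.trans
    (congrArg (fun t => t ≫ tensorμ _ _ _ _ ≫ (_ ⊗ₘ _)) h₄)).symm
  rw [tensorμ_natural_assoc, tensorHom_comp_tensorHom, ← h₁, ← h₂, ← tensorHom_comp_tensorHom]
  have h₅ := πG.tensorμ_mu x₁ x₁' x₂ x₂' e₁
  rw [← reassoc_of% h₅]
  exact congrArg (fun t => _ ≫ _ ≫ t) (πG.mu_wedge φ₃ φ₃')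

theorem triv_wedge_triv {S : C} {i : Fin n} {y : ∀ k, Sec (H k).G₀ S} {h : Sec (H i).G₁ S}
    (hy : y i = (H i).bd h) :
    wedge hs (triv (πH := πH) (πG := πG) (F := F) i y h hy)
      (triv (πH := πH) (πG := πG) (F := F') i y h hy) rfl = triv i y h hy := by
  exact (wedge_mk hs _ _).trans (mk_eq_mk (one_mul 1)
    (πG.wedge_etaInv (NAdditive.mul_trivV hs F F' πH hy)))

theorem wedge_map {S : C} {F₁ F₁' : NAdditive 𝓗 𝓖} (d : Frame πH πG F S) (d' : Frame πH πG F' S)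
    (h : d.y = d'.y) (η : F ⟶ F₁) (η' : F' ⟶ F₁') :
    (wedge hs d d' h).map (NAdditive.mulHom hs η η') = wedge hs (d.map η) (d'.map η') h := by
  obtain ⟨y, x, φ⟩ := d
  obtain ⟨y', x', φ'⟩ := d'
  dsimp only at h
  subst h
  rw [wedge_mk]
  refine Eq.trans ?_ (wedge_mk hs _ _).symm
  refine congrArg (Frame.mk y (x * x')) ?_
  exact πG.wedge_comp _ _ _ _

theorem wedge_assoc {S : C} (d : Frame πH πG F S) (d' : Frame πH πG F' S) (d'' : Frame πH πG F'' S)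
    (h : d.y = d'.y) (h' : d'.y = d''.y) :
    letI := NAdditive.monoidal 𝓗 𝓖 hs
    (wedge hs (wedge hs d d' h) d'' (h.trans h')).map (α_ F F' F'').hom =
      wedge hs d (wedge hs d' d'' h') h := by
  obtain ⟨y, x, φ⟩ := d
  obtain ⟨y', x', φ'⟩ := d'
  obtain ⟨y'', x'', φ''⟩ := d''
  dsimp only at h h'
  subst h h'
  refine (congrArg (Frame.map · _) ((wedge_congr hs (wedge_mk hs φ φ') rfl _).trans
    (wedge_mk hs _ _))).trans ((mk_eq_mk (mul_assoc x x' x'') ?_).trans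
      ((wedge_congr hs rfl (wedge_mk hs φ' φ'') _).trans (wedge_mk hs _ _)).symm)
  exact πG.wedge_assoc φ φ' φ''

variable (πH πG) in
/-- The frame of the trivial functor given by the unit isomorphism of `πG`. -/
noncomputable def unit {S : C} (y : ∀ k, Sec (H k).G₀ S) :
    Frame πH πG (NAdditive.trivial 𝓗 𝓖) S :=
  ⟨y, 1, πG.etaInv S⟩

theorem unit_wedge {S : C} (d : Frame πH πG F S) {y : ∀ k, Sec (H k).G₀ S} (h : y = d.y) :
    letI := NAdditive.monoidal 𝓗 𝓖 hs
    (wedge hs (unit πH πG y) d h).map (λ_ F).hom = d := by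
  obtain ⟨y', x, φ⟩ := d
  dsimp only at h
  subst h
  refine (congrArg (Frame.map · _) (wedge_mk hs _ _)).trans (mk_eq_mk (one_mul x) ?_)
  exact πG.etaInv_wedge φ

theorem wedge_unit {S : C} (d : Frame πH πG F S) {y : ∀ k, Sec (H k).G₀ S} (h : d.y = y) :
    letI := NAdditive.monoidal 𝓗 𝓖 hs
    (wedge hs d (unit πH πG y) h).map (ρ_ F).hom = d := by
  obtain ⟨y', x, φ⟩ := d
  dsimp only at h
  subst h
  refine (congrArg (Frame.map · _) (wedge_mk hs _ _)).trans (mk_eq_mk (mul_one x) ?_)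
  exact πG.wedge_etaInv_right φ

theorem frame_trivialComparison {S : C} {o : (NButterfly.trivial H G).El S} (ho : o.2 = 1) :
    (trivialComparison πH πG).frame o = unit πH πG o.1 := by
  refine (mk_eq_mk (x := 1) (x' := (NButterfly.trivial H G).j o) ?_ ?_).symm
  · exact ((congrArg G.bd ho).trans (map_one G.bd)).symm
  · refine (IsIso.inv_eq_of_hom_inv_id (f := πG.eta S) ?_).symm
    exact NAdditive.eta_unitInv πG.toPresentation _ ho _

end Frame

end Wedge

/-! ## Monoidal structures induced by fully faithful functors -/

section Induced

variable {D : Type u} [Category.{v} D] {N : Type o} [Category.{h} N] [MonoidalCategory N] (U : D ⥤ N)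
  [U.Full] [U.Faithful] (t : D → D → D) (c : D) (m : ∀ X Y, U.obj X ⊗ U.obj Y ≅ U.obj (t X Y))
  (ε : 𝟙_ N ≅ U.obj c)

/-- The tensor product on `D` which corresponds to that of `N` under `m` and `ε`. -/
@[reducible]
noncomputable def fullMonoidalStruct : MonoidalCategoryStruct D where
  tensorObj := t
  whiskerLeft X _ _ f := U.preimage ((m _ _).inv ≫ (U.obj X ◁ U.map f) ≫ (m _ _).hom)
  whiskerRight f Y := U.preimage ((m _ _).inv ≫ (U.map f ▷ U.obj Y) ≫ (m _ _).hom)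
  tensorHom f g := U.preimage ((m _ _).inv ≫ (U.map f ⊗ₘ U.map g) ≫ (m _ _).hom)
  tensorUnit := c
  associator X Y Z := U.preimageIso (((m _ _).symm ≪≫ ((m _ _).symm ⊗ᵢ .refl _))
    ≪≫ α_ (U.obj X) (U.obj Y) (U.obj Z) ≪≫ ((.refl _ ⊗ᵢ m _ _) ≪≫ m _ _))
  leftUnitor X := U.preimageIso (((m _ _).symm ≪≫ (ε.symm ⊗ᵢ .refl _)) ≪≫ λ_ (U.obj X))
  rightUnitor X := U.preimageIso (((m _ _).symm ≪≫ (.refl _ ⊗ᵢ ε.symm)) ≪≫ ρ_ (U.obj X))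

/-- The compatibility of `fullMonoidalStruct` with `U`. -/
noncomputable def fullInducingData :
    letI := fullMonoidalStruct U t c m ε
    Monoidal.InducingFunctorData U :=
  letI := fullMonoidalStruct U t c m ε
  { μIso := m
    whiskerLeft_eq := fun _ _ _ _ => U.map_preimage _
    whiskerRight_eq := fun _ _ => U.map_preimage _
    tensorHom_eq := fun _ _ => U.map_preimage _
    εIso := ε
    associator_eq := fun _ _ _ => U.map_preimage _
    leftUnitor_eq := fun _ => U.map_preimage _
    rightUnitor_eq := fun _ => U.map_preimage _ }

/-- The monoidal structure on `D` which corresponds to that of `N` under `m` and `ε`. -/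
@[reducible]
noncomputable def fullMonoidal : MonoidalCategory D :=
  letI := fullMonoidalStruct U t c m ε
  Monoidal.induced U (fullInducingData U t c m ε)

/-- The functor `U` is monoidal. -/
@[reducible]
noncomputable def fullMonoidalFunctor :
    letI := fullMonoidal U t c m ε
    U.Monoidal :=
  letI := fullMonoidalStruct U t c m ε
  Monoidal.fromInducedMonoidal U (fullInducingData U t c m ε)

variable {U t c m ε}

theorem map_fullMonoidal_tensorHom {X₁ Y₁ X₂ Y₂ : D} (f : X₁ ⟶ Y₁) (g : X₂ ⟶ Y₂) :
    letI := fullMonoidal U t c m ε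
    (m X₁ X₂).hom ≫ U.map (f ⊗ₘ g) = (U.map f ⊗ₘ U.map g) ≫ (m Y₁ Y₂).hom :=
  (congrArg (_ ≫ ·) (U.map_preimage _)).trans (by simp)

theorem map_fullMonoidal_associator (X Y Z : D) :
    letI := fullMonoidal U t c m ε
    ((m X Y).hom ▷ U.obj Z) ≫ (m (t X Y) Z).hom ≫ U.map (α_ X Y Z).hom =
      (α_ (U.obj X) (U.obj Y) (U.obj Z)).hom ≫ (U.obj X ◁ (m Y Z).hom) ≫ (m X (t Y Z)).hom :=
  (congrArg (fun a => _ ≫ _ ≫ a) (U.map_preimage _)).trans (by simp)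

theorem map_fullMonoidal_leftUnitor (X : D) :
    letI := fullMonoidal U t c m ε
    (m c X).hom ≫ U.map (λ_ X).hom = (ε.inv ▷ U.obj X) ≫ (λ_ (U.obj X)).hom :=
  (congrArg (fun a => _ ≫ a) (U.map_preimage _)).trans (by simp)

theorem map_fullMonoidal_rightUnitor (X : D) :
    letI := fullMonoidal U t c m ε
    (m X c).hom ≫ U.map (ρ_ X).hom = (U.obj X ◁ ε.inv) ≫ (ρ_ (U.obj X)).hom :=
  (congrArg (fun a => _ ≫ a) (U.map_preimage _)).trans (by simp)

end Induced

/-! ## The contracted product of butterflies -/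

namespace NButterfly

section Contracted

variable {C : Type u} [Category.{v} C] {J : GrothendieckTopology C} {n : ℕ}
  {H : Fin n → CrossedModule.{w} J} {G : BraidedCrossedModule.{w} J}
  {𝓗 : Fin n → GrStack.{o₁, h₁} J} {𝓖 : BraidedGrStack.{o₂, w} J} (hs : 𝓖.IsSymmetric)
  (πH : ∀ k, Presentation (H k) (𝓗 k)) (πG : BraidedPresentation G 𝓖)

theorem exists_frameIso (F : NAdditive 𝓗 𝓖) :
    ∃ η : F ≅ (toAdditive πH πG).obj (Frame.butterfly πH πG F),
      ∀ {S : C} (d : Frame πH πG F S),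
        d.map η.hom = ((Frame.butterfly πH πG F).comparison πH πG).frame d := by
  obtain ⟨η, hη⟩ := exists_iso πH πG (Frame.comparison πH πG F)
  refine ⟨η.symm, fun {S} d => ?_⟩
  have h : (((Frame.butterfly πH πG F).comparison πH πG).frame d).map η.hom = d := hη (S := S) d
  rw [Iso.symm_hom]
  conv_lhs => rw [← h, ← Frame.map_comp, η.hom_inv_id, Frame.map_id]

/-- An additive functor is isomorphic to that of its butterfly of frames. -/
noncomputable def frameIso (F : NAdditive 𝓗 𝓖) :
    F ≅ (toAdditive πH πG).obj (Frame.butterfly πH πG F) :=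
  (exists_frameIso πH πG F).choose

theorem map_frameIso {F : NAdditive 𝓗 𝓖} {S : C} (d : Frame πH πG F S) :
    d.map (frameIso πH πG F).hom = ((Frame.butterfly πH πG F).comparison πH πG).frame d :=
  (exists_frameIso πH πG F).choose_spec d

/-- The isomorphism between the additive functor of the trivial butterfly and the trivial additive
functor. -/
noncomputable def trivialIso :
    (toAdditive πH πG).obj (NButterfly.trivial H G) ≅ NAdditive.trivial 𝓗 𝓖 :=
  (exists_toAdditive_trivial πH πG).choose

theorem frame_trivialIso {S : C} (o : (NButterfly.trivial H G).El S) :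
    (((NButterfly.trivial H G).comparison πH πG).frame o).map (trivialIso πH πG).hom =
      (trivialComparison πH πG).frame o :=
  (exists_toAdditive_trivial πH πG).choose_spec o

/-- The contracted product. -/
noncomputable def contracted (B B' : NButterfly H G) : NButterfly H G :=
  Frame.butterfly πH πG (NAdditive.mul hs ((toAdditive πH πG).obj B) ((toAdditive πH πG).obj B'))

/-- The point `e ∧ e'` of the contracted product. -/
noncomputable def wedge (B B' : NButterfly H G) {S : C} (e : B.El S) (e' : B'.El S)
    (h : B.p e = B'.p e') : (contracted hs πH πG B B').El S :=
  Frame.wedge hs ((B.comparison πH πG).frame e) ((B'.comparison πH πG).frame e') h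

/-- The additive functor of the contracted product. -/
noncomputable def contractedIso (B B' : NButterfly H G) :
    NAdditive.mul hs ((toAdditive πH πG).obj B) ((toAdditive πH πG).obj B') ≅
      (toAdditive πH πG).obj (contracted hs πH πG B B') :=
  frameIso πH πG _

theorem frame_wedge {B B' : NButterfly H G} {S : C} {e : B.El S} {e' : B'.El S}
    (h : B.p e = B'.p e') :
    ((contracted hs πH πG B B').comparison πH πG).frame (wedge hs πH πG B B' e e' h) =
      (Frame.wedge hs ((B.comparison πH πG).frame e) ((B'.comparison πH πG).frame e') h).map
        (contractedIso hs πH πG B B').hom :=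
  (map_frameIso πH πG _).symm

/-- The monoidal structure on the groupoid of butterflies. -/
@[reducible]
noncomputable def monoidal : MonoidalCategory (NButterfly H G) :=
  letI := NAdditive.monoidal 𝓗 𝓖 hs
  fullMonoidal (toAdditive πH πG) (contracted hs πH πG) (NButterfly.trivial H G)
    (contractedIso hs πH πG) (trivialIso πH πG).symm

theorem wedge_hom {B₁ B₂ B₁' B₂' : NButterfly H G} (φ : B₁ ⟶ B₂) (ψ : B₁' ⟶ B₂') {S : C}
    (e : B₁.El S) (e' : B₁'.El S) (a : B₁.p e = B₁'.p e')
    (a' : B₂.p (φ.hom.app (op S) e) = B₂'.p (ψ.hom.app (op S) e')) :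
    letI := monoidal hs πH πG
    (φ ⊗ₘ ψ).hom.app (op S) (wedge hs πH πG B₁ B₁' e e' a) =
      wedge hs πH πG B₂ B₂' (φ.hom.app (op S) e) (ψ.hom.app (op S) e') a' := by
  let := NAdditive.monoidal 𝓗 𝓖 hs
  let := monoidal hs πH πG
  refine ((contracted hs πH πG B₂ B₂').comparison πH πG).frame_injective ?_
  have h₁ := frame_toAdditive_map πH πG (φ ⊗ₘ ψ) (S := S) (wedge hs πH πG B₁ B₁' e e' a)
  have h₂ := map_fullMonoidal_tensorHom (U := toAdditive πH πG) (t := contracted hs πH πG)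
    (c := NButterfly.trivial H G) (m := contractedIso hs πH πG) (ε := (trivialIso πH πG).symm) φ ψ
  refine h₁.symm.trans ?_
  rw [frame_wedge]
  refine ((congrArg (Frame.map · _) (frame_wedge hs πH πG a)).trans
    (Frame.map_comp _ _ _).symm).trans ((congrArg _ h₂).trans ?_)
  refine (Frame.map_comp _ _ _).trans (congrArg (Frame.map · _) ?_)
  refine (Frame.wedge_map hs _ _ _ _ _).trans ?_
  exact Frame.wedge_congr hs (frame_toAdditive_map πH πG φ e) (frame_toAdditive_map πH πG ψ e') _

theorem wedge_assoc {B B' B'' : NButterfly H G} {S : C} (e : B.El S) (e' : B'.El S) (e'' : B''.El S)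
    (a : B.p e = B'.p e') (a' : B'.p e' = B''.p e'') :
    letI := monoidal hs πH πG
    (α_ B B' B'').hom.hom.app (op S) (wedge hs πH πG (contracted hs πH πG B B') B''
        (wedge hs πH πG B B' e e' a) e'' (a.trans a')) =
      wedge hs πH πG B (contracted hs πH πG B' B'') e (wedge hs πH πG B' B'' e' e'' a') a := by
  let := NAdditive.monoidal 𝓗 𝓖 hs
  let := monoidal hs πH πG
  refine ((contracted hs πH πG B (contracted hs πH πG B' B'')).comparison πH πG).frame_injective ?_
  have h₁ := frame_toAdditive_map πH πG (α_ B B' B'').hom (S := S)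
    (wedge hs πH πG (contracted hs πH πG B B') B'' (wedge hs πH πG B B' e e' a) e'' (a.trans a'))
  have h₂ := map_fullMonoidal_associator (U := toAdditive πH πG) (t := contracted hs πH πG)
    (c := NButterfly.trivial H G) (m := contractedIso hs πH πG) (ε := (trivialIso πH πG).symm)
    B B' B''
  have h₃ : Frame.wedge hs (((contracted hs πH πG B B').comparison πH πG).frame
        (wedge hs πH πG B B' e e' a)) ((B''.comparison πH πG).frame e'') (a.trans a') =
      (Frame.wedge hs (Frame.wedge hs ((B.comparison πH πG).frame e)
        ((B'.comparison πH πG).frame e') a) ((B''.comparison πH πG).frame e'') (a.trans a')).map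
          ((contractedIso hs πH πG B B').hom ▷ (toAdditive πH πG).obj B'') := by
    refine Eq.trans ?_ (Frame.wedge_map hs _ _ _ _ _).symm
    exact Frame.wedge_congr hs (frame_wedge hs πH πG a) (Frame.map_id _).symm _
  have h₄ : Frame.wedge hs ((B.comparison πH πG).frame e)
        (((contracted hs πH πG B' B'').comparison πH πG).frame (wedge hs πH πG B' B'' e' e'' a')) a =
      (Frame.wedge hs ((B.comparison πH πG).frame e) (Frame.wedge hs
        ((B'.comparison πH πG).frame e') ((B''.comparison πH πG).frame e'') a') a).map
          ((toAdditive πH πG).obj B ◁ (contractedIso hs πH πG B' B'').hom) := by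
    refine Eq.trans ?_ (Frame.wedge_map hs _ _ _ _ _).symm
    exact Frame.wedge_congr hs (Frame.map_id _).symm (frame_wedge hs πH πG a') _
  refine h₁.symm.trans ?_
  refine (congrArg (Frame.map · _) ((frame_wedge hs πH πG _).trans
    (congrArg (Frame.map · _) h₃))).trans ?_
  refine (Frame.map_comp _ _ _).symm.trans ((Frame.map_comp _ _ _).symm.trans
    ((congrArg _ h₂).trans ?_))
  refine (Frame.map_comp _ _ _).trans ((Frame.map_comp _ _ _).trans (Eq.trans ?_
    ((frame_wedge hs πH πG _).trans (congrArg (Frame.map · _) h₄)).symm))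
  exact congrArg (fun d => Frame.map (Frame.map d _) _) (Frame.wedge_assoc hs _ _ _ _ _)

theorem trivial_wedge {B : NButterfly H G} {S : C} (o : (NButterfly.trivial H G).El S) (e : B.El S)
    (a : (NButterfly.trivial H G).p o = B.p e) (ho : o.2 = 1) :
    letI := monoidal hs πH πG
    (λ_ B).hom.hom.app (op S) (wedge hs πH πG (NButterfly.trivial H G) B o e a) = e := by
  let := NAdditive.monoidal 𝓗 𝓖 hs
  let := monoidal hs πH πG
  refine (B.comparison πH πG).frame_injective ?_
  have h₁ := frame_toAdditive_map πH πG (λ_ B).hom (S := S)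
    (wedge hs πH πG (NButterfly.trivial H G) B o e a)
  have h₂ := map_fullMonoidal_leftUnitor (U := toAdditive πH πG) (t := contracted hs πH πG)
    (c := NButterfly.trivial H G) (m := contractedIso hs πH πG) (ε := (trivialIso πH πG).symm) B
  refine h₁.symm.trans ((congrArg (Frame.map · _) (frame_wedge hs πH πG a)).trans
    ((Frame.map_comp _ _ _).symm.trans ((congrArg _ h₂).trans ((Frame.map_comp _ _ _).trans
      ((congrArg (Frame.map · _) ((Frame.wedge_map hs _ _ _ _ _).trans ?_)).trans
        (Frame.unit_wedge hs ((B.comparison πH πG).frame e) a))))))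
  exact Frame.wedge_congr hs ((frame_trivialIso πH πG o).trans (Frame.frame_trivialComparison ho))
    (Frame.map_id _) _

theorem wedge_trivial {B : NButterfly H G} {S : C} (o : (NButterfly.trivial H G).El S) (e : B.El S)
    (a : B.p e = (NButterfly.trivial H G).p o) (ho : o.2 = 1) :
    letI := monoidal hs πH πG
    (ρ_ B).hom.hom.app (op S) (wedge hs πH πG B (NButterfly.trivial H G) e o a) = e := by
  let := NAdditive.monoidal 𝓗 𝓖 hs
  let := monoidal hs πH πG
  refine (B.comparison πH πG).frame_injective ?_
  have h₁ := frame_toAdditive_map πH πG (ρ_ B).hom (S := S)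
    (wedge hs πH πG B (NButterfly.trivial H G) e o a)
  have h₂ := map_fullMonoidal_rightUnitor (U := toAdditive πH πG) (t := contracted hs πH πG)
    (c := NButterfly.trivial H G) (m := contractedIso hs πH πG) (ε := (trivialIso πH πG).symm) B
  refine h₁.symm.trans ((congrArg (Frame.map · _) (frame_wedge hs πH πG a)).trans
    ((Frame.map_comp _ _ _).symm.trans ((congrArg _ h₂).trans ((Frame.map_comp _ _ _).trans
      ((congrArg (Frame.map · _) ((Frame.wedge_map hs _ _ _ _ _).trans ?_)).trans
        (Frame.wedge_unit hs ((B.comparison πH πG).frame e) a))))))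
  exact Frame.wedge_congr hs (Frame.map_id _)
    ((frame_trivialIso πH πG o).trans (Frame.frame_trivialComparison ho)) _

/-- The contracted product is a monoidal structure. -/
noncomputable def contractedMonoidal : ContractedMonoidal H G where
  mon := monoidal hs πH πG
  wedge B B' S e e' a := wedge hs πH πG B B' e e' a
  wedge_res B B' T S f e e' a a' :=
    ((((B.comparison πH πG).frame_res f e).wedge hs ((B'.comparison πH πG).frame_res f e') a' a).congr
      (fun _ => rfl) (by rw [G.one_act, one_mul])).eq_res.symm
  p_wedge _ _ _ _ _ _ := rfl
  j_wedge _ _ _ _ _ _ := rfl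
  wedge_act B B' S e e' g a a' := by
    have h := ((Frame.Arr.refl ((B.comparison πH πG).frame e)).wedge hs
      (Frame.arr_act ((B'.comparison πH πG).frame e') g) a a).congr (fun _ => rfl)
      (show _ = g by rw [G.one_act, one_mul])
    exact (Frame.wedge_congr hs rfl ((B'.comparison πH πG).frame_act e' g) _).trans
      (h.target_unique (Frame.arr_act _ g))
  act_wedge B B' S e e' g a a' := by
    have ha : B.p e = B'.p e' := (B.p_act e g).symm.trans a
    have h := ((Frame.arr_act ((B.comparison πH πG).frame e) g).wedge hs
      (Frame.Arr.refl ((B'.comparison πH πG).frame e')) ha ha)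
    have h' := ((Frame.Arr.refl ((B.comparison πH πG).frame e)).wedge hs
      (Frame.arr_act ((B'.comparison πH πG).frame e') (G.act g (B'.j e'))) ha ha).congr
        (fun _ => rfl) (show _ = G.act g (B'.j e') * 1 by rw [G.one_act, one_mul, mul_one])
    exact (Frame.wedge_congr hs ((B.comparison πH πG).frame_act e g) rfl _).trans
      ((h.target_unique h').trans
        (Frame.wedge_congr hs rfl ((B'.comparison πH πG).frame_act e' _).symm _))
  wedge_mul B B' S i e d e' d' a b c a' b' c' := by
    have h := ((B.comparison πH πG).frame_mul i e d a').wedge hs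
      ((B'.comparison πH πG).frame_mul i e' d' b') a b c' (Frame.isMul_mul c)
    exact (h.symm.congr (fun _ => inv_one) (G.inv_act _ _).symm).target_unique (Frame.arr_act _ _)
  wedge_s B B' S i y h hy a :=
    (Frame.wedge_congr hs ((B.comparison πH πG).toFrames.s_hom i y h hy)
      ((B'.comparison πH πG).toFrames.s_hom i y h hy) _).trans (Frame.triv_wedge_triv hs hy)
  wedge_hom φ ψ S e e' a a' := wedge_hom hs πH πG φ ψ e e' a a'
  wedge_assoc B B' B'' S e e' e'' a b a' b' := wedge_assoc hs πH πG e e' e'' a a'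
  unitIso := Iso.refl _
  left_unit B S o e a ho := trivial_wedge hs πH πG o e a (congrArg Prod.snd ho)
  right_unit B S o e a ho := wedge_trivial hs πH πG o e a (congrArg Prod.snd ho)

end Contracted

end NButterfly

/-! ## Inverses of additive functors -/

namespace FibGpd

variable {C : Type u} [Category.{v} C] {𝓧 : FibGpd.{o, h} C} {S T : C} {f : S ⟶ T}
  {x x' x'' : 𝓧.Ob S} {y y' y'' : 𝓧.Ob T} {φ : 𝓧.Hom f x y} {φ' : 𝓧.Hom f x' y'}
  {φ'' : 𝓧.Hom f x'' y''} {a : x ⟶ x'} {b : y ⟶ y'} {a' : x' ⟶ x''} {b' : y' ⟶ y''}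

theorem Sq.of_comp_left (h : 𝓧.Sq φ φ' a b) (h' : 𝓧.Sq φ φ'' (a ≫ a') (b ≫ b')) :
    𝓧.Sq φ' φ'' a' b' := by
  have h₁ : 𝓧.Sq φ' φ (CategoryTheory.inv a) (CategoryTheory.inv b) := Sq.inv (a := asIso a) (b := asIso b) h
  have h₂ := Sq.comp h₁ h'
  rwa [IsIso.inv_hom_id_assoc, IsIso.inv_hom_id_assoc] at h₂

theorem Sq.of_comp_right (h : 𝓧.Sq φ' φ'' a' b') (h' : 𝓧.Sq φ φ'' (a ≫ a') (b ≫ b')) :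
    𝓧.Sq φ φ' a b := by
  have h₁ : 𝓧.Sq φ'' φ' (CategoryTheory.inv a') (CategoryTheory.inv b') := Sq.inv (a := asIso a') (b := asIso b') h
  have h₂ := Sq.comp h' h₁
  rwa [Category.assoc, Category.assoc, IsIso.hom_inv_id, IsIso.hom_inv_id, Category.comp_id,
    Category.comp_id] at h₂

end FibGpd

section Cancel

variable {D : Type o} [Category.{h} D] [MonoidalCategory D] [BraidedCategory D]

theorem tensorHom_left_cancel (hD : ∀ x : D, (tensorLeft x).Faithful) {x x' y y' : D} {f : x ⟶ x'}
    [IsIso f] {g g' : y ⟶ y'} (h : (f ⊗ₘ g) = (f ⊗ₘ g')) : g = g' := by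
  have := hD x
  rw [MonoidalCategory.tensorHom_def', MonoidalCategory.tensorHom_def', cancel_mono] at h
  exact (tensorLeft x).map_injective h

variable [IsGroupoid D]

theorem prod_assoc_cancel (hD : ∀ x : D, (tensorLeft x).Faithful)
    {x y z xy yz l r x' y' z' xy' yz' l' r' : D}
    {a : x ⊗ y ⟶ xy} {b : xy ⊗ z ⟶ l} {c : y ⊗ z ⟶ yz} {d : x ⊗ yz ⟶ r} {A : l ⟶ r}
    {a' : x' ⊗ y' ⟶ xy'} {b' : xy' ⊗ z' ⟶ l'} {c' : y' ⊗ z' ⟶ yz'} {d' : x' ⊗ yz' ⟶ r'}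
    {A' : l' ⟶ r'}
    (e : (a ▷ z) ≫ b ≫ A = (α_ x y z).hom ≫ (x ◁ c) ≫ d)
    (e' : ((tensorμ x x' y y' ≫ (a ⊗ₘ a')) ▷ (z ⊗ z')) ≫ (tensorμ xy xy' z z' ≫ (b ⊗ₘ b')) ≫
        (A ⊗ₘ A') =
      (α_ (x ⊗ x') (y ⊗ y') (z ⊗ z')).hom ≫
        ((x ⊗ x') ◁ (tensorμ y y' z z' ≫ (c ⊗ₘ c'))) ≫ tensorμ x x' yz yz' ≫ (d ⊗ₘ d')) :
    (a' ▷ z') ≫ b' ≫ A' = (α_ x' y' z').hom ≫ (x' ◁ c') ≫ d' := by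
  have h₁ : ((a ⊗ₘ a') ▷ (z ⊗ z')) ≫ tensorμ xy xy' z z' =
      tensorμ (x ⊗ y) (x' ⊗ y') z z' ≫ ((a ▷ z) ⊗ₘ (a' ▷ z')) := tensorμ_natural_left a a' z z'
  have h₂ : ((x ⊗ x') ◁ (c ⊗ₘ c')) ≫ tensorμ x x' yz yz' =
      tensorμ x x' (y ⊗ z) (y' ⊗ z') ≫ ((x ◁ c) ⊗ₘ (x' ◁ c')) := tensorμ_natural_right x x' c c'
  simp only [comp_whiskerRight, MonoidalCategory.whiskerLeft_comp, Category.assoc] at e'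
  rw [reassoc_of% h₁, reassoc_of% h₂, tensorHom_comp_tensorHom, tensorHom_comp_tensorHom, e,
    tensorHom_comp_tensorHom, ← tensor_associativity_assoc, tensorHom_comp_tensorHom, cancel_epi,
    cancel_epi] at e'
  exact tensorHom_left_cancel hD e'

theorem prod_left_unit_cancel (hD : ∀ x : D, (tensorLeft x).Faithful)
    {x y z x' y' z' : D} {a : x ⊗ y ⟶ z} {L : z ⟶ y} {ε : x ⟶ 𝟙_ D}
    {a' : x' ⊗ y' ⟶ z'} {L' : z' ⟶ y'} {ε' : x' ⟶ 𝟙_ D}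
    (e : a ≫ L = (ε ▷ y) ≫ (λ_ y).hom)
    (e' : (tensorμ x x' y y' ≫ (a ⊗ₘ a')) ≫ (L ⊗ₘ L') =
      (((ε ⊗ₘ ε') ≫ (λ_ (𝟙_ D)).hom) ▷ (y ⊗ y')) ≫ (λ_ (y ⊗ y')).hom) :
    a' ≫ L' = (ε' ▷ y') ≫ (λ_ y').hom := by
  rw [← prod_left_unit_aux (a := a) (L := L) (a' := (ε' ▷ y') ≫ (λ_ y').hom) (L' := 𝟙 y') e
    (Category.comp_id _), Category.assoc, Category.assoc, cancel_epi, tensorHom_comp_tensorHom,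
    tensorHom_comp_tensorHom, Category.comp_id] at e'
  exact tensorHom_left_cancel hD e'

theorem prod_right_unit_cancel (hD : ∀ x : D, (tensorLeft x).Faithful)
    {x y z x' y' z' : D} {a : x ⊗ y ⟶ z} {L : z ⟶ x} {ε : y ⟶ 𝟙_ D}
    {a' : x' ⊗ y' ⟶ z'} {L' : z' ⟶ x'} {ε' : y' ⟶ 𝟙_ D}
    (e : a ≫ L = (x ◁ ε) ≫ (ρ_ x).hom)
    (e' : (tensorμ x x' y y' ≫ (a ⊗ₘ a')) ≫ (L ⊗ₘ L') =
      ((x ⊗ x') ◁ ((ε ⊗ₘ ε') ≫ (λ_ (𝟙_ D)).hom)) ≫ (ρ_ (x ⊗ x')).hom) :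
    a' ≫ L' = (x' ◁ ε') ≫ (ρ_ x').hom := by
  rw [← prod_right_unit_aux (a := a) (L := L) (a' := (x' ◁ ε') ≫ (ρ_ x').hom) (L' := 𝟙 x') e
    (Category.comp_id _), Category.assoc, Category.assoc, cancel_epi, tensorHom_comp_tensorHom,
    tensorHom_comp_tensorHom, Category.comp_id] at e'
  exact tensorHom_left_cancel hD e'

theorem prod_interchange_cancel (hD : ∀ x : D, (tensorLeft x).Faithful)
    (hs : ∀ x y : D, (β_ x y).hom ≫ (β_ y x).hom = 𝟙 (x ⊗ y))
    {x₁ x₂ x₃ x₄ p q r s t y₁ y₂ y₃ y₄ p' q' r' s' t' : D}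
    {a : x₁ ⊗ x₂ ⟶ p} {b : x₃ ⊗ x₄ ⟶ q} {c : p ⊗ q ⟶ t} {d : x₁ ⊗ x₃ ⟶ r} {f : x₂ ⊗ x₄ ⟶ s}
    {g : r ⊗ s ⟶ t} {a' : y₁ ⊗ y₂ ⟶ p'} {b' : y₃ ⊗ y₄ ⟶ q'} {c' : p' ⊗ q' ⟶ t'}
    {d' : y₁ ⊗ y₃ ⟶ r'} {f' : y₂ ⊗ y₄ ⟶ s'} {g' : r' ⊗ s' ⟶ t'}
    (e : (a ⊗ₘ b) ≫ c = tensorμ x₁ x₂ x₃ x₄ ≫ (d ⊗ₘ f) ≫ g)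
    (e' : ((tensorμ x₁ y₁ x₂ y₂ ≫ (a ⊗ₘ a')) ⊗ₘ (tensorμ x₃ y₃ x₄ y₄ ≫ (b ⊗ₘ b'))) ≫
        tensorμ p p' q q' ≫ (c ⊗ₘ c') =
      tensorμ (x₁ ⊗ y₁) (x₂ ⊗ y₂) (x₃ ⊗ y₃) (x₄ ⊗ y₄) ≫
        ((tensorμ x₁ y₁ x₃ y₃ ≫ (d ⊗ₘ d')) ⊗ₘ (tensorμ x₂ y₂ x₄ y₄ ≫ (f ⊗ₘ f'))) ≫
          tensorμ r r' s s' ≫ (g ⊗ₘ g')) :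
    (a' ⊗ₘ b') ≫ c' = tensorμ y₁ y₂ y₃ y₄ ≫ (d' ⊗ₘ f') ≫ g' := by
  have h := prod_interchange_aux hs (a' := a') (b' := b')
    (c' := inv (a' ⊗ₘ b') ≫ tensorμ y₁ y₂ y₃ y₄ ≫ (d' ⊗ₘ f') ≫ g') e (IsIso.hom_inv_id_assoc _ _)
  rw [← h, cancel_epi, cancel_epi] at e'
  rw [tensorHom_left_cancel hD e', IsIso.hom_inv_id_assoc]

theorem unit_assoc_aux {x y z xy yz l r : D} {a : x ⊗ y ⟶ xy} {b : xy ⊗ z ⟶ l} {c : y ⊗ z ⟶ yz}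
    {d : x ⊗ yz ⟶ r} {A : l ⟶ r} {jx : x ⟶ 𝟙_ D} {jy : y ⟶ 𝟙_ D} {jz : z ⟶ 𝟙_ D}
    {jxy : xy ⟶ 𝟙_ D} {jyz : yz ⟶ 𝟙_ D} {jl : l ⟶ 𝟙_ D} {jr : r ⟶ 𝟙_ D}
    (ha : a ≫ jxy = (jx ⊗ₘ jy) ≫ (λ_ (𝟙_ D)).hom) (hb : b ≫ jl = (jxy ⊗ₘ jz) ≫ (λ_ (𝟙_ D)).hom)
    (hc : c ≫ jyz = (jy ⊗ₘ jz) ≫ (λ_ (𝟙_ D)).hom) (hd : d ≫ jr = (jx ⊗ₘ jyz) ≫ (λ_ (𝟙_ D)).hom)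
    (hA : A ≫ jr = jl) : (a ▷ z) ≫ b ≫ A = (α_ x y z).hom ≫ (x ◁ c) ≫ d := by
  rw [← cancel_mono jr, Category.assoc, Category.assoc, Category.assoc, Category.assoc, hA, hb, hd,
    ← tensorHom_id, ← id_tensorHom, tensorHom_comp_tensorHom_assoc, tensorHom_comp_tensorHom_assoc,
    ha, hc, Category.id_comp, Category.id_comp, associator_eps_aux]

theorem unit_left_aux {x y z : D} {a : x ⊗ y ⟶ z} {L : z ⟶ y} {jx : x ⟶ 𝟙_ D} {jy : y ⟶ 𝟙_ D}
    {jz : z ⟶ 𝟙_ D} (ha : a ≫ jz = (jx ⊗ₘ jy) ≫ (λ_ (𝟙_ D)).hom) (hL : L ≫ jy = jz) :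
    a ≫ L = (jx ▷ y) ≫ (λ_ y).hom := by
  rw [← cancel_mono jy, Category.assoc, hL, ha, Category.assoc, ← leftUnitor_naturality,
    ← MonoidalCategory.tensorHom_def_assoc]

theorem unit_right_aux {x y z : D} {a : x ⊗ y ⟶ z} {L : z ⟶ x} {jx : x ⟶ 𝟙_ D} {jy : y ⟶ 𝟙_ D}
    {jz : z ⟶ 𝟙_ D} (ha : a ≫ jz = (jx ⊗ₘ jy) ≫ (λ_ (𝟙_ D)).hom) (hL : L ≫ jx = jz) :
    a ≫ L = (x ◁ jy) ≫ (ρ_ x).hom := by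
  rw [← cancel_mono jx, Category.assoc, hL, ha, Category.assoc, ← rightUnitor_naturality,
    ← MonoidalCategory.tensorHom_def'_assoc, unitors_equal]

theorem unit_interchange_aux {x₁ x₂ x₃ x₄ p q r s t : D} {a : x₁ ⊗ x₂ ⟶ p} {b : x₃ ⊗ x₄ ⟶ q}
    {c : p ⊗ q ⟶ t} {d : x₁ ⊗ x₃ ⟶ r} {f : x₂ ⊗ x₄ ⟶ s} {g : r ⊗ s ⟶ t} {j₁ : x₁ ⟶ 𝟙_ D}
    {j₂ : x₂ ⟶ 𝟙_ D} {j₃ : x₃ ⟶ 𝟙_ D} {j₄ : x₄ ⟶ 𝟙_ D} {jp : p ⟶ 𝟙_ D} {jq : q ⟶ 𝟙_ D}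
    {jr : r ⟶ 𝟙_ D} {js : s ⟶ 𝟙_ D} {jt : t ⟶ 𝟙_ D}
    (ha : a ≫ jp = (j₁ ⊗ₘ j₂) ≫ (λ_ (𝟙_ D)).hom) (hb : b ≫ jq = (j₃ ⊗ₘ j₄) ≫ (λ_ (𝟙_ D)).hom)
    (hc : c ≫ jt = (jp ⊗ₘ jq) ≫ (λ_ (𝟙_ D)).hom) (hd : d ≫ jr = (j₁ ⊗ₘ j₃) ≫ (λ_ (𝟙_ D)).hom)
    (hf : f ≫ js = (j₂ ⊗ₘ j₄) ≫ (λ_ (𝟙_ D)).hom) (hg : g ≫ jt = (jr ⊗ₘ js) ≫ (λ_ (𝟙_ D)).hom) :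
    (a ⊗ₘ b) ≫ c = tensorμ x₁ x₂ x₃ x₄ ≫ (d ⊗ₘ f) ≫ g := by
  rw [← cancel_mono jt, Category.assoc, Category.assoc, Category.assoc, hc, hg,
    tensorHom_comp_tensorHom_assoc, tensorHom_comp_tensorHom_assoc, ha, hb, hd, hf,
    ← tensorHom_comp_tensorHom_assoc, ← tensorHom_comp_tensorHom_assoc, ← tensorμ_natural_assoc,
    ← tensorμ_unit]

end Cancel

namespace GrStack

variable {C : Type u} [Category.{v} C] {J : GrothendieckTopology C} {𝓧 : GrStack.{o, h} J}
  {S T : C} {f : S ⟶ T} {x a : 𝓧.fib.Ob S} {y b : 𝓧.fib.Ob T}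

theorem tensorLeft_faithful (x : 𝓧.fib.Ob S) : (tensorLeft x).Faithful :=
  have := 𝓧.translation_left x
  inferInstance

theorem tens_left_cancel {ψ : 𝓧.fib.Hom f x y} {φ φ' : 𝓧.fib.Hom f a b}
    (h : 𝓧.tens ψ φ = 𝓧.tens ψ φ') : φ = φ' := by
  have := 𝓧.tensorLeft_faithful x
  obtain ⟨χ, hχ, -⟩ := 𝓧.fib.cartesian φ' φ (Category.id_comp f)
  have h₁ : φ = 𝓧.fib.pre χ φ' := hχ.symm
  have h₂ : 𝓧.fib.pre (x ◁ χ) (𝓧.tens ψ φ') = 𝓧.fib.pre (x ◁ 𝟙 a) (𝓧.tens ψ φ') := by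
    rw [← tens_pre_right, ← h₁, h, MonoidalCategory.whiskerLeft_id, FibGpd.id_pre]
  have h₃ : x ◁ χ = x ◁ 𝟙 a := FibGpd.comp_cancel h₂
  have h₄ : χ = 𝟙 a := (tensorLeft x).map_injective h₃
  rw [h₁, h₄, FibGpd.id_pre]

theorem exists_tens_eq (ψ : 𝓧.fib.Hom f x y) (ω : 𝓧.fib.Hom f (x ⊗ a) (y ⊗ b)) :
    ∃ φ : 𝓧.fib.Hom f a b, 𝓧.tens ψ φ = ω := by
  have := 𝓧.translation_left x
  obtain ⟨b', ⟨β⟩⟩ := 𝓧.fib.exists_lift f b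
  obtain ⟨χ, hχ, -⟩ := 𝓧.fib.cartesian (𝓧.tens ψ β) ω (Category.id_comp f)
  obtain ⟨χ', hχ'⟩ := (tensorLeft x).map_surjective (X := a) (Y := b') χ
  refine ⟨𝓧.fib.pre χ' β, ?_⟩
  rw [tens_pre_right]
  exact (congrArg (𝓧.fib.pre · _) hχ').trans hχ

end GrStack

section Inverse

variable {C : Type u} [Category.{v} C] {J : GrothendieckTopology C} {n : ℕ}
  {𝓗 : Fin n → GrStack.{o₁, h₁} J} {𝓖 : BraidedGrStack.{o₂, h} J}

/-- Inverses of the values of `F`. -/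
structure PointwiseInverse (F : NAdditive 𝓗 𝓖) where
  obj : ∀ {S : C}, (∀ k, (𝓗 k).fib.Ob S) → 𝓖.gr.fib.Ob S
  hom : ∀ {S : C} (x : ∀ k, (𝓗 k).fib.Ob S), F.obj x ⊗ obj x ⟶ 𝟙_ (𝓖.gr.fib.Ob S)

theorem NAdditive.nonempty_pointwiseInverse (F : NAdditive 𝓗 𝓖) : Nonempty (PointwiseInverse F) := by
  have h : ∀ {S : C} (x : ∀ k, (𝓗 k).fib.Ob S),
      ∃ a, Nonempty (F.obj x ⊗ a ⟶ 𝟙_ (𝓖.gr.fib.Ob S)) := fun x =>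
    have := 𝓖.gr.translation_left (F.obj x)
    ⟨(tensorLeft (F.obj x)).objPreimage (𝟙_ _), ⟨((tensorLeft (F.obj x)).objObjPreimageIso _).hom⟩⟩
  choose a ha using @h
  exact ⟨⟨fun x => a x, fun x => (ha x).some⟩⟩

namespace PointwiseInverse

variable {F : NAdditive 𝓗 𝓖} (A : PointwiseInverse F)

theorem exists_map {S T : C} {f : S ⟶ T} {x : ∀ k, (𝓗 k).fib.Ob S} {y : ∀ k, (𝓗 k).fib.Ob T}
    (φ : ∀ k, (𝓗 k).fib.Hom f (x k) (y k)) :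
    ∃ a : 𝓖.gr.fib.Hom f (A.obj x) (A.obj y),
      𝓖.gr.fib.Sq (𝓖.gr.tens (F.map φ) a) (𝓖.gr.unitMap f) (A.hom x) (A.hom y) := by
  obtain ⟨a, ha⟩ := GrStack.exists_tens_eq (F.map φ)
    (𝓖.gr.fib.pre (A.hom x) (𝓖.gr.fib.post (𝓖.gr.unitMap f) (inv (A.hom y))))
  refine ⟨a, ?_⟩
  unfold FibGpd.Sq
  rw [ha, FibGpd.pre_post, ← FibGpd.post_comp, IsIso.inv_hom_id, FibGpd.post_id]

/-- The effect of the inverse of `F` on morphisms. -/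
noncomputable def map {S T : C} {f : S ⟶ T} {x : ∀ k, (𝓗 k).fib.Ob S} {y : ∀ k, (𝓗 k).fib.Ob T}
    (φ : ∀ k, (𝓗 k).fib.Hom f (x k) (y k)) : 𝓖.gr.fib.Hom f (A.obj x) (A.obj y) :=
  (A.exists_map φ).choose

theorem sq_map {S T : C} {f : S ⟶ T} {x : ∀ k, (𝓗 k).fib.Ob S} {y : ∀ k, (𝓗 k).fib.Ob T}
    (φ : ∀ k, (𝓗 k).fib.Hom f (x k) (y k)) :
    𝓖.gr.fib.Sq (𝓖.gr.tens (F.map φ) (A.map φ)) (𝓖.gr.unitMap f) (A.hom x) (A.hom y) :=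
  (A.exists_map φ).choose_spec

theorem eq_map {S T : C} {f : S ⟶ T} {x : ∀ k, (𝓗 k).fib.Ob S} {y : ∀ k, (𝓗 k).fib.Ob T}
    {φ : ∀ k, (𝓗 k).fib.Hom f (x k) (y k)} {a : 𝓖.gr.fib.Hom f (A.obj x) (A.obj y)}
    (h : 𝓖.gr.fib.Sq (𝓖.gr.tens (F.map φ) a) (𝓖.gr.unitMap f) (A.hom x) (A.hom y)) :
    A.map φ = a := by
  have h₁ : 𝓖.gr.fib.post _ (A.hom y) = 𝓖.gr.fib.post _ (A.hom y) := (A.sq_map φ).trans h.symm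
  have h₂ := congrArg (𝓖.gr.fib.post · (inv (A.hom y))) h₁
  simp only [← FibGpd.post_comp, IsIso.hom_inv_id, FibGpd.post_id] at h₂
  exact GrStack.tens_left_cancel h₂

/-- The effect of the inverse of `F` on morphisms of a fibre. -/
noncomputable def mapF {S : C} {x y : ∀ k, (𝓗 k).fib.Ob S} (φ : ∀ k, x k ⟶ y k) :
    A.obj x ⟶ A.obj y :=
  A.map φ

theorem mapF_hom {S : C} {x y : ∀ k, (𝓗 k).fib.Ob S} (φ : ∀ k, x k ⟶ y k) :
    (F.mapF φ ⊗ₘ A.mapF φ) ≫ A.hom y = A.hom x := by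
  have h := A.sq_map φ
  rw [𝓖.gr.unitMap_id] at h
  have h₁ := 𝓖.gr.tens_fiber (F.mapF φ) (A.mapF φ)
  rw [← h₁]
  exact h.trans (Category.comp_id (A.hom x))

theorem exists_lam {S : C} (i : Fin n) (x y z : ∀ k, (𝓗 k).fib.Ob S) (e : ProdAt 𝓗 i x y z) :
    ∃ l : A.obj x ⊗ A.obj y ⟶ A.obj z,
      (tensorμ (F.obj x) (A.obj x) (F.obj y) (A.obj y) ≫ (F.lam i x y z e ⊗ₘ l)) ≫ A.hom z =
        (A.hom x ⊗ₘ A.hom y) ≫ (λ_ _).hom := by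
  obtain ⟨l, hl⟩ := GrStack.exists_tens_eq (f := 𝟙 S) (F.lam i x y z e)
    (inv (tensorμ (F.obj x) (A.obj x) (F.obj y) (A.obj y)) ≫
      ((A.hom x ⊗ₘ A.hom y) ≫ (λ_ _).hom) ≫ inv (A.hom z))
  refine ⟨l, ?_⟩
  have h₁ := 𝓖.gr.tens_fiber (F.lam i x y z e) l
  rw [← h₁, hl]
  simp

/-- The additivity isomorphisms of the inverse of `F`. -/
noncomputable def lam {S : C} (i : Fin n) (x y z : ∀ k, (𝓗 k).fib.Ob S) (e : ProdAt 𝓗 i x y z) :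
    A.obj x ⊗ A.obj y ⟶ A.obj z :=
  (A.exists_lam i x y z e).choose

theorem lam_hom {S : C} (i : Fin n) (x y z : ∀ k, (𝓗 k).fib.Ob S) (e : ProdAt 𝓗 i x y z) :
    (tensorμ (F.obj x) (A.obj x) (F.obj y) (A.obj y) ≫ (F.lam i x y z e ⊗ₘ A.lam i x y z e)) ≫
      A.hom z = (A.hom x ⊗ₘ A.hom y) ≫ (λ_ _).hom :=
  (A.exists_lam i x y z e).choose_spec

theorem exists_eps {S : C} (i : Fin n) (x : ∀ k, (𝓗 k).fib.Ob S) (e : x i = 𝟙_ ((𝓗 i).fib.Ob S)) :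
    ∃ ε : A.obj x ⟶ 𝟙_ (𝓖.gr.fib.Ob S), (F.eps i x e ⊗ₘ ε) ≫ (λ_ _).hom = A.hom x := by
  obtain ⟨ε, hε⟩ := GrStack.exists_tens_eq (f := 𝟙 S) (F.eps i x e) (A.hom x ≫ (λ_ _).inv)
  refine ⟨ε, ?_⟩
  have h₁ := 𝓖.gr.tens_fiber (F.eps i x e) ε
  rw [← h₁, hε]
  simp

/-- The unit isomorphisms of the inverse of `F`. -/
noncomputable def eps {S : C} (i : Fin n) (x : ∀ k, (𝓗 k).fib.Ob S)
    (e : x i = 𝟙_ ((𝓗 i).fib.Ob S)) : A.obj x ⟶ 𝟙_ (𝓖.gr.fib.Ob S) :=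
  (A.exists_eps i x e).choose

theorem eps_hom {S : C} (i : Fin n) (x : ∀ k, (𝓗 k).fib.Ob S) (e : x i = 𝟙_ ((𝓗 i).fib.Ob S)) :
    (F.eps i x e ⊗ₘ A.eps i x e) ≫ (λ_ _).hom = A.hom x :=
  (A.exists_eps i x e).choose_spec

/-- The pointwise inverse of an additive functor is additive. -/
noncomputable def additive (hs : 𝓖.IsSymmetric) : NAdditive 𝓗 𝓖 where
  obj := A.obj
  map := A.map
  map_id {S} x := A.eq_map (by
    rw [F.map_id, 𝓖.gr.unitMap_id]
    have h := (𝓖.gr.tens_fiber (𝟙 (F.obj x)) (𝟙 (A.obj x))).trans (id_tensorHom_id _ _)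
    refine (congrArg (𝓖.gr.fib.post · (A.hom x)) h).trans ?_
    exact (Category.id_comp (A.hom x)).trans (Category.comp_id (A.hom x)).symm)
  map_comp {R S T f g k x y z} φ ψ e := A.eq_map (by
    rw [F.map_comp, 𝓖.gr.tens_comp, ← 𝓖.gr.unitMap_comp e]
    unfold FibGpd.Sq FibGpd.post FibGpd.pre
    have h₁ := A.sq_map φ
    have h₂ := A.sq_map ψ
    unfold FibGpd.Sq FibGpd.post FibGpd.pre at h₁ h₂
    rw [𝓖.gr.fib.assoc _ _ _ _ _ (Category.comp_id g) e, h₂, ← 𝓖.gr.fib.assoc _ _ _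
      (Category.comp_id f) e, h₁, 𝓖.gr.fib.assoc])
  lam := A.lam
  lam_naturality {S T f} i x y z x' y' z' e e' φ ψ χ hχ := by
    have h₁ : 𝓖.gr.fib.Sq (𝓖.gr.tens (𝓖.gr.tens (F.map φ) (A.map φ))
        (𝓖.gr.tens (F.map ψ) (A.map ψ))) (𝓖.gr.unitMap f)
        ((tensorμ (F.obj x) (A.obj x) (F.obj y) (A.obj y) ≫
          (F.lam i x y z e ⊗ₘ A.lam i x y z e)) ≫ A.hom z)
        ((tensorμ (F.obj x') (A.obj x') (F.obj y') (A.obj y') ≫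
          (F.lam i x' y' z' e' ⊗ₘ A.lam i x' y' z' e')) ≫ A.hom z') := by
      rw [A.lam_hom, A.lam_hom]
      exact FibGpd.Sq.comp (GrStack.sq_tens (A.sq_map φ) (A.sq_map ψ))
        (𝓖.gr.leftUnitor_naturality _)
    have h₂ := FibGpd.Sq.of_comp_left (BraidedGrStack.sq_tensorμ _ _ _ _)
      (FibGpd.Sq.of_comp_right (A.sq_map χ) h₁)
    have h₃ := F.lam_naturality i x y z x' y' z' e e' φ ψ χ hχ
    unfold FibGpd.Sq at h₂
    rw [← GrStack.tens_post, ← GrStack.tens_pre, h₃] at h₂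
    exact GrStack.tens_left_cancel h₂
  lam_assoc {S} i x y z xy yz l r e₁ e₂ e₃ e₄ m hm hm' := by
    refine prod_assoc_cancel 𝓖.gr.tensorLeft_faithful
      (F.lam_assoc i x y z xy yz l r e₁ e₂ e₃ e₄ m hm hm') ?_
    exact unit_assoc_aux (A.lam_hom _ _ _ _ _) (A.lam_hom _ _ _ _ _) (A.lam_hom _ _ _ _ _)
      (A.lam_hom _ _ _ _ _) (A.mapF_hom m)
  eps := A.eps
  eps_naturality {S T f} i x x' e e' φ hφ := by
    have h₁ : 𝓖.gr.fib.Sq (𝓖.gr.tens (F.map φ) (A.map φ)) (𝓖.gr.unitMap f)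
        ((F.eps i x e ⊗ₘ A.eps i x e) ≫ (λ_ _).hom)
        ((F.eps i x' e' ⊗ₘ A.eps i x' e') ≫ (λ_ _).hom) := by
      rw [A.eps_hom, A.eps_hom]
      exact A.sq_map φ
    have h₂ := FibGpd.Sq.of_comp_right (𝓖.gr.leftUnitor_naturality (𝓖.gr.unitMap f)) h₁
    have h₃ := F.eps_naturality i x x' e e' φ hφ
    unfold FibGpd.Sq at h₂
    rw [← GrStack.tens_post, ← GrStack.tens_pre, h₃] at h₂
    exact GrStack.tens_left_cancel h₂
  left_unit i x y z e e' L hL hL' := by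
    refine prod_left_unit_cancel 𝓖.gr.tensorLeft_faithful (F.left_unit i x y z e e' L hL hL') ?_
    rw [A.eps_hom]
    exact unit_left_aux (A.lam_hom _ _ _ _ _) (A.mapF_hom L)
  right_unit i x y z e e' L hL hL' := by
    refine prod_right_unit_cancel 𝓖.gr.tensorLeft_faithful (F.right_unit i x y z e e' L hL hL') ?_
    rw [A.eps_hom]
    exact unit_right_aux (A.lam_hom _ _ _ _ _) (A.mapF_hom L)
  interchange {S} i k hik x x' y y' xx' yy' xy x'y' t e₁ e₂ e₃ e₄ e₅ e₆ := by
    refine prod_interchange_cancel 𝓖.gr.tensorLeft_faithful (hs S)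
      (F.interchange i k hik x x' y y' xx' yy' xy x'y' t e₁ e₂ e₃ e₄ e₅ e₆) ?_
    exact unit_interchange_aux (A.lam_hom _ _ _ _ _) (A.lam_hom _ _ _ _ _) (A.lam_hom _ _ _ _ _)
      (A.lam_hom _ _ _ _ _) (A.lam_hom _ _ _ _ _) (A.lam_hom _ _ _ _ _)
  eps_eq i k x e e' := by
    have h : (F.eps i x e ⊗ₘ A.eps i x e) = (F.eps i x e ⊗ₘ A.eps k x e') := by
      rw [← cancel_mono (λ_ _).hom, A.eps_hom, F.eps_eq i k x e e', A.eps_hom]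
    exact tensorHom_left_cancel 𝓖.gr.tensorLeft_faithful h

/-- The isomorphism given by `hom`. -/
noncomputable def iso {S : C} (x : ∀ k, (𝓗 k).fib.Ob S) :
    F.obj x ⊗ A.obj x ≅ 𝟙_ (𝓖.gr.fib.Ob S) :=
  asIso (A.hom x)

/-- The product of `F` and its inverse is trivial. -/
noncomputable def mulIso (hs : 𝓖.IsSymmetric) :
    NAdditive.mul hs F (A.additive hs) ≅ NAdditive.trivial 𝓗 𝓖 :=
  NAdditive.mkIso (F := NAdditive.mul hs F (A.additive hs)) (F' := NAdditive.trivial 𝓗 𝓖)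
    (fun x => A.iso x) (fun φ => A.sq_map φ) (fun i x y z e => A.lam_hom i x y z e)
    (fun i x e => (Category.comp_id _).trans (A.eps_hom i x e).symm)

end PointwiseInverse

end Inverse

/-! ## Group-like groupoids -/

section GroupLike

variable {D : Type o} [Category.{h} D] [MonoidalCategory D]

theorem isEquivalence_tensorLeft {X Y : D} (a : X ⊗ Y ≅ 𝟙_ D) (b : Y ⊗ X ≅ 𝟙_ D) :
    (tensorLeft X).IsEquivalence :=
  (CategoryTheory.Equivalence.mk (tensorLeft X) (tensorLeft Y)
    ((leftUnitorNatIso D).symm ≪≫ (tensoringLeft D).mapIso b.symm ≪≫ tensorLeftTensor Y X)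
    ((tensorLeftTensor X Y).symm ≪≫ (tensoringLeft D).mapIso a ≪≫
      leftUnitorNatIso D)).isEquivalence_functor

theorem isEquivalence_tensorRight {X Y : D} (a : X ⊗ Y ≅ 𝟙_ D) (b : Y ⊗ X ≅ 𝟙_ D) :
    (tensorRight X).IsEquivalence :=
  (CategoryTheory.Equivalence.mk (tensorRight X) (tensorRight Y)
    ((rightUnitorNatIso D).symm ≪≫ (tensoringRight D).mapIso a.symm ≪≫ tensorRightTensor X Y)
    ((tensorRightTensor Y X).symm ≪≫ (tensoringRight D).mapIso b ≪≫
      rightUnitorNatIso D)).isEquivalence_functor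

theorem isGroupLike_of_inverses [IsGroupoid D] (h : ∀ X : D, ∃ Y : D, Nonempty (X ⊗ Y ≅ 𝟙_ D)) :
    IsGroupLike D := by
  have h' : ∀ X : D, ∃ Y : D, Nonempty (X ⊗ Y ≅ 𝟙_ D) ∧ Nonempty (Y ⊗ X ≅ 𝟙_ D) := by
    intro X
    obtain ⟨Y, ⟨a⟩⟩ := h X
    obtain ⟨Z, ⟨b⟩⟩ := h Y
    have c : X ≅ Z := (ρ_ X).symm ≪≫ whiskerLeftIso X b.symm ≪≫ (α_ X Y Z).symm ≪≫
      whiskerRightIso a Z ≪≫ λ_ Z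
    exact ⟨Y, ⟨a⟩, ⟨whiskerLeftIso Y c ≪≫ b⟩⟩
  refine ⟨inferInstance, fun X => ?_, fun X => ?_⟩
  · obtain ⟨Y, ⟨a⟩, ⟨b⟩⟩ := h' X
    exact isEquivalence_tensorLeft a b
  · obtain ⟨Y, ⟨a⟩, ⟨b⟩⟩ := h' X
    exact isEquivalence_tensorRight a b

theorem IsGroupLike.of_equivalence {N : Type u} [Category.{v} N] [MonoidalCategory N] (U : D ⥤ N)
    [U.IsEquivalence] [U.Monoidal] [IsGroupoid D]
    (h : ∀ X : N, ∃ Y : N, Nonempty (X ⊗ Y ≅ 𝟙_ N)) : IsGroupLike D :=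
  isGroupLike_of_inverses fun X => by
    obtain ⟨Y, ⟨a⟩⟩ := h (U.obj X)
    exact ⟨U.objPreimage Y, ⟨U.preimageIso ((Functor.Monoidal.μIso U X (U.objPreimage Y)).symm ≪≫
      whiskerLeftIso _ (U.objObjPreimageIso Y) ≪≫ a ≪≫ Functor.Monoidal.εIso U)⟩⟩

end GroupLike

theorem NAdditive.exists_mul_iso {C : Type u} [Category.{v} C] {J : GrothendieckTopology C} {n : ℕ}
    {𝓗 : Fin n → GrStack.{o₁, h₁} J} {𝓖 : BraidedGrStack.{o₂, h} J} (hs : 𝓖.IsSymmetric)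
    (F : NAdditive 𝓗 𝓖) : ∃ A, Nonempty (mul hs F A ≅ trivial 𝓗 𝓖) :=
  ⟨_, ⟨F.nonempty_pointwiseInverse.some.mulIso hs⟩⟩

theorem NAdditive.isGroupLike {C : Type u} [Category.{v} C] {J : GrothendieckTopology C} {n : ℕ}
    {𝓗 : Fin n → GrStack.{o₁, h₁} J} {𝓖 : BraidedGrStack.{o₂, h} J} (hs : 𝓖.IsSymmetric) :
    letI := monoidal 𝓗 𝓖 hs
    IsGroupLike (NAdditive 𝓗 𝓖) :=
  let := monoidal 𝓗 𝓖 hs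
  isGroupLike_of_inverses (exists_mul_iso hs)

namespace NButterfly

section Final

variable {C : Type u} [Category.{v} C] {J : GrothendieckTopology C} {n : ℕ}
  {H : Fin n → CrossedModule.{w} J} {G : BraidedCrossedModule.{w} J}
  {𝓗 : Fin n → GrStack.{o₁, h₁} J} {𝓖 : BraidedGrStack.{o₂, w} J} (hs : 𝓖.IsSymmetric)
  (πH : ∀ k, Presentation (H k) (𝓗 k)) (πG : BraidedPresentation G 𝓖)

theorem comparison_wedge (B B' : NButterfly H G) {S : C} (e : B.El S) (e' : B'.El S)
    (a : B.p e = B'.p e') :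
    ((B.comparison πH πG).app e ⊗ₘ ((B'.comparison πH πG).app e' ≫
        ((toAdditive πH πG).obj B').ident πH (B'.p e') (B.p e) a.symm)) ≫
      NAdditive.Hom.app (contractedIso hs πH πG B B').hom (fun k => (πH k).obj (B.p e k)) =
    πG.mu (B.j e) (B'.j e') ≫
      ((contracted hs πH πG B B').comparison πH πG).app (wedge hs πH πG B B' e e' a) := by
  have h := Frame.φ_injective (frame_wedge hs πH πG a)
  refine Eq.trans ?_ (congrArg (πG.mu (B.j e) (B'.j e') ≫ ·) h.symm)
  refine Eq.trans ?_ (Category.assoc _ _ _)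
  exact congrArg (· ≫ _) (πG.mu_wedge _ _).symm

/-- The functor from butterflies to additive functors is monoidal. -/
@[reducible]
noncomputable def toAdditiveMonoidal :
    letI := NAdditive.monoidal 𝓗 𝓖 hs
    letI := monoidal hs πH πG
    (toAdditive πH πG).Monoidal :=
  letI := NAdditive.monoidal 𝓗 𝓖 hs
  fullMonoidalFunctor (toAdditive πH πG) (contracted hs πH πG) (NButterfly.trivial H G)
    (contractedIso hs πH πG) (trivialIso πH πG).symm

theorem isGroupLike :
    letI := monoidal hs πH πG
    IsGroupLike (NButterfly H G) := by
  let := NAdditive.monoidal 𝓗 𝓖 hs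
  let := monoidal hs πH πG
  let := toAdditiveMonoidal hs πH πG
  exact IsGroupLike.of_equivalence (toAdditive πH πG) (NAdditive.exists_mul_iso hs)

end Final

end NButterfly

theorem theorem4 {C : Type u} [Category.{v} C] (J : GrothendieckTopology C) {n : ℕ}
    (H : Fin n → CrossedModule.{w} J) (G : BraidedCrossedModule.{w} J)
    (𝓗 : Fin n → GrStack.{o₁, h₁} J) (𝓖 : BraidedGrStack.{o₂, w} J)
    (πH : ∀ k, Presentation (H k) (𝓗 k)) (πG : BraidedPresentation G 𝓖) :
    IsGroupoid (NButterfly H G) ∧ IsGroupoid (NAdditive 𝓗 𝓖) ∧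
    ∃ (u : NButterfly H G ⥤ NAdditive 𝓗 𝓖) (θ : ∀ B, Comparison πH πG B (u.obj B)),
      u.IsEquivalence ∧
      (∀ {B B' : NButterfly H G} (ψ : B ⟶ B') {S : C} (e : B.El S),
        (θ B).app e ≫ NAdditive.Hom.app (u.map ψ) (fun k => (πH k).obj (B.p e k)) =
          πG.ident (B.j e) (B'.j (ψ.hom.app (op S) e)) (ψ.j_hom e).symm ≫
            (θ B').app (ψ.hom.app (op S) e) ≫
              (u.obj B').ident πH (B'.p (ψ.hom.app (op S) e)) (B.p e) (ψ.p_hom e)) ∧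
      (∃ ι : u.obj (NButterfly.trivial H G) ≅ NAdditive.trivial 𝓗 𝓖,
        ∀ {S : C} (o : (NButterfly.trivial H G).El S) (h : 1 = (NButterfly.trivial H G).j o),
          o.2 = 1 →
          πG.eta S ≫ πG.ident 1 ((NButterfly.trivial H G).j o) h ≫
              (θ (NButterfly.trivial H G)).app o ≫
                NAdditive.Hom.app ι.hom
                  (fun k => (πH k).obj ((NButterfly.trivial H G).p o k)) =
            𝟙 (𝟙_ (𝓖.gr.fib.Ob S))) ∧
      ∀ hs : 𝓖.IsSymmetric, ∃ W : ContractedMonoidal H G,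
        letI := W.mon
        letI := NAdditive.monoidal 𝓗 𝓖 hs
        IsGroupLike (NButterfly H G) ∧ IsGroupLike (NAdditive 𝓗 𝓖) ∧
        ∃ M : u.Monoidal, ∀ (B B' : NButterfly H G) {S : C} (e : B.El S) (e' : B'.El S)
          (a : B.p e = B'.p e'),
          ((θ B).app e ⊗ₘ ((θ B').app e' ≫ (u.obj B').ident πH (B'.p e') (B.p e) a.symm)) ≫
              NAdditive.Hom.app (Functor.LaxMonoidal.μ u B B')
                (fun k => (πH k).obj (B.p e k)) =
            πG.mu (B.j e) (B'.j e') ≫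
              πG.ident (B.j e * B'.j e') ((B ⊗ B').j (W.wedge B B' e e' a))
                (W.j_wedge B B' e e' a).symm ≫
              (θ (B ⊗ B')).app (W.wedge B B' e e' a) ≫
                (u.obj (B ⊗ B')).ident πH ((B ⊗ B').p (W.wedge B B' e e' a)) (B.p e)
                  (W.p_wedge B B' e e' a) := by
  refine ⟨inferInstance, inferInstance, NButterfly.toAdditive πH πG,
    fun B => B.comparison πH πG, inferInstance,
    fun ψ _ e => NButterfly.comparison_naturality πH πG ψ e,
    ⟨NButterfly.trivialIso πH πG, fun o h ho =>
      NButterfly.eta_frame_trivial πH πG (NButterfly.frame_trivialIso πH πG) o h ho⟩,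
    fun hs => ⟨NButterfly.contractedMonoidal hs πH πG, ?_⟩⟩
  refine ⟨NButterfly.isGroupLike hs πH πG, NAdditive.isGroupLike hs,
    NButterfly.toAdditiveMonoidal hs πH πG, fun B B' S e e' a => ?_⟩
  refine (NButterfly.comparison_wedge hs πH πG B B' e e' a).trans
    (congrArg (πG.mu (B.j e) (B'.j e') ≫ ·) ?_)
  refine Eq.trans ?_ (congrArg₂ (fun s t => s ≫ _ ≫ t) (πG.ident_self _ _)
    (NAdditive.ident_self _ πH _ _)).symm
  exact ((Category.id_comp _).trans (Category.comp_id _)).symm
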